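/- Let $(M,g)$ be an oriented four-dimensional smooth pseudo-Riemannian manifold of signature $(--++)$ which is Einstein, i.e. $\mathrm{Ric}=\tfrac{\mathrm s}{4}\,g$, where $\mathrm s$ is the scalar curvature. Let $\Lambda^+M\subset (TM)^{\wedge 2}$ be the bundle of self-dual bivectors (those fixed by the Hodge star), which is invariant under the curvature operator $R$ acting on bivectors, and let $R^+:\Lambda^+M\to\Lambda^+M$ be the restriction of $R$. Suppose that, at every point $x$, the complex-linear extension of $R^+(x)$ to the complexification of $\Lambda^+_xM$ is diagonalizable, and that the set of its complex eigenvalues does not depend on $x$. If $\nabla R^+\neq 0$ at some point of $M$, then: (1) $(M,g)$ is locally homogeneous: for all $x,y\in M$ there is an isometry between a neighbourhood of $x$ and a neighbourhood of $y$ sending $x$ to $y$; (2) $(M,g)$ is locally isometric to a Lie group with a left-invariant metric: there are a four-dimensional Lie group $G$ and a left-invariant pseudo-Riemannian metric $h$ on $G$ such that every point of $M$ has a neighbourhood isometric to an open subset of $(G,h)$; (3) more precisely, $g$ is Ricci-flat and $(M,g)$ is locally isometric to one of Petrov's Ricci-flat manifolds, that is, there are $p\in\mathbb R\smallsetminus\{0\}$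 and $\varepsilon\in\{1,-1\}$ such that every point of $M$ has a neighbourhood isometric to an open subset of the following manifold. Let $V=\mathbb C\times\mathbb R$ with the symmetric bilinear form $\langle(z,t),(z',t')\rangle=\mathrm{Im}\,(zz')+\varepsilon\,tt'$ and the operator $F(z,t)=(p\,e^{2\pi i/3}z,\;p\,t)$. On the four-manifold $V\times\mathbb R$, consider the vector field $u$ given by $u(x,r)=(-Fx,1)$ and the constant vector fields $(v,0)$, denoted by $v$, for $v\in V$; they span a simply transitive Lie algebra of vector fields, with $[u,v]=Fv$ and $[v,v']=0$ for $v,v'\in V$. The metric on $V\times\mathbb R$ is defined by $g(u,u)=-\varepsilon$, $g(u,v)=0$ and $g(v,v')=\langle v,v'\rangle$ for $v,v'\in V$. -/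

import Mathlib

open scoped Manifold ContDiff Topology

noncomputable section

namespace NeutralEinstein

/-! ### Pseudo-Riemannian metrics, orientations and local isometries -/

section Metric

variable {E : Type*} [NormedAddCommGroup E] [NormedSpace ℝ E]
variable {M : Type*} [TopologicalSpace M] [ChartedSpace E M]

/-- The tangent vector `∂_v` at the point of `M` with coordinates `y` in the chart `φ`: the value
at `y` of the coordinate vector field with the constant components `v`. -/
def coordVec (φ : OpenPartialHomeomorph M E) (y : E) (v : E) :
    TangentSpace 𝓘(ℝ, E) (φ.symm y) :=
  mfderiv 𝓘(ℝ, E) 𝓘(ℝ, E) φ.symm y v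

variable (E M) in
/-- A smooth pseudo-Riemannian metric (of any signature) on a manifold modelled on `E`: a symmetric
nondegenerate bilinear form on each tangent space, with smooth components in every chart. -/
structure PseudoMetric where
  form : ∀ x : M, TangentSpace 𝓘(ℝ, E) x →L[ℝ] TangentSpace 𝓘(ℝ, E) x →L[ℝ] ℝ
  symm : ∀ x u v, form x u v = form x v u
  nondegenerate : ∀ x u, (∀ v, form x u v = 0) → u = 0
  smooth : ∀ φ ∈ atlas E M, ∀ v w : E,
    ContDiffOn ℝ ∞ (fun y => form (φ.symm y) (coordVec φ y v) (coordVec φ y w)) φ.target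

variable {E' : Type*} [NormedAddCommGroup E'] [NormedSpace ℝ E']
variable {N : Type*} [TopologicalSpace N] [ChartedSpace E' N]

/-- `f` is an isometry of an open subset (its source) of `(M, g)` onto an open subset (its target)
of `(N, h)`: a smooth diffeomorphism that pulls `h` back to `g`. -/
structure IsIsometry (g : PseudoMetric E M) (h : PseudoMetric E' N)
    (f : OpenPartialHomeomorph M N) : Prop where
  contMDiffOn : ContMDiffOn 𝓘(ℝ, E) 𝓘(ℝ, E') ∞ f f.source
  contMDiffOn_symm : ContMDiffOn 𝓘(ℝ, E') 𝓘(ℝ, E) ∞ f.symm f.target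
  map_form : ∀ x ∈ f.source, ∀ u v : TangentSpace 𝓘(ℝ, E) x,
    h.form (f x) (mfderiv 𝓘(ℝ, E) 𝓘(ℝ, E') f x u) (mfderiv 𝓘(ℝ, E) 𝓘(ℝ, E') f x v) =
      g.form x u v

/-- Every point of `M` has a neighbourhood isometric to an open subset of `(N, h)`. -/
def LocallyIsometric (g : PseudoMetric E M) (h : PseudoMetric E' N) : Prop :=
  ∀ x : M, ∃ f : OpenPartialHomeomorph M N, x ∈ f.source ∧ IsIsometry g h f

/-- For any two points there is an isometry between neighbourhoods of them, taking the first point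
to the second. -/
def LocallyHomogeneous (g : PseudoMetric E M) : Prop :=
  ∀ x y : M, ∃ f : OpenPartialHomeomorph M M, x ∈ f.source ∧ f x = y ∧ IsIsometry g g f

/-- Invariance of a metric on a Lie group under all left translations. -/
def LeftInvariant {G : Type*} [Group G] [TopologicalSpace G] [ChartedSpace E G]
    (h : PseudoMetric E G) : Prop :=
  ∀ (a x : G) (u v : TangentSpace 𝓘(ℝ, E) x),
    h.form (a * x) (mfderiv 𝓘(ℝ, E) 𝓘(ℝ, E) (fun z : G => a * z) x u)
      (mfderiv 𝓘(ℝ, E) 𝓘(ℝ, E) (fun z : G => a * z) x v) = h.form x u v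

end Metric

/-! ### Classical tensor calculus in a coordinate domain of dimension four

`G` is the matrix of components of the metric, as a function of the coordinates, and `s` is `1` or
`-1` according to whether the coordinate frame is positively or negatively oriented. A bivector
`α` has the components `α k l`, skew-symmetric, with
`α = (1/2) ∑ k l, α k l • (∂_k ∧ ∂_l)`. -/

/-- The coordinate space. -/
abbrev R4 := EuclideanSpace ℝ (Fin 4)

/-- Components with four indices. -/
abbrev Comp4 := Fin 4 → Fin 4 → Fin 4 → Fin 4 → ℝ

/-- The partial derivative `∂_i f`. -/
def pd (i : Fin 4) (f : R4 → ℝ) (y : R4) : ℝ := fderiv ℝ f y (EuclideanSpace.single i 1)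

/-- The Christoffel symbols: `∇_{∂_i} ∂_j = ∑ k, christoffel G k i j • ∂_k` for the Levi-Civita
connection `∇`. -/
def christoffel (G : R4 → Matrix (Fin 4) (Fin 4) ℝ) (k i j : Fin 4) (y : R4) : ℝ :=
  (1 / 2) * ∑ l, (G y)⁻¹ k l *
    (pd i (fun z => G z j l) y + pd j (fun z => G z i l) y - pd l (fun z => G z i j) y)

/-- The curvature tensor, with the sign convention
`R(u,v)w = ∇_v ∇_u w - ∇_u ∇_v w + ∇_{[u,v]} w`:
`R(∂_i, ∂_j) ∂_k = ∑ l, curvature G y i j k l • ∂_l`. -/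
def curvature (G : R4 → Matrix (Fin 4) (Fin 4) ℝ) (y : R4) : Comp4 := fun i j k l =>
  pd j (christoffel G l i k) y - pd i (christoffel G l j k) y +
    ∑ m, (christoffel G m i k y * christoffel G l j m y -
      christoffel G m j k y * christoffel G l i m y)

/-- The Ricci tensor `Ric(u,w) = Trace [v ↦ R(u,v)w]`. -/
def ricci (G : R4 → Matrix (Fin 4) (Fin 4) ℝ) (y : R4) (i k : Fin 4) : ℝ :=
  ∑ j, curvature G y i j k j

/-- The scalar curvature. -/
def scalarCurvature (G : R4 → Matrix (Fin 4) (Fin 4) ℝ) (y : R4) : ℝ :=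
  ∑ i, ∑ k, (G y)⁻¹ i k * ricci G y i k

/-- Raising the last two indices. -/
def raise (G : Matrix (Fin 4) (Fin 4) ℝ) (T : Comp4) : Comp4 := fun i j k l =>
  ∑ a, ∑ b, T i j a b * G⁻¹ a k * G⁻¹ b l

/-- Components of the curvature operator on bivectors, the operator with
`⟨R(u ∧ v), w ∧ w'⟩ = g(R(u,v)w, w')`, where
`⟨v ∧ u, v' ∧ u'⟩ = g(v,v') g(u,u') - g(v,u') g(u,v')`. An operator with components `A` sends
`α` to `β`, `β k l = (1/2) ∑ i j, α i j * A i j k l`. -/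
def curvatureOp (G : R4 → Matrix (Fin 4) (Fin 4) ℝ) (y : R4) : Comp4 :=
  raise (G y) fun i j k l => ∑ m, curvature G y i j k m * G y m l

/-- The signum of `(i,j,k,l)` as a permutation of the four indices, or `0` if two of them agree. -/
def leviCivita : Comp4 := fun i j k l =>
  (Matrix.of fun r c : Fin 4 => if ![i, j, k, l] r = c then (1 : ℝ) else 0).det

/-- Components of the Hodge star on bivectors, characterized by
`α ∧ β = ⟨*α, β⟩ vol`, with `∂_0 ∧ ∂_1 ∧ ∂_2 ∧ ∂_3 = s √|det G| vol`. -/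
def hodgeStar (G : R4 → Matrix (Fin 4) (Fin 4) ℝ) (s : R4 → ℝ) (y : R4) : Comp4 :=
  raise (G y) fun i j k l => s y * √|(G y).det| * leviCivita i j k l

/-- Components of the self-dual curvature operator `R⁺`, extended by zero to the anti-self-dual
bivectors: `α ↦ R ((α + *α) / 2)`. -/
def selfDualCurvatureOp (G : R4 → Matrix (Fin 4) (Fin 4) ℝ) (s : R4 → ℝ) (y : R4) : Comp4 :=
  fun i j k l => (1 / 2) * (curvatureOp G y i j k l +
    (1 / 2) * ∑ a, ∑ b, hodgeStar G s y i j a b * curvatureOp G y a b k l)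

/-- The component `(∇_{∂_m} A) i j k l` of the Levi-Civita covariant derivative of a field `A` of
operators on bivectors. -/
def covDeriv (G : R4 → Matrix (Fin 4) (Fin 4) ℝ) (A : R4 → Comp4) (y : R4)
    (m i j k l : Fin 4) : ℝ :=
  pd m (fun z => A z i j k l) y + ∑ a,
    (- christoffel G a m i y * A y a j k l - christoffel G a m j y * A y i a k l +
      christoffel G k m a y * A y i j a l + christoffel G l m a y * A y i j k a)

/-- The complex-linear extension, to complex bivectors, of the operator with components `A`. -/
def complexOp (A : Comp4) : Module.End ℂ (Matrix (Fin 4) (Fin 4) ℂ) where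
  toFun α := Matrix.of fun k l => (1 / 2) * ∑ i, ∑ j, α i j * (A i j k l : ℂ)
  map_add' α β := by
    ext k l
    simp [add_mul, Finset.sum_add_distrib, mul_add]
  map_smul' c α := by
    ext k l
    simp only [Matrix.smul_apply, Matrix.of_apply, smul_eq_mul, RingHom.id_apply, mul_assoc,
      ← Finset.mul_sum]
    ring

/-- The complexification of the space `Λ⁺` of self-dual bivectors: the skew-symmetric complex `α`
with `*α = α`. -/
def complexSelfDual (G : R4 → Matrix (Fin 4) (Fin 4) ℝ) (s : R4 → ℝ) (y : R4) :
    Submodule ℂ (Matrix (Fin 4) (Fin 4) ℂ) where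
  carrier := {α | α.transpose = -α ∧ complexOp (hodgeStar G s y) α = α}
  add_mem' {α β} hα hβ := by
    refine ⟨?_, ?_⟩
    · rw [Matrix.transpose_add, hα.1, hβ.1, neg_add]
    · rw [map_add, hα.2, hβ.2]
  zero_mem' := ⟨by simp, by simp⟩
  smul_mem' c α hα := by
    refine ⟨?_, ?_⟩
    · rw [Matrix.transpose_smul, hα.1, smul_neg]
    · rw [map_smul, hα.2]

/-- The space of all complex self-dual `α` with `R α = μ α`. As `R⁺` is the restriction of `R` to
`Λ⁺`, this is the eigenspace of the complex-linear extension of `R⁺` for `μ`. -/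
def selfDualEigenspace (G : R4 → Matrix (Fin 4) (Fin 4) ℝ) (s : R4 → ℝ) (y : R4) (μ : ℂ) :
    Submodule ℂ (Matrix (Fin 4) (Fin 4) ℂ) :=
  complexSelfDual G s y ⊓ Module.End.eigenspace (complexOp (curvatureOp G y)) μ

/-! ### Four-manifolds -/

section FourManifold

variable {M : Type*} [TopologicalSpace M] [ChartedSpace R4 M]

/-- The coordinate frame `∂_0, …, ∂_3` of the chart `φ`. -/
def coordFrame (φ : OpenPartialHomeomorph M R4) (y : R4) (i : Fin 4) :
    TangentSpace (𝓡 4) (φ.symm y) :=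
  coordVec φ y (EuclideanSpace.single i 1)

open Classical in
/-- For a choice `o` of orientations of all the tangent spaces: `1` if the coordinate frame of `φ`
at the point with coordinates `y` is positively oriented, and `-1` otherwise. -/
def frameSign (o : ∀ x : M, Orientation ℝ (TangentSpace (𝓡 4) x) (Fin 4))
    (φ : OpenPartialHomeomorph M R4) (y : R4) : ℝ :=
  if ∃ b : Module.Basis (Fin 4) ℝ (TangentSpace (𝓡 4) (φ.symm y)),
    (∀ i, b i = coordFrame φ y i) ∧ b.orientation = o (φ.symm y) then 1 else -1

variable (M) in
/-- An orientation of a four-manifold: orientations of all tangent spaces, depending continuously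
on the point. -/
structure ManifoldOrientation where
  at_point : ∀ x : M, Orientation ℝ (TangentSpace (𝓡 4) x) (Fin 4)
  continuous : ∀ φ ∈ atlas R4 M, ContinuousOn (frameSign at_point φ) φ.target

/-- The metric has the sign pattern `--++`. -/
def IsNeutral (g : PseudoMetric R4 M) : Prop :=
  ∀ x : M, ∃ e : Module.Basis (Fin 4) ℝ (TangentSpace (𝓡 4) x), ∀ i j,
    g.form x (e i) (e j) = Matrix.diagonal ![(-1 : ℝ), -1, 1, 1] i j

/-- The components of the metric in the chart `φ`, as functions of the coordinates. -/
def comps (g : PseudoMetric R4 M) (φ : OpenPartialHomeomorph M R4) (y : R4) :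
    Matrix (Fin 4) (Fin 4) ℝ :=
  Matrix.of fun i j => g.form (φ.symm y) (coordFrame φ y i) (coordFrame φ y j)

/-- `Ric = (s/4) g`, where `s` is the scalar curvature. -/
def IsEinstein (g : PseudoMetric R4 M) : Prop :=
  ∀ φ ∈ atlas R4 M, ∀ y ∈ φ.target, ∀ i j,
    ricci (comps g φ) y i j = scalarCurvature (comps g φ) y / 4 * comps g φ y i j

/-- `Ric = 0`. -/
def IsRicciFlat (g : PseudoMetric R4 M) : Prop :=
  ∀ φ ∈ atlas R4 M, ∀ y ∈ φ.target, ∀ i j, ricci (comps g φ) y i j = 0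

/-- At every point, the complex-linear extension of `R⁺` to the complexification of `Λ⁺` is
diagonalizable, that is, its eigenspaces span the complexification of `Λ⁺`. -/
def SelfDualComplexDiagonalizable (g : PseudoMetric R4 M) (o : ManifoldOrientation M) : Prop :=
  ∀ φ ∈ atlas R4 M, ∀ y ∈ φ.target,
    ⨆ μ : ℂ, selfDualEigenspace (comps g φ) (frameSign o.at_point φ) y μ =
      complexSelfDual (comps g φ) (frameSign o.at_point φ) y

/-- The set of the complex eigenvalues of `R⁺` is the same at all points. -/
def SelfDualConstantEigenvalues (g : PseudoMetric R4 M) (o : ManifoldOrientation M) : Prop :=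
  ∃ S : Set ℂ, ∀ φ ∈ atlas R4 M, ∀ y ∈ φ.target,
    {μ : ℂ | selfDualEigenspace (comps g φ) (frameSign o.at_point φ) y μ ≠ ⊥} = S

/-- `∇R⁺ ≠ 0` at some point. -/
def SelfDualNotParallel (g : PseudoMetric R4 M) (o : ManifoldOrientation M) : Prop :=
  ∃ φ ∈ atlas R4 M, ∃ y ∈ φ.target, ∃ m i j k l,
    covDeriv (comps g φ)
      (selfDualCurvatureOp (comps g φ) (frameSign o.at_point φ)) y m i j k l ≠ 0

end FourManifold

/-! ### Petrov's metrics

`V = ℂ × ℝ` carries the form `⟨(z,t),(z',t')⟩ = Im (z z') + ε t t'` and the self-adjoint operator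
`F (z,t) = (p q z, p t)`, where `q = exp (2πi/3)`. On the four-manifold `V × ℝ`, the vector fields
`u`, with the value `(-F x, 1)` at `(x, r)`, and `v`, constant, for `v ∈ V`, span a simply
transitive Lie algebra with the brackets `[u, v] = F v` and `[v, v'] = 0`. The metric is the one
with `g(u,u) = δ`, `g(u,v) = 0` and `g(v,v') = ⟨v,v'⟩`. -/

/-- The vector space `V`. -/
abbrev PetrovV := ℂ × ℝ

/-- The manifold `V × ℝ`. -/
abbrev PetrovSpace := PetrovV × ℝ

/-- The operator `F`. -/
def petrovF (p : ℝ) : PetrovV →L[ℝ] PetrovV :=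
  LinearMap.toContinuousLinearMap
    { toFun := fun v => ((p : ℂ) * Complex.exp (2 * Real.pi * Complex.I / 3) * v.1, p * v.2)
      map_add' := fun v w => by
        ext <;> simp [mul_add]
      map_smul' := fun c v => Prod.ext (by simp; ring) (by simp; ring) }

/-- The form `⟨ , ⟩`. -/
def petrovForm (ε : ℤˣ) : PetrovV →L[ℝ] PetrovV →L[ℝ] ℝ :=
  LinearMap.toContinuousBilinearMap
    (LinearMap.mk₂ ℝ (fun v w : PetrovV => (v.1 * w.1).im + ((ε : ℤ) : ℝ) * (v.2 * w.2))
      (by intro a b c; simp; ring) (by intro r a b; simp; ring)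
      (by intro a b c; simp; ring) (by intro r a b; simp; ring))

/-- At a point `a = (x, r)` one has `(ξ, τ) = τ u + (ξ + τ F x)`; this is the second summand, as a
function of `(ξ, τ)`. -/
def petrovVPart (p : ℝ) (a : PetrovSpace) : PetrovSpace →L[ℝ] PetrovV :=
  ContinuousLinearMap.fst ℝ PetrovV ℝ +
    (ContinuousLinearMap.snd ℝ PetrovV ℝ).smulRight (petrovF p a.1)

/-- The metric of the example at a point of `V × ℝ`. -/
def petrovMetricForm (p : ℝ) (ε δ : ℤˣ) (a : PetrovSpace) :
    PetrovSpace →L[ℝ] PetrovSpace →L[ℝ] ℝ :=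
  ((δ : ℤ) : ℝ) • (ContinuousLinearMap.snd ℝ PetrovV ℝ).smulRight
      (ContinuousLinearMap.snd ℝ PetrovV ℝ) +
    (petrovForm ε).bilinearComp (petrovVPart p a) (petrovVPart p a)

theorem petrovForm_apply (ε : ℤˣ) (v w : PetrovV) :
    petrovForm ε v w = (v.1 * w.1).im + ((ε : ℤ) : ℝ) * (v.2 * w.2) := rfl

theorem petrovMetricForm_apply (p : ℝ) (ε δ : ℤˣ) (a b c : PetrovSpace) :
    petrovMetricForm p ε δ a b c = ((δ : ℤ) : ℝ) * (b.2 * c.2) +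
      petrovForm ε (b.1 + b.2 • petrovF p a.1) (c.1 + c.2 • petrovF p a.1) := rfl

theorem petrovForm_nondegenerate (ε : ℤˣ) (v : PetrovV) (h : ∀ w, petrovForm ε v w = 0) :
    v = 0 := by
  have h1 := h (1, 0)
  have h2 := h (Complex.I, 0)
  have h3 := h (0, 1)
  simp only [petrovForm_apply] at h1 h2 h3
  have hv1 : v.1 = 0 := Complex.ext (by simpa using h2) (by simpa using h1)
  have hv2 : v.2 = 0 := by simpa using h3
  exact Prod.ext hv1 hv2

theorem petrovMetricForm_symm (p : ℝ) (ε δ : ℤˣ) (a b c : PetrovSpace) :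
    petrovMetricForm p ε δ a b c = petrovMetricForm p ε δ a c b := by
  have hs : ∀ v w : PetrovV, petrovForm ε v w = petrovForm ε w v := fun v w => by
    rw [petrovForm_apply, petrovForm_apply, mul_comm v.1, mul_comm v.2]
  rw [petrovMetricForm_apply, petrovMetricForm_apply, hs, mul_comm b.2]

/-- The metric of the example, with the parameters `p`, `ε`, `δ`. -/
def petrovMetric (p : ℝ) (ε δ : ℤˣ) : PseudoMetric PetrovSpace PetrovSpace where
  form a := petrovMetricForm p ε δ a
  symm a u v := petrovMetricForm_symm p ε δ a u v
  nondegenerate a u hu := by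
    have hu' : ∀ c : PetrovSpace, petrovMetricForm p ε δ a u c = 0 := hu
    change PetrovSpace at u
    have h2 : u.2 = 0 := by
      have := hu' (-petrovF p a.1, 1)
      rw [petrovMetricForm_apply] at this
      simpa using this
    have h1 : u.1 = 0 := by
      refine petrovForm_nondegenerate ε _ fun w => ?_
      have := hu' (w, 0)
      rw [petrovMetricForm_apply] at this
      simpa [h2] using this
    exact Prod.ext h1 h2
  smooth φ hφ v w := by
    rw [chartedSpaceSelf_atlas] at hφ
    subst hφ
    have h : ∀ y v : PetrovSpace,
        (coordVec (OpenPartialHomeomorph.refl PetrovSpace) y v : PetrovSpace) = v := by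
      intro y v
      have : mfderiv 𝓘(ℝ, PetrovSpace) 𝓘(ℝ, PetrovSpace) (id : PetrovSpace → PetrovSpace) y v = v := by
        rw [mfderiv_id]; rfl
      exact this
    have h' : ContDiff ℝ ∞ fun y : PetrovSpace => petrovMetricForm p ε δ y v w := by
      simp only [petrovMetricForm_apply]
      fun_prop
    refine h'.contDiffOn.congr fun y _ => ?_
    rw [h, h]
    rfl

/-- The vector field `u` of the example. -/
def petrovU (p : ℝ) (a : PetrovSpace) : PetrovSpace := (-petrovF p a.1, 1)

/-- The inner products of the frame fields `u` and `v ∈ V`. -/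
theorem petrovMetricForm_frame (p : ℝ) (ε δ : ℤˣ) (a : PetrovSpace) (v w : PetrovV) :
    petrovMetricForm p ε δ a (petrovU p a) (petrovU p a) = ((δ : ℤ) : ℝ) ∧
    petrovMetricForm p ε δ a (petrovU p a) (v, 0) = 0 ∧
    petrovMetricForm p ε δ a (v, 0) (w, 0) = petrovForm ε v w := by
  simp [petrovMetricForm_apply, petrovU]

/-- The Lie bracket `[u, v] = F v`. -/
theorem petrov_bracket (p : ℝ) (v : PetrovV) (a : PetrovSpace) :
    VectorField.lieBracket ℝ (petrovU p) (fun _ => ((v, 0) : PetrovSpace)) a =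
      (petrovF p v, 0) := by
  have h : HasFDerivAt (petrovU p)
      ((-(petrovF p).comp (ContinuousLinearMap.fst ℝ PetrovV ℝ)).prod 0) a := by
    refine HasFDerivAt.prodMk ?_ (hasFDerivAt_const _ _)
    exact (((petrovF p).comp (ContinuousLinearMap.fst ℝ PetrovV ℝ)).hasFDerivAt).neg
  rw [VectorField.lieBracket, h.fderiv]
  simp

end NeutralEinstein

end

open NeutralEinstein

/-! The argument is Cartan's method of moving frames, carried out over ℂ. Eigenprojections of R⁺ are
polynomials in R⁺, and their coefficients are constant because the spectrum is. Hence near each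
point there is a smooth complex oriented orthonormal frame, with dual coframe e₀, …, e₃, for which
ω₁ = e₀∧e₁ + e₂∧e₃ and its cyclic companions ω₂, ω₃ are eigenforms of the curvature operator
(`IsCurvatureChart.exists_eigenFrame`). Let ξ₁, ξ₂, ξ₃ be the connection forms of Λ⁺ and λᵢ the
negatives of the eigenvalues. Then dω₁ = ξ₃∧ω₂ − ξ₂∧ω₃ and dξ₁ = λ₁ω₁ − ξ₂∧ξ₃, and cyclically
(`selfDualStructure_of_eigen`).

Since the λᵢ are constant, differentiating the second equation gives (λ₁−λ₂) ξ₃∧ω₂ + (λ₃−λ₁) ξ₂∧ω₃ =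
0. In terms of the quaternion units acting on 1-forms, this says that η₁ = (λ₂−λ₃)ξ₁, η₂ =
(λ₃−λ₁)ξ₂, η₃ = (λ₁−λ₂)ξ₃ are the images of a single 1-form η₀ under the three units
(`SelfDualStructure.isQuaternionic`). If two λᵢ agree, one ηᵢ vanishes, hence all do, and R⁺ is
parallel. So ∇R⁺ ≠ 0 at one point forces distinct eigenvalues, and by constancy of the spectrum they
are distinct everywhere.

The three 3-forms ηᵢ∧ωᵢ coincide. Comparing the three resulting formulas for their common derivative
shows that N = |η₀|² is a nonzero constant n (`SelfDualStructure.exists_const`). Thus η₀, …, η₃ is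
an orthogonal coframe, and substituting it into the structure equations yields dη₀ = 0, dηᵢ = cᵢ
η₀∧ηᵢ with constant cᵢ, and λ₁(λ₃−λ₁)(λ₁−λ₂) = n cyclically
(`SelfDualStructure.structure_equations`). The last relations make the eigenvalues μ, ζμ, ζ²μ with ζ
= exp(2πi/3), where μ may be taken real because the spectrum is closed under conjugation. Their sum
is zero. The first Bianchi identity identifies that sum with a quarter of the scalar curvature, so
an Einstein metric of this kind is Ricci-flat.

For the integration the frame is chosen compatibly with complex conjugation, which makes η₀
imaginary, η₁ real and the conjugate of η₃ equal to −η₂. Then η₀ is a multiple of dr for a real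
function r, and integrating factors turn η₁ and η₃ into multiples of dt + p t dr and dz + pζ z dr.
In the coordinates z, t, r the metric is Petrov's (`IsSolvableCoframe.exists_petrovPullback`).
Petrov's manifold is a semidirect product of V and ℝ with a left-invariant metric, and local
homogeneity is transported from that group.

The exterior calculus is done in an arbitrary commutative ℂ-algebra with four commuting derivations,
where each computation is a ring identity. It is then applied to the complex-valued smooth functions
on a coordinate domain. -/

noncomputable section

namespace NeutralEinstein

/-! ### Differential forms over a commutative ring with commuting derivations -/

section Wedge

variable {A : Type*} [CommRing A]

/-- The exterior product of two 1-forms. -/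
def wedge11 (ξ η : Fin 4 → A) (m n : Fin 4) : A := ξ m * η n - ξ n * η m

/-- The exterior product of a 1-form and a 2-form. -/
def wedge12 (ξ : Fin 4 → A) (α : Fin 4 → Fin 4 → A) (l m n : Fin 4) : A :=
  ξ l * α m n + ξ m * α n l + ξ n * α l m

/-- The exterior product of a 1-form and a 3-form. -/
def wedge13 (ξ : Fin 4 → A) (θ : Fin 4 → Fin 4 → Fin 4 → A) : A :=
  ξ 0 * θ 1 2 3 - ξ 1 * θ 0 2 3 + ξ 2 * θ 0 1 3 - ξ 3 * θ 0 1 2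

/-- The exterior product of two 2-forms. -/
def wedge22 (α β : Fin 4 → Fin 4 → A) : A :=
  α 0 1 * β 2 3 - α 0 2 * β 1 3 + α 0 3 * β 1 2 + α 1 2 * β 0 3 - α 1 3 * β 0 2 + α 2 3 * β 0 1

/-- The self-dual 2-form `a ∧ b + c ∧ d` of a coframe. -/
def sdForm (a b c d : Fin 4 → A) (m n : Fin 4) : A := wedge11 a b m n + wedge11 c d m n

theorem sdForm_skew (a b c d : Fin 4 → A) (m n : Fin 4) :
    sdForm a b c d m n = - sdForm a b c d n m := by
  simp only [sdForm, wedge11]; ring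

/-- The value of a 1-form on a vector. -/
def pair (ξ X : Fin 4 → A) : A := ∑ m, ξ m * X m

/-- The value of a 2-form on two vectors. -/
def eval2 (α : Fin 4 → Fin 4 → A) (X Y : Fin 4 → A) : A := ∑ m, ∑ n, α m n * (X m * Y n)

/-- The value of a 3-form on three vectors. -/
def eval3 (θ : Fin 4 → Fin 4 → Fin 4 → A) (X Y Z : Fin 4 → A) : A :=
  ∑ l, ∑ m, ∑ n, θ l m n * (X l * Y m * Z n)

theorem eval2_wedge11 (ξ η X Y : Fin 4 → A) :
    eval2 (wedge11 ξ η) X Y = pair ξ X * pair η Y - pair ξ Y * pair η X := by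
  simp only [eval2, wedge11, pair, Fin.sum_univ_four]; ring

theorem eval2_sdForm (a b c d X Y : Fin 4 → A) :
    eval2 (sdForm a b c d) X Y = pair a X * pair b Y - pair a Y * pair b X +
      (pair c X * pair d Y - pair c Y * pair d X) := by
  rw [← eval2_wedge11, ← eval2_wedge11]
  simp only [eval2, sdForm, add_mul, Finset.sum_add_distrib]

theorem eval3_wedge12 (ξ : Fin 4 → A) (α : Fin 4 → Fin 4 → A) (X Y Z : Fin 4 → A) :
    eval3 (wedge12 ξ α) X Y Z =
      pair ξ X * eval2 α Y Z + pair ξ Y * eval2 α Z X + pair ξ Z * eval2 α X Y := by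
  simp only [eval3, wedge12, pair, eval2, Fin.sum_univ_four]; ring

end Wedge

/-! ### Exterior derivatives and the structure equations of Λ⁺. -/

section Forms

variable {A : Type*} [CommRing A] [Algebra ℂ A] (D : Fin 4 → Derivation ℂ A A)

/-- The exterior derivative of a 1-form. -/
def extD1 (ξ : Fin 4 → A) (m n : Fin 4) : A := D m (ξ n) - D n (ξ m)

/-- The exterior derivative of a 2-form. -/
def extD2 (α : Fin 4 → Fin 4 → A) (l m n : Fin 4) : A := D l (α m n) + D m (α n l) + D n (α l m)

/-- The exterior derivative of a 3-form, as a multiple of the coordinate volume form. -/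
def extD3 (θ : Fin 4 → Fin 4 → Fin 4 → A) : A :=
  D 0 (θ 1 2 3) - D 1 (θ 0 2 3) + D 2 (θ 0 1 3) - D 3 (θ 0 1 2)

theorem extD2_extD1 (hD : ∀ i j a, D i (D j a) = D j (D i a)) (ξ : Fin 4 → A) (l m n : Fin 4) :
    extD2 D (extD1 D ξ) l m n = 0 := by
  simp only [extD2, extD1, map_sub]
  rw [hD l m, hD l n, hD m n]
  ring

theorem extD2_wedge11 (ξ η : Fin 4 → A) (l m n : Fin 4) :
    extD2 D (wedge11 ξ η) l m n =
      wedge12 η (extD1 D ξ) l m n - wedge12 ξ (extD1 D η) l m n := by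
  simp only [extD2, extD1, wedge11, wedge12, map_sub, Derivation.leibniz, smul_eq_mul]
  ring

theorem extD3_wedge12 (ξ : Fin 4 → A) (α : Fin 4 → Fin 4 → A) (hα : ∀ m n, α m n = - α n m) :
    extD3 D (wedge12 ξ α) = wedge22 (extD1 D ξ) α - wedge13 ξ (extD2 D α) := by
  simp only [extD3, extD2, extD1, wedge22, wedge13, wedge12, map_add, Derivation.leibniz,
    smul_eq_mul]
  rw [hα 2 0, hα 3 0, hα 3 1]
  simp only [map_neg]
  ring

/-- A coframe `e₀, …, e₃`, orthonormal for the complexified metric, whose self-dual 2-forms are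
eigenforms of the curvature operator, along with the connection forms of the bundle of
self-dual 2-forms: the structure equations. -/
structure SelfDualStructure (e0 e1 e2 e3 ξ1 ξ2 ξ3 : Fin 4 → A) (l1 l2 l3 : ℂ) : Prop where
  T1 : ∀ l m n, extD2 D (sdForm e0 e1 e2 e3) l m n =
    wedge12 ξ3 (sdForm e0 e2 e3 e1) l m n - wedge12 ξ2 (sdForm e0 e3 e1 e2) l m n
  T2 : ∀ l m n, extD2 D (sdForm e0 e2 e3 e1) l m n =
    wedge12 ξ1 (sdForm e0 e3 e1 e2) l m n - wedge12 ξ3 (sdForm e0 e1 e2 e3) l m n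
  T3 : ∀ l m n, extD2 D (sdForm e0 e3 e1 e2) l m n =
    wedge12 ξ2 (sdForm e0 e1 e2 e3) l m n - wedge12 ξ1 (sdForm e0 e2 e3 e1) l m n
  C1 : ∀ m n, extD1 D ξ1 m n =
    algebraMap ℂ A l1 * sdForm e0 e1 e2 e3 m n - wedge11 ξ2 ξ3 m n
  C2 : ∀ m n, extD1 D ξ2 m n =
    algebraMap ℂ A l2 * sdForm e0 e2 e3 e1 m n - wedge11 ξ3 ξ1 m n
  C3 : ∀ m n, extD1 D ξ3 m n =
    algebraMap ℂ A l3 * sdForm e0 e3 e1 e2 m n - wedge11 ξ1 ξ2 m n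

variable {D}
variable {e0 e1 e2 e3 ξ1 ξ2 ξ3 : Fin 4 → A} {l1 l2 l3 : ℂ}

/-- The equations are invariant under the cyclic shift of 1, 2, 3 with 0 fixed, so whatever is
proved for the first index transfers to the other two. -/
theorem SelfDualStructure.rotate (h : SelfDualStructure D e0 e1 e2 e3 ξ1 ξ2 ξ3 l1 l2 l3) :
    SelfDualStructure D e0 e2 e3 e1 ξ2 ξ3 ξ1 l2 l3 l1 :=
  ⟨h.T2, h.T3, h.T1, h.C2, h.C3, h.C1⟩

/-- This is d² = 0 applied to ξ₁. In d(λ₁ω₁ − ξ₂∧ξ₃) the constant λ₁ passes through d, the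
derivatives of ω₁, ξ₂, ξ₃ are replaced by the structure equations, and the cubic terms have a
repeated factor. -/
theorem SelfDualStructure.bianchi (hD : ∀ i j a, D i (D j a) = D j (D i a))
    (h : SelfDualStructure D e0 e1 e2 e3 ξ1 ξ2 ξ3 l1 l2 l3) (l m n : Fin 4) :
    algebraMap ℂ A (l1 - l2) * wedge12 ξ3 (sdForm e0 e2 e3 e1) l m n +
      algebraMap ℂ A (l3 - l1) * wedge12 ξ2 (sdForm e0 e3 e1 e2) l m n = 0 := by
  have h1 := extD2_extD1 D hD ξ1 l m n
  have h2 : extD2 D (extD1 D ξ1) l m n = algebraMap ℂ A l1 * extD2 D (sdForm e0 e1 e2 e3) l m n -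
      extD2 D (wedge11 ξ2 ξ3) l m n := by
    simp only [extD2, h.C1, map_sub, Derivation.leibniz, Derivation.map_algebraMap, smul_eq_mul]
    ring
  rw [h2, extD2_wedge11, h.T1] at h1
  have h3 : wedge12 ξ3 (extD1 D ξ2) l m n = algebraMap ℂ A l2 * wedge12 ξ3 (sdForm e0 e2 e3 e1) l m n
      - wedge12 ξ3 (wedge11 ξ3 ξ1) l m n := by
    simp only [wedge12, h.C2]; ring
  have h4 : wedge12 ξ2 (extD1 D ξ3) l m n = algebraMap ℂ A l3 * wedge12 ξ2 (sdForm e0 e3 e1 e2) l m n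
      - wedge12 ξ2 (wedge11 ξ1 ξ2) l m n := by
    simp only [wedge12, h.C3]; ring
  have h5 : wedge12 ξ3 (wedge11 ξ3 ξ1) l m n = 0 := by simp only [wedge12, wedge11]; ring
  have h6 : wedge12 ξ2 (wedge11 ξ1 ξ2) l m n = 0 := by simp only [wedge12, wedge11]; ring
  rw [h3, h4, h5, h6] at h1
  rw [map_sub, map_sub]
  linear_combination h1

end Forms

/-! ### Dual frames and the quaternionic form of the Bianchi relations. -/

section Coframe

variable {A : Type*} [CommRing A]

/-- `X₀, …, X₃` is the frame dual to the coframe `e₀, …, e₃`. -/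
structure IsDualFrame (e0 e1 e2 e3 X0 X1 X2 X3 : Fin 4 → A) : Prop where
  p00 : pair e0 X0 = 1
  p01 : pair e0 X1 = 0
  p02 : pair e0 X2 = 0
  p03 : pair e0 X3 = 0
  p10 : pair e1 X0 = 0
  p11 : pair e1 X1 = 1
  p12 : pair e1 X2 = 0
  p13 : pair e1 X3 = 0
  p20 : pair e2 X0 = 0
  p21 : pair e2 X1 = 0
  p22 : pair e2 X2 = 1
  p23 : pair e2 X3 = 0
  p30 : pair e3 X0 = 0
  p31 : pair e3 X1 = 0
  p32 : pair e3 X2 = 0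
  p33 : pair e3 X3 = 1
  expand : ∀ (ξ : Fin 4 → A) m,
    ξ m = pair ξ X0 * e0 m + pair ξ X1 * e1 m + pair ξ X2 * e2 m + pair ξ X3 * e3 m

theorem isDualFrame_of_mul_eq_one {e X : Matrix (Fin 4) (Fin 4) A} (h : e * X = 1) :
    IsDualFrame (e 0) (e 1) (e 2) (e 3) (fun m => X m 0) (fun m => X m 1) (fun m => X m 2)
      (fun m => X m 3) := by
  have h1 : ∀ a b, pair (e a) (fun m => X m b) = (1 : Matrix (Fin 4) (Fin 4) A) a b := by
    intro a b; rw [← h, Matrix.mul_apply]; rfl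
  have h2 : X * e = 1 := mul_eq_one_comm.mp h
  constructor <;> try (rw [h1]; simp)
  intro ξ m
  have h3 : ξ = Matrix.vecMul ξ (X * e) := by rw [h2, Matrix.vecMul_one]
  rw [← Matrix.vecMul_vecMul] at h3
  conv_lhs => rw [h3]
  simp only [Matrix.vecMul, dotProduct, Fin.sum_univ_four, pair]

variable {e0 e1 e2 e3 X0 X1 X2 X3 : Fin 4 → A}

theorem IsDualFrame.rotate (h : IsDualFrame e0 e1 e2 e3 X0 X1 X2 X3) :
    IsDualFrame e0 e2 e3 e1 X0 X2 X3 X1 :=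
  ⟨h.p00, h.p02, h.p03, h.p01, h.p20, h.p22, h.p23, h.p21, h.p30, h.p32, h.p33, h.p31,
    h.p10, h.p12, h.p13, h.p11, fun ξ m => (h.expand ξ m).trans (by ring)⟩

/-- Wedging with a self-dual form ωᵢ is, up to the Hodge star, the action of the i-th quaternion
unit on 1-forms. The hypothesis therefore expresses η₃ as a unit applied to η₂, and its values on
the four triples of frame vectors are the four components of this relation. -/
theorem IsDualFrame.wedge_relation (h : IsDualFrame e0 e1 e2 e3 X0 X1 X2 X3) {η2 η3 : Fin 4 → A}
    (hη : ∀ l m n, wedge12 η3 (sdForm e0 e2 e3 e1) l m n +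
      wedge12 η2 (sdForm e0 e3 e1 e2) l m n = 0) :
    pair η3 X1 = pair η2 X0 ∧ pair η3 X0 = - pair η2 X1 ∧ pair η3 X3 = pair η2 X2 ∧
      pair η3 X2 = - pair η2 X3 := by
  have key : ∀ X Y Z : Fin 4 → A, eval3 (wedge12 η3 (sdForm e0 e2 e3 e1)) X Y Z +
      eval3 (wedge12 η2 (sdForm e0 e3 e1 e2)) X Y Z = 0 := by
    intro X Y Z
    simp only [eval3, ← Finset.sum_add_distrib, ← add_mul, hη, zero_mul, Finset.sum_const_zero]
  have k1 := key X0 X1 X2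
  have k2 := key X0 X1 X3
  have k3 := key X0 X2 X3
  have k4 := key X1 X2 X3
  simp only [eval3_wedge12, eval2_sdForm, h.p00, h.p01, h.p02, h.p03, h.p10, h.p11, h.p12, h.p13,
    h.p20, h.p21, h.p22, h.p23, h.p30, h.p31, h.p32, h.p33] at k1 k2 k3 k4
  refine ⟨?_, ?_, ?_, ?_⟩
  · linear_combination -k1
  · linear_combination -k2
  · linear_combination k3
  · linear_combination k4

/-- The 1-forms obtained by applying the quaternion units to a 1-form with the components `w`. -/
theorem IsDualFrame.quaternionic (h : IsDualFrame e0 e1 e2 e3 X0 X1 X2 X3)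
    {η1 η2 η3 : Fin 4 → A}
    (h1 : ∀ l m n, wedge12 η3 (sdForm e0 e2 e3 e1) l m n +
      wedge12 η2 (sdForm e0 e3 e1 e2) l m n = 0)
    (h2 : ∀ l m n, wedge12 η1 (sdForm e0 e3 e1 e2) l m n +
      wedge12 η3 (sdForm e0 e1 e2 e3) l m n = 0)
    (h3 : ∀ l m n, wedge12 η2 (sdForm e0 e1 e2 e3) l m n +
      wedge12 η1 (sdForm e0 e2 e3 e1) l m n = 0) :
    ∀ w0 w1 w2 w3, w0 = pair η1 X1 → w1 = - pair η1 X0 → w2 = pair η1 X3 → w3 = - pair η1 X2 →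
      (∀ m, η1 m = - w1 * e0 m + w0 * e1 m - w3 * e2 m + w2 * e3 m) ∧
      (∀ m, η2 m = - w2 * e0 m + w3 * e1 m + w0 * e2 m - w1 * e3 m) ∧
      (∀ m, η3 m = - w3 * e0 m - w2 * e1 m + w1 * e2 m + w0 * e3 m) := by
  rintro w0 w1 w2 w3 rfl rfl rfl rfl
  obtain ⟨a1, a2, a3, a4⟩ := h.wedge_relation h1
  obtain ⟨b1, b2, b3, b4⟩ := h.rotate.wedge_relation h2
  obtain ⟨c1, c2, c3, c4⟩ := h.rotate.rotate.wedge_relation h3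
  refine ⟨fun m => ?_, fun m => ?_, fun m => ?_⟩
  · rw [h.expand η1 m]; ring
  · rw [h.expand η2 m]
    linear_combination (e0 m) * c2 + e1 m * c4 + e2 m * c3 + e3 m * c1
  · rw [h.expand η3 m]
    linear_combination (-e0 m) * b1 + e1 m * b4 + e2 m * b2 - e3 m * b3
end Coframe

/-! ### The coframe generated by a 1-form under the quaternion units. -/

section Quaternionic

variable {A : Type*} [CommRing A]

/-- The 1-forms `η₀, …, η₃` obtained by applying `1` and the three quaternion units to the 1-form
with the components `w₀, …, w₃` in the coframe `e₀, …, e₃`. -/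
structure IsQuaternionic (e0 e1 e2 e3 η0 η1 η2 η3 : Fin 4 → A) (w0 w1 w2 w3 : A) : Prop where
  h0 : ∀ m, η0 m = w0 * e0 m + w1 * e1 m + w2 * e2 m + w3 * e3 m
  h1 : ∀ m, η1 m = - w1 * e0 m + w0 * e1 m - w3 * e2 m + w2 * e3 m
  h2 : ∀ m, η2 m = - w2 * e0 m + w3 * e1 m + w0 * e2 m - w1 * e3 m
  h3 : ∀ m, η3 m = - w3 * e0 m - w2 * e1 m + w1 * e2 m + w0 * e3 m

variable {e0 e1 e2 e3 η0 η1 η2 η3 X0 X1 X2 X3 : Fin 4 → A} {w0 w1 w2 w3 : A}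

theorem IsQuaternionic.rotate (h : IsQuaternionic e0 e1 e2 e3 η0 η1 η2 η3 w0 w1 w2 w3) :
    IsQuaternionic e0 e2 e3 e1 η0 η2 η3 η1 w0 w2 w3 w1 :=
  ⟨fun m => (h.h0 m).trans (by ring), fun m => (h.h2 m).trans (by ring),
    fun m => (h.h3 m).trans (by ring), fun m => (h.h1 m).trans (by ring)⟩

/-- Passing from e to η is multiplication by the quaternion w on the side that commutes with the
three units. Such a map is a homothety with factor |w|², and its rotation part acts trivially on Λ⁺.
-/
theorem IsQuaternionic.sdForm_eq (h : IsQuaternionic e0 e1 e2 e3 η0 η1 η2 η3 w0 w1 w2 w3)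
    (m n : Fin 4) : sdForm η0 η1 η2 η3 m n =
      (w0 ^ 2 + w1 ^ 2 + w2 ^ 2 + w3 ^ 2) * sdForm e0 e1 e2 e3 m n := by
  simp only [sdForm, wedge11, h.h0, h.h1, h.h2, h.h3]; ring

theorem IsQuaternionic.sum_mul (h : IsQuaternionic e0 e1 e2 e3 η0 η1 η2 η3 w0 w1 w2 w3)
    (m n : Fin 4) : η0 m * η0 n + η1 m * η1 n + η2 m * η2 n + η3 m * η3 n =
      (w0 ^ 2 + w1 ^ 2 + w2 ^ 2 + w3 ^ 2) *
        (e0 m * e0 n + e1 m * e1 n + e2 m * e2 n + e3 m * e3 n) := by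
  simp only [h.h0, h.h1, h.h2, h.h3]; ring

/-- Both sides are, up to sign, the Hodge dual of η₀. Thus one 3-form has three presentations ηᵢ∧ωᵢ,
and the three formulas for its derivative can be compared. -/
theorem IsQuaternionic.wedge12_eq (h : IsQuaternionic e0 e1 e2 e3 η0 η1 η2 η3 w0 w1 w2 w3) :
    wedge12 η1 (sdForm e0 e1 e2 e3) = wedge12 η2 (sdForm e0 e2 e3 e1) := by
  funext l m n
  simp only [wedge12, sdForm, wedge11, h.h1, h.h2]; ring

/-- The coordinate component of the 4-form `e₀ ∧ e₁ ∧ e₂ ∧ e₃`. -/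
def vol4 (e0 e1 e2 e3 : Fin 4 → A) : A := wedge22 (wedge11 e0 e1) (wedge11 e2 e3)

theorem wedge22_sdForm_self (e0 e1 e2 e3 : Fin 4 → A) :
    wedge22 (sdForm e0 e1 e2 e3) (sdForm e0 e1 e2 e3) = 2 * vol4 e0 e1 e2 e3 := by
  simp only [wedge22, sdForm, wedge11, vol4]; ring

theorem vol4_rotate (e0 e1 e2 e3 : Fin 4 → A) : vol4 e0 e2 e3 e1 = vol4 e0 e1 e2 e3 := by
  simp only [wedge22, wedge11, vol4]; ring

theorem IsQuaternionic.wedge22_eq (h : IsQuaternionic e0 e1 e2 e3 η0 η1 η2 η3 w0 w1 w2 w3) :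
    wedge22 (wedge11 η2 η3) (sdForm e0 e1 e2 e3) =
      (w0 ^ 2 + w1 ^ 2 + w2 ^ 2 + w3 ^ 2) * vol4 e0 e1 e2 e3 := by
  simp only [wedge22, sdForm, wedge11, vol4, h.h2, h.h3]; ring

theorem wedge13_wedge12 (ξ η : Fin 4 → A) (α : Fin 4 → Fin 4 → A) (hα : ∀ m n, α m n = - α n m) :
    wedge13 ξ (wedge12 η α) = wedge22 (wedge11 ξ η) α := by
  simp only [wedge13, wedge12, wedge22, wedge11]
  rw [hα 2 0, hα 3 0, hα 3 1]
  ring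

theorem wedge22_swap (ξ η : Fin 4 → A) (α : Fin 4 → Fin 4 → A) :
    wedge22 (wedge11 ξ η) α = - wedge22 (wedge11 η ξ) α := by
  simp only [wedge22, wedge11]; ring

theorem eval2_expand (hX : IsDualFrame e0 e1 e2 e3 X0 X1 X2 X3) (α : Fin 4 → Fin 4 → A)
    (h0 : ∀ m n, α m n = - α n m)
    (h01 : eval2 α X0 X1 = 0) (h02 : eval2 α X0 X2 = 0) (h03 : eval2 α X0 X3 = 0)
    (h12 : eval2 α X1 X2 = 0) (h13 : eval2 α X1 X3 = 0) (h23 : eval2 α X2 X3 = 0)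
    (h00 : eval2 α X0 X0 = 0) (h11 : eval2 α X1 X1 = 0) (h22 : eval2 α X2 X2 = 0)
    (h33 : eval2 α X3 X3 = 0) (m n : Fin 4) : α m n = 0 := by
  have hs : ∀ X Y, eval2 α X Y = - eval2 α Y X := by
    intro X Y
    simp only [eval2, ← Finset.sum_neg_distrib]
    rw [Finset.sum_comm]
    refine Finset.sum_congr rfl fun i _ => Finset.sum_congr rfl fun j _ => ?_
    rw [h0]; ring
  have hp : ∀ X Y, pair (fun k => pair (fun j => α k j) Y) X = eval2 α X Y := by
    intro X Y
    simp only [pair, eval2, Finset.sum_mul]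
    exact Finset.sum_congr rfl fun i _ => Finset.sum_congr rfl fun j _ => by ring
  have hz : ∀ Y, eval2 α X0 Y = 0 → eval2 α X1 Y = 0 → eval2 α X2 Y = 0 → eval2 α X3 Y = 0 →
      ∀ k, pair (fun j => α k j) Y = 0 := by
    intro Y y0 y1 y2 y3 k
    have := hX.expand (fun k => pair (fun j => α k j) Y) k
    rw [hp, hp, hp, hp, y0, y1, y2, y3] at this
    simpa using this
  have e := hX.expand (fun j => α m j) n
  rw [hz X0 h00 (by rw [hs, h01, neg_zero]) (by rw [hs, h02, neg_zero]) (by rw [hs, h03, neg_zero]),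
    hz X1 h01 h11 (by rw [hs, h12, neg_zero]) (by rw [hs, h13, neg_zero]),
    hz X2 h02 h12 h22 (by rw [hs, h23, neg_zero]), hz X3 h03 h13 h23 h33] at e
  simpa using e

theorem pair_smul_add (a b c d : A) (e0 e1 e2 e3 X : Fin 4 → A) (η : Fin 4 → A)
    (h : ∀ m, η m = a * e0 m + b * e1 m + c * e2 m + d * e3 m) :
    pair η X = a * pair e0 X + b * pair e1 X + c * pair e2 X + d * pair e3 X := by
  simp only [pair, h, Fin.sum_univ_four]; ring

theorem pair_comb (a b c d t : A) (ξ X0 X1 X2 X3 : Fin 4 → A) :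
    pair ξ (fun m => t * (a * X0 m + b * X1 m + c * X2 m + d * X3 m)) =
      t * (a * pair ξ X0 + b * pair ξ X1 + c * pair ξ X2 + d * pair ξ X3) := by
  simp only [pair, Fin.sum_univ_four]; ring

/-- The frame dual to a quaternionic coframe. -/
theorem IsQuaternionic.dualFrame (h : IsQuaternionic e0 e1 e2 e3 η0 η1 η2 η3 w0 w1 w2 w3)
    (hX : IsDualFrame e0 e1 e2 e3 X0 X1 X2 X3) {t : A}
    (ht : t * (w0 ^ 2 + w1 ^ 2 + w2 ^ 2 + w3 ^ 2) = 1) :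
    IsDualFrame η0 η1 η2 η3
      (fun m => t * (w0 * X0 m + w1 * X1 m + w2 * X2 m + w3 * X3 m))
      (fun m => t * (- w1 * X0 m + w0 * X1 m + - w3 * X2 m + w2 * X3 m))
      (fun m => t * (- w2 * X0 m + w3 * X1 m + w0 * X2 m + - w1 * X3 m))
      (fun m => t * (- w3 * X0 m + - w2 * X1 m + w1 * X2 m + w0 * X3 m)) := by
  have p0 := fun X => pair_smul_add _ _ _ _ e0 e1 e2 e3 X η0 h.h0
  have p1 := fun X => pair_smul_add _ _ _ _ e0 e1 e2 e3 X η1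
    (fun m => (h.h1 m).trans (by rw [sub_eq_add_neg, ← neg_mul]))
  have p2 := fun X => pair_smul_add _ _ _ _ e0 e1 e2 e3 X η2
    (fun m => (h.h2 m).trans (by rw [sub_eq_add_neg, ← neg_mul]))
  have p3 := fun X => pair_smul_add _ _ _ _ e0 e1 e2 e3 X η3
    (fun m => (h.h3 m).trans (by rw [sub_eq_add_neg (-w3 * e0 m), ← neg_mul]))
  constructor
  case expand =>
    intro ξ m
    simp only [pair_comb, h.h0, h.h1, h.h2, h.h3]
    conv_lhs => rw [hX.expand ξ m]
    linear_combination (-(pair ξ X0 * e0 m + pair ξ X1 * e1 m + pair ξ X2 * e2 m +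
      pair ξ X3 * e3 m)) * ht
  all_goals
    simp only [pair_comb, p0, p1, p2, p3, hX.p00, hX.p01, hX.p02, hX.p03, hX.p10, hX.p11, hX.p12,
      hX.p13, hX.p20, hX.p21, hX.p22, hX.p23, hX.p30, hX.p31, hX.p32, hX.p33]
    first | linear_combination ht | ring1

end Quaternionic

section Wedge

variable {A : Type*} [CommRing A]

theorem wedge12_const_mul (c : A) (ξ : Fin 4 → A) (α : Fin 4 → Fin 4 → A) (l m n : Fin 4) :
    wedge12 (fun m => c * ξ m) α l m n = c * wedge12 ξ α l m n := by
  simp only [wedge12]; ring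

theorem wedge22_lin (a b : A) (α β γ : Fin 4 → Fin 4 → A) :
    wedge22 (fun m n => a * α m n - b * β m n) γ = a * wedge22 α γ - b * wedge22 β γ := by
  simp only [wedge22]; ring

theorem wedge13_lin (a b c : A) (ξ : Fin 4 → A) (θ ψ : Fin 4 → Fin 4 → Fin 4 → A) :
    wedge13 (fun m => a * ξ m) (fun l m n => b * θ l m n - c * ψ l m n) =
      a * (b * wedge13 ξ θ - c * wedge13 ξ ψ) := by
  simp only [wedge13]; ring

end Wedge

/-! ### Consequences of the structure equations: the 1-form w and its divergence. -/

section Structure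

variable {A : Type*} [CommRing A] [Algebra ℂ A] {D : Fin 4 → Derivation ℂ A A}
variable {e0 e1 e2 e3 ξ1 ξ2 ξ3 X0 X1 X2 X3 : Fin 4 → A} {l1 l2 l3 : ℂ}

local notation "κ" => algebraMap ℂ A

/-- The common 1-form `w` from which the connection forms arise. -/
def quatBase (l2 l3 : ℂ) (e0 e1 e2 e3 ξ1 X0 X1 X2 X3 : Fin 4 → A) (m : Fin 4) : A :=
  algebraMap ℂ A (l2 - l3) * (pair ξ1 X1 * e0 m - pair ξ1 X0 * e1 m + pair ξ1 X3 * e2 m -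
    pair ξ1 X2 * e3 m)

/-- Once the differences of eigenvalues are absorbed into the connection forms, the Bianchi
relations for the three cyclic shifts are exactly the hypotheses of `IsDualFrame.quaternionic`. -/
theorem SelfDualStructure.isQuaternionic (hD : ∀ i j a, D i (D j a) = D j (D i a))
    (h : SelfDualStructure D e0 e1 e2 e3 ξ1 ξ2 ξ3 l1 l2 l3)
    (hX : IsDualFrame e0 e1 e2 e3 X0 X1 X2 X3) :
    IsQuaternionic e0 e1 e2 e3 (quatBase l2 l3 e0 e1 e2 e3 ξ1 X0 X1 X2 X3)
      (fun m => κ (l2 - l3) * ξ1 m) (fun m => κ (l3 - l1) * ξ2 m) (fun m => κ (l1 - l2) * ξ3 m)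
      (κ (l2 - l3) * pair ξ1 X1) (- (κ (l2 - l3) * pair ξ1 X0)) (κ (l2 - l3) * pair ξ1 X3)
      (- (κ (l2 - l3) * pair ξ1 X2)) := by
  have hp : ∀ X, pair (fun m => κ (l2 - l3) * ξ1 m) X = κ (l2 - l3) * pair ξ1 X := by
    intro X; simp only [pair, Finset.mul_sum, mul_assoc]
  obtain ⟨q1, q2, q3⟩ := hX.quaternionic (η1 := fun m => κ (l2 - l3) * ξ1 m)
    (η2 := fun m => κ (l3 - l1) * ξ2 m) (η3 := fun m => κ (l1 - l2) * ξ3 m)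
    (fun l m n => by rw [wedge12_const_mul, wedge12_const_mul]; exact h.bianchi hD l m n)
    (fun l m n => by rw [wedge12_const_mul, wedge12_const_mul]; exact h.rotate.bianchi hD l m n)
    (fun l m n => by
      rw [wedge12_const_mul, wedge12_const_mul]; exact h.rotate.rotate.bianchi hD l m n)
    _ _ _ _ rfl rfl rfl rfl
  simp only [hp] at q1 q2 q3
  refine ⟨fun m => ?_, q1, q2, q3⟩
  rw [quatBase]; ring

/-- The components of w are read off from (λ₂−λ₃)ξ₁. When this form is zero so is w, and the other
two scaled forms are images of w under quaternion units. -/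
theorem SelfDualStructure.eq_zero_of_eq (hD : ∀ i j a, D i (D j a) = D j (D i a))
    (h : SelfDualStructure D e0 e1 e2 e3 ξ1 ξ2 ξ3 l1 l2 l3)
    (hX : IsDualFrame e0 e1 e2 e3 X0 X1 X2 X3) (hl : l2 = l3) :
    (∀ m, κ (l2 - l3) * ξ1 m = 0) ∧ (∀ m, κ (l3 - l1) * ξ2 m = 0) ∧
      ∀ m, κ (l1 - l2) * ξ3 m = 0 := by
  obtain ⟨-, q1, q2, q3⟩ := h.isQuaternionic hD hX
  have hz : κ (l2 - l3) = 0 := by rw [hl, sub_self, map_zero]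
  rw [hz] at q1 q2 q3
  rw [hz]
  exact ⟨fun m => (q1 m).trans (by ring), fun m => (q2 m).trans (by ring),
    fun m => (q3 m).trans (by ring)⟩

/-- If two of the eigenvalues agree, then the curvature operator is parallel. -/
theorem SelfDualStructure.eq_zero_of_degenerate (hD : ∀ i j a, D i (D j a) = D j (D i a))
    (h : SelfDualStructure D e0 e1 e2 e3 ξ1 ξ2 ξ3 l1 l2 l3)
    (hX : IsDualFrame e0 e1 e2 e3 X0 X1 X2 X3) (hl : l2 = l3 ∨ l3 = l1 ∨ l1 = l2) :
    (∀ m, κ (l2 - l3) * ξ1 m = 0) ∧ (∀ m, κ (l3 - l1) * ξ2 m = 0) ∧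
      ∀ m, κ (l1 - l2) * ξ3 m = 0 := by
  rcases hl with hl | hl | hl
  · exact h.eq_zero_of_eq hD hX hl
  · obtain ⟨a, b, c⟩ := h.rotate.eq_zero_of_eq hD hX.rotate hl
    exact ⟨c, a, b⟩
  · obtain ⟨a, b, c⟩ := h.rotate.rotate.eq_zero_of_eq hD hX.rotate.rotate hl
    exact ⟨b, c, a⟩

/-- The divergence of the 1-form `w`. -/
theorem SelfDualStructure.divergence {η0 η1 η2 η3 : Fin 4 → A} {w0 w1 w2 w3 : A}
    {x1 x2 x3 : ℂ} (h : SelfDualStructure D e0 e1 e2 e3 ξ1 ξ2 ξ3 l1 l2 l3)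
    (hq : IsQuaternionic e0 e1 e2 e3 η0 η1 η2 η3 w0 w1 w2 w3)
    (e_1 : ∀ m, ξ1 m = κ x1⁻¹ * η1 m) (e_2 : ∀ m, ξ2 m = κ x2⁻¹ * η2 m)
    (e_3 : ∀ m, ξ3 m = κ x3⁻¹ * η3 m) (h1 : x1 ≠ 0) (h2 : x2 ≠ 0) (h3 : x3 ≠ 0)
    (hx : x1 + x2 + x3 = 0) :
    extD3 D (wedge12 η1 (sdForm e0 e1 e2 e3)) = 2 * vol4 e0 e1 e2 e3 *
      (κ (x1 * l1) - (w0 ^ 2 + w1 ^ 2 + w2 ^ 2 + w3 ^ 2) * κ (x1 * x1 / (x1 * x2 * x3))) := by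
  have hη1 : ∀ m, η1 m = κ x1 * ξ1 m := fun m => by
    rw [e_1, ← mul_assoc, ← map_mul, mul_inv_cancel₀ h1, map_one, one_mul]
  have hd : extD1 D η1 = fun m n => κ (x1 * l1) * sdForm e0 e1 e2 e3 m n -
      κ (x1 * x2⁻¹ * x3⁻¹) * wedge11 η2 η3 m n := by
    funext m n
    have := h.C1 m n
    simp only [extD1, hη1, Derivation.leibniz, Derivation.map_algebraMap, smul_eq_mul,
      mul_zero, add_zero] at this ⊢
    rw [← mul_sub, this]
    simp only [wedge11, e_2, e_3, map_mul]
    ring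
  have hT : extD2 D (sdForm e0 e1 e2 e3) = fun l m n =>
      κ x3⁻¹ * wedge12 η3 (sdForm e0 e2 e3 e1) l m n -
        κ x2⁻¹ * wedge12 η2 (sdForm e0 e3 e1 e2) l m n := by
    funext l m n
    rw [h.T1]
    simp only [wedge12, e_2, e_3]
    ring
  -- Inserting the factor 1 gives the left argument the shape that `wedge13_lin` rewrites.
  have hη1' : η1 = fun m => κ 1 * η1 m := by simp
  have v1 := hq.wedge22_eq
  have v2 := hq.rotate.wedge22_eq
  have v3 := hq.rotate.rotate.wedge22_eq
  rw [vol4_rotate] at v2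
  rw [vol4_rotate, vol4_rotate] at v3
  have v2' := wedge22_swap η3 η1 (sdForm e0 e2 e3 e1)
  rw [extD3_wedge12 D _ _ (sdForm_skew _ _ _ _), hd, wedge22_lin, wedge22_sdForm_self, v1, hT]
  conv_lhs => rw [hη1']
  rw [wedge13_lin, wedge13_wedge12 _ _ _ (sdForm_skew _ _ _ _),
    wedge13_wedge12 _ _ _ (sdForm_skew _ _ _ _), v3, ← neg_eq_iff_eq_neg.mpr v2', v2, map_one]
  -- The coefficient of |w|²: as x₂ + x₃ = −x₁, one has x₁/(x₂x₃) − 1/x₃ − 1/x₂ = 2x₁/(x₂x₃).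
  have c : κ (x1 * x2⁻¹ * x3⁻¹) - κ x3⁻¹ - κ x2⁻¹ = 2 * κ (x1 * x1 / (x1 * x2 * x3)) := by
    rw [← map_sub, ← map_sub, show (2 : A) = κ 2 from (map_ofNat _ 2).symm, ← map_mul]
    congr 1
    have : x1 = - x2 - x3 := by linear_combination hx
    field_simp
    rw [this]; ring
  linear_combination (-(w0 ^ 2 + w1 ^ 2 + w2 ^ 2 + w3 ^ 2) * vol4 e0 e1 e2 e3) * c

end Structure

section Wedge

variable {A : Type*} [CommRing A]

theorem vol4_eq_det (e : Matrix (Fin 4) (Fin 4) A) : vol4 (e 0) (e 1) (e 2) (e 3) = e.det := by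
  rw [Matrix.det_succ_row_zero]
  simp [Matrix.det_fin_three, Fin.sum_univ_succ, vol4, wedge22, wedge11, Fin.succAbove]
  ring

theorem eval2_lin (a b : A) (α β : Fin 4 → Fin 4 → A) (X Y : Fin 4 → A) :
    eval2 (fun m n => a * α m n + b * β m n) X Y = a * eval2 α X Y + b * eval2 β X Y := by
  simp only [eval2, Fin.sum_univ_four]; ring

theorem eval3_comb (θ1 θ2 θ3 θ4 : Fin 4 → Fin 4 → Fin 4 → A) (X Y Z : Fin 4 → A) :
    eval3 (fun l m n => θ1 l m n - θ2 l m n + (θ3 l m n - θ4 l m n)) X Y Z =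
      eval3 θ1 X Y Z - eval3 θ2 X Y Z + (eval3 θ3 X Y Z - eval3 θ4 X Y Z) := by
  simp only [eval3, add_mul, sub_mul, Finset.sum_add_distrib, Finset.sum_sub_distrib]

theorem eval3_lin (a b : A) (θ1 θ2 : Fin 4 → Fin 4 → Fin 4 → A) (X Y Z : Fin 4 → A) :
    eval3 (fun l m n => a * θ1 l m n - b * θ2 l m n) X Y Z =
      a * eval3 θ1 X Y Z - b * eval3 θ2 X Y Z := by
  simp only [eval3, sub_mul, Finset.sum_sub_distrib, Finset.mul_sum, mul_assoc]

end Wedge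

/-! ### Distinct eigenvalues: |w|² is constant and the coframe obeys Lie-group structure equations.
-/

section Distinct

variable {A : Type*} [CommRing A] [Algebra ℂ A] {D : Fin 4 → Derivation ℂ A A}
variable {e0 e1 e2 e3 ξ1 ξ2 ξ3 X0 X1 X2 X3 : Fin 4 → A} {l1 l2 l3 : ℂ}

local notation "κ" => algebraMap ℂ A

/-- If all three squares agreed, then x₁² − x₂² = −(x₁−x₂)x₃, and likewise cyclically, would force
x₁ = x₂ = x₃, and the sum condition would make them zero. -/
theorem exists_sq_ne {x1 x2 x3 : ℂ} (hx : x1 + x2 + x3 = 0) (h1 : x1 ≠ 0)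
    (h3 : x3 ≠ 0) : x1 * x1 - x2 * x2 ≠ 0 ∨ x2 * x2 - x3 * x3 ≠ 0 := by
  by_contra! hc
  obtain ⟨c1, c2⟩ := hc
  have e1 : (x1 - x2) * x3 = 0 := by linear_combination -c1 + (x1 - x2) * hx
  have e2 : (x2 - x3) * x1 = 0 := by linear_combination -c2 + (x2 - x3) * hx
  have e1' : x1 = x2 := sub_eq_zero.mp ((mul_eq_zero.mp e1).resolve_right h3)
  have e2' : x2 = x3 := sub_eq_zero.mp ((mul_eq_zero.mp e2).resolve_right h1)
  apply h3
  rw [e1', e2'] at hx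
  linear_combination hx / 3

/-- The relations are affine in N with constant coefficients, and in at least one of them the
coefficient of N is nonzero, so N is a constant. Were it zero, the three products (λ₂−λ₃)λ₁ etc.
would be equal with sum zero, hence all zero, giving λ₁ = λ₂ = 0. -/
theorem exists_const_of_relations [Nontrivial A] {N : A} {P l1 l2 l3 : ℂ} (hP : P ≠ 0)
    (h1 : l2 - l3 ≠ 0) (h2 : l3 - l1 ≠ 0) (h3 : l1 - l2 ≠ 0)
    (r1 : κ ((l2 - l3) * l1) - N * κ ((l2 - l3) * (l2 - l3) / P) =
      κ ((l3 - l1) * l2) - N * κ ((l3 - l1) * (l3 - l1) / P))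
    (r2 : κ ((l3 - l1) * l2) - N * κ ((l3 - l1) * (l3 - l1) / P) =
      κ ((l1 - l2) * l3) - N * κ ((l1 - l2) * (l1 - l2) / P)) :
    ∃ n : ℂ, n ≠ 0 ∧ N = κ n := by
  have hinj : Function.Injective κ := (algebraMap ℂ A).injective
  have aux : ∀ {x y u v : ℂ}, κ u - N * κ (x * x / P) = κ v - N * κ (y * y / P) →
      x * x - y * y ≠ 0 → ∃ n : ℂ, N = κ n := by
    intro x y u v hr hne
    refine ⟨(u - v) * P / (x * x - y * y), ?_⟩
    have h4 : κ (x * x / P - y * y / P) * κ (P / (x * x - y * y)) = 1 := by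
      have hne' : x ^ 2 - y ^ 2 ≠ 0 := by simpa only [sq] using hne
      rw [← map_mul, ← map_one κ]; congr 1; field_simp
    have h5 : κ ((u - v) * P / (x * x - y * y)) = (κ u - κ v) * κ (P / (x * x - y * y)) := by
      rw [← map_sub, ← map_mul, mul_div_assoc]
    rw [h5]
    rw [map_sub] at h4
    linear_combination (-N) * h4 - κ (P / (x * x - y * y)) * hr
  obtain ⟨n, hn⟩ : ∃ n : ℂ, N = κ n := by
    rcases exists_sq_ne (x1 := l2 - l3) (x2 := l3 - l1) (x3 := l1 - l2) (by ring) h1 h3 with hne | hne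
    · exact aux r1 hne
    · exact aux r2 hne
  refine ⟨n, ?_, hn⟩
  rintro rfl
  rw [hn, map_zero, zero_mul, zero_mul, sub_zero, sub_zero] at r1
  rw [hn, map_zero, zero_mul, zero_mul, sub_zero, sub_zero] at r2
  have q1 := hinj r1
  have q2 := hinj r2
  have z1 : (l2 - l3) * l1 = 0 := by linear_combination (2 / 3) * q1 + (1 / 3) * q2
  have z2 : (l3 - l1) * l2 = 0 := by rw [← q1, z1]
  have z3 : (l1 - l2) * l3 = 0 := by rw [← q2, z2]
  have z1' := (mul_eq_zero.mp z1).resolve_left h1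
  have z2' := (mul_eq_zero.mp z2).resolve_left h2
  exact h3 (by rw [z1', z2', sub_zero])

/-- If the eigenvalues are distinct, the length of `w` is a nonzero constant. -/
theorem SelfDualStructure.exists_const [Nontrivial A]
    {e X : Matrix (Fin 4) (Fin 4) A} (heX : e * X = 1) {η0 η1 η2 η3 : Fin 4 → A}
    {w0 w1 w2 w3 : A}
    (h : SelfDualStructure D (e 0) (e 1) (e 2) (e 3) ξ1 ξ2 ξ3 l1 l2 l3)
    (hq : IsQuaternionic (e 0) (e 1) (e 2) (e 3) η0 η1 η2 η3 w0 w1 w2 w3)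
    (e_1 : ∀ m, ξ1 m = κ (l2 - l3)⁻¹ * η1 m) (e_2 : ∀ m, ξ2 m = κ (l3 - l1)⁻¹ * η2 m)
    (e_3 : ∀ m, ξ3 m = κ (l1 - l2)⁻¹ * η3 m)
    (h1 : l2 - l3 ≠ 0) (h2 : l3 - l1 ≠ 0) (h3 : l1 - l2 ≠ 0) :
    ∃ n : ℂ, n ≠ 0 ∧ w0 ^ 2 + w1 ^ 2 + w2 ^ 2 + w3 ^ 2 = κ n := by
  have d1 := h.divergence hq e_1 e_2 e_3 h1 h2 h3 (by ring)
  have d2 := h.rotate.divergence hq.rotate e_2 e_3 e_1 h2 h3 h1 (by ring)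
  have d3 := h.rotate.rotate.divergence hq.rotate.rotate e_3 e_1 e_2 h3 h1 h2 (by ring)
  rw [← hq.wedge12_eq, d1, vol4_rotate (e 0) (e 1) (e 2) (e 3)] at d2
  rw [← hq.rotate.wedge12_eq, ← hq.wedge12_eq, d1, vol4_rotate (e 0) (e 2) (e 3) (e 1),
    vol4_rotate (e 0) (e 1) (e 2) (e 3)] at d3
  -- The determinant of an invertible coframe matrix is a unit, so the volume factor common to the
  -- three divergence formulas cancels.
  have hu : IsUnit (2 * vol4 (e 0) (e 1) (e 2) (e 3)) := by
    refine IsUnit.mul ?_ ?_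
    · rw [show (2 : A) = κ 2 from (map_ofNat _ 2).symm]
      exact (isUnit_iff_ne_zero.mpr two_ne_zero).map _
    · rw [vol4_eq_det]
      exact IsUnit.of_mul_eq_one X.det (by rw [← Matrix.det_mul, heX, Matrix.det_one])
  have r1 := hu.mul_left_cancel d2
  have r2 := hu.mul_left_cancel d3
  rw [show (l3 - l1) * (l1 - l2) * (l2 - l3) = (l2 - l3) * (l3 - l1) * (l1 - l2) by ring] at r1
  rw [show (l1 - l2) * (l2 - l3) * (l3 - l1) = (l2 - l3) * (l3 - l1) * (l1 - l2) by ring] at r2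
  refine exists_const_of_relations (mul_ne_zero (mul_ne_zero h1 h2) h3) h1 h2 h3
    (N := w0 ^ 2 + w1 ^ 2 + w2 ^ 2 + w3 ^ 2) (r1.trans (by ring)) ?_
  rw [show w0 ^ 2 + w2 ^ 2 + w3 ^ 2 + w1 ^ 2 = w0 ^ 2 + w1 ^ 2 + w2 ^ 2 + w3 ^ 2 by ring] at r1
  rw [show w0 ^ 2 + w3 ^ 2 + w1 ^ 2 + w2 ^ 2 = w0 ^ 2 + w1 ^ 2 + w2 ^ 2 + w3 ^ 2 by ring] at r2
  exact r1.symm.trans r2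

/-- Since |w|² = n is constant, ω₁ = (η₀∧η₁ + η₂∧η₃)/n. Substituting this into the equation for dξ₁
expresses dη₁ in the coframe η with constant coefficients. -/
theorem extD1_eq_of_quaternionic {η0 η1 η2 η3 : Fin 4 → A}
    {w0 w1 w2 w3 : A} {n x1 x2 x3 : ℂ}
    (h : SelfDualStructure D e0 e1 e2 e3 ξ1 ξ2 ξ3 l1 l2 l3)
    (hq : IsQuaternionic e0 e1 e2 e3 η0 η1 η2 η3 w0 w1 w2 w3)
    (e_1 : ∀ m, ξ1 m = κ x1⁻¹ * η1 m) (e_2 : ∀ m, ξ2 m = κ x2⁻¹ * η2 m)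
    (e_3 : ∀ m, ξ3 m = κ x3⁻¹ * η3 m) (h1 : x1 ≠ 0)
    (hn : n ≠ 0) (hN : w0 ^ 2 + w1 ^ 2 + w2 ^ 2 + w3 ^ 2 = κ n) (p q : Fin 4) :
    extD1 D η1 p q = κ (x1 * l1 / n) * wedge11 η0 η1 p q +
      κ (x1 * l1 / n - x1 / (x2 * x3)) * wedge11 η2 η3 p q := by
  have hη1 : ∀ m, η1 m = κ x1 * ξ1 m := fun m => by
    rw [e_1, ← mul_assoc, ← map_mul, mul_inv_cancel₀ h1, map_one, one_mul]
  have hs := hq.sdForm_eq p q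
  rw [hN] at hs
  have := h.C1 p q
  simp only [extD1, hη1, Derivation.leibniz, Derivation.map_algebraMap, smul_eq_mul,
      mul_zero, add_zero] at this ⊢
  rw [← mul_sub, this]
  have hs' : κ (x1 * l1) * sdForm e0 e1 e2 e3 p q =
      κ (x1 * l1 / n) * (wedge11 η0 η1 p q + wedge11 η2 η3 p q) := by
    have : κ (x1 * l1) = κ (x1 * l1 / n) * κ n := by rw [← map_mul]; congr 1; field_simp
    rw [this, mul_assoc, ← hs]; rfl
  have hw : κ x1 * wedge11 ξ2 ξ3 p q = κ (x1 / (x2 * x3)) * wedge11 η2 η3 p q := by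
    have : κ (x1 / (x2 * x3)) = κ x1 * κ x2⁻¹ * κ x3⁻¹ := by
      rw [← map_mul, ← map_mul]; congr 1; simp only [div_eq_mul_inv, mul_inv]; ring
    rw [this]; simp only [wedge11, e_2, e_3]; ring
  have hw' : wedge11 η0 (fun m => κ x1 * ξ1 m) p q = wedge11 η0 η1 p q := by
    simp only [wedge11, hη1]
  rw [mul_sub, ← mul_assoc, ← map_mul, hs', hw, map_sub,
    show wedge11 η0 η1 p q = η0 p * (κ x1 * ξ1 q) - η0 q * (κ x1 * ξ1 p) by
      simp only [wedge11, hη1]]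
  simp only [wedge11]
  ring

/-- The derivative of `N α₁`, evaluated on the dual frame. -/
theorem closed_of_quaternionic {η0 η1 η2 η3 : Fin 4 → A}
    {w0 w1 w2 w3 : A} {n x2 x3 A1 A2 A3 B1 B2 B3 : ℂ}
    (h : SelfDualStructure D e0 e1 e2 e3 ξ1 ξ2 ξ3 l1 l2 l3)
    (hq : IsQuaternionic e0 e1 e2 e3 η0 η1 η2 η3 w0 w1 w2 w3)
    (hX : IsDualFrame η0 η1 η2 η3 X0 X1 X2 X3)
    (e_2 : ∀ m, ξ2 m = κ x2⁻¹ * η2 m) (e_3 : ∀ m, ξ3 m = κ x3⁻¹ * η3 m)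
    (hN : w0 ^ 2 + w1 ^ 2 + w2 ^ 2 + w3 ^ 2 = κ n)
    (d1 : ∀ p q, extD1 D η1 p q = κ A1 * wedge11 η0 η1 p q + κ B1 * wedge11 η2 η3 p q)
    (d2 : ∀ p q, extD1 D η2 p q = κ A2 * wedge11 η0 η2 p q + κ B2 * wedge11 η3 η1 p q)
    (d3 : ∀ p q, extD1 D η3 p q = κ A3 * wedge11 η0 η3 p q + κ B3 * wedge11 η1 η2 p q) :
    κ (A2 + A3 - B1) = κ (x2⁻¹ + x3⁻¹) ∧ eval2 (extD1 D η0) X0 X2 = 0 ∧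
      eval2 (extD1 D η0) X0 X3 = 0 ∧ eval2 (extD1 D η0) X2 X3 = 0 := by
  have s1 : sdForm η0 η1 η2 η3 = fun p q => κ n * sdForm e0 e1 e2 e3 p q := by
    funext p q; rw [hq.sdForm_eq, hN]
  have s2 : ∀ p q, sdForm η0 η2 η3 η1 p q = κ n * sdForm e0 e2 e3 e1 p q := by
    intro p q; rw [hq.rotate.sdForm_eq, ← hN]; ring
  have s3 : ∀ p q, sdForm η0 η3 η1 η2 p q = κ n * sdForm e0 e3 e1 e2 p q := by
    intro p q; rw [hq.rotate.rotate.sdForm_eq, ← hN]; ring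
  -- The derivative of η₀∧η₁ + η₂∧η₃ is computed twice, by the Leibniz rule here and from the
  -- equation for dω₁ next.
  have hL : extD2 D (sdForm η0 η1 η2 η3) = fun l p q =>
      wedge12 η1 (extD1 D η0) l p q - wedge12 η0 (extD1 D η1) l p q +
        (wedge12 η3 (extD1 D η2) l p q - wedge12 η2 (extD1 D η3) l p q) := by
    funext l p q
    rw [← extD2_wedge11, ← extD2_wedge11]
    simp only [extD2, sdForm, map_add]; ring
  have hR : extD2 D (sdForm η0 η1 η2 η3) = fun l p q =>
      κ x3⁻¹ * wedge12 η3 (sdForm η0 η2 η3 η1) l p q -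
        κ x2⁻¹ * wedge12 η2 (sdForm η0 η3 η1 η2) l p q := by
    funext l p q
    have := h.T1 l p q
    have e : extD2 D (sdForm η0 η1 η2 η3) l p q = κ n * extD2 D (sdForm e0 e1 e2 e3) l p q := by
      rw [s1]
      simp only [extD2, Derivation.leibniz, Derivation.map_algebraMap, smul_eq_mul, mul_zero,
        add_zero]
      ring
    rw [e, this]
    simp only [wedge12, s2, s3, e_2, e_3]
    ring
  have f1 : extD1 D η1 = fun p q => κ A1 * wedge11 η0 η1 p q + κ B1 * wedge11 η2 η3 p q :=
    funext fun p => funext fun q => d1 p q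
  have f2 : extD1 D η2 = fun p q => κ A2 * wedge11 η0 η2 p q + κ B2 * wedge11 η3 η1 p q :=
    funext fun p => funext fun q => d2 p q
  have f3 : extD1 D η3 = fun p q => κ A3 * wedge11 η0 η3 p q + κ B3 * wedge11 η1 η2 p q :=
    funext fun p => funext fun q => d3 p q
  have key : ∀ X Y Z : Fin 4 → A, _ := fun X Y Z =>
    congrArg (fun θ => eval3 θ X Y Z) (hL.symm.trans hR)
  simp only [eval3_comb, eval3_lin, eval3_wedge12, f1, f2, f3, eval2_lin, eval2_wedge11,
    eval2_sdForm] at key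
  -- Every term except η₁∧dη₀ is a multiple of η₀∧η₂∧η₃, a component which η₁∧dη₀ lacks. So the
  -- first triple compares constants, and the other three say that η₁∧dη₀ = 0.
  have k1 := key X0 X2 X3
  have k2 := key X1 X0 X2
  have k3 := key X1 X0 X3
  have k4 := key X1 X2 X3
  simp only [hX.p00, hX.p01, hX.p02, hX.p03, hX.p10, hX.p11, hX.p12, hX.p13,
    hX.p20, hX.p21, hX.p22, hX.p23, hX.p30, hX.p31, hX.p32, hX.p33] at k1 k2 k3 k4
  refine ⟨?_, ?_, ?_, ?_⟩
  · simp only [map_add, map_sub]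
    linear_combination k1
  · linear_combination k2
  · linear_combination k3
  · linear_combination k4

theorem eval2_self (ξ : Fin 4 → A) (X : Fin 4 → A) : eval2 (extD1 D ξ) X X = 0 := by
  simp only [eval2, extD1, Fin.sum_univ_four]; ring

theorem eval2_skew (ξ : Fin 4 → A) (X Y : Fin 4 → A) :
    eval2 (extD1 D ξ) X Y = - eval2 (extD1 D ξ) Y X := by
  simp only [eval2, extD1, Fin.sum_univ_four]; ring

/-- By Σxᵢ = 0 and Σxᵢλᵢ = 0 the hypothesis collapses to −2x₁λ₁/n = −2x₁/(x₂x₃). -/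
theorem coefficient_relation {n x1 x2 x3 l1 l2 l3 : ℂ} (h1 : x1 ≠ 0) (h2 : x2 ≠ 0) (h3 : x3 ≠ 0)
    (hn : n ≠ 0) (hx : x1 + x2 + x3 = 0) (hl : x1 * l1 + x2 * l2 + x3 * l3 = 0)
    (h : x2 * l2 / n + x3 * l3 / n - (x1 * l1 / n - x1 / (x2 * x3)) = x2⁻¹ + x3⁻¹) :
    l1 * (x2 * x3) = n := by
  field_simp at h
  apply mul_left_cancel₀ (mul_ne_zero two_ne_zero h1)
  linear_combination (-1 : ℂ) * h + (x2 * x3) * hl + (-n) * hx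

/-- The structure theorem for distinct eigenvalues. -/
theorem SelfDualStructure.structure_equations [Nontrivial A]
    {e X : Matrix (Fin 4) (Fin 4) A} (heX : e * X = 1)
    (h : SelfDualStructure D (e 0) (e 1) (e 2) (e 3) ξ1 ξ2 ξ3 l1 l2 l3)
    {η0 η1 η2 η3 : Fin 4 → A} {w0 w1 w2 w3 : A}
    (hq : IsQuaternionic (e 0) (e 1) (e 2) (e 3) η0 η1 η2 η3 w0 w1 w2 w3)
    (e_1 : ∀ m, ξ1 m = κ (l2 - l3)⁻¹ * η1 m) (e_2 : ∀ m, ξ2 m = κ (l3 - l1)⁻¹ * η2 m)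
    (e_3 : ∀ m, ξ3 m = κ (l1 - l2)⁻¹ * η3 m)
    (h1 : l2 - l3 ≠ 0) (h2 : l3 - l1 ≠ 0) (h3 : l1 - l2 ≠ 0) :
    ∃ n : ℂ, n ≠ 0 ∧ w0 ^ 2 + w1 ^ 2 + w2 ^ 2 + w3 ^ 2 = κ n ∧
      l1 * ((l3 - l1) * (l1 - l2)) = n ∧ l2 * ((l1 - l2) * (l2 - l3)) = n ∧
      l3 * ((l2 - l3) * (l3 - l1)) = n ∧
      (∀ p q, extD1 D η0 p q = 0) ∧
      (∀ p q, extD1 D η1 p q = κ ((l2 - l3) * l1 / n) * wedge11 η0 η1 p q) ∧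
      (∀ p q, extD1 D η2 p q = κ ((l3 - l1) * l2 / n) * wedge11 η0 η2 p q) ∧
      (∀ p q, extD1 D η3 p q = κ ((l1 - l2) * l3 / n) * wedge11 η0 η3 p q) := by
  obtain ⟨n, hn, hN⟩ := h.exists_const heX hq e_1 e_2 e_3 h1 h2 h3
  have hinj : Function.Injective κ := (algebraMap ℂ A).injective
  have hN2 : w0 ^ 2 + w2 ^ 2 + w3 ^ 2 + w1 ^ 2 = κ n := by rw [← hN]; ring
  have hN3 : w0 ^ 2 + w3 ^ 2 + w1 ^ 2 + w2 ^ 2 = κ n := by rw [← hN]; ring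
  have hY := hq.dualFrame (t := κ n⁻¹) (isDualFrame_of_mul_eq_one heX)
    (by rw [hN, ← map_mul, inv_mul_cancel₀ hn, map_one])
  generalize (fun m => _ : Fin 4 → A) = Y0 at hY
  generalize (fun m => _ : Fin 4 → A) = Y1 at hY
  generalize (fun m => _ : Fin 4 → A) = Y2 at hY
  generalize (fun m => _ : Fin 4 → A) = Y3 at hY
  have d1 := extD1_eq_of_quaternionic h hq e_1 e_2 e_3 h1 hn hN
  have d2 := extD1_eq_of_quaternionic h.rotate hq.rotate e_2 e_3 e_1 h2 hn hN2
  have d3 := extD1_eq_of_quaternionic h.rotate.rotate hq.rotate.rotate e_3 e_1 e_2 h3 hn hN3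
  obtain ⟨a1, b1, c1, f1⟩ := closed_of_quaternionic h hq hY e_2 e_3 hN d1 d2 d3
  obtain ⟨a2, b2, c2, f2⟩ := closed_of_quaternionic h.rotate hq.rotate hY.rotate e_3 e_1 hN2
    d2 d3 d1
  obtain ⟨a3, b3, c3, f3⟩ := closed_of_quaternionic h.rotate.rotate hq.rotate.rotate
    hY.rotate.rotate e_1 e_2 hN3 d3 d1 d2
  have r1 := coefficient_relation h1 h2 h3 hn (by ring) (by ring) (hinj a1)
  have r2 := coefficient_relation h2 h3 h1 hn (by ring) (by ring) (hinj a2)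
  have r3 := coefficient_relation h3 h1 h2 hn (by ring) (by ring) (hinj a3)
  -- The relation l y u = n is precisely the vanishing of the coefficient of η₂∧η₃ in dη₁, and
  -- cyclically.
  have z : ∀ {x y u l : ℂ}, y ≠ 0 → u ≠ 0 → l * (y * u) = n → κ (x * l / n - x / (y * u)) = 0 := by
    intro x y u l hy hu hl
    rw [← map_zero κ]
    congr 1
    have hl0 : l ≠ 0 := by rintro rfl; exact hn (by rw [← hl, zero_mul])
    rw [← hl]; field_simp; ring
  refine ⟨n, hn, hN, r1, r2, r3, ?_, ?_, ?_, ?_⟩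
  -- The relations ηᵢ∧dη₀ = 0 for i = 1, 2, 3 together cover all six components of dη₀.
  · refine eval2_expand hY (extD1 D η0) (fun p q => by simp only [extD1]; ring)
      c2 b1 c1 f3 (by rw [eval2_skew, f2, neg_zero]) f1 (eval2_self _ _) (eval2_self _ _)
      (eval2_self _ _) (eval2_self _ _)
  · intro p q; rw [d1, z h2 h3 r1, zero_mul, add_zero]
  · intro p q; rw [d2, z h3 h1 r2, zero_mul, add_zero]
  · intro p q; rw [d3, z h1 h2 r3, zero_mul, add_zero]

end Distinct

/-! ### Cartan's structure equations in a moving frame -/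

section Units

variable {R : Type*} [CommRing R]

variable (R) in
/-- The components of the bivector `e₀ ∧ e₁ + e₂ ∧ e₃`. -/
def quat1 : Matrix (Fin 4) (Fin 4) R := !![0, 1, 0, 0; -1, 0, 0, 0; 0, 0, 0, 1; 0, 0, -1, 0]

variable (R) in
/-- The components of the bivector `e₀ ∧ e₂ + e₃ ∧ e₁`. -/
def quat2 : Matrix (Fin 4) (Fin 4) R := !![0, 0, 1, 0; 0, 0, 0, -1; -1, 0, 0, 0; 0, 1, 0, 0]

variable (R) in
/-- The components of the bivector `e₀ ∧ e₃ + e₁ ∧ e₂`. -/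
def quat3 : Matrix (Fin 4) (Fin 4) R := !![0, 0, 0, 1; 0, 0, 1, 0; 0, -1, 0, 0; -1, 0, 0, 0]

theorem transpose_mul_quat1_mul (e : Matrix (Fin 4) (Fin 4) R) (a b : Fin 4) :
    (e.transpose * quat1 R * e) a b = sdForm (e 0) (e 1) (e 2) (e 3) a b := by
  simp [Matrix.mul_apply, quat1, Fin.sum_univ_four, sdForm, wedge11]; ring

theorem transpose_mul_quat2_mul (e : Matrix (Fin 4) (Fin 4) R) (a b : Fin 4) :
    (e.transpose * quat2 R * e) a b = sdForm (e 0) (e 2) (e 3) (e 1) a b := by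
  simp [Matrix.mul_apply, quat2, Fin.sum_univ_four, sdForm, wedge11]; ring

theorem transpose_mul_quat3_mul (e : Matrix (Fin 4) (Fin 4) R) (a b : Fin 4) :
    (e.transpose * quat3 R * e) a b = sdForm (e 0) (e 3) (e 1) (e 2) a b := by
  simp [Matrix.mul_apply, quat3, Fin.sum_univ_four, sdForm, wedge11]; ring

end Units

/-! ### Connection and curvature matrices in a moving frame. -/

section Cartan

variable {A : Type*} [CommRing A] [Algebra ℂ A] (D : Fin 4 → Derivation ℂ A A)

local notation "κ" => algebraMap ℂ A

/-- The entrywise derivative of a matrix. -/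
def dmat (m : Fin 4) (M : Matrix (Fin 4) (Fin 4) A) : Matrix (Fin 4) (Fin 4) A := M.map (D m)

theorem dmat_mul (m : Fin 4) (M N : Matrix (Fin 4) (Fin 4) A) :
    dmat D m (M * N) = dmat D m M * N + M * dmat D m N := by
  ext i j
  simp only [dmat, Matrix.map_apply, Matrix.mul_apply, map_sum, Derivation.leibniz, smul_eq_mul,
    Matrix.add_apply, ← Finset.sum_add_distrib]
  exact Finset.sum_congr rfl fun k _ => by ring

theorem dmat_add (m : Fin 4) (M N : Matrix (Fin 4) (Fin 4) A) :
    dmat D m (M + N) = dmat D m M + dmat D m N := by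
  ext i j; simp [dmat]

theorem dmat_one (m : Fin 4) : dmat D m 1 = 0 := by
  ext i j
  by_cases h : i = j <;> simp [dmat, h]

theorem dmat_transpose (m : Fin 4) (M : Matrix (Fin 4) (Fin 4) A) :
    dmat D m M.transpose = (dmat D m M).transpose := rfl

theorem dmat_comm (hD : ∀ i j a, D i (D j a) = D j (D i a)) (m n : Fin 4)
    (M : Matrix (Fin 4) (Fin 4) A) : dmat D m (dmat D n M) = dmat D n (dmat D m M) := by
  ext i j; simp [dmat, hD m n]

/-- The matrices of the Christoffel symbols of the metric `g` with the inverse `gi`. -/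
def chrMat (g gi : Matrix (Fin 4) (Fin 4) A) (m : Fin 4) : Matrix (Fin 4) (Fin 4) A :=
  Matrix.of fun k l => κ (1 / 2) * ∑ p, gi k p * (D m (g l p) + D l (g m p) - D p (g m l))

/-- The curvature matrices of the connection with the matrices `Γ`. -/
def curvMat (Γ : Fin 4 → Matrix (Fin 4) (Fin 4) A) (m n : Fin 4) : Matrix (Fin 4) (Fin 4) A :=
  dmat D m (Γ n) - dmat D n (Γ m) + (Γ m * Γ n - Γ n * Γ m)

/-- The matrices of the connection `Γ` in a moving frame `E` with the dual coframe `e`. -/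
def connMat (Γ : Fin 4 → Matrix (Fin 4) (Fin 4) A) (E e : Matrix (Fin 4) (Fin 4) A) (m : Fin 4) :
    Matrix (Fin 4) (Fin 4) A := e * (dmat D m E + Γ m * E)

variable {D}
variable {g gi : Matrix (Fin 4) (Fin 4) A}

theorem half_add_half : κ (1 / 2) * 2 = 1 := by
  rw [show (2 : A) = κ 2 from (map_ofNat _ 2).symm, ← map_mul]
  norm_num

theorem chrMat_comm (hg : g.transpose = g) (m k l : Fin 4) :
    chrMat D g gi m k l = chrMat D g gi l k m := by
  have hs : ∀ i j, g i j = g j i := fun i j => congrFun (congrFun hg.symm i) j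
  simp only [chrMat, Matrix.of_apply]
  congr 1
  refine Finset.sum_congr rfl fun p _ => ?_
  rw [hs m l]; ring

theorem mul_chrMat (hgi : g * gi = 1) (m : Fin 4) :
    g * chrMat D g gi m =
      Matrix.of fun n l => κ (1 / 2) * (D m (g l n) + D l (g m n) - D n (g m l)) := by
  have : chrMat D g gi m = gi * Matrix.of fun n l =>
      κ (1 / 2) * (D m (g l n) + D l (g m n) - D n (g m l)) := by
    ext k l
    simp only [chrMat, Matrix.of_apply, Matrix.mul_apply, Finset.mul_sum]
    exact Finset.sum_congr rfl fun p _ => by ring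
  rw [this, ← mul_assoc, hgi, one_mul]

theorem dmat_metric (hg : g.transpose = g) (hgi : g * gi = 1) (m : Fin 4) :
    dmat D m g = (chrMat D g gi m).transpose * g + g * chrMat D g gi m := by
  have hs : ∀ i j, g i j = g j i := fun i j => congrFun (congrFun hg.symm i) j
  have h1 : (chrMat D g gi m).transpose * g = (g * chrMat D g gi m).transpose := by
    rw [Matrix.transpose_mul, hg]
  rw [h1, mul_chrMat hgi]
  ext i j
  simp only [dmat, Matrix.map_apply, Matrix.add_apply, Matrix.transpose_apply, Matrix.of_apply]
  rw [hs j i, hs m i, hs m j]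
  linear_combination (-(D m (g i j))) * half_add_half (A := A)

variable {Γ : Fin 4 → Matrix (Fin 4) (Fin 4) A} {E : Matrix (Fin 4) (Fin 4) A}

/-- Differentiate the constant Gram matrix EᵀgE = 1 and use that the connection is metric. -/
theorem connMat_skew (hc : ∀ m, dmat D m g = (Γ m).transpose * g + g * Γ m)
    (hg : g.transpose = g) (hE : E.transpose * g * E = 1) (m : Fin 4) :
    (connMat D Γ E (E.transpose * g) m).transpose = - connMat D Γ E (E.transpose * g) m := by
  have h := congrArg (dmat D m) hE
  rw [dmat_one, dmat_mul, dmat_mul, hc, dmat_transpose] at h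
  rw [eq_neg_iff_add_eq_zero, ← h, connMat]
  simp only [Matrix.transpose_mul, Matrix.transpose_add, Matrix.transpose_transpose, hg]
  noncomm_ring

theorem dmat_frame (hE : E.transpose * g * E = 1) (m : Fin 4) :
    dmat D m E = E * connMat D Γ E (E.transpose * g) m - Γ m * E := by
  have h2 : E * (E.transpose * g) = 1 := mul_eq_one_comm.mp hE
  rw [connMat, ← mul_assoc, h2]
  noncomm_ring

theorem dmat_coframe (hE : E.transpose * g * E = 1) (m : Fin 4) :
    dmat D m (E.transpose * g) = (E.transpose * g) * Γ m -
      connMat D Γ E (E.transpose * g) m * (E.transpose * g) := by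
  have h2 : E * (E.transpose * g) = 1 := mul_eq_one_comm.mp hE
  have h := congrArg (dmat D m) hE
  rw [dmat_mul, dmat_one] at h
  have h3 : dmat D m (E.transpose * g) = - ((E.transpose * g) * dmat D m E * (E.transpose * g)) := by
    have := congrArg (· * (E.transpose * g)) h
    simp only [add_mul, zero_mul] at this
    rw [mul_assoc (dmat D m _), h2, mul_one] at this
    exact eq_neg_of_add_eq_zero_left this
  rw [h3, connMat]
  have h4 : (E.transpose * g) * Γ m = (E.transpose * g) * Γ m * (E * (E.transpose * g)) := by
    rw [h2, mul_one]
  rw [h4]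
  noncomm_ring

/-- Gauge covariance of curvature. The derivative terms of E cancel because the derivations commute
and E is inverse to its coframe. -/
theorem curvMat_frame (hD : ∀ i j a, D i (D j a) = D j (D i a))
    (hE : E.transpose * g * E = 1) (m n : Fin 4) :
    curvMat D (connMat D Γ E (E.transpose * g)) m n =
      (E.transpose * g) * curvMat D Γ m n * E := by
  have hEm := dmat_frame (D := D) (Γ := Γ) hE m
  have hEn := dmat_frame (D := D) (Γ := Γ) hE n
  have hem := dmat_coframe (D := D) (Γ := Γ) hE m
  have hen := dmat_coframe (D := D) (Γ := Γ) hE n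
  have d : ∀ p q, dmat D p (connMat D Γ E (E.transpose * g) q) =
      dmat D p (E.transpose * g) * (dmat D q E + Γ q * E) +
        (E.transpose * g) * (dmat D p (dmat D q E) + (dmat D p (Γ q) * E + Γ q * dmat D p E)) := by
    intro p q
    rw [connMat, dmat_mul, dmat_add, dmat_mul D p (Γ q)]
  rw [curvMat, d, d, dmat_comm D hD n m E]
  set e := E.transpose * g
  set θm := connMat D Γ E e m with hθm
  set θn := connMat D Γ E e n with hθn
  rw [hem, hen]
  have r : ∀ P : Matrix (Fin 4) (Fin 4) A, e * (E * P) = P := fun P => by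
    rw [← mul_assoc, hE, one_mul]
  have hm : dmat D m E + Γ m * E = E * θm := by rw [hEm]; noncomm_ring
  have hn : dmat D n E + Γ n * E = E * θn := by rw [hEn]; noncomm_ring
  rw [hm, hn, hEm, hEn, curvMat]
  simp only [sub_mul, mul_sub, mul_add, add_mul, mul_assoc, r]
  abel

/-- Cartan's first structure equation: the Christoffel terms drop out of the antisymmetrization
because the connection has no torsion. -/
theorem extD1_coframe (hΓ : ∀ m k l, Γ m k l = Γ l k m) (hE : E.transpose * g * E = 1)
    (a m n : Fin 4) :
    extD1 D ((E.transpose * g) a) m n =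
      ∑ b, (connMat D Γ E (E.transpose * g) n a b * (E.transpose * g) b m -
        connMat D Γ E (E.transpose * g) m a b * (E.transpose * g) b n) := by
  have h : ∀ p q, D p ((E.transpose * g) a q) = (dmat D p (E.transpose * g)) a q := fun _ _ => rfl
  rw [extD1, h, h, dmat_coframe (Γ := Γ) hE, dmat_coframe (Γ := Γ) hE]
  simp only [Matrix.sub_apply]
  have hs : ((E.transpose * g) * Γ m) a n = ((E.transpose * g) * Γ n) a m := by
    rw [Matrix.mul_apply, Matrix.mul_apply]
    exact Finset.sum_congr rfl fun k _ => by rw [hΓ]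
  rw [hs, Finset.sum_sub_distrib, ← Matrix.mul_apply, ← Matrix.mul_apply]
  ring

/-- The self-dual part of a field of skew-symmetric matrices. -/
def sdPart1 (θ : Fin 4 → Matrix (Fin 4) (Fin 4) A) (m : Fin 4) : A := - (θ m 0 1 + θ m 2 3)

/-- The self-dual part of a field of skew-symmetric matrices. -/
def sdPart2 (θ : Fin 4 → Matrix (Fin 4) (Fin 4) A) (m : Fin 4) : A := - (θ m 0 2 + θ m 3 1)

/-- The self-dual part of a field of skew-symmetric matrices. -/
def sdPart3 (θ : Fin 4 → Matrix (Fin 4) (Fin 4) A) (m : Fin 4) : A := - (θ m 0 3 + θ m 1 2)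

/-- A skew 4×4 matrix splits into self-dual and anti-self-dual parts, and the latter annihilates
self-dual forms. Hence only the three self-dual combinations of connection entries survive in dωᵢ.
-/
theorem extD2_sdForm_of_connection {e : Matrix (Fin 4) (Fin 4) A}
    {θ : Fin 4 → Matrix (Fin 4) (Fin 4) A} (hθ : ∀ m a b, θ m a b = - θ m b a)
    (hθ0 : ∀ m a, θ m a a = 0)
    (he : ∀ a m n, extD1 D (e a) m n = ∑ b, (θ n a b * e b m - θ m a b * e b n)) :
    (∀ l m n, extD2 D (sdForm (e 0) (e 1) (e 2) (e 3)) l m n =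
      wedge12 (sdPart3 θ) (sdForm (e 0) (e 2) (e 3) (e 1)) l m n -
        wedge12 (sdPart2 θ) (sdForm (e 0) (e 3) (e 1) (e 2)) l m n) ∧
    (∀ l m n, extD2 D (sdForm (e 0) (e 2) (e 3) (e 1)) l m n =
      wedge12 (sdPart1 θ) (sdForm (e 0) (e 3) (e 1) (e 2)) l m n -
        wedge12 (sdPart3 θ) (sdForm (e 0) (e 1) (e 2) (e 3)) l m n) ∧
    (∀ l m n, extD2 D (sdForm (e 0) (e 3) (e 1) (e 2)) l m n =
      wedge12 (sdPart2 θ) (sdForm (e 0) (e 1) (e 2) (e 3)) l m n -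
        wedge12 (sdPart1 θ) (sdForm (e 0) (e 2) (e 3) (e 1)) l m n) := by
  have hsd : ∀ (a b c d : Fin 4 → A) l m n, extD2 D (sdForm a b c d) l m n =
      extD2 D (wedge11 a b) l m n + extD2 D (wedge11 c d) l m n := by
    intro a b c d l m n
    simp only [extD2, sdForm, map_add]; ring
  refine ⟨fun l m n => ?_, fun l m n => ?_, fun l m n => ?_⟩ <;>
  · rw [hsd, extD2_wedge11, extD2_wedge11]
    simp only [wedge12, he, Fin.sum_univ_four, hθ0, sdPart1, sdPart2, sdPart3, sdForm, wedge11,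
      fun m => hθ m 1 0, fun m => hθ m 2 0, fun m => hθ m 3 0, fun m => hθ m 2 1,
      fun m => hθ m 3 2, fun m => hθ m 1 3]
    ring

/-- The projection of so(4) onto its self-dual factor is a Lie algebra homomorphism, so the
curvature of the projected connection is the projection of the curvature. -/
theorem extD1_sdPart {θ : Fin 4 → Matrix (Fin 4) (Fin 4) A} (hθ : ∀ m a b, θ m a b = - θ m b a)
    (hθ0 : ∀ m a, θ m a a = 0) (m n : Fin 4) :
    extD1 D (sdPart1 θ) m n = - (curvMat D θ m n 0 1 + curvMat D θ m n 2 3) -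
      wedge11 (sdPart2 θ) (sdPart3 θ) m n ∧
    extD1 D (sdPart2 θ) m n = - (curvMat D θ m n 0 2 + curvMat D θ m n 3 1) -
      wedge11 (sdPart3 θ) (sdPart1 θ) m n ∧
    extD1 D (sdPart3 θ) m n = - (curvMat D θ m n 0 3 + curvMat D θ m n 1 2) -
      wedge11 (sdPart1 θ) (sdPart2 θ) m n := by
  refine ⟨?_, ?_, ?_⟩ <;>
  · simp only [extD1, sdPart1, sdPart2, sdPart3, curvMat, wedge11, Matrix.add_apply,
      Matrix.sub_apply, Matrix.mul_apply, Fin.sum_univ_four, hθ0, dmat, Matrix.map_apply, map_add,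
      map_neg]
    simp only [fun m => hθ m 1 0, fun m => hθ m 2 0, fun m => hθ m 3 0, fun m => hθ m 2 1,
      fun m => hθ m 3 2, fun m => hθ m 1 3]
    ring

end Cartan

/-! ### Symmetries of the curvature tensor and eigenbivectors. -/

section CurvatureSymmetries

variable {A : Type*} [CommRing A] [Algebra ℂ A] {D : Fin 4 → Derivation ℂ A A}
variable {g gi : Matrix (Fin 4) (Fin 4) A}
variable {Γ : Fin 4 → Matrix (Fin 4) (Fin 4) A} {E : Matrix (Fin 4) (Fin 4) A}

local notation "κ" => algebraMap ℂ A

theorem cancel_two {a b : A} (h : 2 * a = 2 * b) : a = b := by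
  linear_combination κ (1 / 2) * h - (a - b) * half_add_half (A := A)

theorem connMat_apply_swap (hc : ∀ m, dmat D m g = (Γ m).transpose * g + g * Γ m)
    (hg : g.transpose = g) (hE : E.transpose * g * E = 1) (m a b : Fin 4) :
    connMat D Γ E (E.transpose * g) m a b = - connMat D Γ E (E.transpose * g) m b a :=
  congrFun (congrFun (connMat_skew hc hg hE m) b) a

theorem connMat_apply_self (hc : ∀ m, dmat D m g = (Γ m).transpose * g + g * Γ m)
    (hg : g.transpose = g) (hE : E.transpose * g * E = 1) (m a : Fin 4) :
    connMat D Γ E (E.transpose * g) m a a = 0 := by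
  have h := connMat_apply_swap hc hg hE m a a
  exact cancel_two (by linear_combination h)

theorem curvMat_skew_of_skew {θ : Fin 4 → Matrix (Fin 4) (Fin 4) A}
    (hθ : ∀ m, (θ m).transpose = - θ m) (m n : Fin 4) :
    (curvMat D θ m n).transpose = - curvMat D θ m n := by
  have h : ∀ p q, (dmat D p (θ q)).transpose = - dmat D p (θ q) := by
    intro p q
    rw [← dmat_transpose, hθ]
    ext i j; simp [dmat]
  simp only [curvMat, Matrix.transpose_add, Matrix.transpose_sub, Matrix.transpose_mul, h, hθ]
  noncomm_ring

/-- The symmetric part of the lowered curvature is the commutator of two derivations applied to g,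
which is zero. -/
theorem mul_curvMat_skew (hD : ∀ i j a, D i (D j a) = D j (D i a))
    (hc : ∀ m, dmat D m g = (Γ m).transpose * g + g * Γ m)
    (hg : g.transpose = g) (m n : Fin 4) :
    (g * curvMat D Γ m n).transpose = - (g * curvMat D Γ m n) := by
  have h : ∀ p q, dmat D p (dmat D q g) = (dmat D p (Γ q)).transpose * g +
      (Γ q).transpose * ((Γ p).transpose * g + g * Γ p) +
        (((Γ p).transpose * g + g * Γ p) * Γ q + g * dmat D p (Γ q)) := by
    intro p q
    rw [hc q, dmat_add, dmat_mul, dmat_mul, dmat_transpose, hc p]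
  have h1 := dmat_comm D hD m n g
  rw [h, h, ← sub_eq_zero] at h1
  rw [eq_neg_iff_add_eq_zero, ← h1]
  simp only [curvMat, Matrix.transpose_mul, Matrix.transpose_add, Matrix.transpose_sub, hg]
  noncomm_ring

theorem curvMat_bianchi (hΓ : ∀ m k l, Γ m k l = Γ l k m) (m n k l : Fin 4) :
    curvMat D Γ m n l k + curvMat D Γ n k l m + curvMat D Γ k m l n = 0 := by
  simp only [curvMat, Matrix.add_apply, Matrix.sub_apply, Matrix.mul_apply, Fin.sum_univ_four,
    dmat, Matrix.map_apply]
  rw [hΓ n l k, hΓ m l k, hΓ n l m]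
  simp only [hΓ n _ k, hΓ m _ k, hΓ n _ m]
  ring

theorem mul_curvMat_bianchi (hΓ : ∀ m k l, Γ m k l = Γ l k m) (m n k b : Fin 4) :
    (g * curvMat D Γ m n) b k + (g * curvMat D Γ n k) b m + (g * curvMat D Γ k m) b n = 0 := by
  simp only [Matrix.mul_apply, ← Finset.sum_add_distrib, ← mul_add, curvMat_bianchi hΓ, mul_zero,
    Finset.sum_const_zero]

theorem curvMat_swap (m n : Fin 4) : curvMat D Γ m n = - curvMat D Γ n m := by
  simp only [curvMat]; abel

/-- The classical octahedron argument: a signed sum of four cyclic identities, in which the two skew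
symmetries cancel everything but twice the desired difference. -/
theorem pair_symmetry {R : Fin 4 → Fin 4 → Fin 4 → Fin 4 → A}
    (s1 : ∀ a b c d, R a b c d = - R b a c d) (s2 : ∀ a b c d, R a b c d = - R a b d c)
    (B : ∀ a b c d, R a b c d + R b c a d + R c a b d = 0) (b c a d : Fin 4) :
    R b c a d = R a d b c := by
  apply cancel_two (A := A)
  linear_combination B a b c d - B b c d a - B c d a b + B d a b c - s2 a b c d + s2 b c d a
    - s1 c a b d + s2 a c b d + s2 c d b a + s1 d b c a - s2 b d c a + s2 d a c b - 2 * s1 d a b c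

/-- The symmetry of the curvature tensor under the interchange of the two pairs of indices. -/
theorem mul_curvMat_pair (hD : ∀ i j a, D i (D j a) = D j (D i a))
    (hc : ∀ m, dmat D m g = (Γ m).transpose * g + g * Γ m) (hΓ : ∀ m k l, Γ m k l = Γ l k m)
    (hg : g.transpose = g) (m n k l : Fin 4) :
    (g * curvMat D Γ m n) k l = (g * curvMat D Γ k l) m n := by
  have s1 : ∀ a b c d, (g * curvMat D Γ a b) c d = - (g * curvMat D Γ b a) c d := by
    intro a b c d; rw [curvMat_swap, mul_neg]; rfl
  have s2 : ∀ a b c d, (g * curvMat D Γ a b) c d = - (g * curvMat D Γ a b) d c :=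
    fun a b c d => congrFun (congrFun (mul_curvMat_skew hD hc hg a b) d) c
  refine (pair_symmetry (R := fun a b c d => (g * curvMat D Γ a b) c d) s1 s2 (fun a b c d => ?_)
    m n k l)
  have := mul_curvMat_bianchi (D := D) (g := g) hΓ a b c d
  have t1 := s2 a b c d
  have t2 := s2 b c a d
  have t3 := s2 c a b d
  linear_combination -this + t1 + t2 + t3

theorem half_trace_quat {W : Matrix (Fin 4) (Fin 4) A} (hW : ∀ a b, W a b = - W b a) :
    κ (1 / 2) * (quat1 A * W).trace = - (W 0 1 + W 2 3) ∧
    κ (1 / 2) * (quat2 A * W).trace = - (W 0 2 + W 3 1) ∧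
    κ (1 / 2) * (quat3 A * W).trace = - (W 0 3 + W 1 2) := by
  have h := half_add_half (A := A)
  refine ⟨?_, ?_, ?_⟩
  · have : (quat1 A * W).trace = - (2 * (W 0 1 + W 2 3)) := by
      simp only [Matrix.trace, Matrix.diag_apply, Matrix.mul_apply, Fin.sum_univ_four]
      simp [quat1]
      rw [hW 1 0, hW 3 2]; ring
    rw [this]; linear_combination (-(W 0 1 + W 2 3)) * h
  · have : (quat2 A * W).trace = - (2 * (W 0 2 + W 3 1)) := by
      simp only [Matrix.trace, Matrix.diag_apply, Matrix.mul_apply, Fin.sum_univ_four]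
      simp [quat2]
      rw [hW 2 0, hW 1 3]; ring
    rw [this]; linear_combination (-(W 0 2 + W 3 1)) * h
  · have : (quat3 A * W).trace = - (2 * (W 0 3 + W 1 2)) := by
      simp only [Matrix.trace, Matrix.diag_apply, Matrix.mul_apply, Fin.sum_univ_four]
      simp [quat3]
      rw [hW 3 0, hW 2 1]; ring
    rw [this]; linear_combination (-(W 0 3 + W 1 2)) * h

/-- The bivector `E Q Eᵀ` is an eigenvector of the curvature operator, for the eigenvalue `l`. -/
def IsCurvatureEigen (D : Fin 4 → Derivation ℂ A A) (g : Matrix (Fin 4) (Fin 4) A)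
    (Γ : Fin 4 → Matrix (Fin 4) (Fin 4) A) (E Q : Matrix (Fin 4) (Fin 4) A) (l : ℂ) : Prop :=
  ∀ a b, κ (1 / 2) * ∑ i, ∑ j, (E * Q * E.transpose) i j * (g * curvMat D Γ j i) b a =
    κ l * ((E.transpose * g).transpose * Q * (E.transpose * g)) a b

/-- Pair symmetry moves the contraction from the form indices of the curvature to its matrix
indices. Cyclicity of the trace then absorbs E and its transpose into the curvature matrix of the
moving frame. -/
theorem IsCurvatureEigen.trace_eq (hD : ∀ i j a, D i (D j a) = D j (D i a))
    (hc : ∀ m, dmat D m g = (Γ m).transpose * g + g * Γ m) (hΓ : ∀ m k l, Γ m k l = Γ l k m)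
    (hg : g.transpose = g) (hE : E.transpose * g * E = 1) {Q : Matrix (Fin 4) (Fin 4) A} {l : ℂ}
    (h : IsCurvatureEigen D g Γ E Q l) (a b : Fin 4) :
    κ (1 / 2) * (Q * curvMat D (connMat D Γ E (E.transpose * g)) b a).trace =
      κ l * ((E.transpose * g).transpose * Q * (E.transpose * g)) a b := by
  rw [← h a b, curvMat_frame hD hE]
  congr 1
  have h1 : ∀ i j, (g * curvMat D Γ j i) b a = (g * curvMat D Γ b a) j i :=
    fun i j => mul_curvMat_pair hD hc hΓ hg j i b a
  simp only [h1]
  rw [← mul_assoc, Matrix.trace_mul_comm, mul_assoc E.transpose, ← mul_assoc, ← mul_assoc,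
    ← mul_assoc, mul_assoc _ g]
  simp only [Matrix.trace, Matrix.diag_apply]
  exact Finset.sum_congr rfl fun i _ => Matrix.mul_apply

/-- The structure equations hold in every orthonormal frame whose self-dual bivectors are
eigenvectors of the curvature operator. -/
theorem selfDualStructure_of_eigen (hD : ∀ i j a, D i (D j a) = D j (D i a))
    (hc : ∀ m, dmat D m g = (Γ m).transpose * g + g * Γ m) (hΓ : ∀ m k l, Γ m k l = Γ l k m)
    (hg : g.transpose = g) (hE : E.transpose * g * E = 1) {l1 l2 l3 : ℂ}
    (h1 : IsCurvatureEigen D g Γ E (quat1 A) l1) (h2 : IsCurvatureEigen D g Γ E (quat2 A) l2)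
    (h3 : IsCurvatureEigen D g Γ E (quat3 A) l3) :
    SelfDualStructure D ((E.transpose * g) 0) ((E.transpose * g) 1) ((E.transpose * g) 2)
      ((E.transpose * g) 3) (sdPart1 (connMat D Γ E (E.transpose * g)))
      (sdPart2 (connMat D Γ E (E.transpose * g))) (sdPart3 (connMat D Γ E (E.transpose * g)))
      (-l1) (-l2) (-l3) := by
  have hs := connMat_apply_swap hc hg hE
  have h0 := connMat_apply_self hc hg hE
  obtain ⟨T1, T2, T3⟩ := extD2_sdForm_of_connection hs h0 (extD1_coframe hΓ hE)
  have t := fun m n => half_trace_quat (A := A) (W := curvMat D (connMat D Γ E (E.transpose * g)) m n)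
    (fun a b => congrFun (congrFun (curvMat_skew_of_skew (connMat_skew hc hg hE) m n) b) a)
  have c1 := h1.trace_eq hD hc hΓ hg hE
  have c2 := h2.trace_eq hD hc hΓ hg hE
  have c3 := h3.trace_eq hD hc hΓ hg hE
  refine ⟨T1, T2, T3, fun m n => ?_, fun m n => ?_, fun m n => ?_⟩
  · rw [(extD1_sdPart hs h0 m n).1, ← (t m n).1, c1, transpose_mul_quat1_mul, sdForm_skew,
      map_neg]; ring
  · rw [(extD1_sdPart hs h0 m n).2.1, ← (t m n).2.1, c2, transpose_mul_quat2_mul, sdForm_skew,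
      map_neg]; ring
  · rw [(extD1_sdPart hs h0 m n).2.2, ← (t m n).2.2, c3, transpose_mul_quat3_mul, sdForm_skew,
      map_neg]; ring

end CurvatureSymmetries

/-! ### The ring of complex-valued smooth functions on an open subset of the coordinate space -/

section SmoothRing

open TopologicalSpace (Opens)

/-- The partial derivative of a complex-valued function. -/
def pdC (i : Fin 4) (F : R4 → ℂ) (y : R4) : ℂ := fderiv ℝ F y (EuclideanSpace.single i 1)

theorem fderiv_eq_sum_pdC (F : R4 → ℂ) (y v : R4) : fderiv ℝ F y v = ∑ i, (v i : ℂ) * pdC i F y := by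
  have hv : v = ∑ i, v i • EuclideanSpace.single i (1 : ℝ) := by
    ext j; simp [Finset.sum_apply, Pi.single_apply]
  conv_lhs => rw [hv]
  rw [map_sum]
  exact Finset.sum_congr rfl fun i _ => by rw [map_smul, Complex.real_smul]; rfl

theorem contDiffOn_pdC {U : Set R4} (hU : IsOpen U) {F : R4 → ℂ} (hF : ContDiffOn ℝ ∞ F U)
    (i : Fin 4) : ContDiffOn ℝ ∞ (pdC i F) U :=
  (hF.fderiv_of_isOpen hU (m := ∞) (by simp)).clm_apply contDiffOn_const

theorem pdC_congr {U : Set R4} (hU : IsOpen U) {F F' : R4 → ℂ} (h : Set.EqOn F F' U) (i : Fin 4)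
    {y : R4} (hy : y ∈ U) : pdC i F y = pdC i F' y := by
  rw [pdC, pdC, (h.eventuallyEq_of_mem (hU.mem_nhds hy)).fderiv_eq]

theorem pdC_comm {U : Set R4} (hU : IsOpen U) {F : R4 → ℂ} (hF : ContDiffOn ℝ ∞ F U) {y : R4}
    (hy : y ∈ U) (i j : Fin 4) : pdC i (pdC j F) y = pdC j (pdC i F) y := by
  have hFy : ContDiffAt ℝ ∞ F y := hF.contDiffAt (hU.mem_nhds hy)
  have hd : DifferentiableAt ℝ (fderiv ℝ F) y :=
    (hFy.fderiv_right (m := 1) (by norm_cast)).differentiableAt (by norm_num)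
  have h : ∀ a b : Fin 4, pdC a (pdC b F) y =
      fderiv ℝ (fderiv ℝ F) y (EuclideanSpace.single a 1) (EuclideanSpace.single b 1) := by
    intro a b
    have : pdC b F = fun z => fderiv ℝ F z (EuclideanSpace.single b 1) := rfl
    rw [pdC, this, fderiv_clm_apply hd (differentiableAt_const _)]
    simp
  rw [h, h]
  exact (hFy.isSymmSndFDerivAt (by simp; norm_cast)).eq _ _

/-- The ring of the complex-valued smooth functions on `U`. -/
def smoothRing (U : Opens R4) : Subalgebra ℂ (U → ℂ) where
  carrier := {f | ∃ F : R4 → ℂ, ContDiffOn ℝ ∞ F U ∧ ∀ y : U, F y = f y}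
  mul_mem' := by
    rintro f f' ⟨F, hF, h⟩ ⟨F', hF', h'⟩
    exact ⟨F * F', hF.mul hF', fun y => by simp [h, h']⟩
  add_mem' := by
    rintro f f' ⟨F, hF, h⟩ ⟨F', hF', h'⟩
    exact ⟨F + F', hF.add hF', fun y => by simp [h, h']⟩
  algebraMap_mem' c := ⟨fun _ => c, contDiffOn_const, fun _ => rfl⟩

variable {U : Opens R4}

/-- The element of the ring given by a function on the coordinate space. -/
def mkSmooth (F : R4 → ℂ) (hF : ContDiffOn ℝ ∞ F U) : smoothRing U :=
  ⟨fun y => F y, F, hF, fun _ => rfl⟩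

/-- A function on the coordinate space which restricts to a given element of the ring. -/
def extension (f : smoothRing U) : R4 → ℂ := f.2.choose

theorem contDiffOn_extension (f : smoothRing U) : ContDiffOn ℝ ∞ (extension f) U :=
  f.2.choose_spec.1

theorem extension_apply (f : smoothRing U) (y : U) : extension f y = f.1 y := f.2.choose_spec.2 y

theorem extension_apply' (f : smoothRing U) {z : R4} (hz : z ∈ (U : Set R4)) :
    extension f z = f.1 ⟨z, hz⟩ := extension_apply f ⟨z, hz⟩

@[simp] theorem mkSmooth_apply (F : R4 → ℂ) (hF : ContDiffOn ℝ ∞ F U) (y : U) :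
    (mkSmooth F hF).1 y = F y := rfl

/-- The partial derivatives. -/
def partialDeriv (i : Fin 4) : Derivation ℂ (smoothRing U) (smoothRing U) :=
  Derivation.mk'
    { toFun := fun f => mkSmooth (pdC i (extension f))
        (contDiffOn_pdC U.isOpen (contDiffOn_extension f) i)
      map_add' := fun f f' => by
        ext y
        have hd := fun f : smoothRing U => ((contDiffOn_extension f).contDiffAt
          (U.isOpen.mem_nhds y.2)).differentiableAt (by simp)
        rw [mkSmooth_apply, pdC_congr U.isOpen (F' := fun z => extension f z + extension f' z)
          (fun z hz => by
            change extension (f + f') z = extension f z + extension f' z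
            rw [extension_apply' _ hz, extension_apply' _ hz, extension_apply' _ hz]; rfl) i y.2, pdC, fderiv_fun_add (hd f) (hd f')]
        rfl
      map_smul' := fun c f => by
        ext y
        have hd := fun f : smoothRing U => ((contDiffOn_extension f).contDiffAt
          (U.isOpen.mem_nhds y.2)).differentiableAt (by simp)
        rw [mkSmooth_apply, pdC_congr U.isOpen (F' := fun z => c * extension f z)
          (fun z hz => by
            change extension (c • f) z = c * extension f z
            rw [extension_apply' _ hz, extension_apply' _ hz]; rfl) i y.2, pdC,
            fderiv_const_mul (hd f)]
        rfl }
    fun f f' => by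
      ext y
      have hd := fun f : smoothRing U => ((contDiffOn_extension f).contDiffAt
        (U.isOpen.mem_nhds y.2)).differentiableAt (by simp)
      change pdC i (extension (f * f')) y = f.1 y * pdC i (extension f') y +
        f'.1 y * pdC i (extension f) y
      rw [pdC_congr U.isOpen (F' := fun z => extension f z * extension f' z)
        (fun z hz => by
          change extension (f * f') z = extension f z * extension f' z
          rw [extension_apply' _ hz, extension_apply' _ hz, extension_apply' _ hz]; rfl) i y.2, pdC, fderiv_fun_mul (hd f) (hd f'),
            extension_apply, extension_apply]
      rfl

theorem partialDeriv_apply (i : Fin 4) (f : smoothRing U) {F : R4 → ℂ} (h : ∀ y : U, F y = f.1 y)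
    (y : U) : (partialDeriv i f).1 y = pdC i F y :=
  pdC_congr U.isOpen (fun z hz => by rw [extension_apply f ⟨z, hz⟩, h ⟨z, hz⟩]) i y.2

theorem partialDeriv_comm (i j : Fin 4) (f : smoothRing U) :
    partialDeriv i (partialDeriv j f) = partialDeriv j (partialDeriv i f) := by
  ext y
  rw [partialDeriv_apply i _ (F := pdC j (extension f)) (fun _ => rfl),
    partialDeriv_apply j _ (F := pdC i (extension f)) (fun _ => rfl)]
  exact pdC_comm U.isOpen (contDiffOn_extension f) y.2 i j

theorem contDiffOn_conj {s : Set R4} {F : R4 → ℂ} (hF : ContDiffOn ℝ ∞ F s) :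
    ContDiffOn ℝ ∞ (fun y => (starRingEnd ℂ) (F y)) s :=
  Complex.conjCLE.contDiff.comp_contDiffOn hF

/-- Complex conjugation of functions. -/
def conjRing : smoothRing U →+* smoothRing U where
  toFun f := mkSmooth (fun y => (starRingEnd ℂ) (extension f y))
    (contDiffOn_conj (contDiffOn_extension f))
  map_one' := by
    ext y; change starRingEnd ℂ (extension 1 y) = _; rw [extension_apply]; exact map_one _
  map_zero' := by
    ext y; change starRingEnd ℂ (extension 0 y) = _; rw [extension_apply]; exact map_zero _
  map_mul' f f' := by
    ext y; change starRingEnd ℂ (extension (f * f') y) = _; rw [extension_apply]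
    change starRingEnd ℂ (f.1 y * f'.1 y) = _
    rw [map_mul, ← extension_apply, ← extension_apply]; rfl
  map_add' f f' := by
    ext y; change starRingEnd ℂ (extension (f + f') y) = _; rw [extension_apply]
    change starRingEnd ℂ (f.1 y + f'.1 y) = _
    rw [map_add, ← extension_apply, ← extension_apply]; rfl

@[simp] theorem conjRing_apply (f : smoothRing U) (y : U) :
    (conjRing f).1 y = starRingEnd ℂ (f.1 y) := by
  rw [← extension_apply f]; rfl

theorem conjRing_algebraMap (c : ℂ) :
    conjRing (algebraMap ℂ (smoothRing U) c) = algebraMap ℂ _ (starRingEnd ℂ c) := by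
  ext y; rw [conjRing_apply]; rfl

theorem partialDeriv_conjRing (i : Fin 4) (f : smoothRing U) :
    partialDeriv i (conjRing f) = conjRing (partialDeriv i f) := by
  ext y
  rw [conjRing_apply, partialDeriv_apply i _ (F := fun y => starRingEnd ℂ (extension f y))
    (fun _ => rfl), partialDeriv_apply i f (extension_apply f)]
  have hd := ((contDiffOn_extension f).contDiffAt
        (U.isOpen.mem_nhds y.2)).differentiableAt (n := ∞) (by simp)
  have := (Complex.conjCLE.toContinuousLinearMap.hasFDerivAt.comp y.1 hd.hasFDerivAt).fderiv
  exact congrArg (fun L => L (EuclideanSpace.single i 1)) this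

/-- The exponential of a function. -/
def expRing (f : smoothRing U) : smoothRing U :=
  mkSmooth (fun y => Complex.exp (extension f y)) (contDiffOn_extension f).cexp

@[simp] theorem expRing_apply (f : smoothRing U) (y : U) :
    (expRing f).1 y = Complex.exp (f.1 y) := by
  rw [← extension_apply f]; rfl

theorem partialDeriv_expRing (i : Fin 4) (f : smoothRing U) :
    partialDeriv i (expRing f) = expRing f * partialDeriv i f := by
  ext y
  have hd := ((contDiffOn_extension f).contDiffAt
        (U.isOpen.mem_nhds y.2)).differentiableAt (n := ∞) (by simp)
  change (partialDeriv i (expRing f)).1 y = (expRing f).1 y * (partialDeriv i f).1 y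
  rw [expRing_apply, partialDeriv_apply i _ (F := fun y => Complex.exp (extension f y))
    (fun _ => rfl), partialDeriv_apply i f (extension_apply f), pdC, hd.hasFDerivAt.cexp.fderiv,
    ← extension_apply]
  rfl

theorem expRing_add (f f' : smoothRing U) : expRing (f + f') = expRing f * expRing f' := by
  ext y
  change (expRing (f + f')).1 y = (expRing f).1 y * (expRing f').1 y
  rw [expRing_apply, expRing_apply, expRing_apply, ← Complex.exp_add]; rfl

theorem expRing_zero : expRing (0 : smoothRing U) = 1 := by
  ext y
  rw [expRing_apply]
  exact Complex.exp_zero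

/-- The Poincaré lemma for 1-forms. -/
theorem exists_potential (hU : Convex ℝ (U : Set R4)) (ξ : Fin 4 → smoothRing U)
    (hξ : ∀ m n, extD1 partialDeriv ξ m n = 0) : ∃ f, ∀ i, partialDeriv i f = ξ i := by
  set W : R4 → R4 →L[ℝ] ℂ := fun y =>
    ∑ i, (EuclideanSpace.proj i : R4 →L[ℝ] ℝ).smulRight (extension (ξ i) y) with hW
  have hWs : ContDiffOn ℝ ∞ W U := by
    refine ContDiffOn.sum fun i _ => ?_
    exact ((ContinuousLinearMap.smulRightL ℝ R4 ℂ (EuclideanSpace.proj i)).contDiff).comp_contDiffOn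
      (contDiffOn_extension (ξ i))
  have hd : ∀ i, ∀ y ∈ U, DifferentiableAt ℝ (extension (ξ i)) y := fun i y hy =>
    ((contDiffOn_extension (ξ i)).contDiffAt (U.isOpen.mem_nhds hy)).differentiableAt (by simp)
  have hWd : ∀ y ∈ U, ∀ u v, fderiv ℝ W y u v = ∑ i, ∑ j, (v i : ℂ) * ((u j : ℂ) *
      pdC j (extension (ξ i)) y) := by
    intro y hy u v
    have hWy : DifferentiableAt ℝ W y := (hWs.contDiffAt (U.isOpen.mem_nhds hy)).differentiableAt
      (by simp)
    have h1 : fderiv ℝ W y u v = fderiv ℝ (fun z => W z v) y u := by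
      rw [fderiv_clm_apply hWy (differentiableAt_const _)]; simp
    have h2 : (fun z => W z v) = fun z => ∑ i, (v i : ℂ) * extension (ξ i) z := by
      funext z; simp [hW]
    rw [h1, h2, fderiv_fun_sum (fun i _ => (hd i y hy).const_mul _)]
    rw [sum_apply]
    refine Finset.sum_congr rfl fun i _ => ?_
    rw [fderiv_const_mul (hd i y hy), ← Finset.mul_sum, ← fderiv_eq_sum_pdC]
    rfl
  -- Closedness of ξ says that the derivative of the ℂ-valued covector field W is symmetric, which
  -- is the integrability condition on a convex set.
  obtain ⟨F, hF⟩ := hU.exists_forall_hasFDerivAt_of_fderiv_symmetric U.isOpen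
    (hWs.differentiableOn (by simp)) (by
      intro y hy u v
      rw [hWd y hy, hWd y hy, Finset.sum_comm]
      refine Finset.sum_congr rfl fun i _ => Finset.sum_congr rfl fun j _ => ?_
      have := congrArg (fun f : smoothRing U => f.1 ⟨y, hy⟩) (hξ i j)
      change (partialDeriv i (ξ j)).1 ⟨y, hy⟩ - (partialDeriv j (ξ i)).1 ⟨y, hy⟩ = 0 at this
      rw [partialDeriv_apply i _ (extension_apply (ξ j)),
        partialDeriv_apply j _ (extension_apply (ξ i)), sub_eq_zero] at this
      rw [this]; ring)
  have hFs : ContDiffOn ℝ ∞ F U := by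
    rw [show (∞ : WithTop ℕ∞) = ∞ + 1 by simp, contDiffOn_succ_iff_fderiv_of_isOpen U.isOpen]
    refine ⟨fun y hy => (hF y hy).differentiableAt.differentiableWithinAt, by simp, ?_⟩
    exact hWs.congr fun y hy => (hF y hy).fderiv
  refine ⟨mkSmooth F hFs, fun i => ?_⟩
  ext y
  rw [partialDeriv_apply i _ (F := F) (fun _ => rfl), pdC, (hF y y.2).fderiv,
    ← extension_apply (ξ i)]
  simp [hW]

end SmoothRing

/-! ### Passage from real components to the ring of smooth functions -/

section RealComponents

open TopologicalSpace (Opens)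

theorem contDiffOn_det {𝕜 : Type*} [NormedField 𝕜] [NormedAlgebra ℝ 𝕜] {n : ℕ} {s : Set R4}
    {F : R4 → Matrix (Fin n) (Fin n) 𝕜}
    (hF : ∀ i j, ContDiffOn ℝ ∞ (fun y => F y i j) s) : ContDiffOn ℝ ∞ (fun y => (F y).det) s := by
  simp only [Matrix.det_apply]
  refine ContDiffOn.sum fun σ _ => ?_
  have h : ContDiffOn ℝ ∞ (fun y => ∏ i, F y (σ i) i) s := contDiffOn_prod fun i _ => hF _ _
  rcases Int.units_eq_one_or (Equiv.Perm.sign σ) with hσ | hσ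
  · simpa [hσ] using h
  · simpa [hσ] using h.neg

theorem contDiffOn_inv {s : Set R4} {F : R4 → Matrix (Fin 4) (Fin 4) ℝ}
    (hF : ∀ i j, ContDiffOn ℝ ∞ (fun y => F y i j) s) (hdet : ∀ y ∈ s, (F y).det ≠ 0)
    (i j : Fin 4) : ContDiffOn ℝ ∞ (fun y => (F y)⁻¹ i j) s := by
  simp only [Matrix.inv_def, Matrix.smul_apply, Ring.inverse_eq_inv', smul_eq_mul,
    Matrix.adjugate_apply]
  refine ((contDiffOn_det hF).inv hdet).mul (contDiffOn_det fun a b => ?_)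
  simp only [Matrix.updateRow_apply]
  split_ifs
  · exact contDiffOn_const
  · exact hF a b

theorem contDiffOn_pd {s : Set R4} (hs : IsOpen s) {f : R4 → ℝ} (hf : ContDiffOn ℝ ∞ f s)
    (i : Fin 4) : ContDiffOn ℝ ∞ (pd i f) s :=
  (hf.fderiv_of_isOpen hs (m := ∞) (by simp)).clm_apply contDiffOn_const

variable {G : R4 → Matrix (Fin 4) (Fin 4) ℝ}

theorem contDiffOn_christoffel {s : Set R4} (hs : IsOpen s)
    (hG : ∀ i j, ContDiffOn ℝ ∞ (fun y => G y i j) s) (hdet : ∀ y ∈ s, (G y).det ≠ 0)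
    (k i j : Fin 4) : ContDiffOn ℝ ∞ (christoffel G k i j) s := by
  unfold christoffel
  exact contDiffOn_const.mul (ContDiffOn.sum fun l _ => (contDiffOn_inv hG hdet k l).mul
    (((contDiffOn_pd hs (hG j l) i).add (contDiffOn_pd hs (hG i l) j)).sub
      (contDiffOn_pd hs (hG i j) l)))

theorem contDiffOn_curvature {s : Set R4} (hs : IsOpen s)
    (hG : ∀ i j, ContDiffOn ℝ ∞ (fun y => G y i j) s) (hdet : ∀ y ∈ s, (G y).det ≠ 0)
    (i j k l : Fin 4) : ContDiffOn ℝ ∞ (fun y => curvature G y i j k l) s := by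
  unfold curvature
  have h := contDiffOn_christoffel hs hG hdet
  exact ((contDiffOn_pd hs (h l i k) j).sub (contDiffOn_pd hs (h l j k) i)).add
    (ContDiffOn.sum fun m _ => ((h m i k).mul (h l j m)).sub ((h m j k).mul (h l i m)))

theorem contDiffOn_raise {s : Set R4} (hG : ∀ i j, ContDiffOn ℝ ∞ (fun y => G y i j) s)
    (hdet : ∀ y ∈ s, (G y).det ≠ 0) {T : R4 → Comp4}
    (hT : ∀ i j k l, ContDiffOn ℝ ∞ (fun y => T y i j k l) s) (i j k l : Fin 4) :
    ContDiffOn ℝ ∞ (fun y => raise (G y) (T y) i j k l) s := by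
  unfold raise
  exact ContDiffOn.sum fun a _ => ContDiffOn.sum fun b _ =>
    ((hT i j a b).mul (contDiffOn_inv hG hdet a k)).mul (contDiffOn_inv hG hdet b l)

theorem contDiffOn_curvatureOp {s : Set R4} (hs : IsOpen s)
    (hG : ∀ i j, ContDiffOn ℝ ∞ (fun y => G y i j) s) (hdet : ∀ y ∈ s, (G y).det ≠ 0)
    (i j k l : Fin 4) : ContDiffOn ℝ ∞ (fun y => curvatureOp G y i j k l) s :=
  contDiffOn_raise hG hdet (fun i j k l => ContDiffOn.sum fun m _ =>
    (contDiffOn_curvature hs hG hdet i j k m).mul (hG m l)) i j k l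

variable {U : Opens R4}

theorem contDiffOn_ofReal {s : Set R4} {f : R4 → ℝ} (hf : ContDiffOn ℝ ∞ f s) :
    ContDiffOn ℝ ∞ (fun y => (f y : ℂ)) s :=
  Complex.ofRealCLM.contDiff.comp_contDiffOn hf

/-- A real function, as an element of the ring of complex-valued smooth functions. -/
def ofRealRing (f : R4 → ℝ) (hf : ContDiffOn ℝ ∞ f U) : smoothRing U :=
  mkSmooth (fun y => (f y : ℂ)) (contDiffOn_ofReal hf)

theorem pdC_ofReal {f : R4 → ℝ} {y : R4} (hf : DifferentiableAt ℝ f y) (i : Fin 4) :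
    pdC i (fun z => (f z : ℂ)) y = (pd i f y : ℂ) := by
  have := (Complex.ofRealCLM.hasFDerivAt.comp y hf.hasFDerivAt).fderiv
  exact congrArg (fun L => L (EuclideanSpace.single i 1)) this

theorem partialDeriv_ofRealRing (f : R4 → ℝ) (hf : ContDiffOn ℝ ∞ f U) (i : Fin 4) (y : U) :
    (partialDeriv i (ofRealRing f hf)).1 y = (pd i f y : ℂ) := by
  rw [partialDeriv_apply i _ (F := fun y => (f y : ℂ)) (fun _ => rfl)]
  exact pdC_ofReal ((hf.contDiffAt (U.isOpen.mem_nhds y.2)).differentiableAt (by simp)) i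

/-- A metric with smooth components. -/
structure IsSmoothMetric (G : R4 → Matrix (Fin 4) (Fin 4) ℝ) (U : Opens R4) : Prop where
  smooth : ∀ i j, ContDiffOn ℝ ∞ (fun y => G y i j) U
  symm : ∀ y ∈ U, (G y).transpose = G y
  det_ne_zero : ∀ y ∈ U, (G y).det ≠ 0

namespace IsSmoothMetric

variable (hG : IsSmoothMetric G U)
include hG

/-- The components of the metric in the ring of smooth functions. -/
def metric : Matrix (Fin 4) (Fin 4) (smoothRing U) :=
  Matrix.of fun i j => ofRealRing (fun y => G y i j) (hG.smooth i j)

/-- The components of the inverse metric. -/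
def inverse : Matrix (Fin 4) (Fin 4) (smoothRing U) :=
  Matrix.of fun i j => ofRealRing (fun y => (G y)⁻¹ i j)
    (contDiffOn_inv hG.smooth hG.det_ne_zero i j)

/-- The matrices of the Christoffel symbols. -/
def chr : Fin 4 → Matrix (Fin 4) (Fin 4) (smoothRing U) :=
  chrMat partialDeriv hG.metric hG.inverse

theorem metric_transpose : hG.metric.transpose = hG.metric := by
  ext i j y
  change ((G y j i : ℝ) : ℂ) = ((G y i j : ℝ) : ℂ)
  rw [← congrFun (congrFun (hG.symm y y.2) i) j]; rfl

theorem metric_mul_inverse : hG.metric * hG.inverse = 1 := by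
  ext i j y
  have h : G y * (G y)⁻¹ = 1 := Matrix.mul_nonsing_inv _ (hG.det_ne_zero y y.2).isUnit
  have h' := congrFun (congrFun h i) j
  rw [Matrix.mul_apply] at h' ⊢
  have e : ((∑ k, hG.metric i k * hG.inverse k j : smoothRing U)).1 y =
      ∑ k, (G y i k : ℂ) * ((G y)⁻¹ k j : ℂ) := by
    rw [AddSubmonoidClass.coe_finsetSum, Finset.sum_apply]
    rfl
  rw [e]
  have h3 : ((1 : Matrix (Fin 4) (Fin 4) (smoothRing U)) i j).1 y =
      (((1 : Matrix (Fin 4) (Fin 4) ℝ) i j : ℝ) : ℂ) := by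
    by_cases hij : i = j
    · subst hij; simp
    · simp [hij]
  rw [h3, ← h']
  push_cast
  rfl

theorem chr_comm (m k l : Fin 4) : hG.chr m k l = hG.chr l k m :=
  chrMat_comm hG.metric_transpose m k l

theorem dmat_metric (m : Fin 4) :
    dmat partialDeriv m hG.metric = (hG.chr m).transpose * hG.metric + hG.metric * hG.chr m :=
  NeutralEinstein.dmat_metric hG.metric_transpose hG.metric_mul_inverse m

theorem chr_eq (m k l : Fin 4) : hG.chr m k l =
    ofRealRing (christoffel G k m l)
      (contDiffOn_christoffel U.isOpen hG.smooth hG.det_ne_zero k m l) := by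
  ext y
  change (1 / 2 : ℂ) * (∑ p, hG.inverse k p * (partialDeriv m (hG.metric l p) +
    partialDeriv l (hG.metric m p) - partialDeriv p (hG.metric m l)) : smoothRing U).1 y =
      ((christoffel G k m l y : ℝ) : ℂ)
  rw [AddSubmonoidClass.coe_finsetSum, Finset.sum_apply, christoffel]
  push_cast
  congr 1
  refine Finset.sum_congr rfl fun p _ => ?_
  rw [← partialDeriv_ofRealRing _ (hG.smooth l p), ← partialDeriv_ofRealRing _ (hG.smooth m p),
    ← partialDeriv_ofRealRing _ (hG.smooth m l)]
  rfl

/-- The first two indices are interchanged because `curvature` uses the convention ∇_v∇_u − ∇_u∇_v,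
opposite to that of `curvMat`. -/
theorem curvMat_apply (m n l k : Fin 4) (y : U) :
    (curvMat partialDeriv hG.chr m n l k).1 y = (curvature G y n m k l : ℂ) := by
  have hp : ∀ a b c d, (partialDeriv a (hG.chr b c d)).1 y = (pd a (christoffel G c b d) y : ℂ) := by
    intro a b c d
    rw [chr_eq, partialDeriv_ofRealRing]
  have hc : ∀ b c d, (hG.chr b c d).1 y = (christoffel G c b d y : ℂ) := by
    intro b c d; rw [chr_eq]; rfl
  simp only [curvMat, Matrix.add_apply, Matrix.sub_apply, Matrix.mul_apply, dmat, Matrix.map_apply,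
    ← Finset.sum_sub_distrib]
  change (partialDeriv m (hG.chr n l k)).1 y - (partialDeriv n (hG.chr m l k)).1 y +
    (∑ j, (hG.chr m l j * hG.chr n j k - hG.chr n l j * hG.chr m j k) : smoothRing U).1 y = _
  rw [AddSubmonoidClass.coe_finsetSum, Finset.sum_apply, hp, hp, curvature]
  push_cast
  congr 1
  refine Finset.sum_congr rfl fun j _ => ?_
  change (hG.chr m l j).1 y * (hG.chr n j k).1 y - (hG.chr n l j).1 y * (hG.chr m j k).1 y = _
  rw [hc, hc, hc, hc]
  ring

theorem mul_curvMat_apply (m n b a : Fin 4) (y : U) :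
    ((hG.metric * curvMat partialDeriv hG.chr m n) b a).1 y =
      ((∑ p, curvature G y n m a p * G y p b : ℝ) : ℂ) := by
  rw [Matrix.mul_apply, AddSubmonoidClass.coe_finsetSum, Finset.sum_apply]
  push_cast
  refine Finset.sum_congr rfl fun p _ => ?_
  change (G y b p : ℂ) * (curvMat partialDeriv hG.chr m n p a).1 y = _
  rw [curvMat_apply, mul_comm]
  congr 2
  exact congrFun (congrFun (hG.symm y y.2) p) b

end IsSmoothMetric

end RealComponents

/-! ### Bivectors at a point -/

section Pointwise

theorem leviCivita_eq (i j k l : Fin 4) : leviCivita i j k l =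
    vol4 (fun c => if i = c then (1 : ℝ) else 0) (fun c => if j = c then (1 : ℝ) else 0)
      (fun c => if k = c then (1 : ℝ) else 0) (fun c => if l = c then (1 : ℝ) else 0) := by
  rw [leviCivita, ← vol4_eq_det]
  rfl

/-- The components of the 2-form dual to a skew-symmetric array. -/
def dualMat {R : Type*} [CommRing R] (a : Matrix (Fin 4) (Fin 4) R) : Matrix (Fin 4) (Fin 4) R :=
  !![0, a 2 3, a 3 1, a 1 2; a 3 2, 0, a 0 3, a 2 0; a 1 3, a 3 0, 0, a 0 1;
    a 2 1, a 0 2, a 1 0, 0]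

theorem sum_leviCivita (α : Matrix (Fin 4) (Fin 4) ℂ) (hα : α.transpose = -α) (a b : Fin 4) :
    (1 / 2) * ∑ i, ∑ j, α i j * (leviCivita i j a b : ℂ) = dualMat α a b := by
  have hs : ∀ i j, α i j = - α j i := fun i j => congrFun (congrFun hα j) i
  simp only [leviCivita_eq, Fin.sum_univ_four]
  fin_cases a <;> fin_cases b <;>
    simp [vol4, wedge22, wedge11, dualMat, hs 1 0, hs 2 0, hs 3 0, hs 2 1, hs 3 1, hs 3 2] <;>
    try ring1

theorem dualMat_bilin {R : Type*} [CommRing R] {α : Matrix (Fin 4) (Fin 4) R}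
    (hα : ∀ i j, α i j = - α j i) (E : Matrix (Fin 4) (Fin 4) R) (i j : Fin 4) :
    (E.transpose * dualMat α * E) i j = wedge22 α (wedge11 (E.transpose i) (E.transpose j)) := by
  simp [Matrix.mul_apply, Fin.sum_univ_four, dualMat, wedge22, wedge11, hα 1 0, hα 2 0, hα 3 0,
    hα 2 1, hα 3 1, hα 3 2]
  ring

theorem wedge22_conj {R : Type*} [CommRing R] {a E : Matrix (Fin 4) (Fin 4) R}
    (ha : ∀ i j, a i j = - a j i) (h0 : ∀ i, a i i = 0) (β : Fin 4 → Fin 4 → R) :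
    wedge22 (E * a * E.transpose) β =
      a 0 1 * wedge22 (wedge11 (E.transpose 0) (E.transpose 1)) β +
      a 0 2 * wedge22 (wedge11 (E.transpose 0) (E.transpose 2)) β +
      a 0 3 * wedge22 (wedge11 (E.transpose 0) (E.transpose 3)) β +
      a 1 2 * wedge22 (wedge11 (E.transpose 1) (E.transpose 2)) β +
      a 1 3 * wedge22 (wedge11 (E.transpose 1) (E.transpose 3)) β +
      a 2 3 * wedge22 (wedge11 (E.transpose 2) (E.transpose 3)) β := by
  have h : ∀ i j, (E * a * E.transpose) i j =
      a 0 1 * wedge11 (E.transpose 0) (E.transpose 1) i j +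
      a 0 2 * wedge11 (E.transpose 0) (E.transpose 2) i j +
      a 0 3 * wedge11 (E.transpose 0) (E.transpose 3) i j +
      a 1 2 * wedge11 (E.transpose 1) (E.transpose 2) i j +
      a 1 3 * wedge11 (E.transpose 1) (E.transpose 3) i j +
      a 2 3 * wedge11 (E.transpose 2) (E.transpose 3) i j := by
    intro i j
    simp only [Matrix.mul_apply, Fin.sum_univ_four, h0, ha 1 0, ha 2 0, ha 3 0, ha 2 1, ha 3 1,
      ha 3 2, Matrix.transpose_apply, wedge11]
    ring
  simp only [wedge22, h]
  ring

/-- The permutation symbol is invariant under a change of frame up to the determinant. In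
coordinates, every entry is a 4-form evaluated on four columns of E. -/
theorem dualMat_conj {R : Type*} [CommRing R] {a E : Matrix (Fin 4) (Fin 4) R}
    (ha : ∀ i j, a i j = - a j i) (h0 : ∀ i, a i i = 0) :
    E.transpose * dualMat (E * a * E.transpose) * E = E.det • dualMat a := by
  have hs : ∀ i j, (E * a * E.transpose) i j = - (E * a * E.transpose) j i := by
    intro i j
    have : (E * a * E.transpose).transpose = - (E * a * E.transpose) := by
      have h : a.transpose = - a := by ext i j; exact ha j i
      rw [Matrix.transpose_mul, Matrix.transpose_mul, Matrix.transpose_transpose, h]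
      noncomm_ring
    exact congrFun (congrFun this j) i
  ext i j
  rw [dualMat_bilin hs, wedge22_conj ha h0, ← Matrix.det_transpose, ← vol4_eq_det,
    Matrix.smul_apply]
  generalize E.transpose = e
  simp only [wedge22, wedge11, vol4, smul_eq_mul]
  fin_cases i <;> fin_cases j <;>
  · simp [dualMat, ha 1 0, ha 2 0, ha 3 0, ha 2 1, ha 3 1, ha 3 2]
    try ring

theorem skew_diag {R : Type*} [CommRing R] [Algebra ℂ R] {a : Matrix (Fin 4) (Fin 4) R}
    (ha : ∀ i j, a i j = - a j i) (i : Fin 4) : a i i = 0 :=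
  cancel_two (by linear_combination ha i i)

/-- The complexification of a real matrix. -/
def cmat (M : Matrix (Fin 4) (Fin 4) ℝ) : Matrix (Fin 4) (Fin 4) ℂ := Complex.ofRealHom.mapMatrix M

theorem cmat_apply (M : Matrix (Fin 4) (Fin 4) ℝ) (i j : Fin 4) : cmat M i j = (M i j : ℂ) := rfl

theorem cmat_transpose (M : Matrix (Fin 4) (Fin 4) ℝ) : cmat M.transpose = (cmat M).transpose := rfl

theorem cmat_mul (M N : Matrix (Fin 4) (Fin 4) ℝ) : cmat (M * N) = cmat M * cmat N := map_mul _ _ _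

theorem cmat_det (M : Matrix (Fin 4) (Fin 4) ℝ) : (cmat M).det = (M.det : ℂ) :=
  (RingHom.map_det Complex.ofRealHom M).symm

theorem cmat_mul_inv {G : Matrix (Fin 4) (Fin 4) ℝ} (hG : G.det ≠ 0) : cmat G * cmat G⁻¹ = 1 := by
  rw [← cmat_mul, Matrix.mul_nonsing_inv _ hG.isUnit]; exact map_one _

/-- The contraction of a bivector with the first two indices. -/
def contract (T : Comp4) (α : Matrix (Fin 4) (Fin 4) ℂ) : Matrix (Fin 4) (Fin 4) ℂ :=
  Matrix.of fun a b => (1 / 2) * ∑ i, ∑ j, α i j * (T i j a b : ℂ)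

theorem sum_four_comm (f : Fin 4 → Fin 4 → Fin 4 → Fin 4 → ℂ) :
    ∑ i, ∑ j, ∑ a, ∑ b, f i j a b = ∑ b, ∑ a, ∑ i, ∑ j, f i j a b := by
  calc ∑ i, ∑ j, ∑ a, ∑ b, f i j a b = ∑ i, ∑ a, ∑ j, ∑ b, f i j a b :=
        Finset.sum_congr rfl fun i _ => Finset.sum_comm
    _ = ∑ a, ∑ i, ∑ j, ∑ b, f i j a b := Finset.sum_comm
    _ = ∑ a, ∑ i, ∑ b, ∑ j, f i j a b :=
        Finset.sum_congr rfl fun a _ => Finset.sum_congr rfl fun i _ => Finset.sum_comm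
    _ = ∑ a, ∑ b, ∑ i, ∑ j, f i j a b := Finset.sum_congr rfl fun a _ => Finset.sum_comm
    _ = ∑ b, ∑ a, ∑ i, ∑ j, f i j a b := Finset.sum_comm

theorem complexOp_raise (G : Matrix (Fin 4) (Fin 4) ℝ) (T : Comp4)
    (α : Matrix (Fin 4) (Fin 4) ℂ) :
    complexOp (raise G T) α = (cmat G⁻¹).transpose * contract T α * cmat G⁻¹ := by
  ext k l
  change (1 / 2 : ℂ) * ∑ i, ∑ j, α i j * (raise G T i j k l : ℂ) = _
  simp only [raise, Matrix.mul_apply, contract, Matrix.of_apply, Matrix.transpose_apply,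
    cmat_apply]
  push_cast
  simp only [Finset.mul_sum, Finset.sum_mul]
  rw [sum_four_comm]
  refine Finset.sum_congr rfl fun b _ => Finset.sum_congr rfl fun a _ =>
    Finset.sum_congr rfl fun i _ => Finset.sum_congr rfl fun j _ => ?_
  ring

theorem contract_eq_of_complexOp {G : Matrix (Fin 4) (Fin 4) ℝ} (hG : G.det ≠ 0)
    (hs : G.transpose = G) {T : Comp4} {α β : Matrix (Fin 4) (Fin 4) ℂ}
    (h : complexOp (raise G T) α = β) : contract T α = cmat G * β * cmat G := by
  have h1 := cmat_mul_inv hG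
  have h2 : cmat G⁻¹ * cmat G = 1 := mul_eq_one_comm.mp h1
  have h3 : cmat G * (cmat G⁻¹).transpose = 1 := by
    have := congrArg Matrix.transpose h2
    rwa [Matrix.transpose_mul, ← cmat_transpose G, hs, Matrix.transpose_one] at this
  rw [← h, complexOp_raise, mul_assoc, mul_assoc, h2, mul_one, ← mul_assoc, h3, one_mul]

/-- An orthonormal frame of the complexified tangent space, with the given orientation. -/
structure IsOrientedFrame (G : Matrix (Fin 4) (Fin 4) ℝ) (s : ℝ) (E : Matrix (Fin 4) (Fin 4) ℂ) :
    Prop where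
  ortho : E.transpose * cmat G * E = 1
  orient : ((s * √|G.det| : ℝ) : ℂ) * E.det = 1

theorem cmat_inv_eq {G : Matrix (Fin 4) (Fin 4) ℝ} (hG : G.det ≠ 0)
    {E : Matrix (Fin 4) (Fin 4) ℂ} (hE : E.transpose * cmat G * E = 1) :
    cmat G⁻¹ = E * E.transpose := by
  have h1 := cmat_mul_inv hG
  have h2 : E * E.transpose * cmat G = 1 := by
    rw [mul_assoc]; exact mul_eq_one_comm.mp hE
  calc cmat G⁻¹ = E * E.transpose * cmat G * cmat G⁻¹ := by rw [h2, one_mul]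
    _ = _ := by rw [mul_assoc, h1, mul_one]

/-- In an orthonormal frame the star permutes the coefficients by `dualMat`. The scalar compares the
volume form with the frame and records its orientation, equal to 1 for oriented frames. -/
theorem complexOp_hodgeStar {G : R4 → Matrix (Fin 4) (Fin 4) ℝ} {s : R4 → ℝ} {y : R4}
    (hG : (G y).det ≠ 0) {E : Matrix (Fin 4) (Fin 4) ℂ}
    (hE : E.transpose * cmat (G y) * E = 1) {a : Matrix (Fin 4) (Fin 4) ℂ}
    (ha : ∀ i j, a i j = - a j i) :
    complexOp (hodgeStar G s y) (E * a * E.transpose) =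
      (((s y * √|(G y).det| : ℝ) : ℂ) * E.det) • (E * dualMat a * E.transpose) := by
  have hs : (E * a * E.transpose).transpose = - (E * a * E.transpose) := by
    have h : a.transpose = - a := by ext i j; exact ha j i
    rw [Matrix.transpose_mul, Matrix.transpose_mul, Matrix.transpose_transpose, h]
    noncomm_ring
  have hc : contract (fun i j k l => s y * √|(G y).det| * leviCivita i j k l)
      (E * a * E.transpose) =
        ((s y * √|(G y).det| : ℝ) : ℂ) • dualMat (E * a * E.transpose) := by
    ext k l
    rw [Matrix.smul_apply, ← sum_leviCivita _ hs, contract, Matrix.of_apply, smul_eq_mul,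
      Finset.mul_sum, Finset.mul_sum, Finset.mul_sum]
    refine Finset.sum_congr rfl fun i _ => ?_
    rw [Finset.mul_sum, Finset.mul_sum, Finset.mul_sum]
    refine Finset.sum_congr rfl fun j _ => ?_
    push_cast
    ring
  have h2 := dualMat_conj (E := E) ha (skew_diag ha)
  rw [hodgeStar, complexOp_raise, hc, cmat_inv_eq hG hE, Matrix.transpose_mul,
    Matrix.transpose_transpose, Matrix.mul_smul, Matrix.smul_mul, mul_smul]
  congr 1
  rw [← Matrix.smul_mul, ← Matrix.mul_smul, ← h2]
  noncomm_ring

theorem dualMat_quat2 {R : Type*} [CommRing R] : dualMat (quat2 R) = quat2 R := by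
  ext i j; fin_cases i <;> fin_cases j <;> simp [dualMat, quat2]

theorem quat1_skew {R : Type*} [CommRing R] (i j : Fin 4) : quat1 R i j = - quat1 R j i := by
  fin_cases i <;> fin_cases j <;> simp [quat1]

theorem quat2_skew {R : Type*} [CommRing R] (i j : Fin 4) : quat2 R i j = - quat2 R j i := by
  fin_cases i <;> fin_cases j <;> simp [quat2]

theorem quat3_skew {R : Type*} [CommRing R] (i j : Fin 4) : quat3 R i j = - quat3 R j i := by
  fin_cases i <;> fin_cases j <;> simp [quat3]

end Pointwise

/-! ### The space of self-dual bivectors at a point -/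

section SelfDualPoint

open Matrix

/-- The combination of `quat1`, `quat2`, `quat3` with given coefficients. -/
def quat {R : Type*} [CommRing R] (c : Fin 3 → R) : Matrix (Fin 4) (Fin 4) R :=
  !![0, c 0, c 1, c 2; -c 0, 0, c 2, -c 1; -c 1, -c 2, 0, c 0; -c 2, c 1, -c 0, 0]

section Ring
variable {R : Type*} [CommRing R]

/-- Multiplication of imaginary quaternions, with the orientation for which the product of the first
two units is minus the third. -/
theorem quat_mul (c d : Fin 3 → R) :
    quat c * quat d = -(c ⬝ᵥ d) • (1 : Matrix (Fin 4) (Fin 4) R) - quat (crossProduct c d) := by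
  ext i j
  fin_cases i <;> fin_cases j <;>
    simp [quat, Matrix.mul_apply, Fin.sum_univ_four, crossProduct, dotProduct,
      Fin.sum_univ_three] <;> ring

theorem quat_skew (c : Fin 3 → R) (i j : Fin 4) : quat c i j = - quat c j i := by
  fin_cases i <;> fin_cases j <;> simp [quat]

theorem quat_transpose (c : Fin 3 → R) : (quat c)ᵀ = - quat c := by
  ext i j; exact quat_skew c j i

theorem dualMat_quat (c : Fin 3 → R) : dualMat (quat c) = quat c := by
  ext i j; fin_cases i <;> fin_cases j <;> simp [dualMat, quat]

theorem quat_trace (c : Fin 3 → R) : (quat c).trace = 0 := by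
  simp [Matrix.trace, Fin.sum_univ_four, quat]

theorem quat_eq (c : Fin 3 → R) : quat c = c 0 • quat1 R + c 1 • quat2 R + c 2 • quat3 R := by
  ext i j; fin_cases i <;> fin_cases j <;> simp [quat, quat1, quat2, quat3]

theorem add_dualMat {a : Matrix (Fin 4) (Fin 4) R} (ha : ∀ i j, a i j = - a j i)
    (h0 : ∀ i, a i i = 0) :
    a + dualMat a = quat ![a 0 1 + a 2 3, a 0 2 + a 3 1, a 0 3 + a 1 2] := by
  ext i j; fin_cases i <;> fin_cases j <;>
    simp [quat, h0, dualMat, ha 1 0, ha 2 0, ha 3 0, ha 2 1, ha 3 2, ha 1 3] <;> ring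

end Ring

/-- The self-dual bivector with given coefficients in the frame `E`. -/
def bivec (E : Matrix (Fin 4) (Fin 4) ℂ) : (Fin 3 → ℂ) →ₗ[ℂ] Matrix (Fin 4) (Fin 4) ℂ where
  toFun c := E * quat c * Eᵀ
  map_add' c d := by
    rw [← add_mul, ← mul_add]; congr 2
    ext i j; fin_cases i <;> fin_cases j <;> simp [quat] <;> ring
  map_smul' t c := by
    rw [RingHom.id_apply, ← Matrix.smul_mul, ← Matrix.mul_smul]; congr 2
    ext i j; fin_cases i <;> fin_cases j <;> simp [quat]

theorem bivec_apply (E : Matrix (Fin 4) (Fin 4) ℂ) (c : Fin 3 → ℂ) :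
    bivec E c = E * quat c * Eᵀ := rfl

variable {g E : Matrix (Fin 4) (Fin 4) ℂ}

theorem quat_injective : Function.Injective (quat (R := ℂ)) := by
  intro c d h
  ext i
  fin_cases i
  · simpa [quat] using congrFun (congrFun h 0) 1
  · simpa [quat] using congrFun (congrFun h 0) 2
  · simpa [quat] using congrFun (congrFun h 0) 3

theorem frame_cancel (hE : Eᵀ * g * E = 1) (a : Matrix (Fin 4) (Fin 4) ℂ) (hg : gᵀ = g) :
    (Eᵀ * g) * (E * a * Eᵀ) * (Eᵀ * g)ᵀ = a := by
  have : Eᵀ * (Eᵀ * g)ᵀ = 1 := by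
    rw [transpose_mul, transpose_transpose, hg, ← mul_assoc, hE]
  calc _ = (Eᵀ * g * E) * a * (Eᵀ * (Eᵀ * g)ᵀ) := by noncomm_ring
    _ = a := by rw [hE, this, one_mul, mul_one]

theorem frame_cancel' (hE : Eᵀ * g * E = 1) (a : Matrix (Fin 4) (Fin 4) ℂ) :
    E * ((Eᵀ * g) * a * (Eᵀ * g)ᵀ) * Eᵀ = a := by
  have h2 : E * (Eᵀ * g) = 1 := mul_eq_one_comm.mp hE
  have : (Eᵀ * g)ᵀ * Eᵀ = 1 := by rw [← transpose_mul, h2, transpose_one]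
  calc _ = (E * (Eᵀ * g)) * a * ((Eᵀ * g)ᵀ * Eᵀ) := by noncomm_ring
    _ = a := by rw [h2, this, one_mul, mul_one]

theorem bivec_injective (hE : Eᵀ * g * E = 1) (hg : gᵀ = g) : Function.Injective (bivec E) := by
  intro c d h
  apply quat_injective
  rw [← frame_cancel hE (quat c) hg, ← frame_cancel hE (quat d) hg]
  exact congrArg (fun a => (Eᵀ * g) * a * (Eᵀ * g)ᵀ) h

/-- Up to sign, the dot product sits in the metric part of a product of self-dual bivectors and the
cross product in the bivector part. Thus Λ⁺ becomes ℂ³ with its standard bilinear form. -/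
theorem bivec_mul (hE : Eᵀ * g * E = 1) (c d : Fin 3 → ℂ) :
    bivec E c * g * bivec E d = -(c ⬝ᵥ d) • (E * Eᵀ) - bivec E (crossProduct c d) := by
  calc bivec E c * g * bivec E d = E * quat c * (Eᵀ * g * E) * quat d * Eᵀ := by
        rw [bivec_apply, bivec_apply]; noncomm_ring
    _ = E * (quat c * quat d) * Eᵀ := by rw [hE]; noncomm_ring
    _ = _ := by
      rw [quat_mul, mul_sub, sub_mul, Matrix.mul_smul, Matrix.smul_mul, mul_one]; rfl

theorem bivec_transpose (c : Fin 3 → ℂ) : (bivec E c)ᵀ = - bivec E c := by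
  rw [bivec_apply, transpose_mul, transpose_mul, transpose_transpose, quat_transpose]; noncomm_ring

variable {G : R4 → Matrix (Fin 4) (Fin 4) ℝ} {s : R4 → ℝ} {y : R4}

theorem cmat_transpose_eq (hs : (G y)ᵀ = G y) : (cmat (G y))ᵀ = cmat (G y) := by
  rw [← cmat_transpose, hs]

theorem complexOp_hodgeStar_frame (hG : (G y).det ≠ 0) (hE : IsOrientedFrame (G y) (s y) E)
    {a : Matrix (Fin 4) (Fin 4) ℂ} (ha : ∀ i j, a i j = - a j i) :
    complexOp (hodgeStar G s y) (E * a * Eᵀ) = E * dualMat a * Eᵀ := by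
  rw [complexOp_hodgeStar hG hE.ortho ha, hE.orient, one_smul]

theorem skew_conj {a : Matrix (Fin 4) (Fin 4) ℂ} (ha : aᵀ = -a) (P : Matrix (Fin 4) (Fin 4) ℂ) :
    (P * a * Pᵀ)ᵀ = - (P * a * Pᵀ) := by
  rw [transpose_mul, transpose_mul, transpose_transpose, ha]; noncomm_ring

/-- Twice the coefficients of the self-dual part of a skew-symmetric array. -/
def sdCoeff {R : Type*} [CommRing R] (a : Matrix (Fin 4) (Fin 4) R) : Fin 3 → R :=
  ![a 0 1 + a 2 3, a 0 2 + a 3 1, a 0 3 + a 1 2]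

theorem half_add_hodgeStar (hG : (G y).det ≠ 0)
    (hE : IsOrientedFrame (G y) (s y) E) {α : Matrix (Fin 4) (Fin 4) ℂ} (hα : αᵀ = -α) :
    (1 / 2 : ℂ) • (α + complexOp (hodgeStar G s y) α) =
      bivec E ((1 / 2 : ℂ) • sdCoeff ((Eᵀ * cmat (G y)) * α * (Eᵀ * cmat (G y))ᵀ)) := by
  have hsk' := skew_conj hα (Eᵀ * cmat (G y))
  have hα' := frame_cancel' hE.ortho α
  generalize (Eᵀ * cmat (G y)) * α * (Eᵀ * cmat (G y))ᵀ = a at hsk' hα'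
  have hsk : ∀ i j, a i j = - a j i := fun i j => congrFun (congrFun hsk' j) i
  rw [map_smul, bivec_apply, sdCoeff, ← add_dualMat hsk (skew_diag hsk), mul_add, add_mul,
    ← complexOp_hodgeStar_frame hG hE hsk, hα']

/-- A self-dual α equals its own projection (α + *α)/2, and the range of that projection is
described by the three frame coefficients. -/
theorem mem_complexSelfDual_iff (hG : (G y).det ≠ 0)
    (hE : IsOrientedFrame (G y) (s y) E) (α : Matrix (Fin 4) (Fin 4) ℂ) :
    α ∈ complexSelfDual G s y ↔ ∃ c, bivec E c = α := by
  constructor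
  · rintro ⟨h1, h2⟩
    have hc := half_add_hodgeStar hG hE h1
    refine ⟨_, hc.symm.trans ?_⟩
    rw [h2, ← two_smul ℂ α, smul_smul]; norm_num
  · rintro ⟨c, rfl⟩
    refine ⟨bivec_transpose c, ?_⟩
    rw [bivec_apply, complexOp_hodgeStar_frame hG hE (quat_skew c), dualMat_quat]

/-- The curvature tensor with lowered indices. -/
def lowered (G : R4 → Matrix (Fin 4) (Fin 4) ℝ) (y : R4) : Comp4 :=
  fun i j k l => ∑ m, curvature G y i j k m * G y m l

theorem curvature_skew (i j k l : Fin 4) : curvature G y i j k l = - curvature G y j i k l := by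
  simp only [curvature]
  rw [neg_add, ← Finset.sum_neg_distrib]
  congr 1
  · ring
  · exact Finset.sum_congr rfl fun m _ => by ring

theorem lowered_skew (i j k l : Fin 4) : lowered G y i j k l = - lowered G y j i k l := by
  simp only [lowered, curvature_skew i j, neg_mul, Finset.sum_neg_distrib]

section Symmetries
open TopologicalSpace (Opens)
variable {U : Opens R4}

theorem IsSmoothMetric.lowered_pair (hG : IsSmoothMetric G U) (hy : y ∈ U) (i j a b : Fin 4) :
    lowered G y i j a b = lowered G y a b i j := by
  have h := mul_curvMat_pair (D := partialDeriv) (g := hG.metric) (Γ := hG.chr) partialDeriv_comm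
    hG.dmat_metric hG.chr_comm hG.metric_transpose j i b a
  have h' := congrArg (fun f : smoothRing U => f.1 ⟨y, hy⟩) h
  simp only [hG.mul_curvMat_apply] at h'
  exact_mod_cast h'

theorem IsSmoothMetric.lowered_skew_right (hG : IsSmoothMetric G U) (hy : y ∈ U) (i j a b : Fin 4) :
    lowered G y i j a b = - lowered G y i j b a := by
  rw [hG.lowered_pair hy, lowered_skew, hG.lowered_pair hy]

theorem IsSmoothMetric.lowered_bianchi (hG : IsSmoothMetric G U) (hy : y ∈ U) (i j k l : Fin 4) :
    lowered G y i j k l + lowered G y j k i l + lowered G y k i j l = 0 := by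
  have h := mul_curvMat_bianchi (D := partialDeriv) (g := hG.metric) hG.chr_comm j i k l
  have h' := congrArg (fun f : smoothRing U => f.1 ⟨y, hy⟩) h
  change (_ : smoothRing U).1 ⟨y, hy⟩ + (_ : smoothRing U).1 ⟨y, hy⟩ + (_ : smoothRing U).1 ⟨y, hy⟩
    = 0 at h'
  simp only [hG.mul_curvMat_apply] at h'
  have h2 : lowered G y i j k l + lowered G y k i j l + lowered G y j k i l = 0 := by
    exact_mod_cast h'
  linarith

end Symmetries

/-- The operator induced on the coefficients of self-dual bivectors by the curvature operator. -/
structure IsSelfDualModel (G : R4 → Matrix (Fin 4) (Fin 4) ℝ) (s : R4 → ℝ) (y : R4)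
    (E : Matrix (Fin 4) (Fin 4) ℂ) (T : Module.End ℂ (Fin 3 → ℂ)) : Prop where
  frame : IsOrientedFrame (G y) (s y) E
  comm : ∀ c, complexOp (curvatureOp G y) (bivec E c) = bivec E (T c)
  adjoint : ∀ c d, T c ⬝ᵥ d = c ⬝ᵥ T d
  spans : ⨆ μ, T.eigenspace μ = ⊤
  eigenspace_iff : ∀ μ, selfDualEigenspace G s y μ ≠ ⊥ ↔ T.eigenspace μ ≠ ⊥

theorem bivec_pairing (hE : Eᵀ * g * E = 1) (c d : Fin 3 → ℂ) :
    ∑ a, ∑ b, bivec E d a b * (g * bivec E c * g) a b = 4 * (d ⬝ᵥ c) := by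
  have h1 : ∑ a, ∑ b, bivec E d a b * (g * bivec E c * g) a b =
      ((bivec E d)ᵀ * (g * bivec E c * g)).trace := by
    rw [Finset.sum_comm]
    simp only [Matrix.trace, Matrix.diag, Matrix.mul_apply, Matrix.transpose_apply]
  have h2 : E * Eᵀ * g = 1 := by rw [mul_assoc]; exact mul_eq_one_comm.mp hE
  have h3 : (bivec E (crossProduct d c) * g).trace = 0 := by
    rw [bivec_apply, mul_assoc, Matrix.trace_mul_comm, ← mul_assoc, hE, one_mul, quat_trace]
  rw [h1, bivec_transpose, neg_mul, ← mul_assoc, ← mul_assoc, bivec_mul hE, sub_mul,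
    Matrix.smul_mul, h2, Matrix.trace_neg, Matrix.trace_sub, h3, Matrix.trace_smul]
  simp
  ring

/-- Pair symmetry of the curvature tensor is self-adjointness of the curvature operator with respect
to the induced form on bivectors. -/
theorem sum_mul_contract_symm {T : Comp4} (hT : ∀ i j a b, T i j a b = T a b i j)
    (α β : Matrix (Fin 4) (Fin 4) ℂ) :
    ∑ a, ∑ b, β a b * contract T α a b = ∑ a, ∑ b, α a b * contract T β a b := by
  simp only [contract, Matrix.of_apply, Finset.mul_sum]
  have h := sum_four_comm fun a b i j => β a b * ((1 / 2) * (α i j * (T i j a b : ℂ)))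
  have h' := sum_four_comm fun b a i j => β a b * ((1 / 2) * (α i j * (T i j a b : ℂ)))
  calc _ = ∑ b, ∑ a, ∑ i, ∑ j, β a b * (1 / 2 * (α i j * (T i j a b : ℂ))) := Finset.sum_comm
    _ = ∑ j, ∑ i, ∑ b, ∑ a, β a b * (1 / 2 * (α i j * (T i j a b : ℂ))) := h'
    _ = ∑ i, ∑ j, ∑ b, ∑ a, β a b * (1 / 2 * (α i j * (T i j a b : ℂ))) := Finset.sum_comm
    _ = _ := by
      refine Finset.sum_congr rfl fun i _ => Finset.sum_congr rfl fun j _ => ?_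
      rw [Finset.sum_comm]
      refine Finset.sum_congr rfl fun a _ => Finset.sum_congr rfl fun b _ => ?_
      rw [hT]; ring

/-- An oriented frame carries R⁺ over to an endomorphism of ℂ³, so that the spectral hypotheses
become statements about a self-adjoint diagonalizable operator for the complex dot product. -/
theorem exists_selfDualModel (hG : (G y).det ≠ 0) (hs : (G y)ᵀ = G y)
    (hpair : ∀ i j a b, lowered G y i j a b = lowered G y a b i j)
    (hE : IsOrientedFrame (G y) (s y) E)
    (hdiag : ⨆ μ : ℂ, selfDualEigenspace G s y μ = complexSelfDual G s y) :
    ∃ T, IsSelfDualModel G s y E T := by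
  have hg := cmat_transpose_eq hs
  have hinj := bivec_injective hE.ortho hg
  have hmem := mem_complexSelfDual_iff hG hE
  set K := complexOp (curvatureOp G y) with hK
  have hrange : LinearMap.range (bivec E) = complexSelfDual G s y := by
    ext α; rw [hmem]; rfl
  -- Invariance of Λ⁺ under the curvature operator is read off from the fact that eigenvectors span
  -- it.
  have hinv : ∀ α ∈ complexSelfDual G s y, K α ∈ complexSelfDual G s y := by
    rw [← hdiag]
    intro α hα
    refine Submodule.iSup_induction (motive := fun α => K α ∈ ⨆ μ : ℂ, selfDualEigenspace G s y μ)
      _ hα (fun μ β hβ => ?_) (by simp) (fun a b ha hb => by rw [map_add]; exact add_mem ha hb)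
    have : K β = μ • β := Module.End.mem_eigenspace_iff.mp hβ.2
    rw [this]
    exact Submodule.smul_mem _ _ (Submodule.mem_iSup_of_mem μ hβ)
  let ι := LinearEquiv.ofInjective (bivec E) hinj
  have hι : ∀ c, (ι c : Matrix (Fin 4) (Fin 4) ℂ) = bivec E c := fun c => rfl
  have hmaps : ∀ x ∈ LinearMap.range (bivec E), K x ∈ LinearMap.range (bivec E) := by
    rw [hrange]; exact hinv
  let T : Module.End ℂ (Fin 3 → ℂ) := ι.symm.toLinearMap ∘ₗ (K.restrict hmaps) ∘ₗ ι.toLinearMap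
  have hcomm : ∀ c, K (bivec E c) = bivec E (T c) := by
    intro c
    rw [← hι (T c)]
    change _ = ((ι (ι.symm _) : LinearMap.range (bivec E)) : Matrix (Fin 4) (Fin 4) ℂ)
    rw [LinearEquiv.apply_symm_apply]
    rfl
  have hmap : ∀ μ, selfDualEigenspace G s y μ = (T.eigenspace μ).map (bivec E) := by
    intro μ
    ext α
    rw [Submodule.mem_map]
    constructor
    · rintro ⟨h1, h2⟩
      obtain ⟨c, rfl⟩ := (hmem _).mp h1
      refine ⟨c, ?_, rfl⟩
      have h2' : K (bivec E c) = μ • bivec E c := Module.End.mem_eigenspace_iff.mp h2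
      rw [Module.End.mem_eigenspace_iff]
      apply hinj
      rw [← hcomm, map_smul]; exact h2'
    · rintro ⟨c, hc, rfl⟩
      refine ⟨(hmem _).mpr ⟨c, rfl⟩, ?_⟩
      rw [Module.End.mem_eigenspace_iff] at hc
      refine Module.End.mem_eigenspace_iff.mpr ?_
      rw [← hK, hcomm, hc, map_smul]
  refine ⟨T, hE, hcomm, fun c d => ?_, ?_, fun μ => ?_⟩
  · have h1 := contract_eq_of_complexOp (T := lowered G y) hG hs (hcomm c)
    have h2 := contract_eq_of_complexOp (T := lowered G y) hG hs (hcomm d)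
    have h3 := sum_mul_contract_symm hpair (bivec E c) (bivec E d)
    rw [h1, h2, bivec_pairing hE.ortho, bivec_pairing hE.ortho] at h3
    rw [dotProduct_comm]
    exact mul_left_cancel₀ (by norm_num : (4 : ℂ) ≠ 0) h3
  · apply Submodule.map_injective_of_injective hinj
    rw [Submodule.map_iSup, Submodule.map_top, hrange, ← hdiag]
    exact iSup_congr fun μ => (hmap μ).symm
  · rw [hmap μ, not_iff_not]
    constructor
    · intro h
      exact Submodule.map_injective_of_injective hinj (by rw [h, Submodule.map_bot])
    · intro h; rw [h, Submodule.map_bot]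

/-- The existence of oriented orthonormal frames of the complexified tangent space. -/
theorem exists_orientedFrame {G : Matrix (Fin 4) (Fin 4) ℝ} {s : ℝ} (hs : s ^ 2 = 1)
    {B : Matrix (Fin 4) (Fin 4) ℝ} (hB : Bᵀ * G * B = Matrix.diagonal ![(-1 : ℝ), -1, 1, 1]) :
    G.det ≠ 0 ∧ ∃ E, IsOrientedFrame G s E := by
  have hdet := congrArg Matrix.det hB
  rw [Matrix.det_mul, Matrix.det_mul, Matrix.det_transpose, Matrix.det_diagonal] at hdet
  have hdet' : B.det * G.det * B.det = 1 := by
    rw [hdet]; simp [Fin.prod_univ_four]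
  have hB0 : B.det ≠ 0 := by rintro h; simp [h] at hdet'
  have hGpos : 0 < G.det := by
    have h1 : 0 < B.det ^ 2 := by positivity
    nlinarith
  refine ⟨hGpos.ne', ?_⟩
  -- The number d is the sign of the real frame B. Multiplying the two negative vectors by i makes
  -- the frame orthonormal over ℂ, and the factor −d on the last vector then corrects the
  -- orientation, as i·i·(−d) = d.
  set d : ℝ := s * √|G.det| * B.det with hd
  have hd2 : d ^ 2 = 1 := by
    rw [hd, mul_pow, mul_pow, hs, Real.sq_sqrt (abs_nonneg _), abs_of_pos hGpos]
    linarith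
  set P : Matrix (Fin 4) (Fin 4) ℂ := Matrix.diagonal ![Complex.I, Complex.I, 1, (-d : ℂ)] with hP
  refine ⟨cmat B * P, ?_, ?_⟩
  · have h1 : (cmat B * P)ᵀ * cmat G * (cmat B * P) = Pᵀ * cmat (Bᵀ * G * B) * P := by
      rw [cmat_mul, cmat_mul, cmat_transpose, transpose_mul]; noncomm_ring
    have h2 : cmat (Matrix.diagonal ![(-1 : ℝ), -1, 1, 1]) =
        Matrix.diagonal ![(-1 : ℂ), -1, 1, 1] := by
      ext i j; fin_cases i <;> fin_cases j <;> simp [cmat]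
    have h3 : (d : ℂ) * d = 1 := by rw [← sq]; exact_mod_cast hd2
    rw [h1, hB, h2, hP, Matrix.diagonal_transpose, Matrix.diagonal_mul_diagonal,
      Matrix.diagonal_mul_diagonal, ← Matrix.diagonal_one]
    congr 1
    ext i; fin_cases i <;> simp [h3]
  · rw [Matrix.det_mul, cmat_det, hP, Matrix.det_diagonal]
    have h3 : (d : ℂ) * d = 1 := by rw [← sq]; exact_mod_cast hd2
    simp only [Fin.prod_univ_four]
    simp only [Matrix.cons_val]
    rw [show ((s * √|G.det| : ℝ) : ℂ) * ((B.det : ℂ) * (Complex.I * Complex.I * 1 * -(d : ℂ))) =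
      ((s * √|G.det| * B.det : ℝ) : ℂ) * d * (-(Complex.I * Complex.I)) by push_cast; ring, ← hd, h3,
      Complex.I_mul_I]
    norm_num

end SelfDualPoint

/-! ### Diagonalizable self-adjoint operators on the complex 3-space -/

section ThreeSpace

open Matrix Polynomial

variable {T : Module.End ℂ (Fin 3 → ℂ)}

theorem dotProduct_eq_zero_of_eigen (hT : ∀ c d, T c ⬝ᵥ d = c ⬝ᵥ T d) {v w : Fin 3 → ℂ} {μ ν : ℂ}
    (hv : T v = μ • v) (hw : T w = ν • w) (h : μ ≠ ν) : v ⬝ᵥ w = 0 := by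
  have h1 := hT v w
  rw [hv, hw, smul_dotProduct, dotProduct_smul, smul_eq_mul, smul_eq_mul] at h1
  have : (μ - ν) * (v ⬝ᵥ w) = 0 := by linear_combination h1
  exact (mul_eq_zero.mp this).resolve_left (sub_ne_zero.mpr h)

/-- If all eigenvectors in W were isotropic, polarization within an eigenspace and orthogonality
between different ones would make the span of these eigenvectors totally isotropic, contrary to x.
-/
theorem exists_nonisotropic_eigenvector (hT : ∀ c d, T c ⬝ᵥ d = c ⬝ᵥ T d)
    {W : Submodule ℂ (Fin 3 → ℂ)} {x : Fin 3 → ℂ} (hx : x ∈ ⨆ μ, T.eigenspace μ ⊓ W)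
    (hx0 : x ⬝ᵥ x ≠ 0) : ∃ (μ : ℂ) (v : Fin 3 → ℂ), v ∈ W ∧ T v = μ • v ∧ v ⬝ᵥ v ≠ 0 := by
  by_contra! hc
  have h1 : ∀ μ, ∀ v ∈ T.eigenspace μ ⊓ W, ∀ ν, ∀ w ∈ T.eigenspace ν ⊓ W, v ⬝ᵥ w = 0 := by
    rintro μ v ⟨hv, hvW⟩ ν w ⟨hw, hwW⟩
    have hv' : T v = μ • v := Module.End.mem_eigenspace_iff.mp hv
    have hw' : T w = ν • w := Module.End.mem_eigenspace_iff.mp hw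
    by_cases h : μ = ν
    · subst h
      have h2 := hc μ (v + w) (add_mem hvW hwW) (by rw [map_add, hv', hw', smul_add])
      rw [add_dotProduct, dotProduct_add, dotProduct_add, hc μ v hvW hv', hc μ w hwW hw',
        dotProduct_comm w v] at h2
      linear_combination h2 / 2
    · exact dotProduct_eq_zero_of_eigen hT hv' hw' h
  have h2 : ∀ μ, ∀ v ∈ T.eigenspace μ ⊓ W, v ⬝ᵥ x = 0 := fun μ v hv =>
    Submodule.iSup_induction (motive := fun x => v ⬝ᵥ x = 0) _ hx (fun ν w hw => h1 μ v hv ν w hw)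
      (by simp) (fun a b ha hb => by rw [dotProduct_add, ha, hb, add_zero])
  exact hx0 (Submodule.iSup_induction (motive := fun z => z ⬝ᵥ x = 0) _ hx h2
    (by simp) (fun a b ha hb => by rw [add_dotProduct, ha, hb, add_zero]))

theorem exists_unit_eigenvector (hT : ∀ c d, T c ⬝ᵥ d = c ⬝ᵥ T d)
    {W : Submodule ℂ (Fin 3 → ℂ)} {x : Fin 3 → ℂ} (hx : x ∈ ⨆ μ, T.eigenspace μ ⊓ W)
    (hx0 : x ⬝ᵥ x ≠ 0) : ∃ (μ : ℂ) (v : Fin 3 → ℂ), v ∈ W ∧ T v = μ • v ∧ v ⬝ᵥ v = 1 := by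
  obtain ⟨μ, v, hvW, hv, hv0⟩ := exists_nonisotropic_eigenvector hT hx hx0
  obtain ⟨z, hz⟩ := IsAlgClosed.exists_pow_nat_eq (v ⬝ᵥ v) two_pos
  have hz0 : z ≠ 0 := by rintro rfl; exact hv0 (by rw [← hz]; simp)
  refine ⟨μ, z⁻¹ • v, W.smul_mem _ hvW, by rw [map_smul, hv, smul_comm], ?_⟩
  rw [smul_dotProduct, dotProduct_smul, ← hz, smul_eq_mul, smul_eq_mul]
  field_simp

theorem expansion_of_orthonormal {c d : Fin 3 → ℂ} (hc : c ⬝ᵥ c = 1) (hd : d ⬝ᵥ d = 1)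
    (hcd : c ⬝ᵥ d = 0) (x : Fin 3 → ℂ) :
    x = (c ⬝ᵥ x) • c + (d ⬝ᵥ x) • d + (crossProduct c d ⬝ᵥ x) • crossProduct c d := by
  have huu : crossProduct c d ⬝ᵥ crossProduct c d = 1 := by
    rw [cross_dot_cross, hc, hd, hcd]; ring
  have hcu : c ⬝ᵥ crossProduct c d = 0 := dot_self_cross c d
  have hdu : d ⬝ᵥ crossProduct c d = 0 := dot_cross_self c d
  generalize crossProduct c d = u at *
  set O : Matrix (Fin 3) (Fin 3) ℂ := Matrix.of ![c, d, u] with hO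
  have h1 : O * Oᵀ = 1 := by
    ext i j
    rw [Matrix.mul_apply']
    change ![c, d, u] i ⬝ᵥ ![c, d, u] j = _
    fin_cases i <;> fin_cases j <;>
      simp [hc, hd, hcd, huu, hcu, hdu, dotProduct_comm d c, dotProduct_comm u c, dotProduct_comm u d]
  have h2 : Oᵀ * O = 1 := mul_eq_one_comm.mp h1
  calc x = Oᵀ *ᵥ (O *ᵥ x) := by rw [mulVec_mulVec, h2, one_mulVec]
    _ = _ := by
      rw [mulVec_transpose, vecMul_eq_sum, Fin.sum_univ_three]
      rfl

/-- A self-adjoint operator preserves the orthogonal complement of two orthonormal eigenvectors,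
which in ℂ³ is the line of their cross product. -/
theorem cross_eigenvector (hT : ∀ c d, T c ⬝ᵥ d = c ⬝ᵥ T d) {c d : Fin 3 → ℂ} {μ ν : ℂ}
    (hc : c ⬝ᵥ c = 1) (hd : d ⬝ᵥ d = 1) (hcd : c ⬝ᵥ d = 0) (h1 : T c = μ • c) (h2 : T d = ν • d) :
    ∃ l : ℂ, T (crossProduct c d) = l • crossProduct c d := by
  refine ⟨crossProduct c d ⬝ᵥ T (crossProduct c d), ?_⟩
  have e := expansion_of_orthonormal hc hd hcd (T (crossProduct c d))
  rw [← hT, ← hT, h1, h2, smul_dotProduct, smul_dotProduct, dot_self_cross, dot_cross_self,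
    smul_zero, smul_zero, zero_smul, zero_smul, zero_add, zero_add] at e
  exact e

/-- The eigenvalue of c × d is detected by any eigenvector not orthogonal to it, since eigenvectors
for different eigenvalues are orthogonal. -/
theorem cross_eigenvalue (hT : ∀ c d, T c ⬝ᵥ d = c ⬝ᵥ T d) {c d x : Fin 3 → ℂ} {μ ν l : ℂ}
    (hc : c ⬝ᵥ c = 1) (hd : d ⬝ᵥ d = 1) (hcd : c ⬝ᵥ d = 0) (h1 : T c = μ • c) (h2 : T d = ν • d)
    (hx : T x = l • x) (hx0 : crossProduct c d ⬝ᵥ x ≠ 0) :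
    T (crossProduct c d) = l • crossProduct c d := by
  obtain ⟨l', hl'⟩ := cross_eigenvector hT hc hd hcd h1 h2
  by_cases h : l' = l
  · rw [← h, hl']
  · exact absurd (dotProduct_eq_zero_of_eigen hT hl' hx h) hx0

/-- A diagonalizable self-adjoint operator has an orthonormal basis of eigenvectors. -/
theorem exists_orthonormal_eigenbasis (hT : ∀ c d, T c ⬝ᵥ d = c ⬝ᵥ T d)
    (hspan : ⨆ μ, T.eigenspace μ = ⊤) :
    ∃ c d : Fin 3 → ℂ, ∃ l1 l2 l3 : ℂ, c ⬝ᵥ c = 1 ∧ d ⬝ᵥ d = 1 ∧ c ⬝ᵥ d = 0 ∧ T c = l1 • c ∧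
      T d = l2 • d ∧ T (crossProduct c d) = l3 • crossProduct c d ∧
      ∀ μ, T.eigenspace μ ≠ ⊥ ↔ μ = l1 ∨ μ = l2 ∨ μ = l3 := by
  obtain ⟨l1, c, -, h1, hc⟩ := exists_unit_eigenvector (W := ⊤) (x := ![1, 0, 0]) hT
    (by simp [hspan]) (by simp)
  -- If the complement of c were totally isotropic, the projections of the standard basis vectors
  -- would give cᵢ² = 1 for each i, so c·c = 3 instead of 1.
  obtain ⟨x, hcx, hx⟩ : ∃ x, c ⬝ᵥ x = 0 ∧ x ⬝ᵥ x ≠ 0 := by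
    by_contra! h
    have key : ∀ i, 1 - c i * c i = 0 := by
      intro i
      have h3 := h (Pi.single i 1 - c i • c) (by
        rw [dotProduct_sub, dotProduct_smul, hc]; simp)
      rw [dotProduct_sub, sub_dotProduct, sub_dotProduct, dotProduct_smul, dotProduct_smul,
        smul_dotProduct, smul_dotProduct, hc] at h3
      simp at h3
      linear_combination h3
    rw [dotProduct, Fin.sum_univ_three] at hc
    have : (2 : ℂ) = 0 := by linear_combination key 0 + key 1 + key 2 + hc
    norm_num at this
  let W : Submodule ℂ (Fin 3 → ℂ) :=
    { carrier := {w | c ⬝ᵥ w = 0}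
      add_mem' := fun {a b} ha hb => by
        change c ⬝ᵥ (a + b) = 0
        rw [dotProduct_add, ha, hb, add_zero]
      zero_mem' := dotProduct_zero c
      smul_mem' := fun t a ha => by
        change c ⬝ᵥ (t • a) = 0
        rw [dotProduct_smul, ha, smul_zero] }
  -- Projecting an eigenvector off c leaves an eigenvector: it changes only when its eigenvalue is
  -- that of c. So the complement of c is again spanned by eigenvectors.
  have hproj : ∀ z, z - (c ⬝ᵥ z) • c ∈ ⨆ μ, T.eigenspace μ ⊓ W := by
    intro z
    have hz : z ∈ ⨆ μ, T.eigenspace μ := by rw [hspan]; trivial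
    refine Submodule.iSup_induction (motive := fun z => z - (c ⬝ᵥ z) • c ∈ ⨆ μ, T.eigenspace μ ⊓ W)
      _ hz (fun μ v hv => ?_) (by simp) (fun a b ha hb => ?_)
    · refine Submodule.mem_iSup_of_mem μ ⟨?_, ?_⟩
      · refine Module.End.mem_eigenspace_iff.mpr ?_
        have hv' : T v = μ • v := Module.End.mem_eigenspace_iff.mp hv
        by_cases h : l1 = μ
        · rw [map_sub, map_smul, hv', h1, h, smul_sub, smul_comm]
        · rw [dotProduct_eq_zero_of_eigen hT h1 hv' h, zero_smul, sub_zero, hv']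
      · change c ⬝ᵥ (v - (c ⬝ᵥ v) • c) = 0
        rw [dotProduct_sub, dotProduct_smul, hc]; simp
    · have : a + b - (c ⬝ᵥ (a + b)) • c = (a - (c ⬝ᵥ a) • c) + (b - (c ⬝ᵥ b) • c) := by
        rw [dotProduct_add, add_smul]; abel
      rw [this]; exact add_mem ha hb
  have hxm := hproj x
  rw [hcx, zero_smul, sub_zero] at hxm
  obtain ⟨l2, d, hcd, h2, hd⟩ := exists_unit_eigenvector hT hxm hx
  have hcd : c ⬝ᵥ d = 0 := hcd
  obtain ⟨l3, h3⟩ := cross_eigenvector hT hc hd hcd h1 h2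
  have hu : crossProduct c d ⬝ᵥ crossProduct c d = 1 := by
    rw [cross_dot_cross, hc, hd, hcd]; ring
  refine ⟨c, d, l1, l2, l3, hc, hd, hcd, h1, h2, h3, fun μ => ⟨fun h => ?_, fun h => ?_⟩⟩
  · obtain ⟨v, hv, hv0⟩ := Submodule.exists_mem_ne_zero_of_ne_bot h
    have hv' : T v = μ • v := Module.End.mem_eigenspace_iff.mp hv
    by_contra! hn
    apply hv0
    rw [expansion_of_orthonormal hc hd hcd v, dotProduct_eq_zero_of_eigen hT h1 hv' hn.1.symm,
      dotProduct_eq_zero_of_eigen hT h2 hv' hn.2.1.symm,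
      dotProduct_eq_zero_of_eigen hT h3 hv' hn.2.2.symm]
    simp
  · have aux : ∀ {l : ℂ} {w : Fin 3 → ℂ}, T w = l • w → w ⬝ᵥ w = 1 → T.eigenspace l ≠ ⊥ := by
      intro l w hw hw1 hb
      have hm : w ∈ T.eigenspace l := Module.End.mem_eigenspace_iff.mpr hw
      rw [hb, Submodule.mem_bot] at hm
      rw [hm] at hw1
      simp at hw1
    rcases h with rfl | rfl | rfl
    exacts [aux h1 hc, aux h2 hd, aux h3 hu]

/-- A polynomial which projects, up to a factor, onto an eigenspace. -/
def eigenPoly (S : Finset ℂ) (l : ℂ) : ℂ[X] := ∏ μ ∈ S.erase l, (X - C μ)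

theorem eigenPoly_eval_self (S : Finset ℂ) (l : ℂ) : (eigenPoly S l).eval l ≠ 0 := by
  rw [eigenPoly, eval_prod, Finset.prod_ne_zero_iff]
  intro μ hμ
  simpa [sub_eq_zero] using (Finset.ne_of_mem_erase hμ).symm

/-- The polynomial kills every eigenspace except the one for l, and eigenvectors span, so its image
lies in that eigenspace. -/
theorem aeval_eigenPoly_mem {S : Finset ℂ} (hS : ∀ μ, T.eigenspace μ ≠ ⊥ → μ ∈ S)
    (hspan : ⨆ μ, T.eigenspace μ = ⊤) (l : ℂ) (v : Fin 3 → ℂ) :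
    T (aeval T (eigenPoly S l) v) = l • aeval T (eigenPoly S l) v := by
  have hv : v ∈ ⨆ μ, T.eigenspace μ := by rw [hspan]; trivial
  refine Submodule.iSup_induction (motive := fun v => T (aeval T (eigenPoly S l) v) =
    l • aeval T (eigenPoly S l) v) _ hv (fun μ w hw => ?_) (by simp)
      (fun a b ha hb => by simp only [map_add, smul_add, ha, hb])
  by_cases hw0 : w = 0
  · simp [hw0]
  have hw' : T w = μ • w := Module.End.mem_eigenspace_iff.mp hw
  have hμ : μ ∈ S := hS μ fun h => hw0 (by rwa [h, Submodule.mem_bot] at hw)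
  rw [Module.End.aeval_apply_of_hasEigenvector ⟨hw, hw0⟩]
  by_cases h : μ = l
  · rw [map_smul, hw', h, smul_comm]
  · have : (eigenPoly S l).eval μ = 0 := by
      rw [eigenPoly, eval_prod]
      exact Finset.prod_eq_zero (Finset.mem_erase.mpr ⟨h, hμ⟩) (by simp)
    simp [this]

theorem aeval_eigenPoly_apply (S : Finset ℂ) {l : ℂ} {v : Fin 3 → ℂ} (hv : T v = l • v) :
    aeval T (eigenPoly S l) v = (eigenPoly S l).eval l • v := by
  by_cases hv0 : v = 0
  · simp [hv0]
  · exact Module.End.aeval_apply_of_hasEigenvector ⟨Module.End.mem_eigenspace_iff.mpr hv, hv0⟩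

theorem aeval_intertwine {V W : Type*} [AddCommGroup V] [Module ℂ V] [AddCommGroup W] [Module ℂ W]
    {K : Module.End ℂ W} {T : Module.End ℂ V} {ι : V →ₗ[ℂ] W} (h : ∀ c, K (ι c) = ι (T c))
    (P : ℂ[X]) (c : V) : aeval K P (ι c) = ι (aeval T P c) := by
  induction P using Polynomial.induction_on generalizing c with
  | C a => simp
  | add p q hp hq => simp [hp, hq]
  | monomial n a ih =>
    rw [pow_succ, ← mul_assoc, map_mul (aeval K) _ X, map_mul (aeval T) _ X, Module.End.mul_apply, Module.End.mul_apply,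
      aeval_X, aeval_X, h, ih]

end ThreeSpace

/-! ### Smooth fields of eigenvectors -/

section EigenFields

open Matrix Polynomial
open TopologicalSpace (Opens)

/-- A domain of coordinates with a neutral metric satisfying the hypotheses on the self-dual
curvature operator. -/
structure IsCurvatureChart (G : R4 → Matrix (Fin 4) (Fin 4) ℝ) (s : R4 → ℝ) (U : Opens R4)
    (S : Set ℂ) : Prop where
  metric : IsSmoothMetric G U
  neutral : ∀ y ∈ U, ∃ B : Matrix (Fin 4) (Fin 4) ℝ,
    Bᵀ * G y * B = Matrix.diagonal ![(-1 : ℝ), -1, 1, 1]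
  sign_smooth : ContDiffOn ℝ ∞ s U
  sign_sq : ∀ y ∈ U, s y ^ 2 = 1
  spans : ∀ y ∈ U, ⨆ μ : ℂ, selfDualEigenspace G s y μ = complexSelfDual G s y
  eigenvalues : ∀ y ∈ U, {μ : ℂ | selfDualEigenspace G s y μ ≠ ⊥} = S

variable {G : R4 → Matrix (Fin 4) (Fin 4) ℝ} {s : R4 → ℝ} {U : Opens R4} {S : Set ℂ} {y : R4}

theorem IsCurvatureChart.exists_model (h : IsCurvatureChart G s U S) (hy : y ∈ U) :
    ∃ E T, IsSelfDualModel G s y E T ∧ ∀ μ, T.eigenspace μ ≠ ⊥ ↔ μ ∈ S := by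
  obtain ⟨B, hB⟩ := h.neutral y hy
  obtain ⟨hdet, E, hE⟩ := exists_orientedFrame (h.sign_sq y hy) hB
  obtain ⟨T, hT⟩ := exists_selfDualModel hdet (h.metric.symm y hy) (h.metric.lowered_pair hy) hE
    (h.spans y hy)
  refine ⟨E, T, hT, fun μ => ?_⟩
  rw [← h.eigenvalues y hy, ← hT.eigenspace_iff]; rfl

/-- A field of self-dual eigenvectors of the curvature operator. -/
def eigenField (G : R4 → Matrix (Fin 4) (Fin 4) ℝ) (s : R4 → ℝ) (S : Finset ℂ) (l : ℂ)
    (α : Matrix (Fin 4) (Fin 4) ℂ) (y : R4) : Matrix (Fin 4) (Fin 4) ℂ :=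
  aeval (complexOp (curvatureOp G y)) (eigenPoly S l)
    ((1 / 2 : ℂ) • (α + complexOp (hodgeStar G s y) α))

/-- Because one finite set S contains the spectrum at every point, the same polynomial projects into
the l-eigenspace everywhere. This extends an eigenvector at one point to a smooth field of
eigenvectors. -/
theorem IsSelfDualModel.eigenField_eq {E : Matrix (Fin 4) (Fin 4) ℂ}
    {T : Module.End ℂ (Fin 3 → ℂ)} (h : IsSelfDualModel G s y E T) (hdet : (G y).det ≠ 0)
    {S : Finset ℂ} (hS : ∀ μ, T.eigenspace μ ≠ ⊥ → μ ∈ S) (l : ℂ)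
    {α : Matrix (Fin 4) (Fin 4) ℂ} (hα : αᵀ = -α) :
    ∃ c, eigenField G s S l α y = bivec E c ∧ T c = l • c := by
  rw [eigenField, half_add_hodgeStar hdet h.frame hα, aeval_intertwine h.comm]
  exact ⟨_, rfl, aeval_eigenPoly_mem hS h.spans l _⟩

theorem IsSelfDualModel.eigenField_apply {E : Matrix (Fin 4) (Fin 4) ℂ}
    {T : Module.End ℂ (Fin 3 → ℂ)} (h : IsSelfDualModel G s y E T) (hdet : (G y).det ≠ 0)
    (S : Finset ℂ) {l : ℂ} {c : Fin 3 → ℂ} (hc : T c = l • c) :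
    eigenField G s S l (bivec E c) y = bivec E ((eigenPoly S l).eval l • c) := by
  have h1 : complexOp (hodgeStar G s y) (bivec E c) = bivec E c := by
    rw [bivec_apply, complexOp_hodgeStar_frame hdet h.frame (quat_skew c), dualMat_quat]
  rw [eigenField, h1, ← two_smul ℂ, smul_smul, show (1 / 2 : ℂ) * 2 = 1 by norm_num, one_smul,
    aeval_intertwine h.comm, aeval_eigenPoly_apply S hc]

/-- Smoothness of a matrix-valued function. -/
def SmoothMat {m n : Type*} (F : R4 → Matrix m n ℂ) (W : Set R4) : Prop :=
  ∀ i j, ContDiffOn ℝ ∞ (fun y => F y i j) W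

theorem SmoothMat.mono {m n : Type*} {F : R4 → Matrix m n ℂ} {V W : Set R4} (h : SmoothMat F W)
    (hV : V ⊆ W) : SmoothMat F V := fun i j => (h i j).mono hV

theorem SmoothMat.add {m n : Type*} {F F' : R4 → Matrix m n ℂ} {W : Set R4} (h : SmoothMat F W)
    (h' : SmoothMat F' W) : SmoothMat (fun y => F y + F' y) W := fun i j => (h i j).add (h' i j)

theorem SmoothMat.sub {m n : Type*} {F F' : R4 → Matrix m n ℂ} {W : Set R4} (h : SmoothMat F W)
    (h' : SmoothMat F' W) : SmoothMat (fun y => F y - F' y) W := fun i j => (h i j).sub (h' i j)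

theorem SmoothMat.neg {m n : Type*} {F : R4 → Matrix m n ℂ} {W : Set R4} (h : SmoothMat F W) :
    SmoothMat (fun y => - F y) W := fun i j => (h i j).neg

theorem SmoothMat.smul {m n : Type*} {F : R4 → Matrix m n ℂ} {f : R4 → ℂ} {W : Set R4}
    (hf : ContDiffOn ℝ ∞ f W) (h : SmoothMat F W) : SmoothMat (fun y => f y • F y) W :=
  fun i j => hf.mul (h i j)

theorem SmoothMat.mul {l m n : Type*} [Fintype m] {F : R4 → Matrix l m ℂ} {F' : R4 → Matrix m n ℂ}
    {W : Set R4} (h : SmoothMat F W) (h' : SmoothMat F' W) : SmoothMat (fun y => F y * F' y) W := by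
  intro i j
  simp only [Matrix.mul_apply]
  exact ContDiffOn.sum fun k _ => (h i k).mul (h' k j)

theorem smoothMat_const {m n : Type*} (F : Matrix m n ℂ) (W : Set R4) :
    SmoothMat (fun _ => F) W := fun _ _ => contDiffOn_const

theorem SmoothMat.conj {m n : Type*} {F : R4 → Matrix m n ℂ} {W : Set R4} (h : SmoothMat F W) :
    SmoothMat (fun y => (F y).map (starRingEnd ℂ)) W := fun i j => contDiffOn_conj (h i j)

theorem smoothMat_cmat {F : R4 → Matrix (Fin 4) (Fin 4) ℝ} {W : Set R4}
    (h : ∀ i j, ContDiffOn ℝ ∞ (fun y => F y i j) W) : SmoothMat (fun y => cmat (F y)) W :=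
  fun i j => contDiffOn_ofReal (h i j)

theorem SmoothMat.complexOp {A : R4 → Comp4} {F : R4 → Matrix (Fin 4) (Fin 4) ℂ} {W : Set R4}
    (hA : ∀ i j k l, ContDiffOn ℝ ∞ (fun y => A y i j k l) W) (hF : SmoothMat F W) :
    SmoothMat (fun y => NeutralEinstein.complexOp (A y) (F y)) W := fun k l =>
  contDiffOn_const.mul (ContDiffOn.sum fun i _ => ContDiffOn.sum fun j _ =>
    (hF i j).mul (contDiffOn_ofReal (hA i j k l)))

theorem SmoothMat.aeval {A : R4 → Comp4} {F : R4 → Matrix (Fin 4) (Fin 4) ℂ} {W : Set R4}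
    (hA : ∀ i j k l, ContDiffOn ℝ ∞ (fun y => A y i j k l) W) (hF : SmoothMat F W) (P : ℂ[X]) :
    SmoothMat (fun y => Polynomial.aeval (NeutralEinstein.complexOp (A y)) P (F y)) W := by
  induction P using Polynomial.induction_on generalizing F with
  | C a =>
    simp only [Polynomial.aeval_C, Module.algebraMap_end_apply]
    exact SmoothMat.smul contDiffOn_const hF
  | add p q hp hq =>
    simp only [map_add, LinearMap.add_apply]
    exact (hp hF).add (hq hF)
  | monomial n a ih =>
    simp only [pow_succ, ← mul_assoc]
    simp only [map_mul (Polynomial.aeval _) _ X, Module.End.mul_apply, Polynomial.aeval_X]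
    exact ih (hF.complexOp hA)

theorem contDiffOn_hodgeStar (hG : IsSmoothMetric G U) (hs : ContDiffOn ℝ ∞ s U)
    (i j k l : Fin 4) : ContDiffOn ℝ ∞ (fun y => hodgeStar G s y i j k l) U := by
  refine contDiffOn_raise (T := fun y i j k l => s y * √|(G y).det| * leviCivita i j k l)
    hG.smooth hG.det_ne_zero (fun i j k l => (hs.mul ?_).mul contDiffOn_const) i j k l
  intro y hy
  have h1 : ContDiffWithinAt ℝ ∞ (fun y => (G y).det) U y := contDiffOn_det hG.smooth y hy
  have h0 := hG.det_ne_zero y hy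
  have h2 : ContDiffWithinAt ℝ ∞ (fun y => |(G y).det|) U y :=
    ContDiffAt.comp_contDiffWithinAt (g := fun t : ℝ => |t|) y (contDiffAt_abs h0) h1
  exact h2.sqrt (abs_pos.mpr h0).ne'

theorem smoothMat_eigenField (hG : IsSmoothMetric G U) (hs : ContDiffOn ℝ ∞ s U) (S : Finset ℂ)
    (l : ℂ) (α : Matrix (Fin 4) (Fin 4) ℂ) : SmoothMat (eigenField G s S l α) U := by
  refine SmoothMat.aeval (contDiffOn_curvatureOp U.isOpen hG.smooth hG.det_ne_zero) ?_ _
  exact SmoothMat.smul contDiffOn_const ((smoothMat_const α U).add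
    ((smoothMat_const α U).complexOp (contDiffOn_hodgeStar hG hs)))

theorem IsCurvatureChart.finite (h : IsCurvatureChart G s U S) (hy : y ∈ U) : S.Finite := by
  obtain ⟨E, T, hT, hS⟩ := h.exists_model hy
  obtain ⟨c, d, l1, l2, l3, -, -, -, -, -, -, hl⟩ := exists_orthonormal_eigenbasis hT.adjoint hT.spans
  refine (Set.toFinite {l1, l2, l3}).subset fun μ hμ => ?_
  exact (hl μ).mp ((hS μ).mpr hμ)

end EigenFields

/-! ### Frames adapted to a pair of orthogonal unit self-dual bivectors -/

section QuatFrame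

open Matrix

variable {R : Type*} [CommRing R]

/-- The columns of the frame `v, -J₁v, -J₂v, -J₃v` with `J₂ = α g`, `J₃ = β g`, `J₁ = -J₂J₃`. -/
def quatCol (g α β : Matrix (Fin 4) (Fin 4) R) (v : Matrix (Fin 4) (Fin 1) R) :
    Fin 4 → Matrix (Fin 4) (Fin 1) R :=
  ![v, α * g * (β * g * v), -(α * g * v), -(β * g * v)]

/-- The frame `v, -J₁v, -J₂v, -J₃v` with `J₂ = α g`, `J₃ = β g`, `J₁ = -J₂J₃`. -/
def quatFrame (g α β : Matrix (Fin 4) (Fin 4) R) (v : Matrix (Fin 4) (Fin 1) R) :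
    Matrix (Fin 4) (Fin 4) R := Matrix.of fun i j => quatCol g α β v j i 0

theorem mul_quat1_apply (M : Matrix (Fin 4) (Fin 4) R) (i : Fin 4) :
    (M * quat1 R) i 0 = - M i 1 ∧ (M * quat1 R) i 1 = M i 0 ∧ (M * quat1 R) i 2 = - M i 3 ∧
      (M * quat1 R) i 3 = M i 2 := by
  simp [Matrix.mul_apply, Fin.sum_univ_four, quat1]

theorem mul_quat2_apply (M : Matrix (Fin 4) (Fin 4) R) (i : Fin 4) :
    (M * quat2 R) i 0 = - M i 2 ∧ (M * quat2 R) i 1 = M i 3 ∧ (M * quat2 R) i 2 = M i 0 ∧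
      (M * quat2 R) i 3 = - M i 1 := by
  simp [Matrix.mul_apply, Fin.sum_univ_four, quat2]

theorem mul_quat3_apply (M : Matrix (Fin 4) (Fin 4) R) (i : Fin 4) :
    (M * quat3 R) i 0 = - M i 3 ∧ (M * quat3 R) i 1 = - M i 2 ∧ (M * quat3 R) i 2 = M i 1 ∧
      (M * quat3 R) i 3 = M i 0 := by
  simp [Matrix.mul_apply, Fin.sum_univ_four, quat3]

variable {g gi α β : Matrix (Fin 4) (Fin 4) R} {v : Matrix (Fin 4) (Fin 1) R}

/-- The hypotheses are J₂² = J₃² = −1 and J₃J₂ = −J₂J₃. The orbit of v under such a quaternionic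
structure is a frame in which the Jᵢ have the standard matrices. -/
theorem quatFrame_mul_quat (hgi : gi * g = 1) (h2 : α * g * α = -gi) (h3 : β * g * β = -gi)
    (h23 : β * g * α = -(α * g * β)) :
    quatFrame g α β v * quat1 R = -(α * g * β) * g * quatFrame g α β v ∧
    quatFrame g α β v * quat2 R = α * g * quatFrame g α β v ∧
    quatFrame g α β v * quat3 R = β * g * quatFrame g α β v := by
  have j2 : ∀ w : Matrix (Fin 4) (Fin 1) R, α * g * (α * g * w) = -w := fun w => by
    calc α * g * (α * g * w) = (α * g * α) * g * w := by simp only [Matrix.mul_assoc]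
      _ = _ := by rw [h2, neg_mul, hgi, Matrix.neg_mul, Matrix.one_mul]
  have j3 : ∀ w : Matrix (Fin 4) (Fin 1) R, β * g * (β * g * w) = -w := fun w => by
    calc β * g * (β * g * w) = (β * g * β) * g * w := by simp only [Matrix.mul_assoc]
      _ = _ := by rw [h3, neg_mul, hgi, Matrix.neg_mul, Matrix.one_mul]
  have j32 : ∀ w : Matrix (Fin 4) (Fin 1) R, β * g * (α * g * w) = -(α * g * (β * g * w)) :=
    fun w => by
    calc β * g * (α * g * w) = (β * g * α) * g * w := by simp only [Matrix.mul_assoc]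
      _ = _ := by rw [h23]; simp only [neg_mul, Matrix.neg_mul, Matrix.mul_assoc]
  have j1 : ∀ w : Matrix (Fin 4) (Fin 1) R, -(α * g * β) * g * w = -(α * g * (β * g * w)) :=
    fun w => by simp only [neg_mul, Matrix.neg_mul, Matrix.mul_assoc]
  have n := fun (M : Matrix (Fin 4) (Fin 4) R) (w : Matrix (Fin 4) (Fin 1) R) => Matrix.mul_neg M w
  refine ⟨?_, ?_, ?_⟩ <;> refine Matrix.ext fun i j => ?_
  · obtain ⟨m0, m1, m2, m3⟩ := mul_quat1_apply (quatFrame g α β v) i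
    have c0 : -(α * g * (β * g * v)) = -(α * g * β) * g * v := (j1 v).symm
    have c1 : v = -(α * g * β) * g * (α * g * (β * g * v)) := by
      rw [j1, j32, j3, n, n, n, j2, neg_neg, neg_neg]
    have c2 : -(-(β * g * v)) = -(α * g * β) * g * (-(α * g * v)) := by
      rw [j1, n, n, j32, n, j2]; simp only [neg_neg]
    have c3 : -(α * g * v) = -(α * g * β) * g * (-(β * g * v)) := by
      rw [j1, n, j3, neg_neg]
    fin_cases j
    exacts [m0.trans (congrFun (congrFun c0 i) 0), m1.trans (congrFun (congrFun c1 i) 0),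
      m2.trans (congrFun (congrFun c2 i) 0), m3.trans (congrFun (congrFun c3 i) 0)]
  · obtain ⟨m0, m1, m2, m3⟩ := mul_quat2_apply (quatFrame g α β v) i
    have c0 : -(-(α * g * v)) = α * g * v := neg_neg _
    have c1 : -(β * g * v) = α * g * (α * g * (β * g * v)) := by rw [j2]
    have c2 : v = α * g * (-(α * g * v)) := by rw [n, j2, neg_neg]
    have c3 : -(α * g * (β * g * v)) = α * g * (-(β * g * v)) := by rw [n]
    fin_cases j
    exacts [m0.trans (congrFun (congrFun c0 i) 0), m1.trans (congrFun (congrFun c1 i) 0),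
      m2.trans (congrFun (congrFun c2 i) 0), m3.trans (congrFun (congrFun c3 i) 0)]
  · obtain ⟨m0, m1, m2, m3⟩ := mul_quat3_apply (quatFrame g α β v) i
    have c0 : -(-(β * g * v)) = β * g * v := neg_neg _
    have c1 : -(-(α * g * v)) = β * g * (α * g * (β * g * v)) := by
      rw [j32, j3, n]
    have c2 : α * g * (β * g * v) = β * g * (-(α * g * v)) := by rw [n, j32, neg_neg]
    have c3 : v = β * g * (-(β * g * v)) := by rw [n, j3, neg_neg]
    fin_cases j
    exacts [m0.trans (congrFun (congrFun c0 i) 0), m1.trans (congrFun (congrFun c1 i) 0),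
      m2.trans (congrFun (congrFun c2 i) 0), m3.trans (congrFun (congrFun c3 i) 0)]

theorem quat_row : quat1 R 0 0 = 0 ∧ quat1 R 0 1 = 1 ∧ quat1 R 0 2 = 0 ∧ quat1 R 0 3 = 0 ∧
    quat2 R 0 0 = 0 ∧ quat2 R 0 1 = 0 ∧ quat2 R 0 2 = 1 ∧ quat2 R 0 3 = 0 ∧
    quat3 R 0 0 = 0 ∧ quat3 R 0 1 = 0 ∧ quat3 R 0 2 = 0 ∧ quat3 R 0 3 = 1 := by
  simp [quat1, quat2, quat3]

/-- The Jᵢ are skew for g, so the Gram matrix of the frame commutes with the three standard units,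
and g(v, Jᵢv) = 0. Its first row is therefore (1,0,0,0), and commutation determines the other rows.
-/
theorem quatFrame_ortho [Algebra ℂ R] (hg : gᵀ = g) (hgi : gi * g = 1) (hα : αᵀ = -α)
    (hβ : βᵀ = -β)
    (h2 : α * g * α = -gi) (h3 : β * g * β = -gi) (h23 : β * g * α = -(α * g * β))
    (hv : vᵀ * g * v = 1) :
    (quatFrame g α β v)ᵀ * g * quatFrame g α β v = 1 := by
  obtain ⟨q1, q2, q3⟩ := quatFrame_mul_quat (v := v) hgi h2 h3 h23
  set F := quatFrame g α β v with hF
  have hγ : (-(α * g * β))ᵀ = α * g * β := by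
    rw [transpose_neg, transpose_mul, transpose_mul, hα, hβ, hg]
    simp only [neg_mul, mul_neg, neg_neg]
    rw [← mul_assoc, h23, neg_neg]
  have tr1 : ∀ P Q : Matrix (Fin 4) (Fin 4) R, Pᵀ = -P → Qᵀ = -Q → F * Q = P * g * F →
      Q * (Fᵀ * g * F) = (Fᵀ * g * F) * Q := by
    intro P Q hP hQ h
    have h' := congrArg transpose h
    rw [transpose_mul, transpose_mul, transpose_mul, hP, hQ, hg] at h'
    have h'' : Q * Fᵀ = Fᵀ * g * P := by
      have := congrArg Neg.neg h'
      rw [neg_mul, neg_neg] at this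
      rw [this]; noncomm_ring
    calc Q * (Fᵀ * g * F) = (Q * Fᵀ) * g * F := by noncomm_ring
      _ = Fᵀ * g * (P * g * F) := by rw [h'']; noncomm_ring
      _ = _ := by rw [← h]; noncomm_ring
  have hq : ∀ Q : Matrix (Fin 4) (Fin 4) R, (∀ i j, Q i j = - Q j i) → Qᵀ = -Q := by
    intro Q h; ext i j; exact h j i
  have c1 := tr1 _ _ (by rw [hγ, neg_neg]) (hq _ quat1_skew) q1
  have c2 := tr1 _ _ hα (hq _ quat2_skew) q2
  have c3 := tr1 _ _ hβ (hq _ quat3_skew) q3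
  have hz : ∀ P : Matrix (Fin 4) (Fin 4) R, Pᵀ = -P → (vᵀ * P * v) 0 0 = 0 := by
    intro P hP
    have h1 : (vᵀ * P * v)ᵀ = -(vᵀ * P * v) := by
      rw [transpose_mul, transpose_mul, transpose_transpose, hP]
      simp only [Matrix.neg_mul, Matrix.mul_neg, Matrix.mul_assoc]
    have h2 := congrFun (congrFun h1 0) 0
    have h2 : (vᵀ * P * v) 0 0 = -((vᵀ * P * v) 0 0) := h2
    exact cancel_two (by linear_combination h2)
  have col : ∀ j, (Fᵀ * g * F) 0 j = (vᵀ * g * quatCol g α β v j) 0 0 := fun j => rfl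
  have d0 : (Fᵀ * g * F) 0 0 = 1 := by
    rw [col]; change (vᵀ * g * v) 0 0 = 1; rw [hv]; rfl
  have d1 : (Fᵀ * g * F) 0 1 = 0 := by
    rw [col]
    have := hz (g * (α * g * β) * g) (by
      have : (α * g * β)ᵀ = -(α * g * β) := by rw [← neg_eq_iff_eq_neg, ← transpose_neg, hγ]
      rw [transpose_mul, transpose_mul, this, hg]; noncomm_ring)
    rw [← this]
    simp [quatCol, Matrix.mul_assoc]
  have d2 : (Fᵀ * g * F) 0 2 = 0 := by
    rw [col]
    have := hz (g * α * g) (by rw [transpose_mul, transpose_mul, hα, hg]; noncomm_ring)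
    refine Eq.trans ?_ (neg_eq_zero.mpr this)
    change (vᵀ * g * -(α * g * v)) 0 0 = -((vᵀ * (g * α * g) * v) 0 0)
    rw [Matrix.mul_neg]
    simp only [Matrix.mul_assoc]
    rfl
  have d3 : (Fᵀ * g * F) 0 3 = 0 := by
    rw [col]
    have := hz (g * β * g) (by rw [transpose_mul, transpose_mul, hβ, hg]; noncomm_ring)
    refine Eq.trans ?_ (neg_eq_zero.mpr this)
    change (vᵀ * g * -(β * g * v)) 0 0 = -((vᵀ * (g * β * g) * v) 0 0)
    rw [Matrix.mul_neg]
    simp only [Matrix.mul_assoc]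
    rfl
  generalize Fᵀ * g * F = H at c1 c2 c3 d0 d1 d2 d3
  have e1 : ∀ j, H 1 j = quat1 R 0 j := fun j => by
    have := congrFun (congrFun c1 0) j
    rw [Matrix.mul_apply, Matrix.mul_apply, Fin.sum_univ_four, Fin.sum_univ_four, d0, d1, d2,
      d3] at this
    simpa [quat_row] using this
  have e2 : ∀ j, H 2 j = quat2 R 0 j := fun j => by
    have := congrFun (congrFun c2 0) j
    rw [Matrix.mul_apply, Matrix.mul_apply, Fin.sum_univ_four, Fin.sum_univ_four, d0, d1, d2,
      d3] at this
    simpa [quat_row] using this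
  have e3 : ∀ j, H 3 j = quat3 R 0 j := fun j => by
    have := congrFun (congrFun c3 0) j
    rw [Matrix.mul_apply, Matrix.mul_apply, Fin.sum_univ_four, Fin.sum_univ_four, d0, d1, d2,
      d3] at this
    simpa [quat_row] using this
  ext i j
  fin_cases i
  · fin_cases j <;> simp [d0, d1, d2, d3]
  · exact (e1 j).trans (by fin_cases j <;> simp [quat1])
  · exact (e2 j).trans (by fin_cases j <;> simp [quat2])
  · exact (e3 j).trans (by fin_cases j <;> simp [quat3])

/-- With J = Pg and FQ = PgF, orthonormality of F gives FQFᵀ = P gFFᵀ = P. The prescribed bivectors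
are thus recovered as the self-dual bivectors of the frame. -/
theorem quatFrame_bivectors [Algebra ℂ R] (hg : gᵀ = g) (hgi : gi * g = 1) (hα : αᵀ = -α)
    (hβ : βᵀ = -β)
    (h2 : α * g * α = -gi) (h3 : β * g * β = -gi) (h23 : β * g * α = -(α * g * β))
    (hv : vᵀ * g * v = 1) :
    quatFrame g α β v * quat1 R * (quatFrame g α β v)ᵀ = -(α * g * β) ∧
    quatFrame g α β v * quat2 R * (quatFrame g α β v)ᵀ = α ∧
    quatFrame g α β v * quat3 R * (quatFrame g α β v)ᵀ = β := by
  have ho := quatFrame_ortho hg hgi hα hβ h2 h3 h23 hv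
  obtain ⟨q1, q2, q3⟩ := quatFrame_mul_quat (v := v) hgi h2 h3 h23
  set F := quatFrame g α β v
  have h' : g * F * Fᵀ = 1 := by
    have h4 : F * (Fᵀ * g) = 1 := mul_eq_one_comm.mp ho
    have h5 := congrArg transpose h4
    rwa [transpose_mul, transpose_mul, transpose_transpose, transpose_one, hg] at h5
  have aux : ∀ P : Matrix (Fin 4) (Fin 4) R, P * g * F * Fᵀ = P := fun P => by
    calc P * g * F * Fᵀ = P * (g * F * Fᵀ) := by noncomm_ring
      _ = P := by rw [h', mul_one]
  exact ⟨by rw [q1, aux], by rw [q2, aux], by rw [q3, aux]⟩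

end QuatFrame

/-! ### Smooth orthonormal pairs of eigenbivectors and the frames they define. -/

section EigenPairs

open Matrix

variable {G : R4 → Matrix (Fin 4) (Fin 4) ℝ} {s : R4 → ℝ} {y : R4}

/-- The self-dual bivectors `α`, `β` at a point are orthogonal units, and the members of the
resulting oriented orthogonal frame `-α g β, α, β` are eigenvectors of the curvature operator. -/
def IsEigenPair (G : R4 → Matrix (Fin 4) (Fin 4) ℝ) (s : R4 → ℝ) (y : R4) (l1 l2 l3 : ℂ)
    (α β : Matrix (Fin 4) (Fin 4) ℂ) : Prop :=
  ∃ E T, ∃ c d : Fin 3 → ℂ, IsSelfDualModel G s y E T ∧ α = bivec E c ∧ β = bivec E d ∧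
    c ⬝ᵥ c = 1 ∧ d ⬝ᵥ d = 1 ∧ c ⬝ᵥ d = 0 ∧ T (crossProduct c d) = l1 • crossProduct c d ∧
    T c = l2 • c ∧ T d = l3 • d

/-- An oriented orthonormal frame whose self-dual bivectors are eigenvectors of the curvature
operator. -/
structure IsEigenFrame (G : R4 → Matrix (Fin 4) (Fin 4) ℝ) (s : R4 → ℝ) (y : R4) (l1 l2 l3 : ℂ)
    (F : Matrix (Fin 4) (Fin 4) ℂ) : Prop where
  frame : IsOrientedFrame (G y) (s y) F
  eigen1 : complexOp (curvatureOp G y) (F * quat1 ℂ * Fᵀ) = l1 • (F * quat1 ℂ * Fᵀ)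
  eigen2 : complexOp (curvatureOp G y) (F * quat2 ℂ * Fᵀ) = l2 • (F * quat2 ℂ * Fᵀ)
  eigen3 : complexOp (curvatureOp G y) (F * quat3 ℂ * Fᵀ) = l3 • (F * quat3 ℂ * Fᵀ)

/-- A unit vector v and the pair α, β determine the whole frame, so smooth frames reduce to smooth
eigenbivectors and a smooth unit vector. -/
theorem IsEigenPair.isEigenFrame {l1 l2 l3 : ℂ} {α β : Matrix (Fin 4) (Fin 4) ℂ}
    (h : IsEigenPair G s y l1 l2 l3 α β) (hdet : (G y).det ≠ 0) (hs : (G y)ᵀ = G y)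
    {v : Matrix (Fin 4) (Fin 1) ℂ} (hv : vᵀ * cmat (G y) * v = 1) :
    IsEigenFrame G s y l1 l2 l3 (quatFrame (cmat (G y)) α β v) := by
  obtain ⟨E, T, c, d, hM, rfl, rfl, hc, hd, hcd, h1, h2, h3⟩ := h
  have hg := cmat_transpose_eq hs
  have hgi : (E * Eᵀ) * cmat (G y) = 1 := by rw [mul_assoc]; exact mul_eq_one_comm.mp hM.frame.ortho
  have m := bivec_mul hM.frame.ortho
  have m2 : bivec E c * cmat (G y) * bivec E c = -(E * Eᵀ) := by rw [m, hc]; simp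
  have m3 : bivec E d * cmat (G y) * bivec E d = -(E * Eᵀ) := by rw [m, hd]; simp
  have m1 : bivec E c * cmat (G y) * bivec E d = - bivec E (crossProduct c d) := by
    rw [m, hcd]; simp
  have m4 : bivec E d * cmat (G y) * bivec E c = -(bivec E c * cmat (G y) * bivec E d) := by
    rw [m1, m, dotProduct_comm, hcd, ← cross_anticomm c d, map_neg, neg_zero, zero_smul, zero_sub]
  have ho := quatFrame_ortho hg hgi (bivec_transpose c) (bivec_transpose d) m2 m3 m4 hv
  obtain ⟨b1, b2, b3⟩ := quatFrame_bivectors hg hgi (bivec_transpose c) (bivec_transpose d) m2 m3 m4 hv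
  rw [m1, neg_neg] at b1
  set F := quatFrame (cmat (G y)) (bivec E c) (bivec E d) v
  refine ⟨⟨ho, ?_⟩, ?_, ?_, ?_⟩
  -- The frame has the right orientation because α, one of its bivectors, is self-dual and nonzero:
  -- the scalar by which the star acts on it must be 1.
  · have e := complexOp_hodgeStar (s := s) hdet ho (quat2_skew (R := ℂ))
    rw [dualMat_quat2, b2] at e
    have e' : complexOp (hodgeStar G s y) (bivec E c) = bivec E c := by
      rw [bivec_apply, complexOp_hodgeStar_frame hdet hM.frame (quat_skew c), dualMat_quat]
    rw [e', ← map_smul] at e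
    have e2 := bivec_injective hM.frame.ortho hg e
    have e3 : c ⬝ᵥ c = c ⬝ᵥ (((s y * √|(G y).det| : ℝ) : ℂ) * F.det) • c :=
      congrArg (fun x => c ⬝ᵥ x) e2
    rw [dotProduct_smul, hc, smul_eq_mul, mul_one] at e3
    exact e3.symm
  · rw [b1, hM.comm, h1, map_smul]
  · rw [b2, hM.comm, h2, map_smul]
  · rw [b3, hM.comm, h3, map_smul]

/-- The inner product of two bivectors, up to a factor. -/
def pairing (g α β : Matrix (Fin 4) (Fin 4) ℂ) : ℂ := -(1 / 4) * (α * g * β * g).trace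

theorem pairing_bivec {g E : Matrix (Fin 4) (Fin 4) ℂ} (hE : Eᵀ * g * E = 1) (c d : Fin 3 → ℂ) :
    pairing g (bivec E c) (bivec E d) = c ⬝ᵥ d := by
  have h2 : E * Eᵀ * g = 1 := by rw [mul_assoc]; exact mul_eq_one_comm.mp hE
  have h3 : (bivec E (crossProduct c d) * g).trace = 0 := by
    rw [bivec_apply, mul_assoc, Matrix.trace_mul_comm, ← mul_assoc, hE, one_mul, quat_trace]
  rw [pairing, bivec_mul hE, sub_mul, Matrix.smul_mul, h2, Matrix.trace_sub, h3, Matrix.trace_smul]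
  simp
  ring

theorem contDiffOn_trace {n : Type*} [Fintype n] {F : R4 → Matrix n n ℂ} {W : Set R4}
    (hF : SmoothMat F W) : ContDiffOn ℝ ∞ (fun y => (F y).trace) W :=
  ContDiffOn.sum fun i _ => hF i i

theorem contDiffOn_pairing {g α β : R4 → Matrix (Fin 4) (Fin 4) ℂ} {W : Set R4}
    (hg : SmoothMat g W) (hα : SmoothMat α W) (hβ : SmoothMat β W) :
    ContDiffOn ℝ ∞ (fun y => pairing (g y) (α y) (β y)) W :=
  contDiffOn_const.mul (contDiffOn_trace (((hα.mul hg).mul hβ).mul hg))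

open TopologicalSpace (Opens)

/-- A smooth square root of a nonvanishing function near a point. -/
theorem exists_smooth_sqrt {U : Opens R4} {f : R4 → ℂ} (hf : ContDiffOn ℝ ∞ f U) {y0 : R4}
    (hy : y0 ∈ U) (h0 : f y0 ≠ 0) : ∃ W : Opens R4, W ≤ U ∧ y0 ∈ W ∧ ∃ r : R4 → ℂ,
      ContDiffOn ℝ ∞ r W ∧ ∀ y ∈ W, r y ^ 2 = f y ∧ r y ≠ 0 := by
  obtain ⟨z, hz⟩ := IsAlgClosed.exists_pow_nat_eq (f y0) two_pos
  -- Dividing by f(y₀) brings the values near 1, away from the branch cut of the logarithm.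
  have hcont : ContinuousOn (fun y => f y / f y0) U := (hf.continuousOn).div_const _
  have hopen := hcont.isOpen_inter_preimage U.isOpen Complex.isOpen_slitPlane
  refine ⟨⟨_, hopen⟩, fun y hy => hy.1, ⟨hy, ?_⟩,
    fun y => z * Complex.exp ((1 / 2) * Complex.log (f y / f y0)), ?_, ?_⟩
  · change f y0 / f y0 ∈ Complex.slitPlane
    rw [div_self h0]; exact Complex.one_mem_slitPlane
  · have h1 : ContDiffOn ℝ ∞ (fun y => f y / f y0) (U ∩ (fun y => f y / f y0) ⁻¹' Complex.slitPlane) :=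
      (hf.mono Set.inter_subset_left).div_const _
    exact contDiffOn_const.mul (contDiffOn_const.mul
      (fun y hy => ((Complex.contDiffAt_log (show f y / f y0 ∈ Complex.slitPlane from
        hy.2)).restrict_scalars ℝ).comp_contDiffWithinAt y (h1 y hy))).cexp
  · rintro y ⟨-, hy2⟩
    have hne : f y / f y0 ≠ 0 := Complex.slitPlane_ne_zero hy2
    have h3 : (z * Complex.exp ((1 / 2) * Complex.log (f y / f y0))) ^ 2 = f y := by
      rw [mul_pow, hz, ← Complex.exp_nat_mul]
      rw [show ((2 : ℕ) : ℂ) * (1 / 2 * Complex.log (f y / f y0)) = Complex.log (f y / f y0) by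
        push_cast; ring, Complex.exp_log hne]
      field_simp
    refine ⟨h3, fun h => ?_⟩
    simp only at h
    rw [h] at h3
    apply hne
    rw [← h3]; simp

variable {U : Opens R4} {S : Set ℂ}

/-- An orthonormal eigenbasis at y₀ is spread out by the eigenprojections and normalized with smooth
square roots. The eigenvalues may coincide, so orthogonality and the eigenvalue of the third vector
need separate arguments. -/
theorem IsCurvatureChart.exists_eigenPair (h : IsCurvatureChart G s U S) {y0 : R4} (hy0 : y0 ∈ U) :
    ∃ l1 l2 l3 : ℂ, S = {l1, l2, l3} ∧ ∃ W : Opens R4, W ≤ U ∧ y0 ∈ W ∧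
      ∃ α β : R4 → Matrix (Fin 4) (Fin 4) ℂ, SmoothMat α W ∧ SmoothMat β W ∧
        ∀ y ∈ W, IsEigenPair G s y l1 l2 l3 (α y) (β y) := by
  obtain ⟨E0, T0, hM0, hS0⟩ := h.exists_model hy0
  obtain ⟨c, d, l2, l3, l1, hc, hd, hcd, h2, h3, h1, hl⟩ :=
    exists_orthonormal_eigenbasis hM0.adjoint hM0.spans
  have hS : S = {l1, l2, l3} := by
    ext μ; rw [← hS0, hl]
    simp only [Set.mem_insert_iff, Set.mem_singleton_iff]; tauto
  have hfin := h.finite hy0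
  set Sf := hfin.toFinset
  have hmem : ∀ {y}, y ∈ U → ∃ E T, IsSelfDualModel G s y E T ∧
      ∀ μ, T.eigenspace μ ≠ ⊥ → μ ∈ Sf := fun hy => by
    obtain ⟨E, T, hM, hS⟩ := h.exists_model hy
    exact ⟨E, T, hM, fun μ hμ => hfin.mem_toFinset.mpr ((hS μ).mp hμ)⟩
  have hdet := h.metric.det_ne_zero
  have hsym := h.metric.symm
  set b1 := eigenField G s Sf l1 (bivec E0 (crossProduct c d)) with hb1
  set b2 := eigenField G s Sf l2 (bivec E0 c) with hb2
  set b3 := eigenField G s Sf l3 (bivec E0 d) with hb3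
  have e1 : b1 y0 = _ := hM0.eigenField_apply (hdet y0 hy0) Sf h1
  have e2 : b2 y0 = _ := hM0.eigenField_apply (hdet y0 hy0) Sf h2
  have e3 : b3 y0 = _ := hM0.eigenField_apply (hdet y0 hy0) Sf h3
  have p1 := eigenPoly_eval_self Sf l1
  have p2 := eigenPoly_eval_self Sf l2
  have p3 := eigenPoly_eval_self Sf l3
  generalize (eigenPoly Sf l1).eval l1 = P1 at *
  generalize (eigenPoly Sf l2).eval l2 = P2 at *
  generalize (eigenPoly Sf l3).eval l3 = P3 at *
  have sg : SmoothMat (fun y => cmat (G y)) U := smoothMat_cmat h.metric.smooth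
  have s1 : SmoothMat b1 U := smoothMat_eigenField h.metric h.sign_smooth _ _ _
  have s2 : SmoothMat b2 U := smoothMat_eigenField h.metric h.sign_smooth _ _ _
  have s3 : SmoothMat b3 U := smoothMat_eigenField h.metric h.sign_smooth _ _ _
  have o0 := hM0.frame.ortho
  obtain ⟨W1, hW1, hy1, r, hr, hr2⟩ := exists_smooth_sqrt (contDiffOn_pairing sg s2 s2) hy0
    (by rw [e2, pairing_bivec o0]; simp [hc, p2])
  set α : R4 → Matrix (Fin 4) (Fin 4) ℂ := fun y => (r y)⁻¹ • b2 y with hα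
  have sα : SmoothMat α W1 := SmoothMat.smul (hr.inv fun y hy => (hr2 y hy).2) (s2.mono hW1)
  have eα : α y0 = bivec E0 (((r y0)⁻¹ * P2) • c) := by
    rw [hα]; simp only; rw [e2, ← map_smul, smul_smul]
  -- A Gram–Schmidt step, effective only when l₂ = l₃; otherwise the correction term is zero.
  set b : R4 → Matrix (Fin 4) (Fin 4) ℂ := fun y => b3 y - pairing (cmat (G y)) (α y) (b3 y) • α y
    with hb
  have sb : SmoothMat b W1 := (s3.mono hW1).sub
    (SmoothMat.smul (contDiffOn_pairing (sg.mono hW1) sα (s3.mono hW1)) sα)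
  have eb : b y0 = bivec E0 (P3 • d) := by
    rw [hb]; simp only; rw [e3, eα, pairing_bivec o0]; simp [hcd]
  obtain ⟨W2, hW2, hy2, q, hq, hq2⟩ := exists_smooth_sqrt
    (contDiffOn_pairing (sg.mono hW1) sb sb) hy1
    (by rw [eb, pairing_bivec o0]; simp [hd, p3])
  set β : R4 → Matrix (Fin 4) (Fin 4) ℂ := fun y => (q y)⁻¹ • b y with hβ
  have sα' : SmoothMat α W2 := sα.mono hW2
  have sβ : SmoothMat β W2 := SmoothMat.smul (hq.inv fun y hy => (hq2 y hy).2) (sb.mono hW2)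
  have eβ : β y0 = bivec E0 (((q y0)⁻¹ * P3) • d) := by
    rw [hβ]; simp only; rw [eb, ← map_smul, smul_smul]
  have sg2 : SmoothMat (fun y => cmat (G y)) W2 := sg.mono (hW2.trans hW1)
  -- The third vector c × d is an eigenvector in any case. As long as its pairing with the projected
  -- field `b1` is nonzero, an open condition, its eigenvalue is l₁.
  have sf : ContDiffOn ℝ ∞ (fun y => pairing (cmat (G y)) (α y * cmat (G y) * β y) (b1 y)) W2 :=
    contDiffOn_pairing sg2 ((sα'.mul sg2).mul sβ) (s1.mono (hW2.trans hW1))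
  have hopen := sf.continuousOn.isOpen_inter_preimage W2.isOpen
    (isOpen_compl_singleton (x := (0 : ℂ)))
  refine ⟨l1, l2, l3, hS, ⟨_, hopen⟩, fun y hy => hW1 (hW2 hy.1), ⟨hy2, ?_⟩, α, β,
    sα'.mono Set.inter_subset_left, sβ.mono Set.inter_subset_left, ?_⟩
  · have hu : crossProduct c d ⬝ᵥ crossProduct c d = 1 := by
      rw [cross_dot_cross, hc, hd, hcd]; ring
    change pairing _ _ _ ≠ 0
    rw [eα, eβ, bivec_mul o0, e1, dotProduct_smul, smul_dotProduct, hcd]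
    simp only [smul_zero, neg_zero, zero_smul, zero_sub]
    rw [← map_neg, pairing_bivec o0]
    simp [hu, (hr2 y0 hy1).2, (hq2 y0 hy2).2, p1, p2, p3]
  · rintro y ⟨hyW, hf⟩
    have hy1' : y ∈ W1 := hW2 hyW
    have hyU : y ∈ U := hW1 hy1'
    obtain ⟨E, T, hM, hTS⟩ := hmem hyU
    have o := hM.frame.ortho
    obtain ⟨x1, hx1, t1⟩ := hM.eigenField_eq (hdet y hyU) hTS l1
      (bivec_transpose (E := E0) (crossProduct c d))
    obtain ⟨x2, hx2, t2⟩ := hM.eigenField_eq (hdet y hyU) hTS l2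
      (bivec_transpose (E := E0) c)
    obtain ⟨x3, hx3, t3⟩ := hM.eigenField_eq (hdet y hyU) hTS l3
      (bivec_transpose (E := E0) d)
    obtain ⟨ra, rb⟩ := hr2 y hy1'
    obtain ⟨qa, qb⟩ := hq2 y hyW
    have hx1 : b1 y = bivec E x1 := hx1
    have hx2 : b2 y = bivec E x2 := hx2
    have hx3 : b3 y = bivec E x3 := hx3
    have aα : α y = bivec E ((r y)⁻¹ • x2) := by rw [map_smul, ← hx2]
    set x := (r y)⁻¹ • x2
    have ab : b y = bivec E (x3 - (x ⬝ᵥ x3) • x) := by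
      rw [hb]; simp only; rw [hx3, aα, pairing_bivec o, ← map_smul, ← map_sub]
    have aβ : β y = bivec E ((q y)⁻¹ • (x3 - (x ⬝ᵥ x3) • x)) := by rw [map_smul, ← ab]
    have hxx : x ⬝ᵥ x = 1 := by
      rw [hx2, pairing_bivec o] at ra
      simp only [x, smul_dotProduct, dotProduct_smul, ← ra, smul_eq_mul]; field_simp
    have tx : T x = l2 • x := by simp only [x]; rw [map_smul, t2, smul_comm]
    have ty : T (x3 - (x ⬝ᵥ x3) • x) = l3 • (x3 - (x ⬝ᵥ x3) • x) := by
      by_cases hll : l2 = l3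
      · rw [map_sub, map_smul, t3, tx, hll, smul_sub, smul_comm]
      · rw [dotProduct_eq_zero_of_eigen hM.adjoint tx t3 hll]; simp [t3]
    have hxy : x ⬝ᵥ (x3 - (x ⬝ᵥ x3) • x) = 0 := by
      rw [dotProduct_sub, dotProduct_smul, hxx]; simp
    rw [ab, pairing_bivec o] at qa
    generalize x3 - (x ⬝ᵥ x3) • x = z at *
    have hzz : ((q y)⁻¹ • z) ⬝ᵥ ((q y)⁻¹ • z) = 1 := by
      simp only [smul_dotProduct, dotProduct_smul, ← qa, smul_eq_mul]; field_simp
    have tz : T ((q y)⁻¹ • z) = l3 • ((q y)⁻¹ • z) := by rw [map_smul, ty, smul_comm]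
    have hxz : x ⬝ᵥ ((q y)⁻¹ • z) = 0 := by rw [dotProduct_smul, hxy, smul_zero]
    generalize (q y)⁻¹ • z = w at *
    refine ⟨E, T, x, w, hM, aα, aβ, hxx, hzz, hxz, ?_, tx, tz⟩
    refine cross_eigenvalue hM.adjoint hxx hzz hxz tx tz t1 ?_
    intro h0
    apply hf
    change pairing _ _ _ = 0
    rw [aα, aβ, bivec_mul o, hx1, hxz]
    simp only [neg_zero, zero_smul, zero_sub]
    rw [← map_neg, pairing_bivec o, neg_dotProduct, h0, neg_zero]

/-- The entrywise complex conjugate. -/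
def conjMat {m n : Type*} (F : Matrix m n ℂ) : Matrix m n ℂ := F.map (starRingEnd ℂ)

theorem conjMat_mul {l m n : Type*} [Fintype m] (F : Matrix l m ℂ) (F' : Matrix m n ℂ) :
    conjMat (F * F') = conjMat F * conjMat F' := Matrix.map_mul

theorem conjMat_cmat (F : Matrix (Fin 4) (Fin 4) ℝ) : conjMat (cmat F) = cmat F := by
  ext i j; exact Complex.conj_ofReal _

theorem complexOp_conjMat (A : Comp4) (α : Matrix (Fin 4) (Fin 4) ℂ) :
    complexOp A (conjMat α) = conjMat (complexOp A α) := by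
  ext k l
  change (1 / 2 : ℂ) * ∑ i, ∑ j, starRingEnd ℂ (α i j) * (A i j k l : ℂ) =
    starRingEnd ℂ ((1 / 2 : ℂ) * ∑ i, ∑ j, α i j * (A i j k l : ℂ))
  have h2 : starRingEnd ℂ (1 / 2 : ℂ) = 1 / 2 := by
    rw [map_div₀, map_one, map_ofNat]
  simp only [map_mul, map_sum, h2, Complex.conj_ofReal]

theorem pairing_conjMat (g α β : Matrix (Fin 4) (Fin 4) ℂ) (hg : conjMat g = g) :
    pairing g (conjMat α) (conjMat β) = starRingEnd ℂ (pairing g α β) := by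
  have : conjMat α * g * conjMat β * g = conjMat (α * g * β * g) := by
    rw [conjMat_mul, conjMat_mul, conjMat_mul, hg]
  rw [pairing, pairing, this, map_mul]
  congr 1
  · rw [map_neg, map_div₀, map_one, map_ofNat]
  · simp only [Matrix.trace, map_sum]; rfl

/-- The curvature operator and the star are real, so the conjugate of a unit eigenbivector for l is
one for the conjugate of l. It is orthogonal to the first because l is not real, and the third
direction carries the remaining eigenvalue. -/
theorem IsCurvatureChart.exists_conj_eigenPair (h : IsCurvatureChart G s U S) {y0 : R4}
    (hy0 : y0 ∈ U) {l μ : ℂ} (hlS : l ∈ S) (hμS : μ ∈ S) (hl : starRingEnd ℂ l ≠ l) (hμ : μ ≠ l)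
    (hμ' : μ ≠ starRingEnd ℂ l) : ∃ W : Opens R4, W ≤ U ∧ y0 ∈ W ∧
      ∃ α : R4 → Matrix (Fin 4) (Fin 4) ℂ, SmoothMat α W ∧
        ∀ y ∈ W, IsEigenPair G s y μ l (starRingEnd ℂ l) (α y) (conjMat (α y)) := by
  obtain ⟨E0, T0, hM0, hS0⟩ := h.exists_model hy0
  obtain ⟨c, hc, hcl⟩ : ∃ c : Fin 3 → ℂ, c ⬝ᵥ c = 1 ∧ T0 c = l • c := by
    obtain ⟨c, d, l1, l2, l3, hc, hd, hcd, h1, h2, h3, hl⟩ :=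
      exists_orthonormal_eigenbasis hM0.adjoint hM0.spans
    rcases (hl l).mp ((hS0 l).mpr hlS) with rfl | rfl | rfl
    · exact ⟨c, hc, h1⟩
    · exact ⟨d, hd, h2⟩
    · exact ⟨_, by rw [cross_dot_cross, hc, hd, hcd]; ring, h3⟩
  have hfin := h.finite hy0
  set Sf := hfin.toFinset
  have hdet := h.metric.det_ne_zero
  have hsym := h.metric.symm
  set b := eigenField G s Sf l (bivec E0 c) with hb
  have e : b y0 = _ := hM0.eigenField_apply (hdet y0 hy0) Sf hcl
  have p := eigenPoly_eval_self Sf l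
  generalize (eigenPoly Sf l).eval l = P at *
  have sg : SmoothMat (fun y => cmat (G y)) U := smoothMat_cmat h.metric.smooth
  have sb : SmoothMat b U := smoothMat_eigenField h.metric h.sign_smooth _ _ _
  have o0 := hM0.frame.ortho
  obtain ⟨W, hW, hyW, r, hr, hr2⟩ := exists_smooth_sqrt (contDiffOn_pairing sg sb sb) hy0
    (by rw [e, pairing_bivec o0]; simp [hc, p])
  refine ⟨W, hW, hyW, fun y => (r y)⁻¹ • b y,
    SmoothMat.smul (hr.inv fun y hy => (hr2 y hy).2) (sb.mono hW), fun y hy => ?_⟩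
  have hyU : y ∈ U := hW hy
  obtain ⟨E, T, hM, hTS⟩ := h.exists_model hyU
  have o := hM.frame.ortho
  obtain ⟨x, hx, t⟩ := hM.eigenField_eq (hdet y hyU)
    (fun μ hμ => hfin.mem_toFinset.mpr ((hTS μ).mp hμ)) l (bivec_transpose (E := E0) c)
  have hx : b y = bivec E x := hx
  obtain ⟨ra, rb⟩ := hr2 y hy
  rw [hx, pairing_bivec o] at ra
  have hxx : ((r y)⁻¹ • x) ⬝ᵥ ((r y)⁻¹ • x) = 1 := by
    simp only [smul_dotProduct, dotProduct_smul, ← ra, smul_eq_mul]; field_simp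
  have tx : T ((r y)⁻¹ • x) = l • ((r y)⁻¹ • x) := by rw [map_smul, t, smul_comm]
  simp only
  rw [hx, ← map_smul]
  generalize (r y)⁻¹ • x = z at *
  have hzm := (mem_complexSelfDual_iff (hdet y hyU) hM.frame (bivec E z)).mpr ⟨z, rfl⟩
  obtain ⟨w, hw⟩ := (mem_complexSelfDual_iff (hdet y hyU) hM.frame
    (conjMat (bivec E z))).mp ⟨by
      have := congrArg conjMat hzm.1
      ext i j
      have h' := congrFun (congrFun this i) j
      simpa [conjMat] using h', by rw [complexOp_conjMat, hzm.2]⟩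
  have hinj := bivec_injective o (cmat_transpose_eq (hsym y hyU))
  have tw : T w = starRingEnd ℂ l • w := by
    apply hinj
    rw [← hM.comm, hw, complexOp_conjMat, hM.comm, tx, map_smul, map_smul, hw]
    ext i j; simp [conjMat]
  have hww : w ⬝ᵥ w = 1 := by
    rw [← pairing_bivec o, hw, pairing_conjMat _ _ _ (conjMat_cmat _), pairing_bivec o, hxx, map_one]
  have hzw : z ⬝ᵥ w = 0 := dotProduct_eq_zero_of_eigen hM.adjoint tx tw hl.symm
  refine ⟨E, T, z, w, hM, rfl, hw.symm, hxx, hww, hzw, ?_, tx, tw⟩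
  obtain ⟨v, hv, hv0⟩ := Submodule.exists_mem_ne_zero_of_ne_bot ((hTS μ).mpr hμS)
  have hv' : T v = μ • v := Module.End.mem_eigenspace_iff.mp hv
  refine cross_eigenvalue hM.adjoint hxx hww hzw tx tw hv' fun h0 => hv0 ?_
  rw [expansion_of_orthonormal hxx hww hzw v, h0,
    dotProduct_eq_zero_of_eigen hM.adjoint tx hv' hμ.symm,
    dotProduct_eq_zero_of_eigen hM.adjoint tw hv' hμ'.symm]
  simp

/-- A real vector field of unit length near a point. -/
theorem IsCurvatureChart.exists_unit_vector (h : IsCurvatureChart G s U S) {y0 : R4}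
    (hy0 : y0 ∈ U) : ∃ W : Opens R4, W ≤ U ∧ y0 ∈ W ∧ ∃ v : R4 → Matrix (Fin 4) (Fin 1) ℂ,
      SmoothMat v W ∧ ∀ y ∈ W, conjMat (v y) = v y ∧ (v y)ᵀ * cmat (G y) * v y = 1 := by
  obtain ⟨B, hB⟩ := h.neutral y0 hy0
  -- The last column of B has square length 1 at y₀. Kept constant, it stays positive nearby and can
  -- be normalized.
  set f : R4 → ℝ := fun y => ∑ i, ∑ j, B i 3 * G y i j * B j 3 with hf
  have hfs : ContDiffOn ℝ ∞ f U := ContDiffOn.sum fun i _ => ContDiffOn.sum fun j _ =>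
    (contDiffOn_const.mul (h.metric.smooth i j)).mul contDiffOn_const
  have hf0 : f y0 = 1 := by
    have := congrFun (congrFun hB 3) 3
    simp only [Matrix.mul_apply, transpose_apply, Finset.sum_mul] at this
    rw [Finset.sum_comm] at this
    simpa using this
  have hopen := hfs.continuousOn.isOpen_inter_preimage U.isOpen (isOpen_Ioi (a := (0 : ℝ)))
  refine ⟨⟨_, hopen⟩, fun y hy => hy.1, ⟨hy0, by change 0 < f y0; rw [hf0]; norm_num⟩,
    fun y => Matrix.of fun i _ => (((√(f y))⁻¹ * B i 3 : ℝ) : ℂ), fun i _ => ?_, ?_⟩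
  · refine contDiffOn_ofReal (f := fun y => (√(f y))⁻¹ * B i 3) (ContDiffOn.mul ?_ contDiffOn_const)
    refine ContDiffOn.inv ((hfs.mono Set.inter_subset_left).sqrt fun y hy => ?_) fun y hy => ?_
    · exact (show 0 < f y from hy.2).ne'
    · exact (Real.sqrt_pos.mpr hy.2).ne'
  · rintro y ⟨-, hy⟩
    refine ⟨by ext i j; exact Complex.conj_ofReal _, ?_⟩
    have hy : 0 < f y := hy
    have hs : (√(f y))⁻¹ * (√(f y))⁻¹ * f y = 1 := by
      rw [← mul_inv, Real.mul_self_sqrt hy.le, inv_mul_cancel₀ hy.ne']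
    ext i j
    rw [Subsingleton.elim i 0, Subsingleton.elim j 0, one_apply_eq]
    simp only [Matrix.mul_apply, transpose_apply, of_apply, cmat_apply, Finset.sum_mul]
    rw [Finset.sum_comm]
    have : ∑ i, ∑ j, (√(f y))⁻¹ * B i 3 * G y i j * ((√(f y))⁻¹ * B j 3) = 1 := by
      rw [← hs, hf]
      simp only [Finset.mul_sum]
      refine Finset.sum_congr rfl fun i _ => Finset.sum_congr rfl fun j _ => by ring
    exact_mod_cast this

theorem SmoothMat.quatFrame {g α β : R4 → Matrix (Fin 4) (Fin 4) ℂ}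
    {v : R4 → Matrix (Fin 4) (Fin 1) ℂ} {W : Set R4} (hg : SmoothMat g W) (hα : SmoothMat α W)
    (hβ : SmoothMat β W) (hv : SmoothMat v W) :
    SmoothMat (fun y => NeutralEinstein.quatFrame (g y) (α y) (β y) (v y)) W := by
  intro i j
  fin_cases j
  · exact hv i 0
  · exact ((hα.mul hg).mul ((hβ.mul hg).mul hv)) i 0
  · exact ((hα.mul hg).mul hv).neg i 0
  · exact ((hβ.mul hg).mul hv).neg i 0

theorem exists_ball_le {W : Opens R4} {y0 : R4} (hy : y0 ∈ W) :
    ∃ V : Opens R4, V ≤ W ∧ y0 ∈ V ∧ Convex ℝ (V : Set R4) := by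
  obtain ⟨ε, hε, hb⟩ := Metric.isOpen_iff.mp W.isOpen y0 hy
  exact ⟨⟨Metric.ball y0 ε, Metric.isOpen_ball⟩, hb, Metric.mem_ball_self hε, convex_ball _ _⟩

/-- Smooth frames whose self-dual bivectors are eigenvectors of the curvature operator. -/
theorem IsCurvatureChart.exists_eigenFrame (h : IsCurvatureChart G s U S) {y0 : R4}
    (hy0 : y0 ∈ U) : ∃ l1 l2 l3 : ℂ, S = {l1, l2, l3} ∧ ∃ W : Opens R4, W ≤ U ∧ y0 ∈ W ∧
      Convex ℝ (W : Set R4) ∧ ∃ F : R4 → Matrix (Fin 4) (Fin 4) ℂ, SmoothMat F W ∧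
        ∀ y ∈ W, IsEigenFrame G s y l1 l2 l3 (F y) := by
  obtain ⟨l1, l2, l3, hS, W1, hW1, hy1, α, β, hα, hβ, hp⟩ := h.exists_eigenPair hy0
  obtain ⟨W2, hW2, hy2, v, hv, hv1⟩ := h.exists_unit_vector hy0
  obtain ⟨W, hW, hy, hc⟩ := exists_ball_le (W := W1 ⊓ W2) ⟨hy1, hy2⟩
  have k1 : W ≤ W1 := hW.trans inf_le_left
  have k2 : W ≤ W2 := hW.trans inf_le_right
  exact ⟨l1, l2, l3, hS, W, k1.trans hW1, hy, hc, _,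
    SmoothMat.quatFrame ((smoothMat_cmat h.metric.smooth).mono (k1.trans hW1)) (hα.mono k1)
      (hβ.mono k1) (hv.mono k2),
    fun y hy => (hp y (k1 hy)).isEigenFrame (h.metric.det_ne_zero y (hW1 (k1 hy)))
      (h.metric.symm y (hW1 (k1 hy))) (hv1 y (k2 hy)).2⟩

/-- The effect of complex conjugation on a frame adapted to a real eigenvalue and a pair of
conjugate eigenvalues. -/
structure IsConjFrame (F : Matrix (Fin 4) (Fin 4) ℂ) : Prop where
  conj0 : ∀ i, starRingEnd ℂ (F i 0) = F i 0
  conj1 : ∀ i, starRingEnd ℂ (F i 1) = - F i 1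
  conj2 : ∀ i, starRingEnd ℂ (F i 2) = F i 3
  conj3 : ∀ i, starRingEnd ℂ (F i 3) = F i 2

/-- For real v, conjugation interchanges J₂v and J₃v and turns J₂J₃v into J₃J₂v = −J₂J₃v. -/
theorem IsEigenPair.isConjFrame {l1 l2 l3 : ℂ} {α : Matrix (Fin 4) (Fin 4) ℂ}
    (h : IsEigenPair G s y l1 l2 l3 α (conjMat α)) {v : Matrix (Fin 4) (Fin 1) ℂ}
    (hv : conjMat v = v) : IsConjFrame (quatFrame (cmat (G y)) α (conjMat α) v) := by
  have hcc : conjMat (conjMat α) = α := by ext i j; simp [conjMat]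
  have hneg : ∀ w : Matrix (Fin 4) (Fin 1) ℂ, conjMat (-w) = - conjMat w := by
    intro w; ext i j; simp [conjMat]
  have h23 : conjMat α * cmat (G y) * α = -(α * cmat (G y) * conjMat α) := by
    obtain ⟨E, T, c, d, hM, e1, e2, hc, hd, hcd, -, -, -⟩ := h
    rw [e2, e1, bivec_mul hM.frame.ortho, bivec_mul hM.frame.ortho, dotProduct_comm, hcd,
      ← cross_anticomm c d, map_neg, neg_zero, zero_smul, zero_sub, zero_sub]
  have key : ∀ j i, starRingEnd ℂ (quatFrame (cmat (G y)) α (conjMat α) v i j) =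
      conjMat (quatCol (cmat (G y)) α (conjMat α) v j) i 0 := fun j i => rfl
  refine ⟨fun i => ?_, fun i => ?_, fun i => ?_, fun i => ?_⟩ <;> rw [key]
  · change conjMat v i 0 = _; rw [hv]; rfl
  · change conjMat (α * cmat (G y) * (conjMat α * cmat (G y) * v)) i 0 =
      - (α * cmat (G y) * (conjMat α * cmat (G y) * v)) i 0
    rw [← Matrix.neg_apply]
    refine congrFun (congrFun ?_ i) 0
    simp only [conjMat_mul, conjMat_cmat, hcc, hv]
    calc conjMat α * cmat (G y) * (α * cmat (G y) * v) =
        (conjMat α * cmat (G y) * α) * cmat (G y) * v := by simp only [Matrix.mul_assoc]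
      _ = _ := by rw [h23]; simp only [Matrix.neg_mul, Matrix.mul_assoc]
  · change conjMat (-(α * cmat (G y) * v)) i 0 = (-(conjMat α * cmat (G y) * v)) i 0
    rw [hneg]; simp only [conjMat_mul, conjMat_cmat, hv]
  · change conjMat (-(conjMat α * cmat (G y) * v)) i 0 = (-(α * cmat (G y) * v)) i 0
    rw [hneg]; simp only [conjMat_mul, conjMat_cmat, hv, hcc]

theorem IsCurvatureChart.exists_conjFrame (h : IsCurvatureChart G s U S) {y0 : R4}
    (hy0 : y0 ∈ U) {l μ : ℂ} (hlS : l ∈ S) (hμS : μ ∈ S) (hl : starRingEnd ℂ l ≠ l) (hμ : μ ≠ l)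
    (hμ' : μ ≠ starRingEnd ℂ l) : ∃ W : Opens R4, W ≤ U ∧ y0 ∈ W ∧
      Convex ℝ (W : Set R4) ∧ ∃ F : R4 → Matrix (Fin 4) (Fin 4) ℂ, SmoothMat F W ∧
        ∀ y ∈ W, IsEigenFrame G s y μ l (starRingEnd ℂ l) (F y) ∧ IsConjFrame (F y) := by
  obtain ⟨W1, hW1, hy1, α, hα, hp⟩ := h.exists_conj_eigenPair hy0 hlS hμS hl hμ hμ'
  obtain ⟨W2, hW2, hy2, v, hv, hv1⟩ := h.exists_unit_vector hy0
  obtain ⟨W, hW, hy, hc⟩ := exists_ball_le (W := W1 ⊓ W2) ⟨hy1, hy2⟩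
  have k1 : W ≤ W1 := hW.trans inf_le_left
  have k2 : W ≤ W2 := hW.trans inf_le_right
  exact ⟨W, k1.trans hW1, hy, hc, _,
    SmoothMat.quatFrame ((smoothMat_cmat h.metric.smooth).mono (k1.trans hW1)) (hα.mono k1)
      (hα.mono k1).conj (hv.mono k2),
    fun y hy => ⟨(hp y (k1 hy)).isEigenFrame (h.metric.det_ne_zero y (hW1 (k1 hy)))
      (h.metric.symm y (hW1 (k1 hy))) (hv1 y (k2 hy)).2,
      (hp y (k1 hy)).isConjFrame (hv1 y (k2 hy)).1⟩⟩

end EigenPairs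

/-! ### Frames over the ring of smooth functions -/

section RingFrames

open Matrix
open TopologicalSpace (Opens)

variable {U : Opens R4}

/-- Evaluation at a point. -/
def evalAt (y : U) : smoothRing U →ₐ[ℂ] ℂ := (Pi.evalAlgHom ℂ (fun _ : U => ℂ) y).comp (smoothRing U).val

theorem evalAt_apply (y : U) (f : smoothRing U) : evalAt y f = f.1 y := rfl

/-- The value of a matrix of functions at a point. -/
def evalMat (y : U) : Matrix (Fin 4) (Fin 4) (smoothRing U) →+* Matrix (Fin 4) (Fin 4) ℂ :=
  (evalAt y).toRingHom.mapMatrix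

theorem evalMat_apply (y : U) (M : Matrix (Fin 4) (Fin 4) (smoothRing U)) (i j : Fin 4) :
    evalMat y M i j = (M i j).1 y := rfl

theorem evalMat_transpose (y : U) (M : Matrix (Fin 4) (Fin 4) (smoothRing U)) :
    evalMat y Mᵀ = (evalMat y M)ᵀ := rfl

theorem ext_evalMat {M N : Matrix (Fin 4) (Fin 4) (smoothRing U)}
    (h : ∀ y, evalMat y M = evalMat y N) : M = N := by
  ext i j y
  exact congrFun (congrFun (h y) i) j

theorem evalMat_quat1 (y : U) : evalMat y (quat1 _) = quat1 ℂ := by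
  ext i j; rw [evalMat_apply, ← evalAt_apply]; fin_cases i <;> fin_cases j <;> simp [quat1]

theorem evalMat_quat2 (y : U) : evalMat y (quat2 _) = quat2 ℂ := by
  ext i j; rw [evalMat_apply, ← evalAt_apply]; fin_cases i <;> fin_cases j <;> simp [quat2]

theorem evalMat_quat3 (y : U) : evalMat y (quat3 _) = quat3 ℂ := by
  ext i j; rw [evalMat_apply, ← evalAt_apply]; fin_cases i <;> fin_cases j <;> simp [quat3]

/-- A smooth matrix-valued function, as a matrix of elements of the ring. -/
def ringMat (F : R4 → Matrix (Fin 4) (Fin 4) ℂ) (hF : SmoothMat F U) :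
    Matrix (Fin 4) (Fin 4) (smoothRing U) := Matrix.of fun i j => mkSmooth _ (hF i j)

variable {G : R4 → Matrix (Fin 4) (Fin 4) ℝ} {s : R4 → ℝ}

theorem IsSmoothMetric.mono {V : Opens R4} (hG : IsSmoothMetric G U) (hV : V ≤ U) :
    IsSmoothMetric G V :=
  ⟨fun i j => (hG.smooth i j).mono hV, fun y hy => hG.symm y (hV hy),
    fun y hy => hG.det_ne_zero y (hV hy)⟩

theorem IsSmoothMetric.evalMat_metric (hG : IsSmoothMetric G U) (y : U) :
    evalMat y hG.metric = cmat (G y) := rfl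

theorem isCurvatureEigen_of_pointwise (hG : IsSmoothMetric G U)
    {E Q : Matrix (Fin 4) (Fin 4) (smoothRing U)} {l : ℂ}
    (h : ∀ y : U, complexOp (curvatureOp G y) (evalMat y E * evalMat y Q * (evalMat y E)ᵀ) =
      l • (evalMat y E * evalMat y Q * (evalMat y E)ᵀ)) :
    IsCurvatureEigen partialDeriv hG.metric hG.chr E Q l := by
  intro a b
  ext y
  have h1 := contract_eq_of_complexOp (T := lowered G y) (hG.det_ne_zero y y.2) (hG.symm y y.2) (h y)
  have h2 := congrFun (congrFun h1 a) b
  have e1 : (algebraMap ℂ (smoothRing U) (1 / 2) * ∑ i, ∑ j, (E * Q * Eᵀ) i j *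
      (hG.metric * curvMat partialDeriv hG.chr j i) b a).1 y =
      contract (lowered G y) (evalMat y E * evalMat y Q * (evalMat y E)ᵀ) a b := by
    rw [contract, of_apply, ← evalAt_apply, map_mul, map_sum, AlgHom.commutes]
    congr 1
    refine Finset.sum_congr rfl fun i _ => ?_
    rw [map_sum]
    refine Finset.sum_congr rfl fun j _ => ?_
    rw [map_mul, evalAt_apply, evalAt_apply, hG.mul_curvMat_apply, ← evalMat_apply, map_mul,
      map_mul, evalMat_transpose]
    rfl
  rw [e1, h2]
  have e2 : (algebraMap ℂ (smoothRing U) l * ((Eᵀ * hG.metric)ᵀ * Q * (Eᵀ * hG.metric)) a b).1 y =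
      l * evalMat y ((Eᵀ * hG.metric)ᵀ * Q * (Eᵀ * hG.metric)) a b := rfl
  rw [e2, map_mul, map_mul, evalMat_transpose, map_mul, evalMat_transpose, hG.evalMat_metric,
    transpose_mul, transpose_transpose, cmat_transpose_eq (hG.symm y y.2), Matrix.mul_smul,
    Matrix.smul_mul, Matrix.smul_apply, smul_eq_mul]
  congr 2
  simp only [Matrix.mul_assoc]

/-- A frame over the ring of smooth functions whose values are oriented orthonormal frames
consisting of eigenvectors. -/
def IsRingEigenFrame (G : R4 → Matrix (Fin 4) (Fin 4) ℝ) (s : R4 → ℝ) (l1 l2 l3 : ℂ)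
    (E : Matrix (Fin 4) (Fin 4) (smoothRing U)) : Prop :=
  ∀ y : U, IsEigenFrame G s y l1 l2 l3 (evalMat y E)

namespace IsRingEigenFrame

variable {l1 l2 l3 : ℂ} {E : Matrix (Fin 4) (Fin 4) (smoothRing U)}
  (hG : IsSmoothMetric G U) (hE : IsRingEigenFrame G s l1 l2 l3 E)

include hE in
theorem ortho : Eᵀ * hG.metric * E = 1 := by
  refine ext_evalMat fun y => ?_
  rw [map_mul, map_mul, map_one, evalMat_transpose, hG.evalMat_metric]
  exact (hE y).frame.ortho

include hE in
theorem structure_eqs :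
    SelfDualStructure partialDeriv ((Eᵀ * hG.metric) 0) ((Eᵀ * hG.metric) 1) ((Eᵀ * hG.metric) 2)
      ((Eᵀ * hG.metric) 3) (sdPart1 (connMat partialDeriv hG.chr E (Eᵀ * hG.metric)))
      (sdPart2 (connMat partialDeriv hG.chr E (Eᵀ * hG.metric)))
      (sdPart3 (connMat partialDeriv hG.chr E (Eᵀ * hG.metric))) (-l1) (-l2) (-l3) := by
  refine selfDualStructure_of_eigen (D := partialDeriv) (g := hG.metric) (Γ := hG.chr) (E := E)
    partialDeriv_comm hG.dmat_metric hG.chr_comm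
    hG.metric_transpose (hE.ortho hG) ?_ ?_ ?_ <;> refine isCurvatureEigen_of_pointwise hG fun y => ?_
  · rw [evalMat_quat1]; exact (hE y).eigen1
  · rw [evalMat_quat2]; exact (hE y).eigen2
  · rw [evalMat_quat3]; exact (hE y).eigen3

end IsRingEigenFrame

end RingFrames

/-! ### The covariant derivative of the self-dual curvature operator -/

section CovariantDerivative

open Matrix
open TopologicalSpace (Opens)

/-- The anti-self-dual part of θ commutes with the quaternion units, and the self-dual part acts on
them as an element of so(3). -/
theorem commutator_quat {A : Type*} [CommRing A] {θ : Fin 4 → Matrix (Fin 4) (Fin 4) A}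
    (hs : ∀ m a b, θ m a b = - θ m b a) (h0 : ∀ m a, θ m a a = 0) (m : Fin 4) :
    θ m * quat1 A - quat1 A * θ m = sdPart3 θ m • quat2 A - sdPart2 θ m • quat3 A ∧
    θ m * quat2 A - quat2 A * θ m = sdPart1 θ m • quat3 A - sdPart3 θ m • quat1 A ∧
    θ m * quat3 A - quat3 A * θ m = sdPart2 θ m • quat1 A - sdPart1 θ m • quat2 A := by
  refine ⟨?_, ?_, ?_⟩ <;>
  · ext i j
    simp only [Matrix.sub_apply, Matrix.mul_apply, Fin.sum_univ_four, Matrix.smul_apply,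
      smul_eq_mul, sdPart1, sdPart2, sdPart3]
    fin_cases i <;> fin_cases j <;> simp [quat1, quat2, quat3, h0, hs m 1 0, hs m 2 0, hs m 3 0,
      hs m 2 1, hs m 3 2, hs m 3 1] <;> try ring

section Ring

variable {A : Type*} [CommRing A] [Algebra ℂ A] {D : Fin 4 → Derivation ℂ A A}
variable {g : Matrix (Fin 4) (Fin 4) A}
variable {Γ : Fin 4 → Matrix (Fin 4) (Fin 4) A} {E : Matrix (Fin 4) (Fin 4) A}

/-- For a constant Q, the covariant derivative of the tensor with frame components Q has the frame
components [θ, Q]. The two parts are its form and bivector versions. -/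
theorem dmat_const {Q : Matrix (Fin 4) (Fin 4) A} (m : Fin 4) (hQ : dmat D m Q = 0)
    (hc : ∀ m, dmat D m g = (Γ m).transpose * g + g * Γ m) (hg : gᵀ = g)
    (hE : Eᵀ * g * E = 1) :
    dmat D m ((Eᵀ * g)ᵀ * Q * (Eᵀ * g)) = (Γ m)ᵀ * ((Eᵀ * g)ᵀ * Q * (Eᵀ * g)) +
        ((Eᵀ * g)ᵀ * Q * (Eᵀ * g)) * Γ m + (Eᵀ * g)ᵀ * (connMat D Γ E (Eᵀ * g) m * Q -
          Q * connMat D Γ E (Eᵀ * g) m) * (Eᵀ * g) ∧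
    dmat D m (E * Q * Eᵀ) = E * (connMat D Γ E (Eᵀ * g) m * Q -
          Q * connMat D Γ E (Eᵀ * g) m) * Eᵀ - Γ m * (E * Q * Eᵀ) - (E * Q * Eᵀ) * (Γ m)ᵀ := by
  have h1 := dmat_frame (D := D) (Γ := Γ) hE m
  have h2 := dmat_coframe (D := D) (Γ := Γ) hE m
  have h3 := connMat_skew hc hg hE m
  set θ := connMat D Γ E (Eᵀ * g) m
  constructor
  · rw [dmat_mul, dmat_mul, dmat_transpose, h2, hQ, transpose_sub, transpose_mul _ (Γ m),
      transpose_mul θ, h3]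
    noncomm_ring
  · rw [dmat_mul, dmat_mul, dmat_transpose, h1, hQ, transpose_sub, transpose_mul _ E,
      transpose_mul _ θ, h3]
    noncomm_ring

end Ring

theorem dmat_quat {A : Type*} [CommRing A] [Algebra ℂ A] (D : Fin 4 → Derivation ℂ A A)
    (m : Fin 4) : dmat D m (quat1 A) = 0 ∧ dmat D m (quat2 A) = 0 ∧ dmat D m (quat3 A) = 0 := by
  refine ⟨?_, ?_, ?_⟩ <;> ext i j <;> rw [dmat, Matrix.map_apply] <;>
    fin_cases i <;> fin_cases j <;> simp [quat1, quat2, quat3]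

variable {G : R4 → Matrix (Fin 4) (Fin 4) ℝ} {s : R4 → ℝ} {y : R4}

theorem raise_skew {G : Matrix (Fin 4) (Fin 4) ℝ} {T : Comp4}
    (hT : ∀ i j a b, T i j a b = - T j i a b) (i j k l : Fin 4) :
    raise G T i j k l = - raise G T j i k l := by
  simp only [raise, hT i j, neg_mul, Finset.sum_neg_distrib]

theorem curvatureOp_skew (i j k l : Fin 4) : curvatureOp G y i j k l = - curvatureOp G y j i k l :=
  raise_skew (T := lowered G y) lowered_skew i j k l

theorem hodgeStar_skew (i j k l : Fin 4) : hodgeStar G s y i j k l = - hodgeStar G s y j i k l := by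
  refine raise_skew (T := fun i j k l => s y * √|(G y).det| * leviCivita i j k l)
    (fun i j a b => ?_) i j k l
  rw [leviCivita_eq, leviCivita_eq]
  simp only [vol4, wedge22, wedge11]
  ring

theorem selfDualCurvatureOp_skew (i j k l : Fin 4) :
    selfDualCurvatureOp G s y i j k l = - selfDualCurvatureOp G s y j i k l := by
  simp only [selfDualCurvatureOp, curvatureOp_skew i j k l, hodgeStar_skew i j, neg_mul,
    Finset.sum_neg_distrib]
  ring

theorem complexOp_selfDualCurvatureOp (α : Matrix (Fin 4) (Fin 4) ℂ) :
    complexOp (selfDualCurvatureOp G s y) α =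
      complexOp (curvatureOp G y) ((1 / 2 : ℂ) • (α + complexOp (hodgeStar G s y) α)) := by
  ext k l
  rw [map_smul, map_add, Matrix.smul_apply, Matrix.add_apply]
  change (1 / 2 : ℂ) * ∑ i, ∑ j, α i j * (selfDualCurvatureOp G s y i j k l : ℂ) =
    (1 / 2 : ℂ) * ((1 / 2 : ℂ) * ∑ i, ∑ j, α i j * (curvatureOp G y i j k l : ℂ) +
      (1 / 2 : ℂ) * ∑ a, ∑ b, ((1 / 2 : ℂ) * ∑ i, ∑ j, α i j * (hodgeStar G s y i j a b : ℂ)) *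
        (curvatureOp G y a b k l : ℂ))
  have h1 : ∑ a, ∑ b, ((1 / 2 : ℂ) * ∑ i, ∑ j, α i j * (hodgeStar G s y i j a b : ℂ)) *
        (curvatureOp G y a b k l : ℂ) = ∑ i, ∑ j, α i j * ((1 / 2 : ℂ) * ∑ a, ∑ b,
          (hodgeStar G s y i j a b : ℂ) * (curvatureOp G y a b k l : ℂ)) := by
    simp only [Finset.mul_sum, Finset.sum_mul]
    have := sum_four_comm fun a b i j => (1 / 2 : ℂ) * (α i j * (hodgeStar G s y i j a b : ℂ)) *
        (curvatureOp G y a b k l : ℂ)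
    rw [this, Finset.sum_comm]
    refine Finset.sum_congr rfl fun i _ => Finset.sum_congr rfl fun j _ =>
      Finset.sum_congr rfl fun a _ => Finset.sum_congr rfl fun b _ => by ring
  rw [h1, ← mul_add, ← Finset.sum_add_distrib]
  congr 1
  rw [Finset.mul_sum]
  refine Finset.sum_congr rfl fun i _ => ?_
  rw [← Finset.sum_add_distrib, Finset.mul_sum]
  refine Finset.sum_congr rfl fun j _ => ?_
  simp only [selfDualCurvatureOp]
  push_cast
  ring

/-- The spectral decomposition R⁺ = ½ Σ lᵢ ωᵢ ⊗ ωᵢ in an eigenframe, where the factor ½ comes from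
the projection (α + *α)/2. -/
theorem IsEigenFrame.selfDualCurvatureOp_eq {l1 l2 l3 : ℂ} {F : Matrix (Fin 4) (Fin 4) ℂ}
    (h : IsEigenFrame G s y l1 l2 l3 F) (hdet : (G y).det ≠ 0)
    (i j k l : Fin 4) : (selfDualCurvatureOp G s y i j k l : ℂ) = (1 / 2 : ℂ) *
      (l1 * ((Fᵀ * cmat (G y))ᵀ * quat1 ℂ * (Fᵀ * cmat (G y))) i j * (F * quat1 ℂ * Fᵀ) k l +
       l2 * ((Fᵀ * cmat (G y))ᵀ * quat2 ℂ * (Fᵀ * cmat (G y))) i j * (F * quat2 ℂ * Fᵀ) k l +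
       l3 * ((Fᵀ * cmat (G y))ᵀ * quat3 ℂ * (Fᵀ * cmat (G y))) i j * (F * quat3 ℂ * Fᵀ) k l) := by
  -- The value of an operator on the elementary bivector ∂ᵢ∧∂ⱼ is its (i, j) row of components.
  set α : Matrix (Fin 4) (Fin 4) ℂ := Matrix.single i j 1 - Matrix.single j i 1 with hα
  have hsk : αᵀ = -α := by
    rw [hα, transpose_sub, transpose_single, transpose_single, neg_sub]
  have h1 : complexOp (selfDualCurvatureOp G s y) α k l =
      (selfDualCurvatureOp G s y i j k l : ℂ) := by
    change (1 / 2 : ℂ) * ∑ a, ∑ b, α a b * (selfDualCurvatureOp G s y a b k l : ℂ) = _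
    have : ∑ a, ∑ b, α a b * (selfDualCurvatureOp G s y a b k l : ℂ) =
        (selfDualCurvatureOp G s y i j k l : ℂ) - (selfDualCurvatureOp G s y j i k l : ℂ) := by
      simp only [hα, Matrix.sub_apply, Matrix.single_apply, sub_mul, Finset.sum_sub_distrib, ite_mul,
        one_mul, zero_mul, ite_and, Finset.sum_ite_irrel, Finset.sum_const_zero, Finset.sum_ite_eq,
        Finset.mem_univ, if_true]
    rw [this, selfDualCurvatureOp_skew j i]
    push_cast; ring
  have h3 : ∀ c : Fin 3 → ℂ, complexOp (curvatureOp G y) (bivec F c) = (c 0 * l1) •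
      (F * quat1 ℂ * Fᵀ) + (c 1 * l2) • (F * quat2 ℂ * Fᵀ) + (c 2 * l3) • (F * quat3 ℂ * Fᵀ) := by
    intro c
    have : bivec F c = c 0 • (F * quat1 ℂ * Fᵀ) + c 1 • (F * quat2 ℂ * Fᵀ) +
        c 2 • (F * quat3 ℂ * Fᵀ) := by
      rw [bivec_apply, quat_eq]
      simp only [mul_add, add_mul, Matrix.mul_smul, Matrix.smul_mul]
    rw [this, map_add, map_add, map_smul, map_smul, map_smul, h.eigen1, h.eigen2, h.eigen3,
      smul_smul, smul_smul, smul_smul]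
  have h4 : ∀ a b, ((Fᵀ * cmat (G y)) * α * (Fᵀ * cmat (G y))ᵀ) a b =
      wedge11 ((Fᵀ * cmat (G y)) a) ((Fᵀ * cmat (G y)) b) i j := by
    intro a b
    rw [hα, mul_sub, sub_mul, Matrix.sub_apply]
    simp only [Matrix.mul_apply, Matrix.single_apply, Finset.sum_mul, transpose_apply, mul_ite,
      mul_one, mul_zero, ite_and, Finset.sum_ite_eq, Finset.mem_univ, if_true, ite_mul, zero_mul,
      wedge11]
  rw [← h1, complexOp_selfDualCurvatureOp, half_add_hodgeStar hdet h.frame hsk, h3]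
  simp only [sdCoeff, h4, Matrix.add_apply, Matrix.smul_apply, smul_eq_mul, Pi.smul_apply,
    transpose_mul_quat1_mul, transpose_mul_quat2_mul, transpose_mul_quat3_mul, sdForm,
    Matrix.cons_val]
  ring

theorem contDiffOn_selfDualCurvatureOp {U : Opens R4} (hG : IsSmoothMetric G U)
    (hs : ContDiffOn ℝ ∞ s U) (i j k l : Fin 4) :
    ContDiffOn ℝ ∞ (fun y => selfDualCurvatureOp G s y i j k l) U := by
  have h1 := contDiffOn_curvatureOp U.isOpen hG.smooth hG.det_ne_zero
  have h2 := contDiffOn_hodgeStar hG hs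
  unfold selfDualCurvatureOp
  exact contDiffOn_const.mul ((h1 i j k l).add (contDiffOn_const.mul
    (ContDiffOn.sum fun a _ => ContDiffOn.sum fun b _ => (h2 i j a b).mul (h1 a b k l))))

/-- The combination of products of the self-dual 2-forms and bivectors of a frame. -/
def sdTensor {A : Type*} [CommRing A] [Algebra ℂ A] (g E : Matrix (Fin 4) (Fin 4) A)
    (l1 l2 l3 : ℂ) (i j k l : Fin 4) : A :=
  algebraMap ℂ A (1 / 2) *
    (algebraMap ℂ A l1 * ((Eᵀ * g)ᵀ * quat1 A * (Eᵀ * g)) i j * (E * quat1 A * Eᵀ) k l +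
      algebraMap ℂ A l2 * ((Eᵀ * g)ᵀ * quat2 A * (Eᵀ * g)) i j * (E * quat2 A * Eᵀ) k l +
      algebraMap ℂ A l3 * ((Eᵀ * g)ᵀ * quat3 A * (Eᵀ * g)) i j * (E * quat3 A * Eᵀ) k l)

/-- The components of the self-dual part of the connection between eigenvectors for different
eigenvalues vanish. -/
def SdPartsVanish {A : Type*} [CommRing A] [Algebra ℂ A] (D : Fin 4 → Derivation ℂ A A)
    (g : Matrix (Fin 4) (Fin 4) A) (Γ : Fin 4 → Matrix (Fin 4) (Fin 4) A)
    (E : Matrix (Fin 4) (Fin 4) A) (l1 l2 l3 : ℂ) : Prop :=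
  (∀ m, algebraMap ℂ A (l2 - l3) * sdPart1 (connMat D Γ E (Eᵀ * g)) m = 0) ∧
  (∀ m, algebraMap ℂ A (l3 - l1) * sdPart2 (connMat D Γ E (Eᵀ * g)) m = 0) ∧
  (∀ m, algebraMap ℂ A (l1 - l2) * sdPart3 (connMat D Γ E (Eᵀ * g)) m = 0)

/-- From ∇ω₁ = ξ₃ω₂ − ξ₂ω₃ and its cyclic versions, ∇ Σ lᵢ ωᵢ⊗ωᵢ is a combination of ωᵢ⊗ωⱼ + ωⱼ⊗ωᵢ
whose coefficients are the products (l₁−l₂)ξ₃ etc., assumed to vanish. -/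
theorem covariant_sdTensor_eq_zero {A : Type*} [CommRing A] [Algebra ℂ A]
    {D : Fin 4 → Derivation ℂ A A} {g : Matrix (Fin 4) (Fin 4) A}
    {Γ : Fin 4 → Matrix (Fin 4) (Fin 4) A} {E : Matrix (Fin 4) (Fin 4) A}
    (hc : ∀ m, dmat D m g = (Γ m).transpose * g + g * Γ m) (hg : gᵀ = g) (ho : Eᵀ * g * E = 1)
    {l1 l2 l3 : ℂ} (h : SdPartsVanish D g Γ E l1 l2 l3) (m i j k l : Fin 4) :
    D m (sdTensor g E l1 l2 l3 i j k l) + ∑ a, (- Γ m a i * sdTensor g E l1 l2 l3 a j k l -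
      Γ m a j * sdTensor g E l1 l2 l3 i a k l + Γ m k a * sdTensor g E l1 l2 l3 i j a l +
      Γ m l a * sdTensor g E l1 l2 l3 i j k a) = 0 := by
  have h1 := h.1 m
  have h2 := h.2.1 m
  have h3 := h.2.2 m
  have hsk := connMat_apply_swap hc hg ho
  have hsk0 := connMat_apply_self hc hg ho
  obtain ⟨q1, q2, q3⟩ := dmat_quat D m
  obtain ⟨a1, b1⟩ := dmat_const m q1 hc hg ho
  obtain ⟨a2, b2⟩ := dmat_const m q2 hc hg ho
  obtain ⟨a3, b3⟩ := dmat_const m q3 hc hg ho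
  obtain ⟨r1, r2, r3⟩ := commutator_quat hsk hsk0 m
  simp only [sdTensor]
  set e := Eᵀ * g
  set θ := connMat D Γ E e
  rw [r1, mul_sub, sub_mul, Matrix.mul_smul, Matrix.mul_smul, Matrix.smul_mul, Matrix.smul_mul]
    at a1 
  rw [r1, mul_sub, sub_mul, Matrix.mul_smul, Matrix.mul_smul, Matrix.smul_mul, Matrix.smul_mul]
    at b1
  rw [r2, mul_sub, sub_mul, Matrix.mul_smul, Matrix.mul_smul, Matrix.smul_mul, Matrix.smul_mul]
    at a2 
  rw [r2, mul_sub, sub_mul, Matrix.mul_smul, Matrix.mul_smul, Matrix.smul_mul, Matrix.smul_mul]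
    at b2
  rw [r3, mul_sub, sub_mul, Matrix.mul_smul, Matrix.mul_smul, Matrix.smul_mul, Matrix.smul_mul]
    at a3
  rw [r3, mul_sub, sub_mul, Matrix.mul_smul, Matrix.mul_smul, Matrix.smul_mul, Matrix.smul_mul]
    at b3
  generalize eᵀ * quat1 A * e = p1 at *
  generalize eᵀ * quat2 A * e = p2 at *
  generalize eᵀ * quat3 A * e = p3 at *
  generalize E * quat1 A * Eᵀ = t1 at *
  generalize E * quat2 A * Eᵀ = t2 at *
  generalize E * quat3 A * Eᵀ = t3 at *
  have a1 := congrFun (congrFun a1 i) j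
  have a2 := congrFun (congrFun a2 i) j
  have a3 := congrFun (congrFun a3 i) j
  have b1 := congrFun (congrFun b1 k) l
  have b2 := congrFun (congrFun b2 k) l
  have b3 := congrFun (congrFun b3 k) l
  simp only [dmat, Matrix.map_apply, Matrix.add_apply, Matrix.sub_apply, Matrix.smul_apply,
    smul_eq_mul, Matrix.mul_apply, transpose_apply, Fin.sum_univ_four] at a1 a2 a3 b1 b2 b3
  simp only [map_add, Derivation.leibniz, Derivation.map_algebraMap, smul_eq_mul, mul_zero, add_zero,
    a1, a2, a3, b1, b2, b3, Fin.sum_univ_four]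
  rw [map_sub] at h1 h2 h3
  generalize sdPart1 θ m = x1 at *
  generalize sdPart2 θ m = x2 at *
  generalize sdPart3 θ m = x3 at *
  linear_combination algebraMap ℂ A (1 / 2) *
    (h3 * (p2 i j * t1 k l + p1 i j * t2 k l) + h1 * (p3 i j * t2 k l + p2 i j * t3 k l) +
      h2 * (p1 i j * t3 k l + p3 i j * t1 k l))

theorem IsRingEigenFrame.sdTensor_apply {U : Opens R4} {l1 l2 l3 : ℂ}
    {E : Matrix (Fin 4) (Fin 4) (smoothRing U)}
    (hE : IsRingEigenFrame G s l1 l2 l3 E) (hG : IsSmoothMetric G U) (z : U) (i j k l : Fin 4) :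
    (sdTensor hG.metric E l1 l2 l3 i j k l).1 z = (selfDualCurvatureOp G s z i j k l : ℂ) := by
  rw [(hE z).selfDualCurvatureOp_eq (hG.det_ne_zero z z.2)]
  have e : ∀ Q, evalMat z ((Eᵀ * hG.metric)ᵀ * Q * (Eᵀ * hG.metric)) =
      ((evalMat z E)ᵀ * cmat (G z))ᵀ * evalMat z Q * ((evalMat z E)ᵀ * cmat (G z)) := by
    intro Q
    rw [map_mul, map_mul, evalMat_transpose, map_mul, evalMat_transpose, hG.evalMat_metric]
  have f : ∀ Q, evalMat z (E * Q * Eᵀ) = evalMat z E * evalMat z Q * (evalMat z E)ᵀ := by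
    intro Q
    rw [map_mul, map_mul, evalMat_transpose]
  rw [← evalMat_quat1 z, ← evalMat_quat2 z, ← evalMat_quat3 z, ← e, ← e, ← e, ← f, ← f, ← f]
  rfl

theorem IsRingEigenFrame.covDeriv_eq_zero {U : Opens R4} {l1 l2 l3 : ℂ}
    {E : Matrix (Fin 4) (Fin 4) (smoothRing U)}
    (hE : IsRingEigenFrame G s l1 l2 l3 E) (hG : IsSmoothMetric G U) (hs : ContDiffOn ℝ ∞ s U)
    (h : SdPartsVanish partialDeriv hG.metric hG.chr E l1 l2 l3)
    (hy : y ∈ U) (m i j k l : Fin 4) :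
    covDeriv G (selfDualCurvatureOp G s) y m i j k l = 0 := by
  have ho := hE.ortho hG
  have hzero := covariant_sdTensor_eq_zero (A := smoothRing U)
    (D := partialDeriv) (g := hG.metric) (Γ := hG.chr)
    (E := E) hG.dmat_metric hG.metric_transpose ho h m i j k l
  have hBy := hE.sdTensor_apply hG
  have hder : (partialDeriv m (sdTensor hG.metric E l1 l2 l3 i j k l)).1 ⟨y, hy⟩ =
      (pd m (fun z => selfDualCurvatureOp G s z i j k l) y : ℂ) := by
    rw [partialDeriv_apply m _ (F := fun z => (selfDualCurvatureOp G s z i j k l : ℂ))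
      (fun z => (hBy z i j k l).symm)]
    exact pdC_ofReal (((contDiffOn_selfDualCurvatureOp hG hs i j k l).contDiffAt
      (U.isOpen.mem_nhds hy)).differentiableAt (by simp)) m
  have hchr : ∀ a b, (hG.chr m a b).1 ⟨y, hy⟩ = (christoffel G a m b y : ℂ) := fun a b => by
    rw [hG.chr_eq]; rfl
  have hev := congrArg (evalAt ⟨y, hy⟩) hzero
  rw [map_add, map_sum, map_zero, evalAt_apply, hder] at hev
  simp only [map_add, map_sub, map_mul, map_neg, evalAt_apply, hBy, hchr] at hev
  rw [covDeriv]
  exact_mod_cast hev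

end CovariantDerivative

/-! ### The eigenvalues -/

section Spectrum

open Matrix
open TopologicalSpace (Opens)

/-- The primitive third root of unity `exp (2πi/3)`. -/
def zeta3 : ℂ := Complex.exp (2 * Real.pi * Complex.I / 3)

theorem zeta3_sq : zeta3 ^ 2 + zeta3 + 1 = 0 := by
  have h1 : zeta3 ^ 3 = 1 := by
    rw [zeta3, ← Complex.exp_nat_mul, show ((3 : ℕ) : ℂ) * (2 * Real.pi * Complex.I / 3) =
      2 * Real.pi * Complex.I by push_cast; ring, Complex.exp_two_pi_mul_I]
  have h2 : zeta3 ≠ 1 := by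
    rw [zeta3, Ne, Complex.exp_eq_one_iff]
    rintro ⟨n, hn⟩
    have h3 : (2 * Real.pi * Complex.I : ℂ) ≠ 0 := by simp [Real.pi_ne_zero]
    have h4 : (2 * Real.pi * Complex.I : ℂ) * (1 / 3 - n) = 0 := by linear_combination hn
    have h5 : (1 : ℂ) = 3 * n := by
      linear_combination 3 * (mul_eq_zero.mp h4).resolve_left h3
    have h6 : (1 : ℤ) = 3 * n := by exact_mod_cast h5
    omega
  have : (zeta3 - 1) * (zeta3 ^ 2 + zeta3 + 1) = 0 := by linear_combination h1
  exact (mul_eq_zero.mp this).resolve_left (sub_ne_zero.mpr h2)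

theorem zeta3_conj : starRingEnd ℂ zeta3 = zeta3 ^ 2 := by
  rw [zeta3, ← Complex.exp_conj, ← Complex.exp_nat_mul]
  have h : starRingEnd ℂ (2 * Real.pi * Complex.I / 3) = -(2 * Real.pi * Complex.I / 3) := by
    rw [map_div₀, map_mul, map_mul, Complex.conj_I, map_ofNat, Complex.conj_ofReal, map_ofNat]
    ring
  rw [h, Complex.exp_eq_exp_iff_exists_int]
  refine ⟨-1, ?_⟩
  push_cast
  ring

theorem zeta3_ne_one : zeta3 ≠ 1 := fun h => by
  have := zeta3_sq
  rw [h] at this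
  norm_num at this

theorem zeta3_ne_zero : zeta3 ≠ 0 := Complex.exp_ne_zero _

theorem zeta3_sq_ne_one : zeta3 ^ 2 ≠ 1 := fun h => by
  have h2 := zeta3_sq
  rw [h] at h2
  have h3 : zeta3 = -2 := by linear_combination h2
  rw [h3] at h
  norm_num at h

theorem zeta3_cube : zeta3 ^ 3 = 1 := by linear_combination (zeta3 - 1) * zeta3_sq

theorem zeta3_im_real : ∃ t : ℝ, t ≠ 0 ∧ Complex.I * (zeta3 - zeta3 ^ 2) = t := by
  have h1 := zeta3_conj
  refine ⟨-(2 * zeta3.im), ?_, ?_⟩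
  · intro h
    have him : zeta3.im = 0 := by linarith
    have h2 : starRingEnd ℂ zeta3 = zeta3 := Complex.conj_eq_iff_im.mpr him
    rw [h1] at h2
    apply zeta3_ne_one
    have : zeta3 * (zeta3 - 1) = 0 := by linear_combination h2
    exact sub_eq_zero.mp ((mul_eq_zero.mp this).resolve_left zeta3_ne_zero)
  · rw [← h1, Complex.sub_conj]
    push_cast
    linear_combination (2 * (zeta3.im : ℂ)) * Complex.I_mul_I

/-- All three factors and differences are nonzero, so dividing the relations pairwise gives x₁ + x₂
+ x₃ = 0 and then x₁² + x₁x₂ + x₂² = 0, whose roots are x₂ = ζx₁ and x₂ = ζ²x₁. -/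
theorem exists_cube_root_form {x1 x2 x3 n : ℂ} (hn : n ≠ 0)
    (h1 : x1 * ((x3 - x1) * (x1 - x2)) = n) (h2 : x2 * ((x1 - x2) * (x2 - x3)) = n)
    (h3 : x3 * ((x2 - x3) * (x3 - x1)) = n) :
    x1 ≠ 0 ∧ ({x1, x2, x3} : Set ℂ) = {x1, zeta3 * x1, zeta3 ^ 2 * x1} := by
  have n1 : x1 ≠ 0 := by rintro rfl; exact hn (by rw [← h1]; ring)
  have d23 : x2 - x3 ≠ 0 := by intro h; exact hn (by rw [← h2, h]; ring)
  have d31 : x3 - x1 ≠ 0 := by intro h; exact hn (by rw [← h1, h]; ring)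
  have d12 : x1 - x2 ≠ 0 := by intro h; exact hn (by rw [← h1, h]; ring)
  have e1 : x1 * (x3 - x1) = x2 * (x2 - x3) := by
    apply mul_right_cancel₀ d12; linear_combination h1 - h2
  have e2 : x2 * (x1 - x2) = x3 * (x3 - x1) := by
    apply mul_right_cancel₀ d23; linear_combination h2 - h3
  have e3 : x3 * (x2 - x3) = x1 * (x1 - x2) := by
    apply mul_right_cancel₀ d31; linear_combination h3 - h1
  have hsum : x1 + x2 + x3 = 0 := by
    have : (x2 - x3) * (x1 + x2 + x3) = 0 := by
      linear_combination e3 - e1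
    exact (mul_eq_zero.mp this).resolve_left d23
  have h3' : x3 = -x1 - x2 := by linear_combination hsum
  subst h3'
  have hq : (x2 - zeta3 * x1) * (x2 - zeta3 ^ 2 * x1) = 0 := by
    linear_combination -e1 / 2 - x1 * x2 * zeta3_sq + x1 ^ 2 * zeta3_cube
  refine ⟨n1, ?_⟩
  rcases mul_eq_zero.mp hq with h | h
  · rw [sub_eq_zero.mp h, show -x1 - zeta3 * x1 = zeta3 ^ 2 * x1 by
      linear_combination -x1 * zeta3_sq]
  · rw [sub_eq_zero.mp h, show -x1 - zeta3 ^ 2 * x1 = zeta3 * x1 by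
      linear_combination -x1 * zeta3_sq, Set.pair_comm]

/-- Conjugation is an involution of a three-element set and so has a fixed point. That real root can
be taken as the first. -/
theorem exists_real_cube_root_form {S : Set ℂ} {l : ℂ} (hl : l ≠ 0)
    (hS : S = {l, zeta3 * l, zeta3 ^ 2 * l}) (hc : ∀ μ ∈ S, starRingEnd ℂ μ ∈ S) :
    ∃ μ : ℝ, μ ≠ 0 ∧ S = {(μ : ℂ), zeta3 * μ, zeta3 ^ 2 * μ} := by
  have key : ∀ m : ℂ, m ≠ 0 → starRingEnd ℂ m = m → S = {m, zeta3 * m, zeta3 ^ 2 * m} →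
      ∃ μ : ℝ, μ ≠ 0 ∧ S = {(μ : ℂ), zeta3 * μ, zeta3 ^ 2 * μ} := by
    intro m hm hr h
    obtain ⟨r, rfl⟩ := Complex.conj_eq_iff_real.mp hr
    exact ⟨r, by exact_mod_cast hm, h⟩
  have h1 := hc l (by simp [hS])
  rw [hS] at h1
  rcases h1 with h | h | h
  · exact key l hl h hS
  · refine key (zeta3 ^ 2 * l) (mul_ne_zero (pow_ne_zero 2 zeta3_ne_zero) hl) ?_ ?_
    · rw [map_mul, map_pow, zeta3_conj, h]
      linear_combination zeta3 ^ 2 * l * zeta3_cube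
    · rw [hS, show zeta3 * (zeta3 ^ 2 * l) = l by linear_combination l * zeta3_cube,
        show zeta3 ^ 2 * (zeta3 ^ 2 * l) = zeta3 * l by linear_combination zeta3 * l * zeta3_cube]
      ext x; simp only [Set.mem_insert_iff, Set.mem_singleton_iff]; tauto
  · rw [Set.mem_singleton_iff] at h
    refine key (zeta3 * l) (mul_ne_zero zeta3_ne_zero hl) ?_ ?_
    · rw [map_mul, zeta3_conj, h]
      linear_combination zeta3 * l * zeta3_cube
    · rw [hS, show zeta3 ^ 2 * (zeta3 * l) = l by linear_combination l * zeta3_cube,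
        show zeta3 * (zeta3 * l) = zeta3 ^ 2 * l by ring]
      ext x; simp only [Set.mem_insert_iff, Set.mem_singleton_iff]; tauto

variable {G : R4 → Matrix (Fin 4) (Fin 4) ℝ} {s : R4 → ℝ} {U : Opens R4} {S : Set ℂ} {y : R4}

theorem conjMat_mem_selfDualEigenspace {μ : ℂ} {α : Matrix (Fin 4) (Fin 4) ℂ}
    (h : α ∈ selfDualEigenspace G s y μ) :
    conjMat α ∈ selfDualEigenspace G s y (starRingEnd ℂ μ) := by
  obtain ⟨⟨h1, h2⟩, h3⟩ := h
  have h3' := Module.End.mem_eigenspace_iff.mp h3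
  refine ⟨⟨?_, ?_⟩, Module.End.mem_eigenspace_iff.mpr ?_⟩
  · ext i j
    have := congrFun (congrFun h1 i) j
    simp only [transpose_apply, Matrix.neg_apply, conjMat, map_apply] at this ⊢
    rw [this, map_neg]
  · rw [complexOp_conjMat, h2]
  · rw [complexOp_conjMat, h3']
    ext i j
    simp [conjMat]

/-- The operator has real components, so conjugating an eigenvector conjugates its eigenvalue. -/
theorem IsCurvatureChart.conj_mem (h : IsCurvatureChart G s U S) (hy : y ∈ U) {μ : ℂ} (hμ : μ ∈ S) :
    starRingEnd ℂ μ ∈ S := by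
  rw [← h.eigenvalues y hy, Set.mem_ofPred_eq, Submodule.ne_bot_iff] at hμ ⊢
  obtain ⟨α, hα, h0⟩ := hμ
  refine ⟨_, conjMat_mem_selfDualEigenspace hα, fun hz => h0 ?_⟩
  ext i j
  have := congrFun (congrFun hz i) j
  simpa [conjMat] using this

section Generic

variable {A : Type*} [CommRing A] [Algebra ℂ A]

local notation "κ" => algebraMap ℂ A

/-- The 1-forms `η0, …, η3` make up an orthogonal coframe of the metric `g`, with the structure
equations of a solvable Lie group. -/
structure IsSolvableCoframe (D : Fin 4 → Derivation ℂ A A) (g : Matrix (Fin 4) (Fin 4) A)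
    (l1 l2 l3 n : ℂ) (η0 η1 η2 η3 : Fin 4 → A) : Prop where
  sum_mul : ∀ i j, η0 i * η0 j + η1 i * η1 j + η2 i * η2 j + η3 i * η3 j = κ n * g i j
  d0 : ∀ p q, extD1 D η0 p q = 0
  d1 : ∀ p q, extD1 D η1 p q = κ ((l2 - l3) * l1 / n) * wedge11 η0 η1 p q
  d2 : ∀ p q, extD1 D η2 p q = κ ((l3 - l1) * l2 / n) * wedge11 η0 η2 p q
  d3 : ∀ p q, extD1 D η3 p q = κ ((l1 - l2) * l3 / n) * wedge11 η0 η3 p q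

/-- The 1-form completing the self-dual connection forms to a coframe. -/
def baseForm (D : Fin 4 → Derivation ℂ A A) (g : Matrix (Fin 4) (Fin 4) A)
    (Γ : Fin 4 → Matrix (Fin 4) (Fin 4) A) (E : Matrix (Fin 4) (Fin 4) A) (l2 l3 : ℂ) : Fin 4 → A :=
  quatBase l2 l3 ((Eᵀ * g) 0) ((Eᵀ * g) 1) ((Eᵀ * g) 2) ((Eᵀ * g) 3)
    (sdPart1 (connMat D Γ E (Eᵀ * g))) (fun m => E m 0) (fun m => E m 1) (fun m => E m 2)
    (fun m => E m 3)

/-- The self-dual connection forms of the frame `E` satisfy the structure equations. -/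
def HasStructureEqs (D : Fin 4 → Derivation ℂ A A) (g : Matrix (Fin 4) (Fin 4) A)
    (Γ : Fin 4 → Matrix (Fin 4) (Fin 4) A) (E : Matrix (Fin 4) (Fin 4) A) (l1 l2 l3 : ℂ) : Prop :=
  SelfDualStructure D ((Eᵀ * g) 0) ((Eᵀ * g) 1) ((Eᵀ * g) 2) ((Eᵀ * g) 3)
    (sdPart1 (connMat D Γ E (Eᵀ * g))) (sdPart2 (connMat D Γ E (Eᵀ * g)))
    (sdPart3 (connMat D Γ E (Eᵀ * g))) l1 l2 l3

variable {D : Fin 4 → Derivation ℂ A A} {g : Matrix (Fin 4) (Fin 4) A}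
    {Γ : Fin 4 → Matrix (Fin 4) (Fin 4) A} {E : Matrix (Fin 4) (Fin 4) A} {l1 l2 l3 : ℂ}

theorem HasStructureEqs.sdPartsVanish (h : HasStructureEqs D g Γ E (-l1) (-l2) (-l3))
    (hD : ∀ i j a, D i (D j a) = D j (D i a)) (hE : Eᵀ * g * E = 1)
    (hl : l2 = l3 ∨ l3 = l1 ∨ l1 = l2) : SdPartsVanish D g Γ E l1 l2 l3 := by
  have hl' : -l2 = -l3 ∨ -l3 = -l1 ∨ -l1 = -l2 := by simpa only [neg_inj] using hl
  obtain ⟨a, b, c⟩ := SelfDualStructure.eq_zero_of_degenerate hD h (isDualFrame_of_mul_eq_one hE) hl'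
  have key : ∀ (x y : ℂ) (f : A), κ (-x - -y) * f = 0 → κ (x - y) * f = 0 := by
    intro x y f hf
    rw [show -x - -y = -(x - y) by ring, map_neg, neg_mul, neg_eq_zero] at hf
    exact hf
  exact ⟨fun m => key _ _ _ (a m), fun m => key _ _ _ (b m), fun m => key _ _ _ (c m)⟩

theorem HasStructureEqs.exists_solvableCoframe [Nontrivial A] (h : HasStructureEqs D g Γ E l1 l2 l3)
    (hD : ∀ i j a, D i (D j a) = D j (D i a)) (hg : gᵀ = g) (hE : Eᵀ * g * E = 1)
    (h1 : l2 - l3 ≠ 0) (h2 : l3 - l1 ≠ 0) (h3 : l1 - l2 ≠ 0) :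
    ∃ n : ℂ, n ≠ 0 ∧ l1 * ((l3 - l1) * (l1 - l2)) = n ∧ l2 * ((l1 - l2) * (l2 - l3)) = n ∧
      l3 * ((l2 - l3) * (l3 - l1)) = n ∧ IsSolvableCoframe D g l1 l2 l3 n (baseForm D g Γ E l2 l3)
        (fun m => κ (l2 - l3) * sdPart1 (connMat D Γ E (Eᵀ * g)) m)
        (fun m => κ (l3 - l1) * sdPart2 (connMat D Γ E (Eᵀ * g)) m)
        (fun m => κ (l1 - l2) * sdPart3 (connMat D Γ E (Eᵀ * g)) m) := by
  have hq := SelfDualStructure.isQuaternionic hD h (isDualFrame_of_mul_eq_one hE)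
  have hinv : ∀ (x : ℂ) (f : A), x ≠ 0 → f = κ x⁻¹ * (κ x * f) := by
    intro x f hx
    rw [← mul_assoc, ← map_mul, inv_mul_cancel₀ hx, map_one, one_mul]
  obtain ⟨n, hn, hw, e1, e2, e3, d0, d1, d2, d3⟩ := SelfDualStructure.structure_equations hE h hq
    (fun m => hinv _ _ h1) (fun m => hinv _ _ h2) (fun m => hinv _ _ h3) h1 h2 h3
  refine ⟨n, hn, e1, e2, e3, fun i j => ?_, d0, d1, d2, d3⟩
  have hs := hq.sum_mul i j
  rw [hw] at hs
  have hge : (Eᵀ * g)ᵀ * (Eᵀ * g) = g := by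
    have hE' : E * (Eᵀ * g) = 1 := mul_eq_one_comm.mp hE
    rw [transpose_mul, transpose_transpose, hg, Matrix.mul_assoc, hE', Matrix.mul_one]
  have hgij := congrFun (congrFun hge i) j
  rw [Matrix.mul_apply] at hgij
  simp only [transpose_apply] at hgij
  rw [← hgij, Fin.sum_univ_four, ← hs]
  rfl

end Generic

theorem IsRingEigenFrame.hasStructureEqs {l1 l2 l3 : ℂ}
    {E : Matrix (Fin 4) (Fin 4) (smoothRing U)} (hE : IsRingEigenFrame G s l1 l2 l3 E)
    (hG : IsSmoothMetric G U) :
    HasStructureEqs partialDeriv hG.metric hG.chr E (-l1) (-l2) (-l3) := hE.structure_eqs hG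

/-- If `∇R⁺` does not vanish, the eigenvalues of `R⁺` are the three complex cube roots of a real
number. -/
theorem IsCurvatureChart.eigenvalues_eq (h : IsCurvatureChart G s U S) {y : R4} (hy : y ∈ U)
    {m i j k l : Fin 4} (hne : covDeriv G (selfDualCurvatureOp G s) y m i j k l ≠ 0) :
    ∃ μ : ℝ, μ ≠ 0 ∧ S = {(μ : ℂ), zeta3 * μ, zeta3 ^ 2 * μ} := by
  obtain ⟨l1, l2, l3, hS, W, hW, hyW, -, F, hF, hFE⟩ := h.exists_eigenFrame hy
  have hE : IsRingEigenFrame G s l1 l2 l3 (ringMat F hF) := fun z => hFE z z.2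
  have hG := h.metric.mono hW
  have hst := hE.hasStructureEqs hG
  by_cases hl : l2 = l3 ∨ l3 = l1 ∨ l1 = l2
  · exact absurd (hE.covDeriv_eq_zero hG (h.sign_smooth.mono hW)
      (HasStructureEqs.sdPartsVanish (A := smoothRing W) (D := partialDeriv) (g := hG.metric)
        (Γ := hG.chr) hst partialDeriv_comm (hE.ortho hG) hl) hyW m i j k l) hne
  push Not at hl
  have : Nontrivial (smoothRing W) := by
    refine ⟨⟨0, 1, fun hz => ?_⟩⟩
    have := congrArg (evalAt ⟨y, hyW⟩) hz
    rw [map_zero, map_one] at this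
    exact zero_ne_one this
  have hd : ∀ a b : ℂ, a ≠ b → -a - -b ≠ 0 := fun a b hab hz => hab (by linear_combination -hz)
  obtain ⟨n, hn, r1, r2, r3, -⟩ := HasStructureEqs.exists_solvableCoframe (A := smoothRing W)
    (D := partialDeriv) (g := hG.metric) (Γ := hG.chr) hst partialDeriv_comm hG.metric_transpose
    (hE.ortho hG) (hd _ _ hl.1) (hd _ _ hl.2.1) (hd _ _ hl.2.2)
  -- The structure equations carry the negatives of the eigenvalues, and the relation is homogeneous
  -- of degree three; hence −n.
  obtain ⟨h0, hset⟩ := exists_cube_root_form (x1 := l1) (x2 := l2) (x3 := l3) (n := -n)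
    (neg_ne_zero.mpr hn) (by linear_combination -r1) (by linear_combination -r2)
    (by linear_combination -r3)
  exact exists_real_cube_root_form h0 (hS.trans hset) fun μ hμ => h.conj_mem hy hμ

end Spectrum

/-! ### Integration of the structure equations -/

section Integration

open Matrix

variable {A : Type*} [CommRing A] [Algebra ℂ A]

local notation "κ" => algebraMap ℂ A

/-- An algebra with commuting derivations and a conjugation in which closed 1-forms are exact and
exponentials exist. -/
structure IsIntegrable (D : Fin 4 → Derivation ℂ A A) (J : A →+* A) : Prop where
  comm : ∀ i j a, D i (D j a) = D j (D i a)
  conj_algebraMap : ∀ c, J (κ c) = κ (starRingEnd ℂ c)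
  conj_deriv : ∀ i a, J (D i a) = D i (J a)
  conj_conj : ∀ a, J (J a) = a
  exists_potential : ∀ ξ : Fin 4 → A, (∀ p q, extD1 D ξ p q = 0) → ∃ f, ∀ i, D i f = ξ i
  exists_exp : ∀ f, ∃ u v, u * v = 1 ∧ ∀ i, D i u = D i f * u

variable {D : Fin 4 → Derivation ℂ A A} {J : A →+* A}

/-- The hypothesis dT = −c dr∧T says that e^{cr}T is closed. If y is a potential of it, then t =
e^{−cr}y satisfies T = dt + c t dr. -/
theorem IsIntegrable.exists_twisted_potential (hI : IsIntegrable D J) {r : A} {T : Fin 4 → A} {c : ℂ}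
    (hT : ∀ p q, extD1 D T p q = - (κ c * wedge11 (fun i => D i r) T p q)) :
    ∃ t, ∀ i, T i = D i t + κ c * t * D i r := by
  obtain ⟨u, v, huv, hu⟩ := hI.exists_exp (κ c * r)
  have hu' : ∀ i, D i u = κ c * D i r * u := fun i => by
    rw [hu, Derivation.leibniz, Derivation.map_algebraMap, smul_zero, add_zero, smul_eq_mul]
  obtain ⟨y, hy⟩ := hI.exists_potential (fun i => u * T i) (fun p q => by
    have := hT p q
    simp only [extD1, wedge11, Derivation.leibniz, smul_eq_mul, hu'] at this ⊢
    linear_combination u * this)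
  have hv : ∀ i, D i v = - (κ c * D i r * v) := fun i => by
    have h1 : D i (u * v) = 0 := by rw [huv, Derivation.map_one_eq_zero]
    rw [Derivation.leibniz, smul_eq_mul, smul_eq_mul, hu'] at h1
    linear_combination v * h1 - (D i v + κ c * D i r * v) * huv
  refine ⟨v * y, fun i => ?_⟩
  rw [Derivation.leibniz, smul_eq_mul, smul_eq_mul, hy, hv]
  linear_combination - T i * huv

theorem IsIntegrable.conj_half (hI : IsIntegrable D J) : J (κ (1 / 2)) = κ (1 / 2) := by
  rw [hI.conj_algebraMap, map_div₀, map_one, map_ofNat]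

theorem IsIntegrable.half_mul_two : κ (1 / 2) * 2 = 1 := by
  rw [show (2 : A) = κ 2 by rw [map_ofNat], ← map_mul, one_div, inv_mul_cancel₀ two_ne_zero, map_one]

/-- The average of a potential with its conjugate is again a potential, because ξ is real. -/
theorem IsIntegrable.exists_real_potential (hI : IsIntegrable D J) {ξ : Fin 4 → A}
    (hξ : ∀ p q, extD1 D ξ p q = 0) (hr : ∀ i, J (ξ i) = ξ i) :
    ∃ r, J r = r ∧ ∀ i, D i r = ξ i := by
  obtain ⟨f, hf⟩ := hI.exists_potential ξ hξ
  refine ⟨κ (1 / 2) * (f + J f), ?_, fun i => ?_⟩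
  · rw [map_mul, hI.conj_half, map_add, hI.conj_conj, add_comm]
  · rw [Derivation.leibniz, Derivation.map_algebraMap, smul_zero, add_zero, smul_eq_mul, map_add,
      ← hI.conj_deriv, hf, hr]
    linear_combination ξ i * IsIntegrable.half_mul_two (A := A)

theorem IsIntegrable.exists_real_twisted_potential (hI : IsIntegrable D J) {r : A} {T : Fin 4 → A}
    {c : ℝ} (hT : ∀ p q, extD1 D T p q = - (κ c * wedge11 (fun i => D i r) T p q))
    (hr : J r = r) (hTr : ∀ i, J (T i) = T i) :
    ∃ t, J t = t ∧ ∀ i, T i = D i t + κ c * t * D i r := by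
  obtain ⟨t, ht⟩ := hI.exists_twisted_potential hT
  have hc : J (κ c) = κ c := by rw [hI.conj_algebraMap, Complex.conj_ofReal]
  refine ⟨κ (1 / 2) * (t + J t), ?_, fun i => ?_⟩
  · rw [map_mul, hI.conj_half, map_add, hI.conj_conj, add_comm]
  · have h1 := congrArg J (ht i)
    rw [hTr, map_add, hI.conj_deriv, map_mul, map_mul, hI.conj_deriv, hr, hc] at h1
    rw [Derivation.leibniz, Derivation.map_algebraMap, smul_zero, add_zero, smul_eq_mul, map_add]
    linear_combination κ (1 / 2) * (ht i + h1) - T i * IsIntegrable.half_mul_two (A := A)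

/-- The components of Petrov's metric in terms of the coordinate functions `z`, `t`, `r`. -/
structure IsPetrovPullback (D : Fin 4 → Derivation ℂ A A) (J : A →+* A) (g : Matrix (Fin 4) (Fin 4) A)
    (p ε : ℝ) (z t r : A) : Prop where
  real_t : J t = t
  real_r : J r = r
  eq : ∀ i j, g i j = - (κ ε * (D i r * D j r)) +
    κ ε * ((D i t + κ p * t * D i r) * (D j t + κ p * t * D j r)) +
    κ (1 / (2 * Complex.I)) *
      ((D i z + κ (p * zeta3) * z * D i r) * (D j z + κ (p * zeta3) * z * D j r) -
        J ((D i z + κ (p * zeta3) * z * D i r) * (D j z + κ (p * zeta3) * z * D j r)))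

/-- The relation of the parameters `p`, `ε` of Petrov's metric to the real eigenvalue `μ`. -/
structure IsPetrovParam (μ p ε σ : ℝ) : Prop where
  μ_ne_zero : μ ≠ 0
  p_ne_zero : p ≠ 0
  σ_ne_zero : σ ≠ 0
  ε_sq : ε ^ 2 = 1
  cube : 3 * μ ^ 3 = ε * σ ^ 2
  p_eq : (p : ℂ) = -(Complex.I * (zeta3 - zeta3 ^ 2) * σ / (3 * μ))

/-- The number i(ζ − ζ²) is real. Take ε to be the sign of μ and σ² = |3μ³|; then p is determined.
-/
theorem exists_petrovParam {μ : ℝ} (hμ : μ ≠ 0) :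
    ∃ (p σ : ℝ) (ε : ℤˣ), IsPetrovParam μ p ((ε : ℤ) : ℝ) σ := by
  obtain ⟨τ, hτ0, hτ⟩ := zeta3_im_real
  have hp : ∀ σ : ℝ, σ ≠ 0 → -(τ * σ / (3 * μ)) ≠ 0 := fun σ hσ =>
    neg_ne_zero.mpr (div_ne_zero (mul_ne_zero hτ0 hσ) (mul_ne_zero three_ne_zero hμ))
  have hm : (3 * μ ^ 3 : ℝ) ≠ 0 := mul_ne_zero three_ne_zero (pow_ne_zero 3 hμ)
  rcases lt_or_gt_of_ne hm with hlt | hgt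
  · have hs : √(-(3 * μ ^ 3)) ≠ 0 := (Real.sqrt_pos.mpr (by linarith)).ne'
    refine ⟨_, _, -1, hμ, hp _ hs, hs, by simp, ?_, ?_⟩
    · rw [Real.sq_sqrt (by linarith)]; simp
    · rw [hτ]; push_cast; ring
  · have hs : √(3 * μ ^ 3) ≠ 0 := (Real.sqrt_pos.mpr hgt).ne'
    refine ⟨_, _, 1, hμ, hp _ hs, hs, by simp, ?_, ?_⟩
    · rw [Real.sq_sqrt hgt.le]; simp
    · rw [hτ]; push_cast; ring

variable {g : Matrix (Fin 4) (Fin 4) A} {η0 η1 η2 η3 : Fin 4 → A}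

/-- Here n = 3μ³ = εσ² and dη₁ = ((ζ−ζ²)/3μ) η₀∧η₁, while for η₃ this rate is multiplied by ζ. With
η₀ = iσ dr the rates become −p and −pζ, which are the eigenvalues of −F. -/
theorem IsSolvableCoframe.exists_petrovPullback (hI : IsIntegrable D J) {μ p ε σ : ℝ}
    (hpar : IsPetrovParam μ p ε σ) {n : ℂ}     (hn : n = 3 * μ ^ 3)
    (h : IsSolvableCoframe D g (-μ) (-(zeta3 * μ)) (-(zeta3 ^ 2 * μ)) n η0 η1 η2 η3)
    (h0 : ∀ i, J (η0 i) = - η0 i) (h1 : ∀ i, J (η1 i) = η1 i) (h2 : ∀ i, J (η3 i) = - η2 i) :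
    ∃ z t r, IsPetrovPullback D J g p ε z t r := by
  obtain ⟨hμ, hp0, hσ, hε, hσε, hpC⟩ := hpar
  have hμC : (μ : ℂ) ≠ 0 := by exact_mod_cast hμ
  have hσC : (σ : ℂ) ≠ 0 := by exact_mod_cast hσ
  have hn0 : n ≠ 0 := by rw [hn]; exact mul_ne_zero three_ne_zero (pow_ne_zero 3 hμC)
  have hnσ : n = ε * σ ^ 2 := by rw [hn]; exact_mod_cast hσε
  have hI2 := Complex.I_mul_I
  have hsmul : ∀ (c : ℂ) (η : Fin 4 → A) p q,
      extD1 D (fun i => κ c * η i) p q = κ c * extD1 D η p q := fun c η p q => by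
    simp only [extD1, Derivation.leibniz, Derivation.map_algebraMap, smul_eq_mul, mul_zero, add_zero,
      mul_sub]
  have hws : ∀ (c d : ℂ) (η ξ : Fin 4 → A) p q,
      wedge11 (fun i => κ c * η i) (fun i => κ d * ξ i) p q = κ (c * d) * wedge11 η ξ p q :=
    fun c d η ξ p q => by
      simp only [wedge11, map_mul]; ring
  -- Since η₀ is imaginary and closed, −iη₀/σ is real and closed; it is dr, and η₀²/n becomes −ε
  -- dr².
  obtain ⟨r, hr, hDr⟩ := hI.exists_real_potential (ξ := fun i => κ (-Complex.I / σ) * η0 i)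
    (fun p q => by rw [hsmul, h.d0, mul_zero]) (fun i => by
      rw [map_mul, hI.conj_algebraMap, h0, map_div₀, map_neg, Complex.conj_I, Complex.conj_ofReal,
        neg_neg, neg_div, map_neg]; ring)
  have hDr' : (fun i => D i r) = fun i => κ (-Complex.I / σ) * η0 i := funext hDr
  obtain ⟨t, ht, hTt⟩ := hI.exists_real_twisted_potential (r := r) (c := p)
    (T := fun i => κ (1 / σ) * η1 i) (fun a b => by
      rw [hsmul, h.d1, hDr', hws, ← mul_assoc, ← mul_assoc, ← map_mul, ← map_mul,
        ← neg_mul (κ _), ← map_neg (algebraMap ℂ A)]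
      congr 2
      rw [hpC, hn]
      field_simp
      linear_combination (zeta3 - zeta3 ^ 2) * hI2) hr (fun i => by
      rw [map_mul, h1, hI.conj_algebraMap, map_div₀, map_one, Complex.conj_ofReal])
  -- The scale of z is chosen so that η₃²/n = T²/(2i) for T = mη₃. Adding η₂²/n, which is the
  -- conjugate, then gives Im(T²).
  obtain ⟨m, hm⟩ : ∃ m : ℂ, m ^ 2 = 2 * Complex.I / n := 
    IsAlgClosed.exists_pow_nat_eq _ two_pos
  obtain ⟨z, hz⟩ := hI.exists_twisted_potential (r := r) (c := p * zeta3)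
    (T := fun i => κ m * η3 i) (fun a b => by
      rw [hsmul, h.d3, hDr', hws, ← mul_assoc, ← mul_assoc, ← map_mul, ← map_mul,
        ← neg_mul (κ _), ← map_neg (algebraMap ℂ A)]
      congr 2
      rw [hpC, hn]
      field_simp
      linear_combination (m * zeta3 ^ 2 - m * zeta3 ^ 3) * hI2)
  refine ⟨z, t, r, ht, hr, fun i j => ?_⟩
  have hg : g i j = κ (1 / n) * (η0 i * η0 j + η1 i * η1 j + η2 i * η2 j + η3 i * η3 j) := by
    rw [h.sum_mul, ← mul_assoc, ← map_mul, one_div, inv_mul_cancel₀ hn0, map_one, one_mul]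
  have hJ : ∀ i, J (κ m * η3 i) = - (κ (starRingEnd ℂ m) * η2 i) := fun i => by
    rw [map_mul, hI.conj_algebraMap, h2, mul_neg]
  have hnc : starRingEnd ℂ n = n := by rw [hnσ, map_mul, map_pow, Complex.conj_ofReal,
    Complex.conj_ofReal]
  have hmc : (starRingEnd ℂ m) ^ 2 = - (2 * Complex.I) / n := by
    rw [← map_pow, hm, map_div₀, hnc, map_mul, map_ofNat, Complex.conj_I, mul_neg]
  have hεC : (ε : ℂ) ^ 2 = 1 := by exact_mod_cast hε
  have hε0 : (ε : ℂ) ≠ 0 := by intro h; rw [h] at hεC; norm_num at hεC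
  have c0 : κ ε * κ (-Complex.I / σ) * κ (-Complex.I / σ) = - κ (1 / n) := by
    rw [← map_mul, ← map_mul, ← map_neg]
    congr 1
    rw [hnσ]; field_simp
    rw [Complex.I_sq]
    linear_combination -hεC
  have c1 : κ ε * κ (1 / σ) * κ (1 / σ) = κ (1 / n) := by
    rw [← map_mul, ← map_mul]
    congr 1
    rw [hnσ]; field_simp
    linear_combination hεC
  have c2 : κ (1 / (2 * Complex.I)) * κ m * κ m = κ (1 / n) := by
    rw [mul_assoc, ← map_mul, ← map_mul, ← sq, hm]
    congr 1
    have := Complex.I_ne_zero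
    field_simp
  have c3 : κ (1 / (2 * Complex.I)) * κ (starRingEnd ℂ m) * κ (starRingEnd ℂ m) = - κ (1 / n) := by
    rw [mul_assoc, ← map_mul, ← map_mul, ← sq, hmc, ← map_neg]
    congr 1
    have := Complex.I_ne_zero
    field_simp
  rw [← hz, ← hz, ← hTt, ← hTt, hDr, hDr, map_mul, hJ, hJ, hg]
  linear_combination η0 i * η0 j * c0 - η1 i * η1 j * c1 - η3 i * η3 j * c2 + η2 i * η2 j * c3

end Integration

/-! ### Complex conjugation of the frame -/

section ConjugateFrame

open Matrix

variable {A : Type*} [CommRing A]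

/-- The effect of complex conjugation on the columns of a frame. -/
structure IsRingConjFrame (J : A →+* A) (E : Matrix (Fin 4) (Fin 4) A) : Prop where
  conj0 : ∀ i, J (E i 0) = E i 0
  conj1 : ∀ i, J (E i 1) = - E i 1
  conj2 : ∀ i, J (E i 2) = E i 3
  conj3 : ∀ i, J (E i 3) = E i 2

variable {J : A →+* A} {g E : Matrix (Fin 4) (Fin 4) A}

theorem IsRingConjFrame.conj_coframe (hE : IsRingConjFrame J E) (hg : ∀ i j, J (g i j) = g i j) :
    (∀ i, J ((Eᵀ * g) 0 i) = (Eᵀ * g) 0 i) ∧ (∀ i, J ((Eᵀ * g) 1 i) = - (Eᵀ * g) 1 i) ∧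
    (∀ i, J ((Eᵀ * g) 2 i) = (Eᵀ * g) 3 i) ∧ ∀ i, J ((Eᵀ * g) 3 i) = (Eᵀ * g) 2 i := by
  simp only [Matrix.mul_apply, transpose_apply, map_sum, map_mul, hg, hE.conj0, hE.conj1, hE.conj2,
    hE.conj3, neg_mul, Finset.sum_neg_distrib, implies_true, and_self]

variable [Algebra ℂ A] {D : Fin 4 → Derivation ℂ A A} {Γ : Fin 4 → Matrix (Fin 4) (Fin 4) A}

local notation "κ" => algebraMap ℂ A

theorem IsRingConjFrame.conj_connMat (hE : IsRingConjFrame J E) (hg : ∀ i j, J (g i j) = g i j)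
    (hΓ : ∀ m i j, J (Γ m i j) = Γ m i j) (hJ : ∀ i a, J (D i a) = D i (J a)) (m : Fin 4) :
    J (connMat D Γ E (Eᵀ * g) m 0 1) = - connMat D Γ E (Eᵀ * g) m 0 1 ∧
    J (connMat D Γ E (Eᵀ * g) m 2 3) = connMat D Γ E (Eᵀ * g) m 3 2 ∧
    J (connMat D Γ E (Eᵀ * g) m 0 2) = connMat D Γ E (Eᵀ * g) m 0 3 ∧
    J (connMat D Γ E (Eᵀ * g) m 3 1) = - connMat D Γ E (Eᵀ * g) m 2 1 ∧
    J (connMat D Γ E (Eᵀ * g) m 0 3) = connMat D Γ E (Eᵀ * g) m 0 2 ∧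
    J (connMat D Γ E (Eᵀ * g) m 1 2) = - connMat D Γ E (Eᵀ * g) m 1 3 := by
  obtain ⟨e0, e1, e2, e3⟩ := hE.conj_coframe hg
  have key : ∀ a b, connMat D Γ E (Eᵀ * g) m a b =
      ∑ k, (Eᵀ * g) a k * (D m (E k b) + ∑ l, Γ m k l * E l b) := by
    intro a b
    rw [connMat, Matrix.mul_apply]
    simp only [Matrix.add_apply, Matrix.mul_apply (M := Γ m), dmat, Matrix.map_apply]
  simp only [key, map_sum, map_mul, map_add, hJ, hΓ, e0, e1, e2, e3, hE.conj1, hE.conj2,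
    hE.conj3, map_neg, mul_neg, neg_mul, Finset.sum_neg_distrib, ← neg_add, and_self]

/-- Conjugation fixes the first frame vector, negates the second and swaps the last two, while the
Levi-Civita connection is real. The connection entries are permuted accordingly. -/
theorem IsRingConjFrame.conj_sdPart (hE : IsRingConjFrame J E) (hg : ∀ i j, J (g i j) = g i j)
    (hΓ : ∀ m i j, J (Γ m i j) = Γ m i j) (hJ : ∀ i a, J (D i a) = D i (J a))
    (hsk : ∀ m a b, connMat D Γ E (Eᵀ * g) m a b = - connMat D Γ E (Eᵀ * g) m b a) (m : Fin 4) :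
    J (sdPart1 (connMat D Γ E (Eᵀ * g)) m) = - sdPart1 (connMat D Γ E (Eᵀ * g)) m ∧
    J (sdPart2 (connMat D Γ E (Eᵀ * g)) m) = sdPart3 (connMat D Γ E (Eᵀ * g)) m ∧
    J (sdPart3 (connMat D Γ E (Eᵀ * g)) m) = sdPart2 (connMat D Γ E (Eᵀ * g)) m := by
  obtain ⟨a1, a2, a3, a4, a5, a6⟩ := hE.conj_connMat hg hΓ hJ m
  simp only [sdPart1, sdPart2, sdPart3, map_neg, map_add, a1, a2, a3, a4, a5, a6]
  exact ⟨by linear_combination - hsk m 3 2, by linear_combination hsk m 2 1,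
    by linear_combination hsk m 3 1⟩

theorem IsRingConjFrame.conj_baseForm (hE : IsRingConjFrame J E) (hg : ∀ i j, J (g i j) = g i j)
    (hc : ∀ c, J (κ c) = κ (starRingEnd ℂ c))
    (h1 : ∀ m, J (sdPart1 (connMat D Γ E (Eᵀ * g)) m) = - sdPart1 (connMat D Γ E (Eᵀ * g)) m)
    {l2 l3 : ℂ} (hl : starRingEnd ℂ l2 = l3) (i : Fin 4) :
    J (baseForm D g Γ E l2 l3 i) = - baseForm D g Γ E l2 l3 i := by
  obtain ⟨e0, e1, e2, e3⟩ := hE.conj_coframe hg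
  have hl' : starRingEnd ℂ l3 = l2 := by rw [← hl, Complex.conj_conj]
  simp only [baseForm, quatBase, pair, map_mul, map_sub, map_add, hc, hl, hl', map_sum, e0, e1, e2,
    e3, h1, hE.conj0, hE.conj1, hE.conj2, hE.conj3, neg_mul, mul_neg, Finset.sum_neg_distrib]
  ring

/-- For the spectrum μ, ζμ, ζ²μ the reality of the ηᵢ follows: λ₂−λ₃ and ξ₁ are both negated by
conjugation, so η₁ is real, and η₃ goes to (λ₁−λ₃)ξ₂ = −η₂. -/
theorem HasStructureEqs.exists_petrovPullback [Nontrivial A] (hI : IsIntegrable D J) {μ p ε σ : ℝ}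
    (hpar : IsPetrovParam μ p ε σ)
    (h : HasStructureEqs D g Γ E (-μ) (-(zeta3 * μ)) (-(zeta3 ^ 2 * μ)))
    (hc : ∀ m, dmat D m g = (Γ m)ᵀ * g + g * Γ m) (hgT : gᵀ = g) (hEo : Eᵀ * g * E = 1)
    (hE : IsRingConjFrame J E) (hg : ∀ i j, J (g i j) = g i j)
    (hΓ : ∀ m i j, J (Γ m i j) = Γ m i j) :
    ∃ z t r, IsPetrovPullback D J g p ε z t r := by
  have hμ : (μ : ℂ) ≠ 0 := by exact_mod_cast hpar.μ_ne_zero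
  have hz : zeta3 - 1 ≠ 0 := sub_ne_zero.mpr zeta3_ne_one
  obtain ⟨n, -, hn, -, -, hη⟩ := h.exists_solvableCoframe hI.comm hgT hEo
    (by rw [show -(zeta3 * μ) - -(zeta3 ^ 2 * μ) = zeta3 * (zeta3 - 1) * μ by ring]
        exact mul_ne_zero (mul_ne_zero zeta3_ne_zero hz) hμ)
    (by rw [show -(zeta3 ^ 2 * μ) - -(μ : ℂ) = -(zeta3 ^ 2 - 1) * μ by ring]
        exact mul_ne_zero (neg_ne_zero.mpr (sub_ne_zero.mpr zeta3_sq_ne_one)) hμ)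
    (by rw [show -(μ : ℂ) - -(zeta3 * μ) = (zeta3 - 1) * μ by ring]
        exact mul_ne_zero hz hμ)
  have hsd := fun m => hE.conj_sdPart hg hΓ hI.conj_deriv
    (fun m a b => connMat_apply_swap hc hgT hEo m a b) m
  have hl : starRingEnd ℂ (-(zeta3 * μ)) = -(zeta3 ^ 2 * μ) := by
    rw [map_neg, map_mul, zeta3_conj, Complex.conj_ofReal]
  refine hη.exists_petrovPullback hI hpar ?_ (hE.conj_baseForm hg hI.conj_algebraMap
    (fun m => (hsd m).1) hl) (fun i => ?_) fun i => ?_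
  · rw [← hn]
    linear_combination (μ : ℂ) ^ 3 * (zeta3_cube - zeta3_sq)
  · rw [map_mul, (hsd i).1, hI.conj_algebraMap, map_sub, hl, ← hl, Complex.conj_conj, hl,
      mul_neg, ← neg_mul (κ _), ← map_neg (algebraMap ℂ A), neg_sub]
  · rw [map_mul, (hsd i).2.2, hI.conj_algebraMap, map_sub, hl, map_neg, Complex.conj_ofReal,
      ← neg_mul (κ _), ← map_neg (algebraMap ℂ A), neg_sub]

end ConjugateFrame

/-! ### Smooth functions as an integrable ring, and Petrov's form of the metric in a chart. -/

section SmoothFunctions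

open Matrix
open TopologicalSpace (Opens)

variable {U : Opens R4}

theorem isIntegrable_smoothRing (hU : Convex ℝ (U : Set R4)) :
    IsIntegrable (A := smoothRing U) partialDeriv conjRing where
  comm := partialDeriv_comm
  conj_algebraMap := conjRing_algebraMap
  conj_deriv i a := (partialDeriv_conjRing i a).symm
  conj_conj a := by
    ext y
    rw [conjRing_apply, conjRing_apply, Complex.conj_conj]
  exists_potential ξ hξ := exists_potential hU ξ hξ
  exists_exp f := ⟨expRing f, expRing (-f), by rw [← expRing_add, add_neg_cancel, expRing_zero],
    fun i => (partialDeriv_expRing i f).trans (mul_comm _ _)⟩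

theorem conjRing_ofRealRing (f : R4 → ℝ) (hf : ContDiffOn ℝ ∞ f U) :
    conjRing (ofRealRing f hf) = ofRealRing f hf := by
  ext y
  rw [conjRing_apply]
  exact Complex.conj_ofReal _

variable {G : R4 → Matrix (Fin 4) (Fin 4) ℝ} {s : R4 → ℝ} {S : Set ℂ}

theorem IsCurvatureChart.exists_rootFrame (h : IsCurvatureChart G s U S) {y : R4} (hy : y ∈ U)
    {μ : ℝ} (hμ : μ ≠ 0) (hS : S = {(μ : ℂ), zeta3 * μ, zeta3 ^ 2 * μ}) :
    ∃ W : Opens R4, W ≤ U ∧ y ∈ W ∧ Convex ℝ (W : Set R4) ∧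
      ∃ F : R4 → Matrix (Fin 4) (Fin 4) ℂ, SmoothMat F W ∧
        ∀ y ∈ W, IsEigenFrame G s y μ (zeta3 * μ) (zeta3 ^ 2 * μ) (F y) ∧ IsConjFrame (F y) := by
  have hμ : (μ : ℂ) ≠ 0 := by exact_mod_cast hμ
  have hc : starRingEnd ℂ (zeta3 * μ) = zeta3 ^ 2 * μ := by
    rw [map_mul, zeta3_conj, Complex.conj_ofReal]
  rw [← hc]
  refine h.exists_conjFrame hy (l := zeta3 * μ) (μ := μ)
    (by simp [hS]) (by simp [hS]) (fun hz => ?_)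
    (fun hz => zeta3_ne_one (mul_right_cancel₀ hμ (hz.symm.trans (one_mul _).symm)))
    (fun hz => zeta3_sq_ne_one (mul_right_cancel₀ hμ ((hc.symm.trans hz.symm).trans (one_mul _).symm)))
  rw [hc] at hz
  have h2 : zeta3 * (zeta3 - 1) = 0 := by linear_combination mul_right_cancel₀ hμ hz
  exact (mul_ne_zero zeta3_ne_zero (sub_ne_zero.mpr zeta3_ne_one)) h2

/-- The components of the metric in terms of Petrov's coordinates. -/
theorem IsCurvatureChart.exists_petrovPullback (h : IsCurvatureChart G s U S) {y : R4} (hy : y ∈ U)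
    {μ p ε σ : ℝ} (hpar : IsPetrovParam μ p ε σ)
    (hS : S = {(μ : ℂ), zeta3 * μ, zeta3 ^ 2 * μ}) :
    ∃ (W : Opens R4) (hG : IsSmoothMetric G W), W ≤ U ∧ y ∈ W ∧ ∃ z t r : smoothRing W,
      IsPetrovPullback partialDeriv conjRing hG.metric p ε z t r := by
  obtain ⟨W, hW, hyW, hconv, F, hF, hFE⟩ := h.exists_rootFrame hy hpar.μ_ne_zero hS
  have hE : IsRingEigenFrame G s μ (zeta3 * μ) (zeta3 ^ 2 * μ) (ringMat F hF) :=
    fun z => (hFE z z.2).1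
  have hG := h.metric.mono hW
  have : Nontrivial (smoothRing W) := by
    refine ⟨⟨0, 1, fun hz => ?_⟩⟩
    have := congrArg (evalAt ⟨y, hyW⟩) hz
    rw [map_zero, map_one] at this
    exact zero_ne_one this
  refine ⟨W, hG, hW, hyW, ?_⟩
  refine HasStructureEqs.exists_petrovPullback (A := smoothRing W) (D := partialDeriv)
    (J := conjRing) (g := hG.metric) (Γ := hG.chr) (E := ringMat F hF)
    (isIntegrable_smoothRing hconv) hpar (hE.hasStructureEqs hG) hG.dmat_metric hG.metric_transpose
    (hE.ortho hG) ⟨?_, ?_, ?_, ?_⟩ (fun i j => ?_) (fun m i j => ?_)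
  · intro i; ext z; rw [conjRing_apply]; exact (hFE z z.2).2.conj0 i
  · intro i; ext z; rw [conjRing_apply]; exact (hFE z z.2).2.conj1 i
  · intro i; ext z; rw [conjRing_apply]; exact (hFE z z.2).2.conj2 i
  · intro i; ext z; rw [conjRing_apply]; exact (hFE z z.2).2.conj3 i
  · ext z; rw [conjRing_apply]; exact Complex.conj_ofReal _
  · rw [hG.chr_eq]; exact conjRing_ofRealRing _ _

end SmoothFunctions

/-! ### Coordinates in which the metric is Petrov's metric -/

section PetrovCoordinates

open Matrix
open TopologicalSpace (Opens)

variable {G : R4 → Matrix (Fin 4) (Fin 4) ℝ} {U : Opens R4}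

theorem petrovF_apply (p : ℝ) (v : PetrovV) :
    petrovF p v = ((p : ℂ) * zeta3 * v.1, p * v.2) := rfl

theorem ofReal_re_of_conjRing {f : smoothRing U} (hf : conjRing f = f) (y : U) :
    (((f.1 y).re : ℝ) : ℂ) = f.1 y := by
  have h := conjRing_apply f y
  rw [hf] at h
  exact Complex.conj_eq_iff_re.mp h.symm

theorem fderiv_extension (f : smoothRing U) (y : U) (u : R4) :
    fderiv ℝ (extension f) y u = ∑ i, (u i : ℂ) * (partialDeriv i f).1 y := by
  rw [fderiv_eq_sum_pdC]
  refine Finset.sum_congr rfl fun i _ => ?_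
  rw [partialDeriv_apply i f (extension_apply f)]

/-- The map to Petrov's manifold with the given coordinate functions. -/
def petrovMap (z t r : smoothRing U) (y : R4) : PetrovSpace :=
  ((extension z y, (extension t y).re), (extension r y).re)

theorem contDiffOn_petrovMap (z t r : smoothRing U) : ContDiffOn ℝ ∞ (petrovMap z t r) U :=
  ((contDiffOn_extension z).prodMk (Complex.reCLM.contDiff.comp_contDiffOn
    (contDiffOn_extension t))).prodMk (Complex.reCLM.contDiff.comp_contDiffOn
    (contDiffOn_extension r))

theorem fderiv_petrovMap (z t r : smoothRing U) (y : U) (u : R4) :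
    fderiv ℝ (petrovMap z t r) y u = ((fderiv ℝ (extension z) y u,
      (fderiv ℝ (extension t) y u).re), (fderiv ℝ (extension r) y u).re) := by
  have hd : ∀ f : smoothRing U, HasFDerivAt (extension f) (fderiv ℝ (extension f) y) y := fun f =>
    (((contDiffOn_extension f).contDiffAt (U.isOpen.mem_nhds y.2)).differentiableAt (n := ∞)
      (by simp)).hasFDerivAt
  have h := ((hd z).prodMk (Complex.reCLM.hasFDerivAt.comp y.1 (hd t))).prodMk
    (Complex.reCLM.hasFDerivAt.comp y.1 (hd r))
  exact congrArg (fun L => L u) h.fderiv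

theorem IsPetrovPullback.eval {hG : IsSmoothMetric G U} {p : ℝ} {ε : ℝ} {z t r : smoothRing U}
    (h : IsPetrovPullback partialDeriv conjRing hG.metric p ε z t r) (y : U) (i j : Fin 4) :
    G y i j = - (ε * (((partialDeriv i r).1 y).re * ((partialDeriv j r).1 y).re)) +
      ε * ((((partialDeriv i t).1 y).re + p * (t.1 y).re * ((partialDeriv i r).1 y).re) *
        (((partialDeriv j t).1 y).re + p * (t.1 y).re * ((partialDeriv j r).1 y).re)) +
      (((partialDeriv i z).1 y + p * zeta3 * z.1 y * (partialDeriv i r).1 y) *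
        ((partialDeriv j z).1 y + p * zeta3 * z.1 y * (partialDeriv j r).1 y)).im := by
  have h1 := congrArg (evalAt y) (h.eq i j)
  have hr : ∀ i, (((partialDeriv i r).1 y).re : ℂ) = (partialDeriv i r).1 y := fun i =>
    ofReal_re_of_conjRing (by rw [← partialDeriv_conjRing, h.real_r]) y
  have ht : ∀ i, (((partialDeriv i t).1 y).re : ℂ) = (partialDeriv i t).1 y := fun i =>
    ofReal_re_of_conjRing (by rw [← partialDeriv_conjRing, h.real_t]) y
  have ht0 := ofReal_re_of_conjRing h.real_t y
  have hm : evalAt y (hG.metric i j) = (G y i j : ℂ) := rfl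
  simp only [hm, map_add, map_neg, map_sub, map_mul, AlgHom.commutes, Algebra.algebraMap_self,
    RingHom.id_apply] at h1
  simp only [evalAt_apply, conjRing_apply] at h1
  apply Complex.ofReal_injective
  rw [h1]
  push_cast
  rw [hr, hr, ht, ht, ht0]
  congr 1
  have hk : ∀ c, algebraMap ℂ (U → ℂ) c y = c := fun c => rfl
  rw [hk, hk]
  simp only [← map_mul, ← map_add]
  generalize ((partialDeriv i z).1 y + _) * _ = w
  rw [Complex.sub_conj]
  have := Complex.I_ne_zero
  field_simp
  push_cast
  rw [mul_comm]

/-- The V-part of a tangent vector in Petrov's metric is ξ + τFx, which along the map (z, t, r)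
becomes dz + pζ z dr in ℂ and dt + p t dr in ℝ. -/
theorem IsPetrovPullback.map_form {hG : IsSmoothMetric G U} {p : ℝ} {ε : ℤˣ} {z t r : smoothRing U}
    (h : IsPetrovPullback partialDeriv conjRing hG.metric p ((ε : ℤ) : ℝ) z t r) (y : U) (u v : R4) :
    petrovMetricForm p ε (-ε) (petrovMap z t r y) (fderiv ℝ (petrovMap z t r) y u)
      (fderiv ℝ (petrovMap z t r) y v) = ∑ i, ∑ j, G y i j * u i * v j := by
  have hr : ∀ i, (((partialDeriv i r).1 y).re : ℂ) = (partialDeriv i r).1 y := fun i =>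
    ofReal_re_of_conjRing (by rw [← partialDeriv_conjRing, h.real_r]) y
  have hre : ∀ (f : smoothRing U) (u : R4), (fderiv ℝ (extension f) y u).re =
      ∑ i, u i * ((partialDeriv i f).1 y).re := fun f u => by
    rw [fderiv_extension, Complex.re_sum]
    exact Finset.sum_congr rfl fun i _ => Complex.re_ofReal_mul _ _
  have hz : ∀ u : R4, fderiv ℝ (extension z) y u +
      (fderiv ℝ (extension r) y u).re • (p * zeta3 * z.1 y) =
      ∑ i, (u i : ℂ) * ((partialDeriv i z).1 y + p * zeta3 * z.1 y * (partialDeriv i r).1 y) :=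
      fun u => by
    rw [fderiv_extension, hre, Complex.real_smul]
    push_cast
    simp only [hr, Finset.sum_mul, ← Finset.sum_add_distrib]
    exact Finset.sum_congr rfl fun i _ => by ring
  have ht : ∀ u : R4, (fderiv ℝ (extension t) y u).re +
      (fderiv ℝ (extension r) y u).re * (p * (t.1 y).re) =
      ∑ i, u i * (((partialDeriv i t).1 y).re + p * (t.1 y).re * ((partialDeriv i r).1 y).re) :=
      fun u => by
    rw [hre, hre]
    simp only [Finset.sum_mul, ← Finset.sum_add_distrib]
    exact Finset.sum_congr rfl fun i _ => by ring
  rw [petrovMetricForm_apply, petrovForm_apply, petrovF_apply, fderiv_petrovMap, fderiv_petrovMap]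
  simp only [petrovMap, Prod.fst_add, Prod.snd_add, Prod.smul_fst, Prod.smul_snd, smul_eq_mul,
    extension_apply, hz, ht, h.eval y]
  rw [hre, hre]
  simp only [Finset.sum_mul_sum]
  simp only [Complex.im_sum, Finset.mul_sum, ← Finset.sum_add_distrib]
  refine Finset.sum_congr rfl fun i _ => Finset.sum_congr rfl fun j _ => ?_
  generalize (partialDeriv i z).1 y + _ = a
  generalize (partialDeriv j z).1 y + _ = b
  rw [show (u i : ℂ) * a * (v j * b) = ((u i * v j : ℝ) : ℂ) * (a * b) by push_cast; ring,
    Complex.im_ofReal_mul]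
  push_cast
  ring

theorem finrank_petrovSpace : Module.finrank ℝ R4 = Module.finrank ℝ PetrovSpace := by
  rw [Module.finrank_prod, Module.finrank_prod, Complex.finrank_real_complex, Module.finrank_self,
    finrank_euclideanSpace, Fintype.card_fin]

/-- A map pulling a bilinear form back to a nondegenerate one has an invertible derivative. -/
theorem exists_fderiv_equiv {Φ : R4 → PetrovSpace} {y : R4} (hdet : (G y).det ≠ 0)
    {B : PetrovSpace → PetrovSpace → ℝ} (hB : ∀ v, B 0 v = 0)
    (h : ∀ u v, B (fderiv ℝ Φ y u) (fderiv ℝ Φ y v) = ∑ i, ∑ j, G y i j * u i * v j) :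
    ∃ L : R4 ≃L[ℝ] PetrovSpace, (L : R4 →L[ℝ] PetrovSpace) = fderiv ℝ Φ y := by
  have hinj : Function.Injective (fderiv ℝ Φ y : R4 →ₗ[ℝ] PetrovSpace) := by
    refine (injective_iff_map_eq_zero _).mpr fun u hu => ?_
    have hu' : fderiv ℝ Φ y u = 0 := hu
    have h0 : (fun i => u i) ᵥ* G y = 0 := by
      funext j
      have := h u (EuclideanSpace.single j 1)
      rw [hu', hB] at this
      simp only [PiLp.single_apply, mul_ite, mul_one, mul_zero, Finset.sum_ite_eq',
        Finset.mem_univ, if_true] at this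
      rw [Matrix.vecMul, dotProduct, Pi.zero_apply, this]
      exact Finset.sum_congr rfl fun i _ => mul_comm _ _
    have := Matrix.eq_zero_of_vecMul_eq_zero hdet h0
    ext i
    exact congrFun this i
  refine ⟨(LinearEquiv.ofInjectiveOfFinrankEq _ hinj finrank_petrovSpace).toContinuousLinearEquiv, ?_⟩
  ext1 u
  rfl

/-- The inverse function theorem at y₀ supplies the local homeomorphism. Restricting it to U, where
the derivative is invertible everywhere, makes the inverse smooth on the whole target. -/
theorem exists_local_diffeo {Φ : R4 → PetrovSpace} (hΦ : ContDiffOn ℝ ∞ Φ U)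
    (hL : ∀ y ∈ U, ∃ L : R4 ≃L[ℝ] PetrovSpace, (L : R4 →L[ℝ] PetrovSpace) = fderiv ℝ Φ y) {y0 : R4}
    (hy0 : y0 ∈ U) : ∃ f : OpenPartialHomeomorph R4 PetrovSpace, y0 ∈ f.source ∧
      f.source ⊆ U ∧ (f : R4 → PetrovSpace) = Φ ∧ ContDiffOn ℝ ∞ f.symm f.target := by
  have hc : ∀ y ∈ U, ContDiffAt ℝ ∞ Φ y := fun y hy => hΦ.contDiffAt (U.isOpen.mem_nhds hy)
  have hd : ∀ y ∈ U, HasFDerivAt Φ (fderiv ℝ Φ y) y := fun y hy =>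
    ((hc y hy).differentiableAt (by simp)).hasFDerivAt
  obtain ⟨L, hL0⟩ := hL y0 hy0
  have hd0 := hd y0 hy0
  rw [← hL0] at hd0
  set f0 := (hc y0 hy0).toOpenPartialHomeomorph Φ hd0 (by simp)
  have hf0 : (f0 : R4 → PetrovSpace) = Φ := (hc y0 hy0).toOpenPartialHomeomorph_coe hd0 (by simp)
  refine ⟨f0.restrOpen U U.isOpen, ?_, ?_, hf0, ?_⟩
  · exact ⟨(hc y0 hy0).mem_toOpenPartialHomeomorph_source hd0 (by simp), hy0⟩
  · exact Set.inter_subset_right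
  · intro a ha
    have hs := (f0.restrOpen U U.isOpen).map_target ha
    have hU : (f0.restrOpen U U.isOpen).symm a ∈ U := hs.2
    obtain ⟨L', hL'⟩ := hL _ hU
    have hd' := hd _ hU
    rw [← hL'] at hd'
    exact ((f0.restrOpen U U.isOpen).contDiffAt_symm ha (by exact hf0 ▸ hd')
      (by exact hf0 ▸ hc _ hU)).contDiffWithinAt

end PetrovCoordinates

/-! ### Composition of local isometries -/

section Isometries

variable {E : Type*} [NormedAddCommGroup E] [NormedSpace ℝ E]
  {M : Type*} [TopologicalSpace M] [ChartedSpace E M]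
  {E' : Type*} [NormedAddCommGroup E'] [NormedSpace ℝ E']
  {N : Type*} [TopologicalSpace N] [ChartedSpace E' N]
  {E'' : Type*} [NormedAddCommGroup E''] [NormedSpace ℝ E'']
  {P : Type*} [TopologicalSpace P] [ChartedSpace E'' P]
  {g : PseudoMetric E M} {h : PseudoMetric E' N} {k : PseudoMetric E'' P}

theorem IsIsometry.mdifferentiableAt {f : OpenPartialHomeomorph M N} (hf : IsIsometry g h f) {x : M}
    (hx : x ∈ f.source) : MDifferentiableAt 𝓘(ℝ, E) 𝓘(ℝ, E') f x :=
  (hf.contMDiffOn.contMDiffAt (f.open_source.mem_nhds hx)).mdifferentiableAt (by simp)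

theorem IsIsometry.mdifferentiableAt_symm {f : OpenPartialHomeomorph M N} (hf : IsIsometry g h f)
    {x : N} (hx : x ∈ f.target) : MDifferentiableAt 𝓘(ℝ, E') 𝓘(ℝ, E) f.symm x :=
  (hf.contMDiffOn_symm.contMDiffAt (f.open_target.mem_nhds hx)).mdifferentiableAt (by simp)

theorem IsIsometry.trans {f : OpenPartialHomeomorph M N} {f' : OpenPartialHomeomorph N P}
    (hf : IsIsometry g h f) (hf' : IsIsometry h k f') : IsIsometry g k (f.trans f') where
  contMDiffOn := by
    rw [OpenPartialHomeomorph.trans_source, OpenPartialHomeomorph.coe_trans]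
    exact hf'.contMDiffOn.comp (hf.contMDiffOn.mono Set.inter_subset_left) fun x hx => hx.2
  contMDiffOn_symm := by
    rw [OpenPartialHomeomorph.trans_target, OpenPartialHomeomorph.coe_trans_symm]
    exact hf.contMDiffOn_symm.comp (hf'.contMDiffOn_symm.mono Set.inter_subset_left)
      fun x hx => hx.2
  map_form x hx u v := by
    rw [OpenPartialHomeomorph.trans_source] at hx
    have hc : mfderiv 𝓘(ℝ, E) 𝓘(ℝ, E'') (f.trans f') x =
        (mfderiv 𝓘(ℝ, E') 𝓘(ℝ, E'') f' (f x)).comp (mfderiv 𝓘(ℝ, E) 𝓘(ℝ, E') f x) :=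
      mfderiv_comp x (hf'.mdifferentiableAt hx.2) (hf.mdifferentiableAt hx.1)
    rw [hc, ← hf.map_form x hx.1, ← hf'.map_form (f x) hx.2]
    rfl

theorem PseudoMetric.form_congr (g : PseudoMetric E M) {x x' : M} (hx : x = x') (u v : E) :
    g.form x u v = g.form x' u v := by
  subst hx; rfl

theorem mfderiv_symm_apply {f : OpenPartialHomeomorph M N} {x : N}
    (hf : MDifferentiableAt 𝓘(ℝ, E) 𝓘(ℝ, E') f (f.symm x))
    (hf' : MDifferentiableAt 𝓘(ℝ, E') 𝓘(ℝ, E) f.symm x) (hx : x ∈ f.target) (u : E') :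
    (mfderiv 𝓘(ℝ, E) 𝓘(ℝ, E') f (f.symm x) (mfderiv 𝓘(ℝ, E') 𝓘(ℝ, E) f.symm x u) : E') = u := by
  have hc := mfderiv_comp x hf hf'
  have he : (f ∘ f.symm) =ᶠ[𝓝 x] id :=
    Filter.eventually_of_mem (f.open_target.mem_nhds hx) fun z hz => f.right_inv hz
  rw [he.mfderiv_eq, mfderiv_id] at hc
  exact (congrArg (fun L : E' →L[ℝ] E' => L u) hc).symm

theorem IsIsometry.symm {f : OpenPartialHomeomorph M N} (hf : IsIsometry g h f) :
    IsIsometry h g f.symm where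
  contMDiffOn := hf.contMDiffOn_symm
  contMDiffOn_symm := by rw [OpenPartialHomeomorph.symm_symm]; exact hf.contMDiffOn
  map_form x hx u v := by
    have hx' : x ∈ f.target := hx
    have hs := f.map_target hx'
    rw [← hf.map_form (f.symm x) hs]
    refine (h.form_congr (f.right_inv hx') _ _).trans ?_
    have key := fun w => mfderiv_symm_apply (hf.mdifferentiableAt hs)
      (hf.mdifferentiableAt_symm hx') hx' w
    exact congrArg₂ (fun a b : E' => h.form x a b) (key u) (key v)

/-- Map a neighbourhood of x into G, apply the left translation that carries the image of x to the
image of y, and come back. -/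
theorem LocallyIsometric.locallyHomogeneous {G : Type*} [Group G] [TopologicalSpace G]
    [ChartedSpace E' G] [LieGroup 𝓘(ℝ, E') ∞ G] {h : PseudoMetric E' G} (hg : LocallyIsometric g h)
    (hh : LeftInvariant h) : LocallyHomogeneous g := by
  intro x y
  obtain ⟨f, hx, hf⟩ := hg x
  obtain ⟨f', hy, hf'⟩ := hg y
  have : IsTopologicalGroup G := topologicalGroup_of_lieGroup 𝓘(ℝ, E') ∞
  have hL : ∀ a : G, IsIsometry h h (Homeomorph.mulLeft a).toOpenPartialHomeomorph := fun a =>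
    { contMDiffOn := (contMDiff_mul_left (I := 𝓘(ℝ, E')) (n := ∞) (a := a)).contMDiffOn
      contMDiffOn_symm := (contMDiff_mul_left (I := 𝓘(ℝ, E')) (n := ∞) (a := a⁻¹)).contMDiffOn
      map_form := fun z _ u v => hh a z u v }
  refine ⟨_, ?_, ?_, (hf.trans (hL (f' y * (f x)⁻¹))).trans hf'.symm⟩
  · simp [hx, f'.map_source hy]
  · simp [f'.left_inv hy]

/-- A chart followed by a diffeomorphism that transforms the components of the metric correctly. -/
theorem isIsometry_chart_trans [IsManifold 𝓘(ℝ, E) ∞ M] {h : PseudoMetric E' E'}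
    {φ : OpenPartialHomeomorph M E} (hφ : φ ∈ atlas E M) {f : OpenPartialHomeomorph E E'}
    (hf : ContDiffOn ℝ ∞ f f.source) (hf' : ContDiffOn ℝ ∞ f.symm f.target)
    (hform : ∀ y ∈ f.source, ∀ u v : E, h.form (f y) (fderiv ℝ f y u) (fderiv ℝ f y v) =
      g.form (φ.symm y) (coordVec φ y u) (coordVec φ y v)) :
    IsIsometry g h (φ.trans f) where
  contMDiffOn := by
    rw [OpenPartialHomeomorph.trans_source, OpenPartialHomeomorph.coe_trans]
    exact hf.contMDiffOn.comp ((contMDiffOn_of_mem_maximalAtlas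
      (IsManifold.subset_maximalAtlas hφ)).mono Set.inter_subset_left) fun x hx => hx.2
  contMDiffOn_symm := by
    rw [OpenPartialHomeomorph.trans_target, OpenPartialHomeomorph.coe_trans_symm]
    exact (contMDiffOn_symm_of_mem_maximalAtlas (IsManifold.subset_maximalAtlas hφ)).comp
      (hf'.contMDiffOn.mono Set.inter_subset_left) fun x hx => hx.2
  map_form x hx u v := by
    rw [OpenPartialHomeomorph.trans_source] at hx
    have d1 : MDifferentiableAt 𝓘(ℝ, E) 𝓘(ℝ, E) φ x :=
      ((contMDiffOn_of_mem_maximalAtlas (n := ∞) (IsManifold.subset_maximalAtlas hφ)).contMDiffAt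
        (φ.open_source.mem_nhds hx.1)).mdifferentiableAt (by simp)
    have d2 : MDifferentiableAt 𝓘(ℝ, E) 𝓘(ℝ, E) φ.symm (φ x) :=
      ((contMDiffOn_symm_of_mem_maximalAtlas (n := ∞)
        (IsManifold.subset_maximalAtlas hφ)).contMDiffAt
        (φ.open_target.mem_nhds (φ.map_source hx.1))).mdifferentiableAt (by simp)
    have d3 : DifferentiableAt ℝ f (φ x) :=
      (hf.contDiffAt (f.open_source.mem_nhds hx.2)).differentiableAt (by simp)
    have hc : mfderiv 𝓘(ℝ, E) 𝓘(ℝ, E') (φ.trans f) x =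
        (mfderiv 𝓘(ℝ, E) 𝓘(ℝ, E') f (φ x)).comp (mfderiv 𝓘(ℝ, E) 𝓘(ℝ, E) φ x) :=
      mfderiv_comp x d3.mdifferentiableAt d1
    rw [mfderiv_eq_fderiv] at hc
    have hsymm : ∀ w : E, (coordVec φ (φ x) (mfderiv 𝓘(ℝ, E) 𝓘(ℝ, E) φ x w) : E) = w := fun w => by
      have hc := mfderiv_comp x d2 d1
      have he : (φ.symm ∘ φ) =ᶠ[𝓝 x] id :=
        Filter.eventually_of_mem (φ.open_source.mem_nhds hx.1) fun z hz => φ.left_inv hz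
      rw [he.mfderiv_eq, mfderiv_id] at hc
      exact (congrArg (fun L : E →L[ℝ] E => L w) hc).symm
    rw [hc]
    refine (hform (φ x) hx.2 (mfderiv 𝓘(ℝ, E) 𝓘(ℝ, E) φ x u)
      (mfderiv 𝓘(ℝ, E) 𝓘(ℝ, E) φ x v)).trans ((g.form_congr (φ.left_inv hx.1) _ _).trans ?_)
    exact congrArg₂ (fun a b : E => g.form x a b) (hsymm u) (hsymm v)

end Isometries

/-! ### The Lie group carrying Petrov's metric -/

section PetrovGroup

/-- The flow of the operator `-F`. -/
def petrovFlow (p r : ℝ) (v : PetrovV) : PetrovV :=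
  (Complex.exp (-(r * p * zeta3)) * v.1, Real.exp (-(r * p)) * v.2)

theorem petrovFlow_add (p r r' : ℝ) (v : PetrovV) :
    petrovFlow p (r + r') v = petrovFlow p r (petrovFlow p r' v) := by
  refine Prod.ext ?_ ?_
  · change Complex.exp _ * v.1 = Complex.exp _ * (Complex.exp _ * v.1)
    rw [← mul_assoc, ← Complex.exp_add]
    congr 2
    push_cast
    ring
  · change Real.exp _ * v.2 = Real.exp _ * (Real.exp _ * v.2)
    rw [← mul_assoc, ← Real.exp_add]
    congr 2
    ring

theorem petrovFlow_zero (p : ℝ) (v : PetrovV) : petrovFlow p 0 v = v := by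
  refine Prod.ext ?_ ?_ <;> simp [petrovFlow]

theorem petrovFlow_map_add (p r : ℝ) (v w : PetrovV) :
    petrovFlow p r (v + w) = petrovFlow p r v + petrovFlow p r w := by
  refine Prod.ext ?_ ?_ <;> simp [petrovFlow, mul_add]

theorem petrovFlow_map_neg (p r : ℝ) (v : PetrovV) :
    petrovFlow p r (-v) = - petrovFlow p r v := by
  refine Prod.ext ?_ ?_ <;> simp [petrovFlow]

theorem contDiff_petrovFlow (p : ℝ) : ContDiff ℝ ∞ fun a : ℝ × PetrovV => petrovFlow p a.1 a.2 := by
  have h : ContDiff ℝ ∞ fun a : ℝ × PetrovV => (a.1 : ℂ) :=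
    Complex.ofRealCLM.contDiff.comp contDiff_fst
  have h1 : ContDiff ℝ ∞ fun a : ℝ × PetrovV => Complex.exp (-(a.1 * p * zeta3)) := by fun_prop
  unfold petrovFlow
  fun_prop

theorem hasDerivAt_petrovFlow (p r : ℝ) (v : PetrovV) :
    HasDerivAt (fun r => petrovFlow p r v) (- petrovF p (petrovFlow p r v)) r := by
  have h1 : HasDerivAt (fun r : ℝ => Complex.exp (-(r * p * zeta3)) * v.1)
      (-((p : ℂ) * zeta3 * (Complex.exp (-(r * p * zeta3)) * v.1))) r := by
    have h : HasDerivAt (fun r : ℝ => -((r : ℂ) * p * zeta3)) (-(1 * p * zeta3)) r :=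
      ((Complex.ofRealCLM.hasDerivAt.mul_const _).mul_const _).neg
    refine (h.cexp.mul_const _).congr_deriv ?_
    ring
  have h2 : HasDerivAt (fun r : ℝ => Real.exp (-(r * p)) * v.2)
      (-(p * (Real.exp (-(r * p)) * v.2))) r := by
    have h : HasDerivAt (fun r : ℝ => -(r * p)) (-(1 * p)) r :=
      ((hasDerivAt_id r).mul_const _).neg
    refine (h.exp.mul_const _).congr_deriv ?_
    ring
  exact h1.prodMk h2

/-- The Lie group underlying Petrov's manifold, modelled on Euclidean space. -/
def PetrovGroup (_p : ℝ) : Type := R4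

variable (p : ℝ)

instance : TopologicalSpace (PetrovGroup p) := inferInstanceAs (TopologicalSpace R4)
instance : T2Space (PetrovGroup p) := inferInstanceAs (T2Space R4)
instance : SecondCountableTopology (PetrovGroup p) := inferInstanceAs (SecondCountableTopology R4)
instance : ChartedSpace R4 (PetrovGroup p) := chartedSpaceSelf R4
instance : IsManifold (𝓡 4) ∞ (PetrovGroup p) := instIsManifoldModelSpace

/-- Linear coordinates on Petrov's manifold. -/
def petrovEquiv : R4 ≃L[ℝ] PetrovSpace := ContinuousLinearEquiv.ofFinrankEq finrank_petrovSpace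

/-- The product of Petrov's group. -/
def petrovMul (a b : PetrovSpace) : PetrovSpace := (b.1 + petrovFlow p b.2 a.1, b.2 + a.2)

/-- The inverse of Petrov's group. -/
def petrovInv (a : PetrovSpace) : PetrovSpace := (-petrovFlow p (-a.2) a.1, -a.2)

theorem petrovMul_assoc (a b c : PetrovSpace) :
    petrovMul p (petrovMul p a b) c = petrovMul p a (petrovMul p b c) := by
  refine Prod.ext ?_ ?_
  · simp only [petrovMul]
    rw [petrovFlow_map_add, petrovFlow_add, add_assoc]
  · simp only [petrovMul]; ring

theorem zero_petrovMul (a : PetrovSpace) : petrovMul p 0 a = a := by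
  refine Prod.ext (Prod.ext ?_ ?_) ?_ <;> simp [petrovMul, petrovFlow]

theorem petrovMul_zero (a : PetrovSpace) : petrovMul p a 0 = a := by
  refine Prod.ext (Prod.ext ?_ ?_) ?_ <;> simp [petrovMul, petrovFlow]

instance : Group (PetrovGroup p) where
  mul a b := petrovEquiv.symm (petrovMul p (petrovEquiv a) (petrovEquiv b))
  one := petrovEquiv.symm 0
  inv a := petrovEquiv.symm (petrovInv p (petrovEquiv a))
  mul_assoc a b c := by
    change petrovEquiv.symm (petrovMul p (petrovEquiv (petrovEquiv.symm _)) _) =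
      petrovEquiv.symm (petrovMul p _ (petrovEquiv (petrovEquiv.symm _)))
    rw [ContinuousLinearEquiv.apply_symm_apply, ContinuousLinearEquiv.apply_symm_apply,
      petrovMul_assoc]
  one_mul a := by
    change petrovEquiv.symm (petrovMul p (petrovEquiv (petrovEquiv.symm 0)) (petrovEquiv a)) = a
    rw [ContinuousLinearEquiv.apply_symm_apply, zero_petrovMul]
    exact petrovEquiv.symm_apply_apply _
  mul_one a := by
    change petrovEquiv.symm (petrovMul p (petrovEquiv a) (petrovEquiv (petrovEquiv.symm 0))) = a
    rw [ContinuousLinearEquiv.apply_symm_apply, petrovMul_zero]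
    exact petrovEquiv.symm_apply_apply _
  inv_mul_cancel a := by
    change petrovEquiv.symm (petrovMul p (petrovEquiv (petrovEquiv.symm _)) (petrovEquiv a)) =
      petrovEquiv.symm 0
    rw [ContinuousLinearEquiv.apply_symm_apply]
    congr 1
    simp only [petrovMul, petrovInv]
    rw [petrovFlow_map_neg, ← petrovFlow_add, add_neg_cancel, petrovFlow_zero]
    simp

theorem petrovGroup_mul (a b : PetrovGroup p) :
    petrovEquiv (a * b : PetrovGroup p) = petrovMul p (petrovEquiv a) (petrovEquiv b) :=
  ContinuousLinearEquiv.apply_symm_apply _ _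

instance : LieGroup (𝓡 4) ∞ (PetrovGroup p) where
  contMDiff_mul := by
    have h : ContDiff ℝ ∞ fun a : R4 × R4 =>
        petrovEquiv.symm (petrovMul p (petrovEquiv a.1) (petrovEquiv a.2)) := by
      refine petrovEquiv.symm.contDiff.comp ?_
      have h1 : ContDiff ℝ ∞ fun a : R4 × R4 => petrovEquiv a.1 :=
        petrovEquiv.contDiff.comp contDiff_fst
      have h2 : ContDiff ℝ ∞ fun a : R4 × R4 => petrovEquiv a.2 :=
        petrovEquiv.contDiff.comp contDiff_snd
      exact (h2.fst.add ((contDiff_petrovFlow p).comp (h2.snd.prodMk h1.fst))).prodMk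
        (h2.snd.add h1.snd)
    have h' := h.contMDiff
    rw [modelWithCornersSelf_prod, ← chartedSpaceSelf_prod] at h'
    exact h'
  contMDiff_inv := by
    have h : ContDiff ℝ ∞ fun a : R4 => petrovEquiv.symm (petrovInv p (petrovEquiv a)) := by
      refine petrovEquiv.symm.contDiff.comp ?_
      have h1 : ContDiff ℝ ∞ fun a : R4 => petrovEquiv a := petrovEquiv.contDiff
      exact ((contDiff_petrovFlow p).comp (h1.snd.neg.prodMk h1.fst)).neg.prodMk h1.snd.neg
    exact h.contMDiff

/-- Left translation by a adds the flow e^{−x₂F}a₁ to the V-coordinate. Its derivative contributes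
−F of that term, which cancels the change of the term Fx in the V-part, so u is left-invariant. -/
theorem petrovMul_form (ε δ : ℤˣ) (a x u v : PetrovSpace) :
    petrovMetricForm p ε δ (petrovMul p a x) (fderiv ℝ (petrovMul p a) x u)
      (fderiv ℝ (petrovMul p a) x v) = petrovMetricForm p ε δ x u v := by
  have hd : ∀ w : PetrovSpace, fderiv ℝ (petrovMul p a) x w =
      (w.1 + w.2 • - petrovF p (petrovFlow p x.2 a.1), w.2) := by
    intro w
    have h1 : HasFDerivAt (fun x : PetrovSpace => petrovFlow p x.2 a.1) _ x :=
      (hasDerivAt_petrovFlow p x.2 a.1).hasFDerivAt.comp x hasFDerivAt_snd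
    have h := (hasFDerivAt_fst.add h1).prodMk (hasFDerivAt_snd.add_const a.2)
    exact congrArg (fun L => L w) h.fderiv
  rw [hd, hd, petrovMetricForm_apply, petrovMetricForm_apply]
  have key : ∀ w : PetrovSpace, w.1 + w.2 • - petrovF p (petrovFlow p x.2 a.1) +
      w.2 • petrovF p (petrovMul p a x).1 = w.1 + w.2 • petrovF p x.1 := by
    intro w
    rw [petrovMul, map_add, smul_add, smul_neg]
    abel
  simp only [key]

/-- Petrov's metric, as a metric on the group. -/
def petrovGroupMetric (ε δ : ℤˣ) : PseudoMetric R4 (PetrovGroup p) where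
  form a := ((petrovMetricForm p ε δ (petrovEquiv a)).bilinearComp
    (petrovEquiv : R4 →L[ℝ] PetrovSpace) (petrovEquiv : R4 →L[ℝ] PetrovSpace) : R4 →L[ℝ] R4 →L[ℝ] ℝ)
  symm a u v := petrovMetricForm_symm p ε δ _ _ _
  nondegenerate a u hu := by
    have h := (petrovMetric p ε δ).nondegenerate (petrovEquiv a) (petrovEquiv u) fun v => by
      have := hu (petrovEquiv.symm v)
      exact (congrArg (petrovMetricForm p ε δ (petrovEquiv a) (petrovEquiv u))
        (petrovEquiv.apply_symm_apply v)).symm.trans this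
    exact (map_eq_zero_iff _ petrovEquiv.injective).mp h
  smooth φ hφ v w := by
    have hφ' : φ = OpenPartialHomeomorph.refl R4 := hφ
    subst hφ'
    have h : ∀ y v : R4, (coordVec (OpenPartialHomeomorph.refl R4) y v : R4) = v := by
      intro y v
      have : mfderiv 𝓘(ℝ, R4) 𝓘(ℝ, R4) (id : R4 → R4) y v = v := by
        rw [mfderiv_id]; rfl
      exact this
    have h' : ContDiff ℝ ∞ fun y : R4 =>
        petrovMetricForm p ε δ (petrovEquiv y) (petrovEquiv v) (petrovEquiv w) := by
      simp only [petrovMetricForm_apply]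
      fun_prop
    refine h'.contDiffOn.congr fun y _ => ?_
    exact congrArg₂ (fun a b : R4 => petrovMetricForm p ε δ (petrovEquiv y) (petrovEquiv a)
      (petrovEquiv b)) (h y v) (h y w)

theorem mfderiv_petrovMul (a x w : R4) : petrovEquiv (mfderiv 𝓘(ℝ, R4) 𝓘(ℝ, R4) (fun z : R4 =>
    petrovEquiv.symm (petrovMul p (petrovEquiv a) (petrovEquiv z))) x w) =
    fderiv ℝ (petrovMul p (petrovEquiv a)) (petrovEquiv x) (petrovEquiv w) := by
  have hdm : DifferentiableAt ℝ (petrovMul p (petrovEquiv a)) (petrovEquiv x) := by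
    have h : ContDiff ℝ ∞ (petrovMul p (petrovEquiv a)) :=
      (contDiff_fst.add ((contDiff_petrovFlow p).comp (contDiff_snd.prodMk contDiff_const))).prodMk
        (contDiff_snd.add contDiff_const)
    exact h.differentiable (by simp) _
  have h1 : HasFDerivAt (fun z : R4 => petrovEquiv.symm (petrovMul p (petrovEquiv a) (petrovEquiv z)))
      ((petrovEquiv.symm : PetrovSpace →L[ℝ] R4).comp
        ((fderiv ℝ (petrovMul p (petrovEquiv a)) (petrovEquiv x)).comp
          (petrovEquiv : R4 →L[ℝ] PetrovSpace))) x :=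
    petrovEquiv.symm.hasFDerivAt.comp x (hdm.hasFDerivAt.comp x petrovEquiv.hasFDerivAt)
  have h2 : mfderiv 𝓘(ℝ, R4) 𝓘(ℝ, R4) (fun z : R4 =>
      petrovEquiv.symm (petrovMul p (petrovEquiv a) (petrovEquiv z))) x = _ :=
    mfderiv_eq_fderiv.trans h1.fderiv
  exact (congrArg (fun L : R4 →L[ℝ] R4 => petrovEquiv (L w)) h2).trans
    (petrovEquiv.apply_symm_apply _)

theorem leftInvariant_petrovGroupMetric (ε δ : ℤˣ) : LeftInvariant (petrovGroupMetric p ε δ) := by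
  intro a x u v
  refine Eq.trans ?_ (petrovMul_form p ε δ (petrovEquiv a) (petrovEquiv x) (petrovEquiv u)
    (petrovEquiv v))
  refine (congrArg (fun q => petrovMetricForm p ε δ q _ _) (petrovGroup_mul p a x)).trans ?_
  exact congrArg₂ (fun q q' : PetrovSpace => petrovMetricForm p ε δ
    (petrovMul p (petrovEquiv a) (petrovEquiv x)) q q') (mfderiv_petrovMul p a x u)
    (mfderiv_petrovMul p a x v)

theorem isIsometry_petrovEquiv (ε δ : ℤˣ) : IsIsometry (petrovMetric p ε δ) (petrovGroupMetric p ε δ)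
    (petrovEquiv.symm.toHomeomorph.toOpenPartialHomeomorph :
      OpenPartialHomeomorph PetrovSpace R4) where
  contMDiffOn := petrovEquiv.symm.contDiff.contMDiff.contMDiffOn
  contMDiffOn_symm := petrovEquiv.contDiff.contMDiff.contMDiffOn
  map_form x _ u v := by
    have hd : ∀ w : PetrovSpace,
        petrovEquiv (mfderiv 𝓘(ℝ, PetrovSpace) 𝓘(ℝ, R4) petrovEquiv.symm x w) = w := by
      intro w
      rw [mfderiv_eq_fderiv, petrovEquiv.symm.fderiv]
      exact petrovEquiv.apply_symm_apply w
    refine (congrArg (fun q => petrovMetricForm p ε δ q _ _) (petrovEquiv.apply_symm_apply x)).trans ?_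
    exact congrArg₂ (fun q q' : PetrovSpace => petrovMetricForm p ε δ x q q') (hd u) (hd v)

end PetrovGroup

/-! ### The scalar curvature -/

section ScalarCurvature

open Matrix
open TopologicalSpace (Opens)

variable {G : R4 → Matrix (Fin 4) (Fin 4) ℝ} {s : R4 → ℝ} {U : Opens R4} {y : R4}

/-- The sum of the squares of the self-dual bivectors of a frame, minus the metric part. -/
def volPart (E : Matrix (Fin 4) (Fin 4) ℂ) (i j a b : Fin 4) : ℂ :=
  (E * quat1 ℂ * Eᵀ) i j * (E * quat1 ℂ * Eᵀ) a b + (E * quat2 ℂ * Eᵀ) i j * (E * quat2 ℂ * Eᵀ) a b +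
    (E * quat3 ℂ * Eᵀ) i j * (E * quat3 ℂ * Eᵀ) a b -
    ((E * Eᵀ) i a * (E * Eᵀ) j b - (E * Eᵀ) i b * (E * Eᵀ) j a)

/-- The sum Σ ωᵢ⊗ωᵢ is twice the projection onto Λ⁺, that is, identity plus star. Removing the
metric part leaves the volume 4-vector e₀∧e₁∧e₂∧e₃, which is totally skew. -/
theorem volPart_cyclic (E : Matrix (Fin 4) (Fin 4) ℂ) (i j a b : Fin 4) :
    volPart E i j a b = volPart E j a i b := by
  have t1 : ∀ i j, (E * quat1 ℂ * Eᵀ) i j = _ := fun i j => by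
    have := transpose_mul_quat1_mul Eᵀ i j
    rwa [transpose_transpose] at this
  have t2 : ∀ i j, (E * quat2 ℂ * Eᵀ) i j = _ := fun i j => by
    have := transpose_mul_quat2_mul Eᵀ i j
    rwa [transpose_transpose] at this
  have t3 : ∀ i j, (E * quat3 ℂ * Eᵀ) i j = _ := fun i j => by
    have := transpose_mul_quat3_mul Eᵀ i j
    rwa [transpose_transpose] at this
  simp only [volPart, t1, t2, t3, sdForm, wedge11, Matrix.mul_apply (M := E), Fin.sum_univ_four, transpose_apply]
  ring

/-- Cyclic permutation of three indices fixes the first factor, so the sum is one third of its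
cyclic symmetrization, which the first Bianchi identity makes zero. -/
theorem sum_volPart_mul (E : Matrix (Fin 4) (Fin 4) ℂ) {T : Comp4}
    (hT : ∀ i j k l, T i j k l + T j k i l + T k i j l = 0) :
    ∑ i, ∑ j, ∑ a, ∑ b, volPart E i j a b * (T i j a b : ℂ) = 0 := by
  set f : Fin 4 → Fin 4 → Fin 4 → ℂ := fun i j a => ∑ b, volPart E i j a b * (T i j a b : ℂ)
  have hf : ∀ i j a, f i j a + f j a i + f a i j = 0 := by
    intro i j a
    simp only [f, ← Finset.sum_add_distrib]
    refine Finset.sum_eq_zero fun b _ => ?_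
    rw [← volPart_cyclic E i j a, volPart_cyclic E a i j, ← mul_add, ← mul_add]
    have : ((T i j a b + T j a i b + T a i j b : ℝ) : ℂ) = 0 := by rw [hT]; simp
    push_cast at this
    rw [this, mul_zero]
  have h1 : ∑ i, ∑ j, ∑ a, f j a i = ∑ i, ∑ j, ∑ a, f i j a := by
    rw [Finset.sum_comm]
    exact Finset.sum_congr rfl fun j _ => Finset.sum_comm
  have h2 : ∑ i, ∑ j, ∑ a, f a i j = ∑ i, ∑ j, ∑ a, f i j a := by
    rw [Finset.sum_congr rfl fun i _ => Finset.sum_comm]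
    exact Finset.sum_comm
  have h3 : ∑ i, ∑ j, ∑ a, (f i j a + f j a i + f a i j) = 0 :=
    Finset.sum_eq_zero fun i _ => Finset.sum_eq_zero fun j _ => Finset.sum_eq_zero fun a _ => hf i j a
  simp only [Finset.sum_add_distrib] at h3
  rw [h1, h2] at h3
  have : (3 : ℂ) * ∑ i, ∑ j, ∑ a, f i j a = 0 := by linear_combination h3
  exact (mul_eq_zero.mp this).resolve_left three_ne_zero

/-- Each self-dual bivector of an orthonormal frame has trace norm 4, and the contraction carries a
factor ½; hence 2 · 4l. -/
theorem sum_contract_eigen {g : Matrix (Fin 4) (Fin 4) ℝ} (hdet : g.det ≠ 0) (hg : gᵀ = g)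
    {E Q : Matrix (Fin 4) (Fin 4) ℂ} (hE : Eᵀ * cmat g * E = 1) (hQ : Q * Q = -1) (hQt : Qᵀ = -Q)
    {T : Comp4} {l : ℂ} (h : complexOp (raise g T) (E * Q * Eᵀ) = l • (E * Q * Eᵀ)) :
    ∑ i, ∑ j, ∑ a, ∑ b, (E * Q * Eᵀ) i j * (E * Q * Eᵀ) a b * (T i j a b : ℂ) = 8 * l := by
  have h1 := contract_eq_of_complexOp hdet hg h
  have h2 : ((E * Q * Eᵀ)ᵀ * contract T (E * Q * Eᵀ)).trace = 4 * l := by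
    rw [h1]
    have e : (E * Q * Eᵀ)ᵀ * (cmat g * (l • (E * Q * Eᵀ)) * cmat g) =
        l • (E * (Qᵀ * (Eᵀ * cmat g * E) * Q) * (Eᵀ * cmat g)) := by
      simp only [transpose_mul, transpose_transpose, Matrix.mul_smul, Matrix.smul_mul,
        Matrix.mul_assoc]
    rw [e, hE, Matrix.mul_one, hQt, Matrix.neg_mul, hQ, neg_neg, Matrix.mul_one, trace_smul,
      trace_mul_comm, hE, trace_one, Fintype.card_fin, smul_eq_mul]
    push_cast
    ring
  have h3 : ((E * Q * Eᵀ)ᵀ * contract T (E * Q * Eᵀ)).trace = ∑ a, ∑ b, (E * Q * Eᵀ) a b *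
      ((1 / 2 : ℂ) * ∑ i, ∑ j, (E * Q * Eᵀ) i j * (T i j a b : ℂ)) := by
    rw [Matrix.trace, Finset.sum_comm]
    rfl
  rw [h3] at h2
  generalize E * Q * Eᵀ = α at h2
  have h4 : ∑ i, ∑ j, ∑ a, ∑ b, α i j * α a b * (T i j a b : ℂ) =
      ∑ a, ∑ b, ∑ i, ∑ j, α i j * α a b * (T i j a b : ℂ) := by
    rw [sum_four_comm]
    exact Finset.sum_comm
  rw [h4, show (8 : ℂ) * l = 2 * (4 * l) by ring, ← h2]
  simp only [Finset.mul_sum]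
  refine Finset.sum_congr rfl fun a _ => Finset.sum_congr rfl fun b _ =>
    Finset.sum_congr rfl fun i _ => Finset.sum_congr rfl fun j _ => ?_
  ring

theorem scalarCurvature_eq_sum_lowered (hdet : (G y).det ≠ 0) (hg : (G y)ᵀ = G y) :
    scalarCurvature G y =
      ∑ i, ∑ j, ∑ a, ∑ b, (G y)⁻¹ i a * (G y)⁻¹ j b * lowered G y i j a b := by
  have hinv : ∀ m j, ∑ b, (G y)⁻¹ j b * G y m b = if m = j then 1 else 0 := by
    intro m j
    have h := congrFun (congrFun (nonsing_inv_mul (G y) (isUnit_iff_ne_zero.mpr hdet)) j) m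
    rw [Matrix.mul_apply, Matrix.one_apply] at h
    rw [if_congr (eq_comm (a := m)) rfl rfl, ← h]
    refine Finset.sum_congr rfl fun b _ => ?_
    rw [← congrFun (congrFun hg b) m, transpose_apply]
  have key : ∀ i j a, ∑ b, (G y)⁻¹ i a * (G y)⁻¹ j b * lowered G y i j a b =
      (G y)⁻¹ i a * curvature G y i j a j := by
    intro i j a
    simp only [lowered, mul_assoc, ← Finset.mul_sum]
    congr 1
    simp only [Finset.mul_sum]
    rw [Finset.sum_comm]
    have : ∀ m, ∑ b, (G y)⁻¹ j b * (curvature G y i j a m * G y m b) =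
        curvature G y i j a m * if m = j then 1 else 0 := by
      intro m
      rw [← hinv m j, Finset.mul_sum]
      exact Finset.sum_congr rfl fun b _ => by ring
    simp only [this, mul_ite, mul_one, mul_zero, Finset.sum_ite_eq', Finset.mem_univ, if_true]
  simp only [key, scalarCurvature, ricci, Finset.mul_sum]
  exact Finset.sum_congr rfl fun i _ => Finset.sum_comm

theorem quat_mul_self : quat1 ℂ * quat1 ℂ = -1 ∧ quat2 ℂ * quat2 ℂ = -1 ∧ quat3 ℂ * quat3 ℂ = -1 := by
  refine ⟨?_, ?_, ?_⟩ <;> ext i j <;> fin_cases i <;> fin_cases j <;>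
    simp [quat1, quat2, quat3, Matrix.mul_apply, Fin.sum_univ_four]

theorem quat_units_transpose :
    (quat1 ℂ)ᵀ = - quat1 ℂ ∧ (quat2 ℂ)ᵀ = - quat2 ℂ ∧ (quat3 ℂ)ᵀ = - quat3 ℂ := by
  refine ⟨?_, ?_, ?_⟩ <;> ext i j <;> fin_cases i <;> fin_cases j <;> simp [quat1, quat2, quat3]

/-- The trace of the self-dual curvature operator is a quarter of the scalar curvature. -/
theorem IsEigenFrame.scalarCurvature_eq {l1 l2 l3 : ℂ} {F : Matrix (Fin 4) (Fin 4) ℂ}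
    (h : IsEigenFrame G s y l1 l2 l3 F) (hG : IsSmoothMetric G U) (hy : y ∈ U) :
    (scalarCurvature G y : ℂ) = 4 * (l1 + l2 + l3) := by
  have hdet := hG.det_ne_zero y hy
  have hg := hG.symm y hy
  obtain ⟨q1, q2, q3⟩ := quat_mul_self
  obtain ⟨p1, p2, p3⟩ := quat_units_transpose
  have e1 := sum_contract_eigen (T := lowered G y) hdet hg h.frame.ortho q1 p1 h.eigen1
  have e2 := sum_contract_eigen (T := lowered G y) hdet hg h.frame.ortho q2 p2 h.eigen2
  have e3 := sum_contract_eigen (T := lowered G y) hdet hg h.frame.ortho q3 p3 h.eigen3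
  have ev := sum_volPart_mul F (hG.lowered_bianchi hy)
  have hs := congrArg (fun x : ℝ => (x : ℂ)) (scalarCurvature_eq_sum_lowered hdet hg)
  have hinv : ∀ i j, ((G y)⁻¹ i j : ℂ) = (F * Fᵀ) i j := fun i j => by
    rw [← cmat_inv_eq hdet h.frame.ortho]; rfl
  push_cast at hs
  simp only [hinv] at hs
  have hs' : (scalarCurvature G y : ℂ) = - ∑ i, ∑ j, ∑ a, ∑ b, (F * Fᵀ) i b * (F * Fᵀ) j a *
      (lowered G y i j a b : ℂ) := by
    rw [hs, ← Finset.sum_neg_distrib]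
    refine Finset.sum_congr rfl fun i _ => ?_
    rw [← Finset.sum_neg_distrib]
    refine Finset.sum_congr rfl fun j _ => ?_
    rw [Finset.sum_comm, ← Finset.sum_neg_distrib]
    refine Finset.sum_congr rfl fun b _ => ?_
    rw [← Finset.sum_neg_distrib]
    refine Finset.sum_congr rfl fun a _ => ?_
    rw [hG.lowered_skew_right hy i j a b]
    push_cast
    ring
  -- Contracting the curvature with Σ ωᵢ⊗ωᵢ gives 8 Σ lᵢ. Only the metric part contributes, and its
  -- two terms each give the scalar curvature by skewness in the last two indices.
  have htot : 8 * l1 + 8 * l2 + 8 * l3 =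
      (scalarCurvature G y : ℂ) + (scalarCurvature G y : ℂ) := by
    rw [← e1, ← e2, ← e3, ← sub_zero (_ + _ + _), ← ev]
    nth_rewrite 1 [hs]
    rw [hs', ← sub_eq_add_neg]
    simp only [← Finset.sum_sub_distrib, ← Finset.sum_add_distrib]
    refine Finset.sum_congr rfl fun i _ => Finset.sum_congr rfl fun j _ =>
      Finset.sum_congr rfl fun a _ => Finset.sum_congr rfl fun b _ => ?_
    rw [volPart]
    ring
  linear_combination -htot / 2

theorem IsCurvatureChart.scalarCurvature_eq_zero {S : Set ℂ} (h : IsCurvatureChart G s U S)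
    (hy : y ∈ U) {μ : ℝ} (hμ : μ ≠ 0) (hS : S = {(μ : ℂ), zeta3 * μ, zeta3 ^ 2 * μ}) :
    scalarCurvature G y = 0 := by
  obtain ⟨W, hW, hyW, -, F, -, hF⟩ := h.exists_rootFrame hy hμ hS
  have := (hF y hyW).1.scalarCurvature_eq h.metric hy
  rw [show (μ : ℂ) + zeta3 * μ + zeta3 ^ 2 * μ = 0 by linear_combination (μ : ℂ) * zeta3_sq,
    mul_zero] at this
  exact_mod_cast this

end ScalarCurvature

/-! ### Charts of a neutral four-manifold -/

section Charts

open Matrix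
open TopologicalSpace (Opens)

variable {M : Type*} [TopologicalSpace M] [ChartedSpace R4 M] {g : PseudoMetric R4 M}
  {o : ManifoldOrientation M} {φ : OpenPartialHomeomorph M R4} {y : R4}

theorem clm_eq_sum {F : Type*} [NormedAddCommGroup F] [NormedSpace ℝ F] (L : R4 →L[ℝ] F) (v : R4) :
    L v = ∑ i, v i • L (EuclideanSpace.single i 1) := by
  have hv : v = ∑ i, v i • EuclideanSpace.single i (1 : ℝ) := by
    ext j
    simp [Pi.single_apply]
  conv_lhs => rw [hv]
  simp only [map_sum, map_smul]

theorem form_coordVec (g : PseudoMetric R4 M) (φ : OpenPartialHomeomorph M R4) (y u v : R4) :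
    g.form (φ.symm y) (coordVec φ y u) (coordVec φ y v) =
      ∑ i, ∑ j, comps g φ y i j * u i * v j := by
  have key : ∀ (B : R4 →L[ℝ] R4 →L[ℝ] ℝ) (L : R4 →L[ℝ] R4), B (L u) (L v) =
      ∑ i, ∑ j, B (L (EuclideanSpace.single i 1)) (L (EuclideanSpace.single j 1)) * u i * v j := by
    intro B L
    refine (clm_eq_sum ((B (L u)).comp L) v).trans ?_
    rw [Finset.sum_comm]
    refine Finset.sum_congr rfl fun j _ => ?_
    have h := clm_eq_sum ((B.comp L).flip (L (EuclideanSpace.single j 1))) u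
    change B (L u) (L (EuclideanSpace.single j 1)) =
      ∑ i, u i • B (L (EuclideanSpace.single i 1)) (L (EuclideanSpace.single j 1)) at h
    rw [ContinuousLinearMap.comp_apply, h, smul_eq_mul, Finset.mul_sum]
    exact Finset.sum_congr rfl fun i _ => by rw [smul_eq_mul]; ring
  exact key (g.form (φ.symm y)) (mfderiv 𝓘(ℝ, R4) 𝓘(ℝ, R4) φ.symm y)

theorem frameSign_sq (o : ∀ x : M, Orientation ℝ (TangentSpace (𝓡 4) x) (Fin 4))
    (φ : OpenPartialHomeomorph M R4) (y : R4) : frameSign o φ y ^ 2 = 1 := by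
  rw [frameSign]
  split_ifs <;> norm_num

/-- A continuous function with values ±1 is locally constant. -/
theorem contDiffOn_frameSign (o : ManifoldOrientation M) (hφ : φ ∈ atlas R4 M) :
    ContDiffOn ℝ ∞ (frameSign o.at_point φ) φ.target := by
  intro y hy
  have hc := (o.continuous φ hφ).continuousAt (φ.open_target.mem_nhds hy)
  have hev : ∀ᶠ z in 𝓝 y, frameSign o.at_point φ z = frameSign o.at_point φ y := by
    filter_upwards [hc.eventually (Metric.ball_mem_nhds _ one_pos)] with z hz
    replace hz : dist (frameSign o.at_point φ z) (frameSign o.at_point φ y) < 1 := hz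
    rw [Real.dist_eq, abs_lt] at hz
    rcases sq_eq_one_iff.mp (frameSign_sq o.at_point φ z) with h1 | h1 <;>
    rcases sq_eq_one_iff.mp (frameSign_sq o.at_point φ y) with h2 | h2 <;>
    rw [h1, h2] at hz ⊢ <;> norm_num at hz
  exact (contDiffAt_const.congr_of_eventuallyEq hev).contDiffWithinAt

variable [IsManifold (𝓡 4) ∞ M]

theorem coordVec_surjective (hφ : φ ∈ atlas R4 M) (hy : y ∈ φ.target) :
    Function.Surjective (fun v : R4 => (coordVec φ y v : R4)) := by
  have d1 : MDifferentiableAt 𝓘(ℝ, R4) 𝓘(ℝ, R4) φ (φ.symm y) :=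
    ((contMDiffOn_of_mem_maximalAtlas (n := ∞) (IsManifold.subset_maximalAtlas hφ)).contMDiffAt
      (φ.open_source.mem_nhds (φ.map_target hy))).mdifferentiableAt (by simp)
  have d2 : MDifferentiableAt 𝓘(ℝ, R4) 𝓘(ℝ, R4) φ.symm y :=
    ((contMDiffOn_symm_of_mem_maximalAtlas (n := ∞)
      (IsManifold.subset_maximalAtlas hφ)).contMDiffAt
      (φ.open_target.mem_nhds hy)).mdifferentiableAt (by simp)
  let L : R4 →L[ℝ] R4 := mfderiv 𝓘(ℝ, R4) 𝓘(ℝ, R4) φ.symm y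
  have hinj : Function.Injective (L : R4 →ₗ[ℝ] R4) :=
    Function.LeftInverse.injective (g := fun w : R4 =>
      (mfderiv 𝓘(ℝ, R4) 𝓘(ℝ, R4) φ (φ.symm y) w : R4)) fun u => mfderiv_symm_apply d1 d2 hy u
  exact (LinearMap.injective_iff_surjective (f := (L : R4 →ₗ[ℝ] R4))).mp hinj

theorem IsNeutral.comps_congruent (h : IsNeutral g) (hφ : φ ∈ atlas R4 M) (hy : y ∈ φ.target) :
    ∃ B : Matrix (Fin 4) (Fin 4) ℝ,
      Bᵀ * comps g φ y * B = Matrix.diagonal ![(-1 : ℝ), -1, 1, 1] := by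
  obtain ⟨e, he⟩ := h (φ.symm y)
  choose b hb using fun j => coordVec_surjective hφ hy (e j)
  refine ⟨Matrix.of fun i j => b j i, ?_⟩
  ext i j
  rw [← he i j]
  refine Eq.trans ?_ ((form_coordVec g φ y (b i) (b j)).symm.trans
    (congrArg₂ (fun u v : R4 => g.form (φ.symm y) u v) (hb i) (hb j)))
  rw [Matrix.mul_assoc, Matrix.mul_apply]
  simp only [Matrix.mul_apply, transpose_apply, of_apply, Finset.mul_sum]
  exact Finset.sum_congr rfl fun k _ => Finset.sum_congr rfl fun l _ => by ring

/-- The domain of coordinates of a chart. -/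
def chartDomain (φ : OpenPartialHomeomorph M R4) : Opens R4 := ⟨φ.target, φ.open_target⟩

theorem isCurvatureChart_comps (h_neutral : IsNeutral g)
    (h_diag : SelfDualComplexDiagonalizable g o) {S : Set ℂ}
    (hS : ∀ φ ∈ atlas R4 M, ∀ y ∈ φ.target,
      {μ : ℂ | selfDualEigenspace (comps g φ) (frameSign o.at_point φ) y μ ≠ ⊥} = S)
    (hφ : φ ∈ atlas R4 M) :
    IsCurvatureChart (comps g φ) (frameSign o.at_point φ) (chartDomain φ) S where
  metric :=
    { smooth := fun i j => g.smooth φ hφ _ _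
      symm := fun y _ => by ext i j; exact g.symm _ _ _
      det_ne_zero := fun y hy => by
        obtain ⟨B, hB⟩ := h_neutral.comps_congruent hφ hy
        exact (exists_orientedFrame (s := 1) (one_pow 2) hB).1 }
  neutral y hy := h_neutral.comps_congruent hφ hy
  sign_smooth := contDiffOn_frameSign o hφ
  sign_sq y _ := frameSign_sq _ φ y
  spans := h_diag φ hφ
  eigenvalues := hS φ hφ

/-- The parameters depend only on μ, hence only on the common spectrum, so one Petrov metric serves
all points. The coordinate map is a local diffeomorphism because it pulls a form back to a
nondegenerate one. -/
theorem locallyIsometric_petrovMetric {S : Set ℂ}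
    (hchart : ∀ φ ∈ atlas R4 M,
      IsCurvatureChart (comps g φ) (frameSign o.at_point φ) (chartDomain φ) S)
    {μ p σ : ℝ} {ε : ℤˣ} (hpar : IsPetrovParam μ p ((ε : ℤ) : ℝ) σ)
    (hS : S = {(μ : ℂ), zeta3 * μ, zeta3 ^ 2 * μ}) :
    LocallyIsometric g (petrovMetric p ε (-ε)) := by
  intro x
  have hφ := chart_mem_atlas R4 x
  have hx := mem_chart_source R4 x
  obtain ⟨W, hG, hW, hyW, z, t, r, h⟩ :=
    (hchart _ hφ).exists_petrovPullback ((chartAt R4 x).map_source hx) hpar hS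
  obtain ⟨f, hf, hfW, hfe, hfs⟩ := exists_local_diffeo (contDiffOn_petrovMap z t r)
    (fun y hy => exists_fderiv_equiv (hG.det_ne_zero y hy)
      (B := fun a b => petrovMetricForm p ε (-ε) (petrovMap z t r y) a b) (by simp)
      (h.map_form ⟨y, hy⟩)) hyW
  refine ⟨(chartAt R4 x).trans f, ?_, isIsometry_chart_trans hφ ?_ hfs fun y hy u v => ?_⟩
  · rw [OpenPartialHomeomorph.trans_source]; exact ⟨hx, hf⟩
  · rw [hfe]; exact (contDiffOn_petrovMap z t r).mono hfW
  · rw [hfe, form_coordVec]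
    exact h.map_form ⟨y, hfW hy⟩ u v

end Charts

end NeutralEinstein

end

/-! ### The main theorem. -/

open NeutralEinstein
theorem theorem6p1 {M : Type*} [TopologicalSpace M] [ChartedSpace R4 M] [IsManifold (𝓡 4) ∞ M]
    (g : PseudoMetric R4 M) (o : ManifoldOrientation M)
    (h_neutral : IsNeutral g) (h_einstein : IsEinstein g)
    (h_diag : SelfDualComplexDiagonalizable g o)
    (h_const : SelfDualConstantEigenvalues g o)
    (h_nonpar : SelfDualNotParallel g o) :
    LocallyHomogeneous g ∧ IsRicciFlat g ∧
    (∃ (p : ℝ) (ε : ℤˣ), p ≠ 0 ∧ LocallyIsometric g (petrovMetric p ε (-ε))) ∧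
    ∃ (G : Type) (_ : Group G) (_ : TopologicalSpace G) (_ : ChartedSpace R4 G)
      (_ : LieGroup (𝓡 4) ∞ G) (_ : T2Space G) (_ : SecondCountableTopology G)
      (h : PseudoMetric R4 G), LeftInvariant h ∧ LocallyIsometric g h := by
  obtain ⟨S, hS⟩ := h_const
  have hchart := fun φ hφ => isCurvatureChart_comps (φ := φ) h_neutral h_diag hS hφ
  obtain ⟨φ, hφ, y, hy, m, i, j, k, l, hne⟩ := h_nonpar
  -- Nonvanishing of ∇R⁺ at a single point determines the spectrum, which is the same at all points.
  -- From here on only the spectrum matters.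
  obtain ⟨μ, hμ, hSμ⟩ := (hchart φ hφ).eigenvalues_eq hy hne
  obtain ⟨p, σ, ε, hpar⟩ := exists_petrovParam hμ
  have hloc := locallyIsometric_petrovMetric hchart hpar hSμ
  have hgroup : LocallyIsometric g (petrovGroupMetric p ε (-ε)) := fun x => by
    obtain ⟨f, hx, hf⟩ := hloc x
    refine ⟨_, ?_, hf.trans (isIsometry_petrovEquiv p ε (-ε))⟩
    exact ⟨hx, Set.mem_univ _⟩
  have hleft := leftInvariant_petrovGroupMetric p ε (-ε)
  refine ⟨hgroup.locallyHomogeneous hleft, fun ψ hψ z hz a b => ?_,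
    ⟨p, ε, hpar.p_ne_zero, hloc⟩,
    ⟨PetrovGroup p, inferInstance, inferInstance, inferInstance, inferInstance, inferInstance,
      inferInstance, petrovGroupMetric p ε (-ε), hleft, hgroup⟩⟩
  -- The cube roots sum to zero, so the scalar curvature vanishes and the Einstein equation becomes
  -- Ric = 0.
  rw [h_einstein ψ hψ z hz, (hchart ψ hψ).scalarCurvature_eq_zero hz hμ hSμ, zero_div, zero_mul]
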